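/- **Setting.** Let $F$ be a non-archimedean local field of characteristic $0$ with ring of integers $\mathfrak o$, maximal ideal $\mathfrak p$, a fixed uniformizer $\pi$, residue field of **odd** cardinality $q$, and normalized absolute value $|\cdot|$ (so $|\pi|=q^{-1}$). Let $\chi(x)=\langle \pi,x\rangle$ $(x\in F^\times)$ with $\langle\,,\,\rangle$ the quadratic Hilbert symbol, and let $\psi$ be a (continuous, unitary) additive character of $F$ of order $0$, i.e. $\mathfrak o$ is the largest fractional ideal on which $\psi$ is trivial. The Weil constant $\alpha_\psi(a)$ $(a\in F^\times)$ is the complex number with $\int_F\phi(x)\psi(ax^2)\,dx=\alpha_\psi(a)|2a|^{-1/2}\int_F\hat\phi(x)\psi(-x^2/4a)\,dx$ for all Schwartz functions $\phi$ on $F$, where $\hat\phi(x)=\int_F\phi(y)\psi(xy)\,dy$ and $\mathrm{vol}(\mathfrak o)=1$. Let $n\ge1$, $G=\mathrm{Sp}_n(F)\subset \mathrm{GL}_{2n}(F)$ (defined by $\begin{pmatrix}0&-1_n\\1_n&0\end{pmatrix}$), and $\Gamma=\{\begin{pmatrix}A&B\\C&D\end{pmatrix}\in \mathrm{Sp}_n(\mathfrak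 o): C\equiv0 \bmod \mathfrak p\}$. For $0\le i\le n$ put $$w_i=\left(\begin{array}{cc|cc}1_{n-i}&&&\\&&&-1_i\\\hline&&1_{n-i}&\\&1_i&&\end{array}\right).$$ For $s\in\mathbb C$ and $0\le t\le n$, $f_t=f_{t,s}$ is the unique locally constant function on $G$ such that $f_t\left(\begin{pmatrix}A&*\\0&{}^tA^{-1}\end{pmatrix}g\right)=\chi(\det A)|\det A|^{s}f_t(g)$, $f_t(gk)=\chi(\det D)f_t(g)$ for $k=\begin{pmatrix}A&B\\C&D\end{pmatrix}\in\Gamma$, and $f_t(w_j)=\delta_{tj}$ $(0\le j\le n)$; it exists and is unique. Let $B=\mathrm{diag}(\alpha_1\pi^{e_1},\dots,\alpha_n\pi^{e_n})$ with $\alpha_i\in\mathfrak o^\times$ and integers $0\le e_1\le\dots\le e_n$. The Siegel series is $$S_t(B,s)^\chi=\int_{\mathrm{Sym}_n(F)}f_{t,s}\left(w_n\begin{pmatrix}1&X\\0&1\end{pmatrix}\right)\psi(-\mathrm{tr}(BX))\,dX,\qquad \mathrm{vol}(\mathrm{Sym}_n(\mathfrak o))=1,$$ which is absolutely convergent for $\mathrm{Re}\,s>n$,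 and is defined for all $s\in\mathbb C$ by meromorphic continuation. **Notation.** Let $I=\{1,\dots,n\}$, $\sigma\in\mathfrak S_n$ with $\sigma^2=1$, and let $I=I_0\cup\dots\cup I_r$ be an ordered partition of $I$ into disjoint nonempty $\sigma$-stable subsets. Put $c_1^{(l)}(\sigma)=\#\{i\in I_l:\sigma(i)=i\}$, $c_2(\sigma)=\frac12\#\{i\in I:\sigma(i)\ne i\}$, $n_l=\#I_l$, $n^{(k)}=\sum_{l=k}^r n_l$ $(0\le k\le r+1$, so $n^{(r+1)}=0)$, $n(k)=\frac12n^{(k)}(n^{(k)}+1)$, $$\tau(\{I_i\})=\sum_{l=1}^r\#\{(i,j)\in I_l\times(I_0\cup\dots\cup I_{l-1}): j<i\},$$ $$t(\sigma,\{I_i\})=\sum_{l=0}^r\#\{(i,j)\in I_l\times I_l: i<j<\sigma(i),\ \sigma(j)<\sigma(i)\};$$ $e_{\sigma,i,k}=0$ if $k\le i$ and $k\le\sigma(i)$, $e_{\sigma,i,k}=2$ if $i<k$ and $\sigma(i)<k$, and $e_{\sigma,i,k}=1$ otherwise; $$b_l(\sigma,B)=\min\left(\{e_i: i\in I_l,\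 \sigma(i)>i\}\cup\{e_i+1: i\in I_l,\ \sigma(i)\le i\}\right),$$ $$\tilde\rho_{l,\lambda}(\sigma;B)=\tfrac12\sum_{i\in I_l}\sum_{k=1}^n\min\{e_k+e_{\sigma,i,k}+\lambda,0\},$$ $$B_i(\lambda)=\{k<i: e_k+\lambda<0,\ e_k\not\equiv\lambda\bmod 2\}\cup\{k>i: e_k+\lambda+2<0,\ e_k\not\equiv\lambda \bmod 2\},$$ and, for $e_i+\lambda\ge-1$, $$\xi_{i,\lambda}(B)_\chi=\prod_{k\in B_i(\lambda)}\chi(\alpha_k)\times\begin{cases}0& e_i+\lambda\ge0,\ \#B_i(\lambda)\text{ even}\\(1-q^{-1})\chi(-1)^{[\#B_i(\lambda)/2]+1}& e_i+\lambda\ge0,\ \#B_i(\lambda)\text{ odd}\\\chi(\alpha_i)\chi(-1)^{[\#B_i(\lambda)/2]+1}& e_i+\lambda=-1,\ \#B_i(\lambda)\text{ even}\\-q^{-1/2}\chi(-1)^{[\#B_i(\lambda)/2]+1}& e_i+\lambda=-1,\ \#B_i(\lambda)\text{ odd.}\end{cases}$$ **Theorem.** For every $0\le t\le n$, $$\begin{aligned}S_t(B,s)^\chi=\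 &\alpha_\psi(\pi)^{n-t}\sum_{\substack{\sigma\in\mathfrak S_n\\\sigma^2=1}}(1-q^{-1})^{c_2(\sigma)}q^{-c_2(\sigma)}\sum_{\substack{I=I_0\cup\dots\cup I_r\\n^{(k)}=t}}q^{-\tau(\{I_i\})-t(\sigma,\{I_i\})}\frac{(1-q^{-1})^{\sum_{l=k}^rc_1^{(l)}(\sigma)}q^{n(k)}}{\prod_{l=k}^r(q^{n(l)}-1)}\\&\times\sum_{\{\nu\}_k^t}\prod_{l=0}^{k-1}\chi(-1)^{\nu_l(n^{(l)}-n^{(k)})}q^{\nu_l((sn^{(l)}-n(l))-(sn^{(k)}-n(k)))+\tilde\rho_{l,\nu_0+\dots+\nu_l}(\sigma;B)}\prod_{\substack{i\in I_l\\\sigma(i)=i}}\xi_{i,\nu_0+\dots+\nu_l}(B)_\chi .\end{aligned}$$ Here the second sum is over all $r\ge 0$ and all ordered partitions as above for which some $0\le k\le r+1$ (necessarily unique) satisfies $n^{(k)}=t$, and $\{\nu\}_k^t$ runs over the finite set of $(\nu_0,\dots,\nu_{k-1})\in\mathbb Z\times\mathbb Z_{>0}^{k-1}$ with $-b_l(\sigma,B)\le\nu_0+\dots+\nu_l\le-1$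 for $0\le l\le k-1$ (for $k=0$ the inner sum is $1$). The identity holds for the integral when $\mathrm{Re}\,s>n$, and for its meromorphic continuation for all $s\in\mathbb C$. -/

import Mathlib

open Matrix MeasureTheory ValuativeRel

open scoped Classical in
/-- The Hilbert symbol of index 2 on a field `F`: it is `1` if `z² = a x² + b y²` has a nonzero
solution in `F³`, and `-1` otherwise. -/
noncomputable def hilbertSymbol {F : Type*} [Field F] (a b : F) : ℤ :=
  if ∃ x y z : F, (x, y, z) ≠ (0, 0, 0) ∧ z ^ 2 = a * x ^ 2 + b * y ^ 2 then 1 else -1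

/-- The quadratic character `χ(x) = ⟨ϖ, x⟩` of `Fˣ`, with complex values. -/
noncomputable def quadChar {F : Type*} [Field F] (ϖ : F) (x : F) : ℂ :=
  (hilbertSymbol ϖ x : ℂ)

section LocalField

variable (F : Type*) [Field F] [ValuativeRel F] [TopologicalSpace F] [IsNonarchimedeanLocalField F]

/-- The cardinality `q` of the residue field. -/
noncomputable def residueCard : ℕ := Nat.card 𝓀[F]

variable {F}

/-- The normalized absolute value on `F`: `|x| = q ^ (-ord x)` for `x ≠ 0`, and `|0| = 0`.
The order isomorphism from the value group to `ℤᵐ⁰` is unique. -/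
noncomputable def normAbs (x : F) : ℝ :=
  open scoped Classical in
  if x = 0 then 0 else
    (residueCard F : ℝ) ^
      WithZero.log (IsNonarchimedeanLocalField.valueGroupWithZeroIsoInt F (valuation F x))

/-- `ψ` has order `0`: the set of `a` such that `ψ` is trivial on `a 𝒪` is exactly `𝒪`, that is, `𝒪`
is the largest fractional ideal on which `ψ` is trivial. -/
def HasOrderZero (ψ : AddChar F Circle) : Prop :=
  ∀ a : F, (∀ x ∈ 𝒪[F], ψ (a * x) = 1) ↔ a ∈ 𝒪[F]

section Weil

variable [MeasurableSpace F]

/-- Fourier transform with respect to `ψ` and the measure `μ`. -/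
noncomputable def fourierF (μ : Measure F) (ψ : AddChar F Circle) (φ : F → ℂ) (x : F) : ℂ :=
  ∫ y, φ y * (ψ (x * y) : ℂ) ∂μ

/-- The defining property of the Weil constant `α_ψ(a)`. Schwartz functions on `F` are the locally
constant functions with compact support. -/
def IsWeilConstant (μ : Measure F) (ψ : AddChar F Circle) (a : F) (α : ℂ) : Prop :=
  ∀ φ : F → ℂ, IsLocallyConstant φ → HasCompactSupport φ →
    ∫ x, φ x * (ψ (a * x ^ 2) : ℂ) ∂μ =
      α * (normAbs (2 * a) : ℂ) ^ (-(1 / 2) : ℂ) *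
        ∫ x, fourierF μ ψ φ x * (ψ (-(x ^ 2 / (4 * a))) : ℂ) ∂μ

/-- The Weil constant `α_ψ(a)`. -/
noncomputable def weilConstant (μ : Measure F) (ψ : AddChar F Circle) (a : F) : ℂ :=
  Classical.epsilon (IsWeilConstant μ ψ a)

end Weil

end LocalField

section Symplectic

/-- The space of symmetric matrices of degree `n` over `F`. -/
def SymMat (n : ℕ) (F : Type*) [Field F] : Submodule F (Matrix (Fin n) (Fin n) F) where
  carrier := {X | X.IsSymm}
  add_mem' ha hb := Matrix.IsSymm.add ha hb
  zero_mem' := Matrix.isSymm_zero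
  smul_mem' c _ h := Matrix.IsSymm.smul h c

instance symMatMeasurableSpace (n : ℕ) (F : Type*) [Field F] [TopologicalSpace F] :
    MeasurableSpace (SymMat n F) :=
  borel _

instance symMatBorelSpace (n : ℕ) (F : Type*) [Field F] [TopologicalSpace F] : BorelSpace (SymMat n F) :=
  ⟨rfl⟩

/-- The group `G = Sp_n(F)`, of matrices of size `2n`. -/
abbrev Sp (n : ℕ) (F : Type*) [Field F] := Matrix.symplecticGroup (Fin n) F

variable {n : ℕ} {F : Type*} [Field F]

/-- The element `w_i` of `Sp_n(F)`: the last `i` coordinates are exchanged, with a sign. -/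
def weylElt (n : ℕ) (F : Type*) [Field F] (i : ℕ) : Sp n F :=
  ⟨Matrix.fromBlocks
      (Matrix.diagonal fun j : Fin n => if (j : ℕ) < n - i then 1 else 0)
      (-Matrix.diagonal fun j : Fin n => if (j : ℕ) < n - i then 0 else 1)
      (Matrix.diagonal fun j : Fin n => if (j : ℕ) < n - i then 0 else 1)
      (Matrix.diagonal fun j : Fin n => if (j : ℕ) < n - i then 1 else 0), by
    rw [SymplecticGroup.mem_iff, Matrix.J, Matrix.fromBlocks_transpose,
      Matrix.fromBlocks_multiply, Matrix.fromBlocks_multiply, Matrix.fromBlocks_inj]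
    refine ⟨?_, ?_, ?_, ?_⟩ <;>
      · ext a b
        by_cases h : a = b <;>
          simp [Matrix.one_apply, h]
        try split_ifs <;> simp⟩

/-- The unipotent element `(1 X; 0 1)` of `Sp_n(F)` attached to a symmetric matrix `X`. -/
def unipElt (X : SymMat n F) : Sp n F :=
  ⟨Matrix.fromBlocks 1 (X : Matrix (Fin n) (Fin n) F) 0 1, by
    have hX : (X : Matrix (Fin n) (Fin n) F)ᵀ = X := X.2
    rw [SymplecticGroup.mem_iff, Matrix.J, Matrix.fromBlocks_transpose,
      Matrix.fromBlocks_multiply, Matrix.fromBlocks_multiply, Matrix.fromBlocks_inj]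
    simp [hX]⟩

variable [ValuativeRel F] [TopologicalSpace F] [IsNonarchimedeanLocalField F]

/-- The subgroup `Γ` of `Sp_n(𝒪)`, given by the condition `C ≡ 0 mod 𝔭`, as a set. -/
def gammaSet (n : ℕ) (F : Type*) [Field F] [ValuativeRel F] : Set (Sp n F) :=
  {g | (∀ i j, g.1 i j ∈ 𝒪[F]) ∧ ∀ i j, valuation F (g.1.toBlocks₂₁ i j) < 1}

/-- `f ∈ I_n(ω, s)`: `f` is smooth (locally constant) on `Sp_n(F)` and transforms under the Siegel
parabolic `P = {C = 0}` by `ω(det A) |det A| ^ (s + (n + 1) / 2)`. -/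
def MemInduced (ω : F → ℂ) (s : ℂ) (f : Sp n F → ℂ) : Prop :=
  IsLocallyConstant f ∧
    ∀ p g : Sp n F, p.1.toBlocks₂₁ = 0 →
      f (p * g) = ω p.1.toBlocks₁₁.det *
        (normAbs p.1.toBlocks₁₁.det : ℂ) ^ (s + ((n : ℂ) + 1) / 2) * f g

/-- `f ∈ I_n(ω, s)^{Γ, ω}`: moreover `f (g k) = ω(det D_k) f(g)` for `k ∈ Γ`. -/
def MemInducedGamma (ω : F → ℂ) (s : ℂ) (f : Sp n F → ℂ) : Prop :=
  MemInduced ω s f ∧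
    ∀ g k : Sp n F, k ∈ gammaSet n F → f (g * k) = ω k.1.toBlocks₂₂.det * f g

/-- `f` is the basis vector `f_t` of `I_n(ω, s - (n + 1) / 2)^{Γ, ω}`, i.e. `f(w_j) = δ_{tj}`. -/
def IsBasisVector (ω : F → ℂ) (t : ℕ) (s : ℂ) (f : Sp n F → ℂ) : Prop :=
  MemInducedGamma ω (s - ((n : ℂ) + 1) / 2) f ∧
    ∀ j ≤ n, f (weylElt n F j) = if j = t then 1 else 0

/-- The integrand `φ(w_n (1 X; 0 1)) ψ(-tr(BX))`. -/
noncomputable def siegelIntegrand (ψ : AddChar F Circle) (B : Matrix (Fin n) (Fin n) F)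
    (φ : Sp n F → ℂ) (X : SymMat n F) : ℂ :=
  φ (weylElt n F n * unipElt X) * (ψ (-(B * (X : Matrix (Fin n) (Fin n) F)).trace) : ℂ)

/-- `S` is the Siegel series of the family `φ s ∈ I_n(ω, s - (n + 1) / 2)^{Γ, ω}`: it is a meromorphic
function on `ℂ` (in normal form, i.e. with the removable singularities removed) given by the
absolutely convergent integral on some right half plane. -/
def IsSiegelSeries (ν : Measure (SymMat n F)) (ψ : AddChar F Circle)
    (B : Matrix (Fin n) (Fin n) F) (φ : ℂ → Sp n F → ℂ) (S : ℂ → ℂ) : Prop :=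
  MeromorphicNFOn S Set.univ ∧
    ∃ c : ℝ, ∀ s : ℂ, c < s.re →
      Integrable (siegelIntegrand ψ B (φ s)) ν ∧ S s = ∫ X, siegelIntegrand ψ B (φ s) X ∂ν

end Symplectic

/-! The combinatorial data. An ordered partition `I = I_0 ∪ ⋯ ∪ I_r` of `I = {1, …, n}` into
nonempty subsets is a surjection `p : Fin n → Fin m` with `m = r + 1` and `I_l = p⁻¹(l)`. -/

section Combinatorics

variable {n m : ℕ}

/-- `c_1^{(l)}(σ)`. -/
def cOne (σ : Equiv.Perm (Fin n)) (p : Fin n → Fin m) (l : ℕ) : ℕ :=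
  (Finset.univ.filter fun i => (p i : ℕ) = l ∧ σ i = i).card

/-- `c_2(σ)`. -/
def cTwo (σ : Equiv.Perm (Fin n)) : ℕ := (Finset.univ.filter fun i => σ i ≠ i).card / 2

/-- `n_l`. -/
def blockCard (p : Fin n → Fin m) (l : ℕ) : ℕ :=
  (Finset.univ.filter fun i => (p i : ℕ) = l).card

/-- `n^{(k)} = n_k + ⋯ + n_r`. -/
def nUpper (p : Fin n → Fin m) (k : ℕ) : ℕ := ∑ l ∈ Finset.Ico k m, blockCard p l

/-- `n(k) = n^{(k)} (n^{(k)} + 1) / 2`. -/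
def nTri (p : Fin n → Fin m) (k : ℕ) : ℕ := nUpper p k * (nUpper p k + 1) / 2

/-- `τ({I_i})`. -/
def tauPart (p : Fin n → Fin m) : ℕ :=
  (Finset.univ.filter fun x : Fin n × Fin n => p x.2 < p x.1 ∧ x.2 < x.1).card

/-- `t(σ, {I_i})`. -/
def tPart (σ : Equiv.Perm (Fin n)) (p : Fin n → Fin m) : ℕ :=
  (Finset.univ.filter fun x : Fin n × Fin n =>
    p x.1 = p x.2 ∧ x.1 < x.2 ∧ x.2 < σ x.1 ∧ σ x.2 < σ x.1).card

/-- `e_{σ, i, k}`. -/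
def eShift (σ : Equiv.Perm (Fin n)) (i k : Fin n) : ℤ :=
  if k ≤ i ∧ k ≤ σ i then 0 else if i < k ∧ σ i < k then 2 else 1

/-- `b_l(σ, B)`, the minimum over a nonempty block `I_l`. -/
noncomputable def bMin (σ : Equiv.Perm (Fin n)) (e : Fin n → ℕ) (p : Fin n → Fin m) (l : ℕ) : ℕ :=
  sInf ((fun i => if i < σ i then e i else e i + 1) '' {i | (p i : ℕ) = l})

/-- `B_i(λ)`. -/
def BSet (e : Fin n → ℕ) (i : Fin n) (lam : ℤ) : Finset (Fin n) :=
  Finset.univ.filter fun k =>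
    ((k < i ∧ (e k : ℤ) + lam < 0) ∨ (i < k ∧ (e k : ℤ) + lam + 2 < 0)) ∧
      ¬ (e k : ℤ) ≡ lam [ZMOD 2]

/-- `ρ̃_{l, λ}(σ; B)`. -/
noncomputable def rhoTilde (σ : Equiv.Perm (Fin n)) (e : Fin n → ℕ) (p : Fin n → Fin m)
    (l : ℕ) (lam : ℤ) : ℂ :=
  (1 / 2) * ∑ i ∈ Finset.univ.filter (fun i => (p i : ℕ) = l), ∑ k : Fin n,
    ((min ((e k : ℤ) + eShift σ i k + lam) 0 : ℤ) : ℂ)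

/-- `ξ_{i, λ}(B)_χ`, where `v k` is the unit part of the `k`-th diagonal entry of `B`. It is only
used for `e i + λ ≥ -1`. -/
noncomputable def xiFactor {F : Type*} [Field F] (q : ℕ) (χ : F → ℂ) (v : Fin n → F)
    (e : Fin n → ℕ) (i : Fin n) (lam : ℤ) : ℂ :=
  (∏ k ∈ BSet e i lam, χ (v k)) *
    (if 0 ≤ (e i : ℤ) + lam then
      (if Even (BSet e i lam).card then 0
        else (1 - (q : ℂ)⁻¹) * χ (-1) ^ ((BSet e i lam).card / 2 + 1))
    else if (e i : ℤ) + lam = -1 then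
      (if Even (BSet e i lam).card then χ (v i) * χ (-1) ^ ((BSet e i lam).card / 2 + 1)
        else -(q : ℂ) ^ (-(1 / 2) : ℂ) * χ (-1) ^ ((BSet e i lam).card / 2 + 1))
    else 0)

/-- `λ_l = ν_0 + ⋯ + ν_l`. -/
def partialSum {k : ℕ} (ν : Fin k → ℤ) (l : Fin k) : ℤ := ∑ j ∈ Finset.Iic l, ν j

/-- The set of `(ν_0, …, ν_{k-1}) ∈ ℤ × ℤ_{>0}^{k-1}` with
`-b_l(σ, B) ≤ ν_0 + ⋯ + ν_l ≤ -1` for `0 ≤ l ≤ k - 1`. For `k = 0` it consists of the empty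
tuple. -/
def nuSet (σ : Equiv.Perm (Fin n)) (e : Fin n → ℕ) (p : Fin n → Fin m) (k : ℕ) :
    Set (Fin k → ℤ) :=
  {ν | (∀ l : Fin k, 0 < (l : ℕ) → 0 < ν l) ∧
    ∀ l : Fin k, -(bMin σ e p l : ℤ) ≤ partialSum ν l ∧ partialSum ν l ≤ -1}

theorem nuSet_finite (σ : Equiv.Perm (Fin n)) (e : Fin n → ℕ) (p : Fin n → Fin m) (k : ℕ) :
    (nuSet σ e p k).Finite := by
  have hinj : Function.Injective (partialSum : (Fin k → ℤ) → Fin k → ℤ) := by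
    intro ν ν' h
    have key : ∀ a : ℕ, ∀ ha : a < k, ν ⟨a, ha⟩ = ν' ⟨a, ha⟩ := by
      intro a
      induction a using Nat.strong_induction_on with
      | _ a ih =>
        intro ha
        have h1 := congrFun h ⟨a, ha⟩
        simp only [partialSum] at h1
        rw [← Finset.sum_erase_add _ _ (Finset.mem_Iic.2 (le_refl (⟨a, ha⟩ : Fin k))),
          ← Finset.sum_erase_add (a := (⟨a, ha⟩ : Fin k)) _ ν'
            (Finset.mem_Iic.2 (le_refl _))] at h1
        have h2 : ∑ x ∈ (Finset.Iic (⟨a, ha⟩ : Fin k)).erase ⟨a, ha⟩, ν x =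
            ∑ x ∈ (Finset.Iic (⟨a, ha⟩ : Fin k)).erase ⟨a, ha⟩, ν' x := by
          refine Finset.sum_congr rfl fun x hx => ?_
          rw [Finset.mem_erase, Finset.mem_Iic] at hx
          have hlt : x < ⟨a, ha⟩ := lt_of_le_of_ne hx.2 hx.1
          exact ih x.1 hlt x.2
        linarith
    funext l
    exact key l.1 l.2
  refine Set.Finite.of_finite_image (f := partialSum) ?_ hinj.injOn
  refine Set.Finite.subset (Set.Finite.pi' fun l : Fin k =>
    Set.finite_Icc (-(bMin σ e p l : ℤ)) (-1)) ?_
  rintro _ ⟨ν, hν, rfl⟩ l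
  exact hν.2 l

/-- The explicit expression for `S_t(B, s)^χ`, where `B = diag(v_1 π^{e_1}, …, v_n π^{e_n})` and
`αψ` is the Weil constant `α_ψ(π)`. The sum over `m = r + 1`, `p` and `k` is the sum over the ordered
`σ`-stable partitions with `n^{(k)} = t`; here `0 ≤ k ≤ r + 1` with `n^{(r+1)} = 0`. -/
noncomputable def siegelFormula {F : Type*} [Field F] (n : ℕ) (q : ℕ) (αψ : ℂ) (χ : F → ℂ)
    (v : Fin n → F) (e : Fin n → ℕ) (t : ℕ) (s : ℂ) : ℂ :=
  αψ ^ (n - t) *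
    ∑ σ ∈ Finset.univ.filter (fun σ : Equiv.Perm (Fin n) => σ ^ 2 = 1),
      (1 - (q : ℂ)⁻¹) ^ cTwo σ * (q : ℂ) ^ (-(cTwo σ : ℤ)) *
      ∑ m ∈ Finset.Icc 1 n,
      ∑ p ∈ Finset.univ.filter
          (fun p : Fin n → Fin m => Function.Surjective p ∧ ∀ i, p (σ i) = p i),
      ∑ k ∈ (Finset.range (m + 1)).filter (fun k => nUpper p k = t),
        (q : ℂ) ^ (-(tauPart p : ℤ) - (tPart σ p : ℤ)) *
        ((1 - (q : ℂ)⁻¹) ^ (∑ l ∈ Finset.Ico k m, cOne σ p l) * (q : ℂ) ^ nTri p k /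
          ∏ l ∈ Finset.Ico k m, ((q : ℂ) ^ nTri p l - 1)) *
        ∑ ν ∈ (nuSet_finite σ e p k).toFinset,
          ∏ l : Fin k,
            (χ (-1) ^ (ν l * ((nUpper p l : ℤ) - (nUpper p k : ℤ))) *
            (q : ℂ) ^ ((ν l : ℂ) * ((s * (nUpper p l : ℂ) - (nTri p l : ℂ)) -
                (s * (nUpper p k : ℂ) - (nTri p k : ℂ))) +
              rhoTilde σ e p l (partialSum ν l)) *
            ∏ i ∈ Finset.univ.filter (fun i => (p i : ℕ) = l ∧ σ i = i),
              xiFactor q χ v e i (partialSum ν l))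

end Combinatorics

/-! Reduction to symmetric matrices. On the big cell put $\Phi(X)=f_t(w_n(1\ X;0\ 1))$ and
$\kappa(x)=\chi(x)|x|^{-s}$. Only three properties of $\Phi$ matter (`SiegelKernel`): it is
invariant under integral translations $X\mapsto X+Y$, invariant under congruences $X\mapsto
UX\,{}^tU$ with $U\in GL_n(\mathfrak o)$, and equal to $\kappa(\det(D+1_J))\,\delta_{\#J,t}$ when
$D$ vanishes on the indices $J$ and is invertible off $J$ with inverse $\equiv0$ mod $\mathfrak p$.
They follow by comparing bottom rows of symplectic matrices (`siegelKernel_of_isBasisVector`).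

Elimination. The integral over the matrices with entries in $\mathfrak p^{-l}$ is computed by
clearing the most negative level first. At level $\lambda$ the rows are scanned from the last one
upwards; in row $i$ the pivot column is the last $j\le i$ whose entry has order exactly $\lambda$.
The pivot is a $1\times1$ block if $j=i$, otherwise a $2\times2$ block on $\{i,j\}$ dominated by its
off-diagonal entry. Completing the square is an integral congruence, and the Schur complement is a
translation preserving the domain of the remaining variables. Fubini therefore splits off a weight
depending on the pivot and leaves an integral of the same kind (`SiegelKernel.setIntegral_single`,
`SiegelKernel.setIntegral_pair`). Within a level the recursion is `levelPass`, over the levels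
`levelIter`.

Expansion. The pivot positions form an involution $\sigma$, the indices removed at one level form a
$\sigma$-stable block, the levels of successive blocks strictly increase, and a set of $t$ indices
is left over at the end (`levelIter_eq_sum`). The formula of the theorem also partitions this
leftover set, although no integral is attached to it: those extra terms add up to $1$. The reason is
that the same elimination, applied to volumes of integral matrices, recovers the total volume $1$;
the factors $1/(1-q^{-N})$ account for levels at which nothing is removed (`levelPass_volWeight`,
`sum_tailSum`).

Weights. As $q$ is odd, the Gaussian integral $\int\psi(ax^2)$ over an ideal is a power of $q^{1/2}$
times a normalized Gauss sum if the effective order is odd and negative (`integral_addChar_sq`). For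
a $1\times1$ pivot the parity of the number of such Gauss sums decides whether the final integral
over the pivot carries $\chi$; the cases give $\xi_{i,\lambda}$ (`singleWeight_eq`). For a
$2\times2$ pivot all forms are split and no Gauss sum appears (`pairWeight_eq`). The normalized
Gauss sum is $\alpha_\psi(\pi)$ (`weilConstant_uniformizer`). Over a block the exponents telescope
(`passWeight_pivotWeight`), and summation by parts passes from levels to the increments $\nu_l$
(`sum_headProd_tailProd`). Pivots at a level below $-b_l$ have weight zero, so the box integrals are
eventually constant.

Convergence and continuation. $|\Phi|$ has the same three properties, so the same recursion bounds
the integrals of $|\Phi|$ over all boxes when $\mathrm{Re}\,s>n$ (`SiegelKernel.integrable`). The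
explicit expression is entire in $s$, and the identity theorem finishes the proof.

Existence and uniqueness of $f_t$. Choosing a best minor of the bottom rows shows that $G$ is the
union of the $Pw_S\Gamma$ (`exists_reduced`), and $f(w_S)$ depends on $\#S$ only. For existence the
characters of $P$ and $\Gamma$ must agree whenever $pw_S=w_Sk$; modulo $\mathfrak p$ the product of
the two determinants is a nonzero square (`exists_det_mul_det_eq_sq`). -/

/-! ### Orders, fractional ideals and topology of a local field -/

section LocalFieldBasics

open scoped WithZero
open WithZero

variable {F : Type*} [Field F] [ValuativeRel F] [TopologicalSpace F] [IsNonarchimedeanLocalField F]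

variable (F) in
/-- The valuation of a local field with values in `ℤᵐ⁰`. -/
noncomputable def ordVal : Valuation F ℤᵐ⁰ :=
  (valuation F).map (IsNonarchimedeanLocalField.valueGroupWithZeroIsoInt F).toMulEquiv.toMonoidWithZeroHom
    (IsNonarchimedeanLocalField.valueGroupWithZeroIsoInt F).strictMono.monotone

theorem ordVal_apply (x : F) :
    ordVal F x = IsNonarchimedeanLocalField.valueGroupWithZeroIsoInt F (valuation F x) := rfl

/-- The additive valuation of `x` (equal to `0` at `x = 0`). -/
noncomputable def ord (x : F) : ℤ := -log (ordVal F x)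

variable (F) in
/-- The fractional ideal `𝔭 ^ m`. -/
def pw (m : ℤ) : AddSubgroup F where
  carrier := {x | ordVal F x ≤ exp (-m)}
  add_mem' ha hb := (ordVal F).map_add_le ha hb
  zero_mem' := by simp
  neg_mem' h := by simpa using h

theorem mem_pw_def {m : ℤ} {x : F} : x ∈ pw F m ↔ ordVal F x ≤ exp (-m) := Iff.rfl

theorem ordVal_le_one_iff {x : F} : ordVal F x ≤ 1 ↔ valuation F x ≤ 1 := by
  rw [ordVal_apply, ← map_one (IsNonarchimedeanLocalField.valueGroupWithZeroIsoInt F),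
    OrderIsoClass.map_le_map_iff]

theorem ordVal_lt_one_iff {x : F} : ordVal F x < 1 ↔ valuation F x < 1 := by
  rw [ordVal_apply, ← map_one (IsNonarchimedeanLocalField.valueGroupWithZeroIsoInt F),
    (IsNonarchimedeanLocalField.valueGroupWithZeroIsoInt F).strictMono.lt_iff_lt]

theorem ordVal_eq_one_iff {x : F} : ordVal F x = 1 ↔ valuation F x = 1 := by
  rw [ordVal_apply, ← map_one (IsNonarchimedeanLocalField.valueGroupWithZeroIsoInt F),
    EmbeddingLike.apply_eq_iff_eq]

theorem mem_pw_zero {x : F} : x ∈ pw F 0 ↔ x ∈ 𝒪[F] := by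
  rw [mem_pw_def, neg_zero, exp_zero, ordVal_le_one_iff, Valuation.mem_integer_iff]

theorem ordVal_ne_zero {x : F} (hx : x ≠ 0) : ordVal F x ≠ 0 := (ordVal F).ne_zero_iff.2 hx

theorem ordVal_eq_exp {x : F} (hx : x ≠ 0) : ordVal F x = exp (-ord x) := by
  rw [ord, neg_neg, exp_log (ordVal_ne_zero hx)]

theorem mem_pw_iff_ord {m : ℤ} {x : F} (hx : x ≠ 0) : x ∈ pw F m ↔ m ≤ ord x := by
  rw [mem_pw_def, ordVal_eq_exp hx, exp_le_exp, neg_le_neg_iff]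

theorem pw_mono {m n : ℤ} (h : m ≤ n) : pw F n ≤ pw F m := fun x hx =>
  le_trans (mem_pw_def.1 hx) (exp_le_exp.2 (neg_le_neg h))

theorem mul_mem_pw {m n : ℤ} {x y : F} (hx : x ∈ pw F m) (hy : y ∈ pw F n) :
    x * y ∈ pw F (m + n) := by
  rw [mem_pw_def] at *
  rw [map_mul, neg_add, exp_add]
  exact mul_le_mul' hx hy

theorem ord_mul {x y : F} (hx : x ≠ 0) (hy : y ≠ 0) : ord (x * y) = ord x + ord y := by
  rw [ord, map_mul, log_mul (ordVal_ne_zero hx) (ordVal_ne_zero hy), ord, ord]; ring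

theorem ord_inv (x : F) : ord x⁻¹ = -ord x := by
  rw [ord, map_inv₀, log_inv, ord]

@[simp] theorem ord_one : ord (1 : F) = 0 := by simp [ord]

@[simp] theorem ord_neg (x : F) : ord (-x) = ord x := by simp [ord]

theorem ord_zpow (x : F) (m : ℤ) : ord (x ^ m) = m * ord x := by
  rw [ord, map_zpow₀, log_zpow, ord]; simp

theorem ord_pow (x : F) (m : ℕ) : ord (x ^ m) = m * ord x := by
  rw [← zpow_natCast, ord_zpow]

theorem ord_eq_zero_iff {x : F} (hx : x ≠ 0) : ord x = 0 ↔ valuation F x = 1 := by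
  rw [← ordVal_eq_one_iff, ordVal_eq_exp hx, exp_eq_one, neg_eq_zero]

theorem ord_unit (u : 𝒪[F]ˣ) : ord (u : F) = 0 := by
  have h := (Valuation.integer.integers (valuation F)).valuation_unit u
  refine (ord_eq_zero_iff (fun h0 => ?_)).2 h
  have h' : valuation F ((u : 𝒪[F]) : F) = 1 := h
  rw [h0] at h'; simp at h'

theorem coe_unit_ne_zero (u : 𝒪[F]ˣ) : ((u : 𝒪[F]) : F) ≠ 0 := by
  simpa using u.ne_zero

theorem ne_zero_of_notMem_pw {m : ℤ} {x : F} (h : x ∉ pw F m) : x ≠ 0 := by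
  rintro rfl; exact h (zero_mem _)

theorem ord_eq_of_mem {m : ℤ} {x : F} (h : x ∈ pw F m) (h' : x ∉ pw F (m + 1)) : ord x = m := by
  have hx := ne_zero_of_notMem_pw h'
  rw [mem_pw_iff_ord hx] at h h'
  omega

theorem ord_add_of_mem {m : ℤ} {x y : F} (hx : x ≠ 0) (hm : ord x = m) (h' : y ∈ pw F (m + 1)) :
    x + y ≠ 0 ∧ ord (x + y) = m := by
  have h1 : x ∈ pw F m := (mem_pw_iff_ord hx).2 hm.ge
  have h2 : x ∉ pw F (m + 1) := by rw [mem_pw_iff_ord hx]; omega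
  have h3 : x + y ∈ pw F m := add_mem h1 (pw_mono (by omega) h')
  have h4 : x + y ∉ pw F (m + 1) := fun h => h2 (by simpa using sub_mem h h')
  exact ⟨ne_zero_of_notMem_pw h4, ord_eq_of_mem h3 h4⟩

/-- Division by an element of known order. -/
theorem div_mem_pw {m k : ℤ} {x y : F} (hx : x ∈ pw F m) (hy : y ≠ 0) (hk : ord y = k) :
    x / y ∈ pw F (m - k) := by
  rw [div_eq_mul_inv, sub_eq_add_neg]
  refine mul_mem_pw hx ((mem_pw_iff_ord (inv_ne_zero hy)).2 ?_)
  rw [ord_inv, hk]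

theorem mul_mem_pw_iff {m k : ℤ} {x y : F} (hy : y ≠ 0) (hk : ord y = k) :
    y * x ∈ pw F m ↔ x ∈ pw F (m - k) := by
  constructor
  · intro h
    have := div_mem_pw h hy hk
    rwa [mul_div_cancel_left₀ _ hy] at this
  · intro h
    have := mul_mem_pw ((mem_pw_iff_ord hy).2 hk.ge) h
    rwa [add_sub_cancel] at this

theorem exists_ord_eq_one : ∃ y : F, y ≠ 0 ∧ ord y = 1 := by
  obtain ⟨y, hy⟩ := ValuativeRel.valuation_surjective
    ((IsNonarchimedeanLocalField.valueGroupWithZeroIsoInt F).symm (exp (-1)))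
  have h : ordVal F y = exp (-1) := by rw [ordVal_apply, hy]; simp
  refine ⟨y, fun h0 => ?_, ?_⟩
  · rw [h0, map_zero] at h; exact exp_ne_zero h.symm
  · rw [ord, h]; simp

theorem uniformizer_ne_zero {ϖ : 𝒪[F]} (hϖ : Irreducible ϖ) : (ϖ : F) ≠ 0 := by
  simpa using hϖ.ne_zero

/-- If the order were at least 2, splitting off an element of order 1 would factor `ϖ` into two
non-units. -/
theorem ord_uniformizer {ϖ : 𝒪[F]} (hϖ : Irreducible ϖ) : ord (ϖ : F) = 1 := by
  have h0 := uniformizer_ne_zero hϖ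
  have h1 : valuation F (ϖ : F) < 1 := Valuation.integer.v_irreducible_lt_one hϖ
  rw [← ordVal_lt_one_iff, ordVal_eq_exp h0, ← exp_zero, exp_lt_exp] at h1
  obtain ⟨y, hy0, hy⟩ := exists_ord_eq_one (F := F)
  have hyO : y ∈ 𝒪[F] := mem_pw_zero.1 ((mem_pw_iff_ord hy0).2 (by omega))
  by_contra hne
  have h2 : (2 : ℤ) ≤ ord (ϖ : F) := by omega
  have hzO : (ϖ : F) / y ∈ 𝒪[F] := by
    have := div_mem_pw ((mem_pw_iff_ord h0).2 h2) hy0 hy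
    exact mem_pw_zero.1 (pw_mono (by omega) this)
  have hmul : ϖ = (⟨y, hyO⟩ : 𝒪[F]) * ⟨(ϖ : F) / y, hzO⟩ := by
    ext; simp [mul_div_cancel₀ _ hy0]
  have hz : ord ((ϖ : F) / y) = ord (ϖ : F) - 1 := by
    rw [div_eq_mul_inv, ord_mul h0 (inv_ne_zero hy0), ord_inv, hy]; ring
  rcases hϖ.isUnit_or_isUnit hmul with h | h
  · obtain ⟨u, hu⟩ := h
    have := ord_unit u
    rw [hu] at this
    change ord y = 0 at this
    omega
  · obtain ⟨u, hu⟩ := h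
    have := ord_unit u
    rw [hu] at this
    change ord ((ϖ : F) / y) = 0 at this
    omega

theorem ord_uniformizer_zpow {ϖ : 𝒪[F]} (hϖ : Irreducible ϖ) (m : ℤ) :
    ord ((ϖ : F) ^ m) = m := by
  rw [ord_zpow, ord_uniformizer hϖ, mul_one]

theorem exists_unit_of_ord_eq_zero {x : F} (hx : x ≠ 0) (h : ord x = 0) :
    ∃ u : 𝒪[F]ˣ, ((u : 𝒪[F]) : F) = x := by
  have hv : valuation F x = 1 := (ord_eq_zero_iff hx).1 h
  have : IsUnit (⟨x, hv.le⟩ : 𝒪[F]) :=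
    (Valuation.integer.integers (valuation F)).isUnit_of_one' hv
  obtain ⟨u, hu⟩ := this
  exact ⟨u, by rw [hu]⟩

theorem exists_unit_mul_zpow {ϖ : 𝒪[F]} (hϖ : Irreducible ϖ) {x : F} (hx : x ≠ 0) :
    ∃ u : 𝒪[F]ˣ, x = (ϖ : F) ^ ord x * u := by
  have h0 := zpow_ne_zero (ord x) (uniformizer_ne_zero hϖ)
  obtain ⟨u, hu⟩ := exists_unit_of_ord_eq_zero (x := x / (ϖ : F) ^ ord x) (div_ne_zero hx h0) (by
    rw [div_eq_mul_inv, ord_mul hx (inv_ne_zero h0), ord_inv, ord_uniformizer_zpow hϖ]; ring)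
  exact ⟨u, by rw [hu, mul_div_cancel₀ _ h0]⟩

theorem normAbs_eq {x : F} (hx : x ≠ 0) : normAbs x = (residueCard F : ℝ) ^ (-ord x) := by
  rw [normAbs, if_neg hx, ord, neg_neg, ordVal_apply]

theorem pw_eq_setOf (m : ℤ) : (pw F m : Set F) = {x | valuation F x ≤
    (IsNonarchimedeanLocalField.valueGroupWithZeroIsoInt F).symm (exp (-m))} := by
  ext x
  change ordVal F x ≤ _ ↔ valuation F x ≤ _
  rw [ordVal_apply]
  exact (OrderIso.le_symm_apply
    (IsNonarchimedeanLocalField.valueGroupWithZeroIsoInt F).toOrderIso).symm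

theorem isCompact_pw (m : ℤ) : IsCompact (pw F m : Set F) := by
  rw [pw_eq_setOf]; exact IsNonarchimedeanLocalField.isCompact_closedBall F _

theorem exists_pw_subset {s : Set F} (hs : s ∈ nhds (0 : F)) : ∃ m : ℕ, (pw F m : Set F) ⊆ s := by
  obtain ⟨γ, hγ, h⟩ := (IsValuativeTopology.hasBasis_nhds_zero' F).mem_iff.1 hs
  have hγ' : IsNonarchimedeanLocalField.valueGroupWithZeroIsoInt F γ ≠ 0 := by simpa using hγ
  obtain ⟨m, hm⟩ := exists_exp_neg_natCast_lt hγ'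
  refine ⟨m, fun x hx => h ?_⟩
  have h1 : ordVal F x < IsNonarchimedeanLocalField.valueGroupWithZeroIsoInt F γ :=
    lt_of_le_of_lt hx hm
  rw [ordVal_apply] at h1
  exact (IsNonarchimedeanLocalField.valueGroupWithZeroIsoInt F).strictMono.lt_iff_lt.1 h1

theorem pw_mem_nhds (m : ℤ) : (pw F m : Set F) ∈ nhds (0 : F) := by
  refine (IsValuativeTopology.hasBasis_nhds_zero' F).mem_iff.2
    ⟨(IsNonarchimedeanLocalField.valueGroupWithZeroIsoInt F).symm (exp (-m)), ?_, ?_⟩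
  · simp
  · rw [pw_eq_setOf]; exact fun x hx => Set.mem_setOf.2 (Set.mem_setOf.1 hx).le

theorem isOpen_pw (m : ℤ) : IsOpen (pw F m : Set F) :=
  (pw F m).isOpen_of_mem_nhds (g := 0) (pw_mem_nhds m)

theorem isClosed_pw (m : ℤ) : IsClosed (pw F m : Set F) :=
  (pw F m).isClosed_of_isOpen (isOpen_pw m)

theorem exists_mem_pw_neg (x : F) : ∃ m : ℕ, x ∈ pw F (-m) := by
  by_cases hx : x = 0
  · exact ⟨0, by simp [hx]⟩
  · exact ⟨(-ord x).toNat, (mem_pw_iff_ord hx).2 (by omega)⟩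

theorem nhds_zero_hasBasis_pw : (nhds (0 : F)).HasBasis (fun _ : ℕ => True) fun m => (pw F m : Set F) :=
  ⟨fun s => ⟨fun h => by simpa using exists_pw_subset h,
    fun ⟨m, _, h⟩ => Filter.mem_of_superset (pw_mem_nhds m) h⟩⟩

instance : T2Space F := by
  refine IsTopologicalAddGroup.t2Space_of_zero_sep fun x hx => ?_
  exact ⟨pw F (ord x + 1), pw_mem_nhds _, fun h => by
    have := (mem_pw_iff_ord hx).1 h; omega⟩

/-- The ideals $\mathfrak p^m$ make $F$ first countable at $0$, hence pseudometrizable, and $F$ is a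
countable union of compact ideals. This is what makes Fubini available for Borel measures on
products of copies of $F$. -/
instance : SecondCountableTopology F := by
  let := IsTopologicalAddGroup.rightUniformSpace F
  have := isUniformAddGroup_of_addCommGroup (G := F)
  have : (nhds (0 : F)).IsCountablyGenerated :=
    nhds_zero_hasBasis_pw.isCountablyGenerated
  have : (_root_.uniformity F).IsCountablyGenerated :=
    IsUniformAddGroup.uniformity_countably_generated
  let := UniformSpace.pseudoMetricSpace F
  have : SigmaCompactSpace F := SigmaCompactSpace.of_countable
    (Set.range fun m : ℕ => (pw F (-m) : Set F)) (Set.countable_range _)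
    (by rintro _ ⟨m, rfl⟩; exact isCompact_pw _)
    (by
      ext x
      obtain ⟨m, hm⟩ := exists_mem_pw_neg x
      simp only [Set.mem_sUnion, Set.mem_range, exists_exists_eq_and, Set.mem_univ, iff_true]
      exact ⟨m, hm⟩)
  exact EMetric.secondCountable_of_sigmaCompact F

/-- The set of elements of order `m`. -/
def shell (F : Type*) [Field F] [ValuativeRel F] [TopologicalSpace F]
    [IsNonarchimedeanLocalField F] (m : ℤ) : Set F := (pw F m : Set F) \ pw F (m + 1)

theorem mem_shell {m : ℤ} {x : F} : x ∈ shell F m ↔ x ≠ 0 ∧ ord x = m := by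
  constructor
  · rintro ⟨h1, h2⟩
    exact ⟨ne_zero_of_notMem_pw h2, ord_eq_of_mem h1 h2⟩
  · rintro ⟨h1, h2⟩
    exact ⟨(mem_pw_iff_ord h1).2 h2.ge, fun h => by
      have := (mem_pw_iff_ord h1).1 h; omega⟩

end LocalFieldBasics

/-! ### The character $\chi$: explicit values from the Hilbert symbol -/

section QuadraticCharacter

variable {F : Type*} [Field F] [ValuativeRel F] [TopologicalSpace F] [IsNonarchimedeanLocalField F]

theorem residue_eq_zero_iff {x : 𝒪[F]} : IsLocalRing.residue 𝒪[F] x = 0 ↔ (x : F) ∈ pw F 1 := by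
  rw [IsLocalRing.residue_eq_zero_iff, IsLocalRing.mem_maximalIdeal, mem_nonunits_iff,
    Valuation.Integer.not_isUnit_iff_valuation_lt_one, ← ordVal_lt_one_iff]
  by_cases hx : (x : F) = 0
  · simp [hx]
  · rw [mem_pw_iff_ord hx, ordVal_eq_exp hx, ← WithZero.exp_zero, WithZero.exp_lt_exp]; omega

theorem two_residue_ne_zero (hq : Odd (residueCard F)) : (2 : 𝓀[F]) ≠ 0 := by
  have := Fintype.ofFinite 𝓀[F]
  refine Ring.two_ne_zero fun h => ?_
  rw [residueCard, Nat.card_eq_fintype_card] at hq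
  have := FiniteField.even_card_iff_char_two.1 h
  rw [Nat.odd_iff] at hq; omega

theorem two_ne_zero_of_odd (hq : Odd (residueCard F)) : (2 : F) ≠ 0 := by
  intro h
  refine two_residue_ne_zero hq ?_
  have h1 : (2 : 𝒪[F]) = 0 := Subtype.ext h
  rw [← map_ofNat (IsLocalRing.residue 𝒪[F]) 2, h1, map_zero]

theorem ord_two (hq : Odd (residueCard F)) : ord (2 : F) = 0 := by
  have h := two_residue_ne_zero hq
  rw [← map_ofNat (IsLocalRing.residue 𝒪[F]) 2, Ne, residue_eq_zero_iff] at h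
  refine ord_eq_of_mem ?_ h
  exact mem_pw_zero.2 (2 : 𝒪[F]).2

/-- Hensel's lemma for square roots of units. -/
theorem exists_sq_eq_of_residue (hq : Odd (residueCard F)) (u : 𝒪[F]ˣ) (w : 𝒪[F])
    (h : IsLocalRing.residue 𝒪[F] w ^ 2 = IsLocalRing.residue 𝒪[F] u) :
    ∃ y : 𝒪[F], y ^ 2 = u ∧ IsLocalRing.residue 𝒪[F] y = IsLocalRing.residue 𝒪[F] w := by
  let := IsTopologicalAddGroup.rightUniformSpace F
  have := isUniformAddGroup_of_addCommGroup (G := F)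
  have hens : HenselianRing 𝒪[F] 𝓂[F] := inferInstance
  obtain ⟨y, hy, hy'⟩ := hens.is_henselian (Polynomial.X ^ 2 - Polynomial.C (u : 𝒪[F]))
    (Polynomial.monic_X_pow_sub_C _ two_ne_zero) w (by
      rw [← IsLocalRing.residue_eq_zero_iff]; simp [h]) (by
      change IsUnit (IsLocalRing.residue 𝒪[F] _)
      have hw : IsLocalRing.residue 𝒪[F] w ≠ 0 := by
        intro h0
        rw [h0] at h
        exact (u.isUnit.map (IsLocalRing.residue 𝒪[F])).ne_zero (by rw [← h]; simp)
      simp [hw]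
      rw [one_add_one_eq_two]; exact two_residue_ne_zero hq)
  refine ⟨y, ?_, ?_⟩
  · simpa [Polynomial.IsRoot, sub_eq_zero] using hy
  · rwa [← IsLocalRing.residue_eq_zero_iff, map_sub, sub_eq_zero] at hy'

theorem exists_sq_eq_one_add (hq : Odd (residueCard F)) {x : F} (hx : x ∈ pw F 1) :
    ∃ y : F, y ^ 2 = 1 + x ∧ y - 1 ∈ pw F 1 := by
  obtain ⟨h0, hord⟩ := ord_add_of_mem one_ne_zero ord_one (by simpa using hx)
  obtain ⟨u, hu⟩ := exists_unit_of_ord_eq_zero h0 hord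
  have hres : IsLocalRing.residue 𝒪[F] ((u : 𝒪[F]) - 1) = 0 := by
    rw [residue_eq_zero_iff]; push_cast; rw [hu]; simpa using hx
  obtain ⟨y, hy, hy'⟩ := exists_sq_eq_of_residue hq u 1 (by
    rw [map_sub, sub_eq_zero] at hres; rw [hres]; simp)
  refine ⟨y, ?_, ?_⟩
  · rw [← hu, ← hy]; simp
  · have : IsLocalRing.residue 𝒪[F] (y - 1) = 0 := by rw [map_sub, hy', sub_self]
    rw [residue_eq_zero_iff] at this; simpa using this

open scoped Classical in
/-- The quadratic symbol of a unit. -/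
noncomputable def unitSymbol (u : 𝒪[F]ˣ) : ℤ :=
  if IsSquare (IsLocalRing.residue 𝒪[F] u) then 1 else -1

open scoped Classical in
theorem unitSymbol_eq_quadraticChar [Fintype 𝓀[F]] (u : 𝒪[F]ˣ) :
    unitSymbol u = quadraticChar 𝓀[F] (IsLocalRing.residue 𝒪[F] u) := by
  have h : IsLocalRing.residue 𝒪[F] u ≠ 0 := (u.isUnit.map (IsLocalRing.residue 𝒪[F])).ne_zero
  rw [unitSymbol, quadraticChar_apply, quadraticCharFun, if_neg h]
  congr

theorem unitSymbol_mul (u v : 𝒪[F]ˣ) : unitSymbol (u * v) = unitSymbol u * unitSymbol v := by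
  classical
  have := Fintype.ofFinite 𝓀[F]
  simp only [unitSymbol_eq_quadraticChar, Units.val_mul, map_mul]

theorem unitSymbol_eq (u : 𝒪[F]ˣ) : unitSymbol u = 1 ∨ unitSymbol u = -1 := by
  unfold unitSymbol; split_ifs <;> simp

theorem unitSymbol_of_sub_one_mem {u : 𝒪[F]ˣ} (h : ((u : 𝒪[F]) : F) - 1 ∈ pw F 1) :
    unitSymbol u = 1 := by
  have : IsLocalRing.residue 𝒪[F] ((u : 𝒪[F]) - 1) = 0 := by
    rw [residue_eq_zero_iff]; simpa using h
  rw [map_sub, map_one, sub_eq_zero] at this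
  rw [unitSymbol, this, if_pos IsSquare.one]

/-- If $z$ and $y$ have different orders, one term dominates and has even order. If the orders
agree, cancellation would make the residue of $u$ the square of the residue of $z/y$. -/
theorem even_ord_sq_sub (u : 𝒪[F]ˣ) (hu : ¬ IsSquare (IsLocalRing.residue 𝒪[F] u)) {z y : F}
    (h : z ≠ 0 ∨ y ≠ 0) : z ^ 2 - u * y ^ 2 ≠ 0 ∧ Even (ord (z ^ 2 - u * y ^ 2)) := by
  have hu0 := coe_unit_ne_zero u
  have hord : ∀ y : F, y ≠ 0 → ord (-(u * y ^ 2)) = 2 * ord y := fun y hy => by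
    rw [ord_neg, ord_mul hu0 (pow_ne_zero 2 hy), ord_unit, ord_pow]; simp
  have hord2 : ∀ y : F, ord (y ^ 2) = 2 * ord y := fun y => by rw [ord_pow]; simp
  by_cases hz : z = 0
  · have hy : y ≠ 0 := by tauto
    subst hz
    rw [zero_pow two_ne_zero, zero_sub, hord y hy]
    exact ⟨by simp [hu0, hy], even_two_mul _⟩
  by_cases hy : y = 0
  · subst hy
    rw [zero_pow two_ne_zero, mul_zero, sub_zero, hord2]
    exact ⟨pow_ne_zero _ hz, even_two_mul _⟩
  have hy' : -((u : F) * y ^ 2) ≠ 0 := by simp [hu0, hy]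
  rcases lt_trichotomy (ord z) (ord y) with hlt | heq | hlt
  · obtain ⟨h1, h2⟩ := ord_add_of_mem (pow_ne_zero 2 hz) (hord2 z)
      ((mem_pw_iff_ord hy').2 (by rw [hord y hy]; omega))
    rw [← sub_eq_add_neg] at h1 h2
    exact ⟨h1, h2 ▸ even_two_mul _⟩
  · obtain ⟨w, hw⟩ := exists_unit_of_ord_eq_zero (x := z / y) (div_ne_zero hz hy) (by
      rw [div_eq_mul_inv, ord_mul hz (inv_ne_zero hy), ord_inv]; omega)
    have hzw : z ^ 2 - u * y ^ 2 = y ^ 2 * ((((w : 𝒪[F]) ^ 2 - u : 𝒪[F])) : F) := by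
      have : z = w * y := by rw [hw, div_mul_cancel₀ _ hy]
      rw [this]; push_cast; ring
    have hne : ((((w : 𝒪[F]) ^ 2 - u : 𝒪[F])) : F) ∉ pw F 1 := by
      rw [← residue_eq_zero_iff, map_sub, sub_eq_zero, map_pow]
      exact fun h => hu ⟨_, by rw [← h, sq]⟩
    have h0 := ord_eq_of_mem (m := 0) (mem_pw_zero.2 ((w : 𝒪[F]) ^ 2 - u : 𝒪[F]).2) hne
    have hne0 := ne_zero_of_notMem_pw hne
    rw [hzw, ord_mul (pow_ne_zero 2 hy) hne0, h0, add_zero, hord2]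
    exact ⟨mul_ne_zero (pow_ne_zero 2 hy) hne0, even_two_mul _⟩
  · obtain ⟨h1, h2⟩ := ord_add_of_mem hy' (hord y hy)
      ((mem_pw_iff_ord (x := z ^ 2) (pow_ne_zero 2 hz)).2 (by rw [hord2]; omega))
    rw [add_comm, ← sub_eq_add_neg] at h1 h2
    exact ⟨h1, h2 ▸ even_two_mul _⟩

variable {ϖ : 𝒪[F]}

theorem hilbertSymbol_mul_sq (a x : F) {y : F} (hy : y ≠ 0) :
    hilbertSymbol a (x * y ^ 2) = hilbertSymbol a x := by
  unfold hilbertSymbol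
  congr 1
  refine propext ⟨?_, ?_⟩
  · rintro ⟨r, s, t, h, e⟩
    refine ⟨r, y * s, t, fun h0 => h ?_, by rw [e]; ring⟩
    simp_all
  · rintro ⟨r, s, t, h, e⟩
    refine ⟨r, s / y, t, fun h0 => h ?_, by rw [e]; field_simp⟩
    simp_all

/-- Dividing $t^2=ar^2+axs^2$ by $a$ gives $r^2=a(t/a)^2-xs^2$: the roles of $r$ and $t$ are
exchanged. -/
theorem hilbertSymbol_uniformizer_mul {a : F} (ha : a ≠ 0) (x : F) :
    hilbertSymbol a (a * x) = hilbertSymbol a (-x) := by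
  unfold hilbertSymbol
  congr 1
  refine propext ⟨?_, ?_⟩
  · rintro ⟨r, s, t, h, e⟩
    refine ⟨t / a, s, r, fun h0 => h ?_, ?_⟩
    · simp_all
    · field_simp; rw [e]; ring
  · rintro ⟨r, s, t, h, e⟩
    refine ⟨t, s, a * r, fun h0 => h ?_, ?_⟩
    · simp_all
    · rw [e]; ring

/-- A solution gives $t^2-us^2=\varpi r^2$, whose right side has odd order; by `even_ord_sq_sub`
this is impossible for a non-square residue. For a square residue Hensel's lemma gives a solution
with $r=0$. -/
theorem hilbertSymbol_unit (hq : Odd (residueCard F)) (hϖ : Irreducible ϖ) (u : 𝒪[F]ˣ) :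
    hilbertSymbol (ϖ : F) u = unitSymbol u := by
  unfold hilbertSymbol unitSymbol
  congr 1
  refine propext ⟨?_, ?_⟩
  · rintro ⟨r, s, t, h, e⟩
    by_contra hu
    have hϖ0 := uniformizer_ne_zero hϖ
    have e' : t ^ 2 - u * s ^ 2 = ϖ * r ^ 2 := by rw [e]; ring
    by_cases hts : t ≠ 0 ∨ s ≠ 0
    · obtain ⟨h1, h2⟩ := even_ord_sq_sub u hu hts
      rw [e'] at h1 h2
      have hr : r ≠ 0 := by rintro rfl; simp at h1
      rw [ord_mul hϖ0 (pow_ne_zero 2 hr), ord_uniformizer hϖ, ord_pow] at h2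
      simp [parity_simps] at h2
    · push Not at hts
      obtain ⟨rfl, rfl⟩ := hts
      simp [hϖ0] at e'
      simp [e'] at h
  · rintro ⟨w, hw⟩
    obtain ⟨w, rfl⟩ := IsLocalRing.residue_surjective w
    obtain ⟨y, hy, -⟩ := exists_sq_eq_of_residue hq u w (by rw [hw, sq])
    refine ⟨0, 1, y, by simp, ?_⟩
    have := congrArg (Subtype.val : 𝒪[F] → F) hy
    simpa using this

theorem unitSymbol_neg (u : 𝒪[F]ˣ) : unitSymbol (-u) = unitSymbol (-1 : 𝒪[F]ˣ) * unitSymbol u := by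
  rw [← unitSymbol_mul, neg_one_mul]

/-- Even powers of `ϖ` are squares and drop out; one remaining factor `ϖ` is traded for a sign.
Multiplicativity of $\chi$, not visible from the definition of the symbol, is read off from this
formula. -/
theorem hilbertSymbol_zpow_mul (hq : Odd (residueCard F)) (hϖ : Irreducible ϖ) (m : ℤ)
    (u : 𝒪[F]ˣ) :
    (hilbertSymbol (ϖ : F) ((ϖ : F) ^ m * u) : ℂ) =
      (unitSymbol (-1 : 𝒪[F]ˣ) : ℂ) ^ m * unitSymbol u := by
  have hϖ0 := uniformizer_ne_zero hϖ
  have h1 : (unitSymbol (-1 : 𝒪[F]ˣ) : ℂ) ^ 2 = 1 := by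
    rcases unitSymbol_eq (-1 : 𝒪[F]ˣ) with h | h <;> simp [h]
  have h0 : (unitSymbol (-1 : 𝒪[F]ˣ) : ℂ) ≠ 0 := fun h => by rw [h] at h1; norm_num at h1
  have h2 : ∀ k : ℤ, (unitSymbol (-1 : 𝒪[F]ˣ) : ℂ) ^ (2 * k) = 1 := fun k => by
    rw [_root_.zpow_mul, zpow_ofNat, h1, _root_.one_zpow]
  have h3 : ∀ k : ℤ, (ϖ : F) ^ (2 * k) = ((ϖ : F) ^ k) ^ 2 := fun k => by
    rw [mul_comm, _root_.zpow_mul, zpow_ofNat]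
  rcases Int.even_or_odd' m with ⟨k, rfl | rfl⟩
  · rw [h2, one_mul, h3, mul_comm, hilbertSymbol_mul_sq _ _ (zpow_ne_zero _ hϖ0),
      hilbertSymbol_unit hq hϖ]
  · rw [zpow_add₀ h0, h2, one_mul, zpow_one, zpow_add₀ hϖ0, zpow_one, h3,
      mul_comm (((ϖ : F) ^ k) ^ 2), mul_right_comm,
      hilbertSymbol_mul_sq _ _ (zpow_ne_zero _ hϖ0), hilbertSymbol_uniformizer_mul hϖ0]
    have := hilbertSymbol_unit hq hϖ (-u)
    push_cast [Units.val_neg] at this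
    rw [this, unitSymbol_neg]; push_cast; ring

theorem quadChar_zpow_mul (hq : Odd (residueCard F)) (hϖ : Irreducible ϖ) (m : ℤ) (u : 𝒪[F]ˣ) :
    quadChar (ϖ : F) ((ϖ : F) ^ m * u) = (unitSymbol (-1 : 𝒪[F]ˣ) : ℂ) ^ m * unitSymbol u :=
  hilbertSymbol_zpow_mul hq hϖ m u

theorem quadChar_unit (hq : Odd (residueCard F)) (hϖ : Irreducible ϖ) (u : 𝒪[F]ˣ) :
    quadChar (ϖ : F) u = unitSymbol u := by
  simpa using quadChar_zpow_mul hq hϖ 0 u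

theorem quadChar_neg_one (hq : Odd (residueCard F)) (hϖ : Irreducible ϖ) :
    quadChar (ϖ : F) (-1) = unitSymbol (-1 : 𝒪[F]ˣ) := by
  simpa using quadChar_unit hq hϖ (-1)

theorem quadChar_eq (a x : F) : quadChar a x = 1 ∨ quadChar a x = -1 := by
  unfold quadChar hilbertSymbol; split_ifs <;> simp

theorem quadChar_sq (a x : F) : quadChar a x ^ 2 = 1 := by
  rcases quadChar_eq a x with h | h <;> simp [h]

theorem quadChar_mul_self (a x : F) : quadChar a x * quadChar a x = 1 := by
  rw [← sq, quadChar_sq]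

theorem quadChar_ne_zero (a x : F) : quadChar a x ≠ 0 := fun h => by
  have := quadChar_sq a x; rw [h] at this; norm_num at this

theorem quadChar_mul (hq : Odd (residueCard F)) (hϖ : Irreducible ϖ) {x y : F} (hx : x ≠ 0)
    (hy : y ≠ 0) : quadChar (ϖ : F) (x * y) = quadChar (ϖ : F) x * quadChar (ϖ : F) y := by
  obtain ⟨u, hu⟩ := exists_unit_mul_zpow hϖ hx
  obtain ⟨v, hv⟩ := exists_unit_mul_zpow hϖ hy
  have hxy : x * y = (ϖ : F) ^ (ord x + ord y) * ((u * v : 𝒪[F]ˣ) : 𝒪[F]) := by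
    rw [zpow_add₀ (uniformizer_ne_zero hϖ)]; push_cast
    conv_lhs => rw [hu, hv]
    ring
  have h0 : (unitSymbol (-1 : 𝒪[F]ˣ) : ℂ) ≠ 0 := by
    rcases unitSymbol_eq (-1 : 𝒪[F]ˣ) with h | h <;> simp [h]
  rw [hxy, quadChar_zpow_mul hq hϖ, unitSymbol_mul, zpow_add₀ h0]
  conv_rhs => rw [hu, hv]
  rw [quadChar_zpow_mul hq hϖ, quadChar_zpow_mul hq hϖ]
  push_cast; ring

@[simp] theorem quadChar_one (a : F) : quadChar a 1 = 1 := by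
  unfold quadChar hilbertSymbol
  rw [if_pos ⟨0, 1, 1, by simp, by simp⟩]; simp

theorem quadChar_inv (hq : Odd (residueCard F)) (hϖ : Irreducible ϖ) {x : F} (hx : x ≠ 0) :
    quadChar (ϖ : F) x⁻¹ = quadChar (ϖ : F) x := by
  have h := quadChar_mul hq hϖ hx (inv_ne_zero hx)
  rw [mul_inv_cancel₀ hx, quadChar_one] at h
  calc quadChar (ϖ : F) x⁻¹ = quadChar (ϖ : F) x * quadChar (ϖ : F) x * quadChar (ϖ : F) x⁻¹ := by
        rw [quadChar_mul_self, one_mul]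
    _ = quadChar (ϖ : F) x := by rw [mul_assoc, ← h, mul_one]

theorem quadChar_of_sub_one_mem (hq : Odd (residueCard F)) (hϖ : Irreducible ϖ) {x : F}
    (h : x - 1 ∈ pw F 1) : quadChar (ϖ : F) x = 1 := by
  obtain ⟨h0, hord⟩ := ord_add_of_mem one_ne_zero ord_one (y := x - 1) (by simpa using h)
  rw [add_sub_cancel] at h0 hord
  obtain ⟨u, rfl⟩ := exists_unit_of_ord_eq_zero h0 hord
  rw [quadChar_unit hq hϖ, unitSymbol_of_sub_one_mem h]; simp

theorem quadChar_uniformizer (hq : Odd (residueCard F)) (hϖ : Irreducible ϖ) :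
    quadChar (ϖ : F) ϖ = quadChar (ϖ : F) (-1) := by
  have := quadChar_zpow_mul hq hϖ 1 1
  rw [quadChar_neg_one hq hϖ]
  have h1 : unitSymbol (1 : 𝒪[F]ˣ) = 1 := unitSymbol_of_sub_one_mem (by simp)
  simpa [h1] using this

theorem quadChar_eq_zpow (hq : Odd (residueCard F)) (hϖ : Irreducible ϖ) (m : ℤ) (u : 𝒪[F]ˣ) :
    quadChar (ϖ : F) ((ϖ : F) ^ m * u) = quadChar (ϖ : F) (-1) ^ m * quadChar (ϖ : F) u := by
  rw [quadChar_zpow_mul hq hϖ, quadChar_neg_one hq hϖ, quadChar_unit hq hϖ]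

end QuadraticCharacter

/-! ### Haar measure of ideals and changes of variable -/

section HaarMeasure

variable {F : Type*} [Field F] [ValuativeRel F] [TopologicalSpace F] [IsNonarchimedeanLocalField F]

/-- A set of representatives of the residue field. -/
noncomputable def resRep (a : 𝓀[F]) : F :=
  (Function.surjInv (IsLocalRing.residue_surjective (R := 𝒪[F])) a : 𝒪[F])

theorem resRep_mem (a : 𝓀[F]) : resRep a ∈ pw F 0 := mem_pw_zero.2 (Subtype.prop _)

theorem residue_resRep (a : 𝓀[F]) :
    IsLocalRing.residue 𝒪[F] ⟨resRep a, mem_pw_zero.1 (resRep_mem a)⟩ = a :=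
  Function.surjInv_eq (IsLocalRing.residue_surjective (R := 𝒪[F])) a

theorem residue_eq_iff {x y : 𝒪[F]} :
    IsLocalRing.residue 𝒪[F] x = IsLocalRing.residue 𝒪[F] y ↔ (x : F) - y ∈ pw F 1 := by
  rw [← sub_eq_zero, ← map_sub, residue_eq_zero_iff]; rfl

theorem sub_resRep_mem_iff {x : 𝒪[F]} {a : 𝓀[F]} :
    (x : F) - resRep a ∈ pw F 1 ↔ IsLocalRing.residue 𝒪[F] x = a := by
  conv_rhs => rw [← residue_resRep a]
  rw [residue_eq_iff]

theorem iUnion_resRep_add :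
    (pw F 0 : Set F) = ⋃ a : 𝓀[F], (fun x => -resRep a + x) ⁻¹' (pw F 1 : Set F) := by
  ext x
  simp only [Set.mem_iUnion, Set.mem_preimage, SetLike.mem_coe]
  constructor
  · intro hx
    refine ⟨IsLocalRing.residue 𝒪[F] ⟨x, mem_pw_zero.1 hx⟩, ?_⟩
    rw [neg_add_eq_sub]
    exact sub_resRep_mem_iff (x := ⟨x, mem_pw_zero.1 hx⟩).2 rfl
  · rintro ⟨a, ha⟩
    have := add_mem (resRep_mem a) (pw_mono (by omega : (0 : ℤ) ≤ 1) ha)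
    simpa using this

theorem pairwise_disjoint_resRep_add :
    Pairwise (Function.onFun Disjoint fun a : 𝓀[F] =>
      (fun x => -resRep a + x) ⁻¹' (pw F 1 : Set F)) := by
  intro a b hab
  refine Set.disjoint_left.2 fun x hxa hxb => hab ?_
  simp only [Set.mem_preimage, SetLike.mem_coe] at hxa hxb
  have hx : x ∈ pw F 0 := by
    have := add_mem (resRep_mem a) (pw_mono (by omega : (0 : ℤ) ≤ 1) hxa)
    simpa using this
  rw [neg_add_eq_sub] at hxa hxb
  rw [← sub_resRep_mem_iff (x := ⟨x, mem_pw_zero.1 hx⟩).1 hxa,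
    sub_resRep_mem_iff (x := ⟨x, mem_pw_zero.1 hx⟩).1 hxb]

theorem residueCard_pos : 0 < residueCard F := Nat.card_pos

theorem one_lt_residueCard : 1 < residueCard F := Finite.one_lt_card

variable [MeasurableSpace F] [BorelSpace F] {μ : Measure F} [μ.IsAddHaarMeasure]

theorem measurableSet_pw (m : ℤ) : MeasurableSet (pw F m : Set F) := (isOpen_pw m).measurableSet

theorem measure_pw_ne_top (m : ℤ) : μ (pw F m : Set F) ≠ ⊤ := (isCompact_pw m).measure_lt_top.ne

theorem measure_pw_zero_eq : μ (pw F 0 : Set F) = residueCard F * μ (pw F 1 : Set F) := by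
  rw [iUnion_resRep_add, measure_iUnion pairwise_disjoint_resRep_add
    (fun a => (measurable_const_add _) (measurableSet_pw 1))]
  simp only [measure_preimage_add]
  have := Fintype.ofFinite 𝓀[F]
  rw [tsum_fintype, Finset.sum_const, Finset.card_univ, nsmul_eq_mul, residueCard,
    Nat.card_eq_fintype_card]

theorem exists_map_mulLeft_eq_smul {c : F} (hc : c ≠ 0) :
    ∃ r : NNReal, μ.map (fun x => c * x) = r • μ := by
  have : (μ.map (fun x => c * x)).IsAddHaarMeasure := Measure.isAddHaarMeasure_map μ (AddMonoidHom.mulLeft c) (continuous_const_mul c)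
    (fun y => ⟨c⁻¹ * y, by simp [hc]⟩) (Homeomorph.mulLeft₀ c hc).isClosedEmbedding.tendsto_cocompact
  exact ⟨_, Measure.isAddLeftInvariant_eq_smul (μ.map (fun x => c * x)) μ⟩

theorem preimage_mul_pw {c : F} (hc : c ≠ 0) (m : ℤ) :
    (fun x => c * x) ⁻¹' (pw F m : Set F) = (pw F (m - ord c) : Set F) := by
  ext x; exact mul_mem_pw_iff hc rfl

variable (hμ : μ (𝒪[F] : Set F) = 1)

include hμ in
theorem measure_pw_zero : μ (pw F 0 : Set F) = 1 := by
  rw [← hμ]; congr 1; ext x; exact mem_pw_zero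

include hμ in
-- Multiplication by an element of order 1 scales the measure by a constant, which the decomposition
-- of $\mathfrak o$ into $q$ cosets of $\mathfrak p$ identifies as $q$.
theorem measure_pw (m : ℤ) : μ.real (pw F m : Set F) = (residueCard F : ℝ) ^ (-m) := by
  obtain ⟨π, hπ0, hπ⟩ := exists_ord_eq_one (F := F)
  obtain ⟨r, hr⟩ := exists_map_mulLeft_eq_smul (μ := μ) hπ0
  have hq0 : (residueCard F : ℝ) ≠ 0 := by exact_mod_cast residueCard_pos.ne'
  have key : ∀ m : ℤ, μ.real (pw F m : Set F) = r * μ.real (pw F (m + 1) : Set F) := fun m => by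
    have h1 : μ.map (fun x => π * x) (pw F (m + 1) : Set F) = μ (pw F m : Set F) := by
      rw [Measure.map_apply (measurable_const_mul π) (measurableSet_pw _), preimage_mul_pw hπ0, hπ,
        add_sub_cancel_right]
    rw [Measure.real, ← h1, hr]
    simp [Measure.real]
  have h0 : μ.real (pw F 0 : Set F) = 1 := by rw [Measure.real, measure_pw_zero hμ]; simp
  have h1 : μ.real (pw F 0 : Set F) = residueCard F * μ.real (pw F 1 : Set F) := by
    rw [Measure.real, measure_pw_zero_eq]; simp [Measure.real]
  have hrq : (r : ℝ) = residueCard F := by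
    have h2 := key 0
    rw [h0, zero_add] at h2
    rw [h0] at h1
    have h3 : μ.real (pw F 1 : Set F) ≠ 0 := fun h => by rw [h] at h1; simp at h1
    exact mul_right_cancel₀ h3 (h2.symm.trans h1)
  rw [hrq] at key
  induction m using Int.induction_on with
  | zero => simp [h0]
  | succ m ih =>
    have := key m
    rw [ih] at this
    rw [neg_add, zpow_add₀ hq0, this, _root_.zpow_neg_one, mul_comm, ← mul_assoc, inv_mul_cancel₀ hq0,
      one_mul]
  | pred m ih =>
    rw [key (-m - 1), sub_add_cancel, ih, neg_sub, sub_neg_eq_add, zpow_add₀ hq0, zpow_one, neg_neg]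

include hμ in
theorem map_mulLeft {c : F} (hc : c ≠ 0) :
    μ.map (fun x => c * x) = ((residueCard F : NNReal) ^ ord c) • μ := by
  obtain ⟨r, hr⟩ := exists_map_mulLeft_eq_smul (μ := μ) hc
  have h1 : μ.map (fun x => c * x) (pw F (ord c) : Set F) = μ (pw F 0 : Set F) := by
    rw [Measure.map_apply (measurable_const_mul c) (measurableSet_pw _), preimage_mul_pw hc, sub_self]
  rw [hr]
  congr 1
  rw [hr, measure_pw_zero hμ] at h1
  have h2 := congrArg ENNReal.toReal h1
  simp only [Measure.smul_apply] at h2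
  have h3 := measure_pw hμ (ord c)
  rw [Measure.real] at h3
  rw [ENNReal.smul_def, smul_eq_mul, ENNReal.toReal_mul, h3, _root_.zpow_neg] at h2
  ext
  have hq0 : (residueCard F : ℝ) ^ ord c ≠ 0 := by
    have : (residueCard F : ℝ) ≠ 0 := by exact_mod_cast residueCard_pos.ne'
    positivity
  simp only [ENNReal.coe_toReal, ENNReal.toReal_one] at h2
  simpa using (mul_inv_eq_one₀ hq0).1 h2

include hμ in
theorem setIntegral_comp_mul {c : F} (hc : c ≠ 0) (m : ℤ) (f : F → ℂ) :
    ∫ x in (pw F m : Set F), f (c * x) ∂μ =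
      (residueCard F : ℂ) ^ ord c * ∫ x in (pw F (m + ord c) : Set F), f x ∂μ := by
  have h := setIntegral_map_equiv (μ := μ) (MeasurableEquiv.mulLeft₀ c hc) f
    (pw F (m + ord c) : Set F)
  rw [MeasurableEquiv.coe_mulLeft₀, preimage_mul_pw hc, add_sub_cancel_right] at h
  rw [← h, map_mulLeft hμ hc, Measure.restrict_smul, integral_smul_nnreal_measure, NNReal.smul_def,
    Complex.real_smul]
  congr 1
  simp

theorem setIntegral_add_pw {m : ℤ} {y : F} (hy : y ∈ pw F m) (f : F → ℂ) :
    ∫ x in (pw F m : Set F), f (x + y) ∂μ = ∫ x in (pw F m : Set F), f x ∂μ := by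
  have h := (measurePreserving_add_right μ y).setIntegral_preimage_emb
    (MeasurableEquiv.addRight y).measurableEmbedding f (pw F m : Set F)
  convert h using 3
  ext x
  exact (AddSubgroup.add_mem_cancel_right _ hy).symm

include hμ in
theorem setIntegral_const_pw (m : ℤ) (c : ℂ) :
    ∫ _x in (pw F m : Set F), c ∂μ = (residueCard F : ℂ) ^ (-m) * c := by
  rw [setIntegral_const, measure_pw hμ, Complex.real_smul]; simp

include hμ in
theorem setIntegral_pw_zero_eq_sum [Fintype 𝓀[F]] (f : F → ℂ)
    (hf : ∀ x ∈ pw F 0, ∀ y ∈ pw F 1, f (x + y) = f x) :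
    ∫ x in (pw F 0 : Set F), f x ∂μ = (residueCard F : ℂ)⁻¹ * ∑ a : 𝓀[F], f (resRep a) := by
  have hm : ∀ a : 𝓀[F], MeasurableSet ((fun x => -resRep a + x) ⁻¹' (pw F 1 : Set F)) := fun a =>
    (measurable_const_add _) (measurableSet_pw 1)
  have hc : ∀ a : 𝓀[F], ∀ x ∈ (fun x => -resRep a + x) ⁻¹' (pw F 1 : Set F),
      f (resRep a) = f x := fun a x hx => by
    have := hf _ (resRep_mem a) _ hx
    rwa [add_neg_cancel_left, eq_comm] at this
  have hmeas : ∀ a : 𝓀[F], μ ((fun x => -resRep a + x) ⁻¹' (pw F 1 : Set F)) =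
      μ (pw F 1 : Set F) := fun a => measure_preimage_add _ _ _
  rw [iUnion_resRep_add, integral_iUnion_fintype hm pairwise_disjoint_resRep_add, Finset.mul_sum]
  · refine Finset.sum_congr rfl fun a _ => ?_
    rw [← setIntegral_congr_fun (hm a) (hc a), setIntegral_const, Measure.real, hmeas]
    have := measure_pw hμ 1
    rw [Measure.real] at this
    rw [this, Complex.real_smul]; simp
  · intro a
    refine (integrableOn_congr_fun (hc a) (hm a)).1 (integrableOn_const ?_)
    rw [hmeas]; exact measure_pw_ne_top 1

theorem integrableOn_pw {f : F → ℂ} (hf : Continuous f) (m : ℤ) :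
    IntegrableOn f (pw F m : Set F) μ :=
  hf.continuousOn.integrableOn_compact (isCompact_pw m)

theorem setIntegral_pw_swap {f : F → F → ℂ} (hf : Continuous (Function.uncurry f)) (m k : ℤ) :
    ∫ x in (pw F m : Set F), ∫ y in (pw F k : Set F), f x y ∂μ ∂μ =
      ∫ y in (pw F k : Set F), ∫ x in (pw F m : Set F), f x y ∂μ ∂μ := by
  refine integral_integral_swap ?_
  rw [Measure.prod_restrict]
  exact hf.continuousOn.integrableOn_compact ((isCompact_pw m).prod (isCompact_pw k))

end HaarMeasure

/-! ### Integrals of additive characters over ideals and shells -/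

section GaussIntegrals

variable {F : Type*} [Field F] [ValuativeRel F] [TopologicalSpace F] [IsNonarchimedeanLocalField F]

variable (F) in
/-- Complex powers of the residue cardinality. -/
noncomputable def qpow (r : ℂ) : ℂ := (residueCard F : ℂ) ^ r

theorem residueCard_ne_zero : (residueCard F : ℂ) ≠ 0 := by exact_mod_cast residueCard_pos.ne'

theorem qpow_add (r s : ℂ) : qpow F (r + s) = qpow F r * qpow F s :=
  Complex.cpow_add _ _ residueCard_ne_zero

theorem qpow_zero : qpow F 0 = 1 := Complex.cpow_zero _

theorem qpow_ne_zero (r : ℂ) : qpow F r ≠ 0 := by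
  rw [qpow, Ne, Complex.cpow_eq_zero_iff]
  exact fun h => residueCard_ne_zero h.1

theorem qpow_intCast (m : ℤ) : qpow F m = (residueCard F : ℂ) ^ m := Complex.cpow_intCast _ _

theorem qpow_neg_intCast (m : ℤ) : qpow F (-m) = (residueCard F : ℂ) ^ (-m) := by
  rw [← qpow_intCast]; push_cast; rfl

theorem qpow_sum {ι : Type*} (s : Finset ι) (f : ι → ℂ) :
    qpow F (∑ i ∈ s, f i) = ∏ i ∈ s, qpow F (f i) := by
  classical
  induction s using Finset.induction_on with
  | empty => simp [qpow_zero]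
  | insert a s ha ih => rw [Finset.sum_insert ha, Finset.prod_insert ha, qpow_add, ih]

theorem norm_qpow (r : ℂ) : ‖qpow F r‖ = (residueCard F : ℝ) ^ r.re :=
  Complex.norm_natCast_cpow_of_pos residueCard_pos r

variable {ψ : AddChar F Circle}

theorem addChar_of_mem (hψ0 : HasOrderZero ψ) {x : F} (hx : x ∈ pw F 0) : ψ x = 1 := by
  simpa using (hψ0 x).2 (mem_pw_zero.1 hx) 1 (one_mem _)

theorem exists_addChar_ne_one (hψ0 : HasOrderZero ψ) {a : F} {m : ℤ} (ha : a ∉ pw F (-m)) :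
    ∃ y ∈ pw F m, ψ (a * y) ≠ 1 := by
  obtain ⟨π, hπ0, hπ⟩ := exists_ord_eq_one (F := F)
  have hm : ord (π ^ m) = m := by rw [ord_zpow, hπ, mul_one]
  have hm0 : π ^ m ≠ 0 := zpow_ne_zero m hπ0
  by_contra! h
  refine ha ?_
  have h1 : a * π ^ m ∈ 𝒪[F] := (hψ0 _).1 fun x hx => by
    rw [mul_assoc]
    refine h _ ((mul_mem_pw_iff hm0 hm).2 ?_)
    rw [sub_self]; exact mem_pw_zero.2 hx
  rw [← mem_pw_zero, mul_comm, mul_mem_pw_iff hm0 hm, zero_sub] at h1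
  exact h1

variable [MeasurableSpace F] [BorelSpace F] {μ : Measure F} [μ.IsAddHaarMeasure]
variable (hμ : μ (𝒪[F] : Set F) = 1)

open scoped Classical in
include hμ in
-- If the character is nontrivial on the ideal, translation by some $y$ multiplies the integral by
-- $\psi(ay)\ne1$, so the integral vanishes.
theorem integral_addChar (hψ0 : HasOrderZero ψ) (a : F) (m : ℤ) :
    ∫ x in (pw F m : Set F), (ψ (a * x) : ℂ) ∂μ =
      if a ∈ pw F (-m) then (residueCard F : ℂ) ^ (-m) else 0 := by
  split_ifs with h
  · rw [setIntegral_congr_fun (measurableSet_pw m) (g := fun _ => (1 : ℂ)) fun x hx => ?_,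
      setIntegral_const_pw hμ, mul_one]
    have : a * x ∈ pw F 0 := by simpa using mul_mem_pw h hx
    simp [addChar_of_mem hψ0 this]
  · obtain ⟨y, hy, hy1⟩ := exists_addChar_ne_one hψ0 h
    have h1 := setIntegral_add_pw (μ := μ) hy (fun x => (ψ (a * x) : ℂ))
    simp only [mul_add, AddChar.map_add_eq_mul, Circle.coe_mul] at h1
    rw [integral_mul_const] at h1
    have h2 : (ψ (a * y) : ℂ) ≠ 1 := fun h => hy1 (Circle.ext (by simpa using h))
    by_contra h3
    exact h2 (mul_left_cancel₀ h3 (h1.trans (mul_one _).symm))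

theorem measurableSet_shell (m : ℤ) : MeasurableSet (shell F m) :=
  (measurableSet_pw m).diff (measurableSet_pw _)

theorem integral_shell {f : F → ℂ} {m : ℤ} (hf : IntegrableOn f (pw F m : Set F) μ) :
    ∫ x in shell F m, f x ∂μ =
      ∫ x in (pw F m : Set F), f x ∂μ - ∫ x in (pw F (m + 1) : Set F), f x ∂μ :=
  integral_diff (measurableSet_pw _) hf (pw_mono (by omega))

theorem preimage_mul_shell {c : F} (hc : c ≠ 0) (m : ℤ) :
    (fun x => c * x) ⁻¹' (shell F m) = shell F (m - ord c) := by
  ext x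
  simp only [Set.mem_preimage, mem_shell, mul_ne_zero_iff]
  by_cases hx : x = 0
  · simp [hx]
  · rw [ord_mul hc hx]
    exact ⟨fun h => ⟨hx, by omega⟩, fun h => ⟨⟨hc, hx⟩, by omega⟩⟩

include hμ in
theorem integral_shell_comp_mul {c : F} (hc : c ≠ 0) (m : ℤ) (f : F → ℂ) :
    ∫ x in shell F m, f (c * x) ∂μ =
      (residueCard F : ℂ) ^ ord c * ∫ x in shell F (m + ord c), f x ∂μ := by
  have h := setIntegral_map_equiv (μ := μ) (MeasurableEquiv.mulLeft₀ c hc) f (shell F (m + ord c))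
  rw [MeasurableEquiv.coe_mulLeft₀, preimage_mul_shell hc, add_sub_cancel_right] at h
  rw [← h, map_mulLeft hμ hc, Measure.restrict_smul, integral_smul_nnreal_measure, NNReal.smul_def,
    Complex.real_smul]
  congr 1
  simp

theorem integral_shell_add {m : ℤ} {y : F} (hy : y ∈ pw F (m + 1)) (f : F → ℂ) :
    ∫ x in shell F m, f (x + y) ∂μ = ∫ x in shell F m, f x ∂μ := by
  have h := (measurePreserving_add_right μ y).setIntegral_preimage_emb
    (MeasurableEquiv.addRight y).measurableEmbedding f (shell F m)
  convert h using 3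
  ext x
  change _ ∧ ¬ _ ↔ _ ∧ ¬ _
  rw [SetLike.mem_coe, SetLike.mem_coe, SetLike.mem_coe, SetLike.mem_coe,
    AddSubgroup.add_mem_cancel_right _ hy,
    AddSubgroup.add_mem_cancel_right _ (pw_mono (by omega : m ≤ m + 1) hy)]

include hμ in
/-- `∫ ψ(b x)` over the elements of order `m`. -/
theorem integral_shell_addChar (hψ : Continuous ψ) (hψ0 : HasOrderZero ψ) {b : F} (hb : b ≠ 0)
    (m : ℤ) :
    ∫ x in shell F m, (ψ (b * x) : ℂ) ∂μ = (residueCard F : ℂ) ^ (-m) *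
      (if 0 ≤ ord b + m then 1 - (residueCard F : ℂ)⁻¹ else
        if ord b + m = -1 then -(residueCard F : ℂ)⁻¹ else 0) := by
  have hq0 := residueCard_ne_zero (F := F)
  have h1 : (residueCard F : ℂ) ^ (-(m + 1)) = (residueCard F : ℂ) ^ (-m) * (residueCard F : ℂ)⁻¹ := by
    rw [neg_add, zpow_add₀ hq0, _root_.zpow_neg_one]
  rw [integral_shell (integrableOn_pw (by fun_prop) m), integral_addChar hμ hψ0,
    integral_addChar hμ hψ0, mem_pw_iff_ord hb, mem_pw_iff_ord hb, h1]
  split_ifs <;> first | omega | ring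

section Residue

variable {ϖ : 𝒪[F]}

/-- The additive character of the residue field induced by `x ↦ ψ(x / ϖ)`. -/
noncomputable def resAddChar (hψ0 : HasOrderZero ψ) (hϖ : Irreducible ϖ) : AddChar 𝓀[F] ℂ where
  toFun a := (ψ ((ϖ : F)⁻¹ * resRep a) : ℂ)
  map_zero_eq_one' := by
    have h : resRep (0 : 𝓀[F]) ∈ pw F 1 := by
      have := residue_resRep (0 : 𝓀[F])
      rwa [residue_eq_zero_iff] at this
    have h2 : (ϖ : F)⁻¹ * resRep (0 : 𝓀[F]) ∈ pw F 0 := by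
      rw [mul_mem_pw_iff (inv_ne_zero (uniformizer_ne_zero hϖ)) (ord_inv _), ord_uniformizer hϖ]
      simpa using h
    rw [addChar_of_mem hψ0 h2]; simp
  map_add_eq_mul' a b := by
    have h : resRep (a + b) - (resRep a + resRep b) ∈ pw F 1 := by
      have := residue_eq_iff (x := ⟨resRep (a + b), mem_pw_zero.1 (resRep_mem _)⟩)
        (y := ⟨resRep a, mem_pw_zero.1 (resRep_mem _)⟩ + ⟨resRep b, mem_pw_zero.1 (resRep_mem _)⟩)
      rw [map_add, residue_resRep, residue_resRep, residue_resRep] at this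
      simpa using this.1 rfl
    have h2 : (ϖ : F)⁻¹ * (resRep (a + b) - (resRep a + resRep b)) ∈ pw F 0 := by
      rw [mul_mem_pw_iff (inv_ne_zero (uniformizer_ne_zero hϖ)) (ord_inv _), ord_uniformizer hϖ]
      simpa using h
    have h3 : (ϖ : F)⁻¹ * resRep (a + b) = (ϖ : F)⁻¹ * (resRep (a + b) - (resRep a + resRep b)) +
      (ϖ : F)⁻¹ * resRep a + (ϖ : F)⁻¹ * resRep b := by ring
    rw [h3, AddChar.map_add_eq_mul, AddChar.map_add_eq_mul, addChar_of_mem hψ0 h2]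
    simp

theorem resAddChar_residue (hψ0 : HasOrderZero ψ) (hϖ : Irreducible ϖ) (x : 𝒪[F]) :
    resAddChar hψ0 hϖ (IsLocalRing.residue 𝒪[F] x) = (ψ ((ϖ : F)⁻¹ * x) : ℂ) := by
  have h : (x : F) - resRep (IsLocalRing.residue 𝒪[F] x) ∈ pw F 1 := sub_resRep_mem_iff.2 rfl
  have h2 : (ϖ : F)⁻¹ * (x - resRep (IsLocalRing.residue 𝒪[F] x)) ∈ pw F 0 := by
    rw [mul_mem_pw_iff (inv_ne_zero (uniformizer_ne_zero hϖ)) (ord_inv _), ord_uniformizer hϖ]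
    simpa using h
  have h3 : (ϖ : F)⁻¹ * x = (ϖ : F)⁻¹ * (x - resRep (IsLocalRing.residue 𝒪[F] x)) +
    (ϖ : F)⁻¹ * resRep (IsLocalRing.residue 𝒪[F] x) := by ring
  rw [h3, AddChar.map_add_eq_mul, addChar_of_mem hψ0 h2, one_mul]
  rfl

theorem resAddChar_ne_one (hψ0 : HasOrderZero ψ) (hϖ : Irreducible ϖ) :
    resAddChar hψ0 hϖ ≠ 1 := by
  intro h
  obtain ⟨y, hy, hy1⟩ := exists_addChar_ne_one hψ0 (a := (ϖ : F)⁻¹) (m := 0) (by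
    rw [mem_pw_iff_ord (inv_ne_zero (uniformizer_ne_zero hϖ)), ord_inv, ord_uniformizer hϖ]; omega)
  have := resAddChar_residue hψ0 hϖ ⟨y, mem_pw_zero.1 hy⟩
  rw [h] at this
  exact hy1 (Circle.ext (by simpa using this.symm))

end Residue

end GaussIntegrals

/-! ### Quadratic Gauss sums and integrals of $\chi\psi$ over shells -/

section QuadraticGauss

variable {F : Type*} [Field F] [ValuativeRel F] [TopologicalSpace F] [IsNonarchimedeanLocalField F]
variable [MeasurableSpace F] [BorelSpace F] {μ : Measure F} [μ.IsAddHaarMeasure]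
variable {ψ : AddChar F Circle} {ϖ : 𝒪[F]}

open scoped Classical in
/-- The quadratic character of the residue field with complex values. -/
noncomputable def resQuadChar (F : Type*) [Field F] [ValuativeRel F] [TopologicalSpace F]
    [IsNonarchimedeanLocalField F] [Fintype 𝓀[F]] : MulChar 𝓀[F] ℂ :=
  (quadraticChar 𝓀[F]).ringHomComp (Int.castRingHom ℂ)

theorem resQuadChar_residue [Fintype 𝓀[F]] (u : 𝒪[F]ˣ) :
    resQuadChar F (IsLocalRing.residue 𝒪[F] u) = unitSymbol u := by
  rw [unitSymbol_eq_quadraticChar]; rfl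

theorem ringChar_residue_ne_two (hq : Odd (residueCard F)) : ringChar 𝓀[F] ≠ 2 := by
  intro h
  have := Fintype.ofFinite 𝓀[F]
  rw [residueCard, Nat.card_eq_fintype_card] at hq
  have := FiniteField.even_card_iff_char_two.1 h
  rw [Nat.odd_iff] at hq; omega

theorem resQuadChar_ne_one [Fintype 𝓀[F]] (hq : Odd (residueCard F)) : resQuadChar F ≠ 1 := by
  classical
  exact (MulChar.ringHomComp_ne_one_iff Int.cast_injective).2
    (quadraticChar_ne_one (ringChar_residue_ne_two hq))

/-- An element $y$ of the residue field has $1+\chi(y)$ square roots; the constant $1$ contributes a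
full character sum, which is zero. -/
theorem sum_addChar_sq [Fintype 𝓀[F]] (hq : Odd (residueCard F)) {θ : AddChar 𝓀[F] ℂ} (hθ : θ ≠ 1)
    (w : 𝓀[F]ˣ) : ∑ a : 𝓀[F], θ (w * a ^ 2) = resQuadChar F w * gaussSum (resQuadChar F) θ := by
  classical
  have h1 : ∑ a : 𝓀[F], θ (w * a ^ 2) = ∑ y : 𝓀[F], (resQuadChar F y + 1) * θ (w * y) := by
    rw [← Finset.sum_fiberwise (s := Finset.univ) (g := fun a : 𝓀[F] => a ^ 2)]
    refine Finset.sum_congr rfl fun y _ => ?_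
    rw [Finset.sum_congr rfl (g := fun _ => θ (w * y)), Finset.sum_const, nsmul_eq_mul]
    · congr 1
      have := quadraticChar_card_sqrts (ringChar_residue_ne_two hq) y
      have h2 : resQuadChar F y = ((quadraticChar 𝓀[F] y : ℤ) : ℂ) := by
        simp only [resQuadChar, MulChar.ringHomComp_apply, eq_intCast]
      rw [h2, ← Int.cast_one, ← Int.cast_add, ← this]
      push_cast
      congr 2
      ext; simp
    · intro a ha
      rw [(Finset.mem_filter.1 ha).2]
  have h2 : ∑ y : 𝓀[F], θ (w * y) = 0 := by
    rw [← AddChar.sum_eq_zero_of_ne_one hθ]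
    exact Fintype.sum_equiv (Units.mulLeft w) _ _ fun _ => rfl
  have h3 := gaussSum_mulShift (resQuadChar F) θ w
  have h4 : resQuadChar F w * resQuadChar F w = 1 := by
    have := (MulChar.IsQuadratic.comp (quadraticChar_isQuadratic 𝓀[F]) (Int.castRingHom ℂ)).sq_eq_one
    rw [← MulChar.mul_apply, ← sq]
    have h5 : resQuadChar F ^ 2 = 1 := this
    rw [h5]; simp
  rw [h1, ← h3, ← mul_assoc, h4, one_mul]
  simp only [add_mul, one_mul, Finset.sum_add_distrib, h2, add_zero]
  rfl

variable (μ ψ ϖ) in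
/-- The normalized quadratic Gauss sum attached to `ψ` and `ϖ`. -/
noncomputable def gaussConst : ℂ :=
  qpow F (1 / 2) * ∫ x in (pw F 0 : Set F), (ψ ((ϖ : F)⁻¹ * x ^ 2) : ℂ) ∂μ

variable (hμ : μ (𝒪[F] : Set F) = 1)

theorem addChar_add_of_mem (hψ0 : HasOrderZero ψ) {x y : F} (h : y ∈ pw F 0) :
    ψ (x + y) = ψ x := by
  rw [AddChar.map_add_eq_mul, addChar_of_mem hψ0 h, mul_one]

theorem inv_uniformizer_mul_mem (hϖ : Irreducible ϖ) {x : F} (h : x ∈ pw F 1) :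
    (ϖ : F)⁻¹ * x ∈ pw F 0 := by
  rw [mul_mem_pw_iff (inv_ne_zero (uniformizer_ne_zero hϖ)) (ord_inv _), ord_uniformizer hϖ]
  simpa using h

include hμ in
theorem integral_addChar_unit_sq_eq_gaussSum [Fintype 𝓀[F]] (hq : Odd (residueCard F))
    (hψ0 : HasOrderZero ψ) (hϖ : Irreducible ϖ) (u : 𝒪[F]ˣ) :
    ∫ x in (pw F 0 : Set F), (ψ ((ϖ : F)⁻¹ * (u * x ^ 2)) : ℂ) ∂μ =
      unitSymbol u * ((residueCard F : ℂ)⁻¹ * gaussSum (resQuadChar F) (resAddChar hψ0 hϖ)) := by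
  rw [setIntegral_pw_zero_eq_sum hμ]
  · have h := sum_addChar_sq hq (resAddChar_ne_one hψ0 hϖ)
      (Units.map (IsLocalRing.residue 𝒪[F] : 𝒪[F] →* 𝓀[F]) u)
    have h1 : ∀ a : 𝓀[F], (ψ ((ϖ : F)⁻¹ * (u * resRep a ^ 2)) : ℂ) = resAddChar hψ0 hϖ
        ((Units.map (IsLocalRing.residue 𝒪[F] : 𝒪[F] →* 𝓀[F]) u : 𝓀[F]ˣ) * a ^ 2) := fun a => by
      have h2 := resAddChar_residue hψ0 hϖ
        ((u : 𝒪[F]) * (⟨resRep a, mem_pw_zero.1 (resRep_mem a)⟩ : 𝒪[F]) ^ 2)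
      rw [map_mul, map_pow, residue_resRep] at h2
      exact h2.symm
    simp only [h1, h]
    have h3 : resQuadChar F (Units.map (IsLocalRing.residue 𝒪[F] : 𝒪[F] →* 𝓀[F]) u : 𝓀[F]ˣ) =
      unitSymbol u := resQuadChar_residue u
    rw [h3]; ring
  · intro x hx y hy
    have h1 : (ϖ : F)⁻¹ * (u * (x + y) ^ 2) = (ϖ : F)⁻¹ * (u * x ^ 2) +
      (ϖ : F)⁻¹ * (u * (y * (2 * x + y))) := by ring
    have hu : ((u : 𝒪[F]) : F) ∈ pw F 0 := mem_pw_zero.2 (u : 𝒪[F]).2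
    have h2 : (2 : F) * x + y ∈ pw F 0 := by
      rw [two_mul]; exact add_mem (add_mem hx hx) (pw_mono (by omega) hy)
    have h3 : (u : F) * (y * (2 * x + y)) ∈ pw F 1 := by
      simpa using mul_mem_pw hu (mul_mem_pw hy h2)
    rw [h1, addChar_add_of_mem hψ0 (inv_uniformizer_mul_mem hϖ h3)]

theorem qpow_half_mul : qpow F (1 / 2) * qpow F (1 / 2) = residueCard F := by
  rw [← qpow_add]; norm_num [qpow]

theorem qpow_neg (r : ℂ) : qpow F (-r) = (qpow F r)⁻¹ := Complex.cpow_neg _ _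

include hμ in
theorem gaussConst_eq_gaussSum [Fintype 𝓀[F]] (hq : Odd (residueCard F))
    (hψ0 : HasOrderZero ψ) (hϖ : Irreducible ϖ) :
    gaussConst μ ψ ϖ = qpow F (-(1 / 2)) * gaussSum (resQuadChar F) (resAddChar hψ0 hϖ) := by
  have h := integral_addChar_unit_sq_eq_gaussSum hμ hq hψ0 hϖ 1
  have h1 : unitSymbol (1 : 𝒪[F]ˣ) = 1 := unitSymbol_of_sub_one_mem (by simp)
  simp only [h1, Units.val_one, Int.cast_one, OneMemClass.coe_one, one_mul] at h
  rw [gaussConst, h, ← qpow_half_mul, mul_inv, ← mul_assoc, ← mul_assoc,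
    mul_inv_cancel₀ (qpow_ne_zero _), one_mul, qpow_neg]

include hμ in
theorem integral_addChar_unit_sq (hq : Odd (residueCard F))
    (hψ0 : HasOrderZero ψ) (hϖ : Irreducible ϖ) (u : 𝒪[F]ˣ) :
    ∫ x in (pw F 0 : Set F), (ψ ((ϖ : F)⁻¹ * (u * x ^ 2)) : ℂ) ∂μ =
      unitSymbol u * (qpow F (-(1 / 2)) * gaussConst μ ψ ϖ) := by
  have := Fintype.ofFinite 𝓀[F]
  rw [integral_addChar_unit_sq_eq_gaussSum hμ hq hψ0 hϖ, gaussConst_eq_gaussSum hμ hq hψ0 hϖ,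
    ← mul_assoc (qpow F _), qpow_neg, ← mul_inv, qpow_half_mul]

include hμ in
theorem gaussConst_sq (hq : Odd (residueCard F)) (hψ0 : HasOrderZero ψ) (hϖ : Irreducible ϖ) :
    gaussConst μ ψ ϖ ^ 2 = quadChar (ϖ : F) (-1) := by
  classical
  have := Fintype.ofFinite 𝓀[F]
  have h := gaussSum_sq (resQuadChar_ne_one hq)
    (MulChar.IsQuadratic.comp (quadraticChar_isQuadratic 𝓀[F]) (Int.castRingHom ℂ))
    (AddChar.IsPrimitive.of_ne_one (resAddChar_ne_one hψ0 hϖ))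
  have h1 := resQuadChar_residue (-1 : 𝒪[F]ˣ)
  have h2 : IsLocalRing.residue 𝒪[F] ((-1 : 𝒪[F]ˣ) : 𝒪[F]) = -1 := by simp
  rw [h2] at h1
  rw [h1] at h
  rw [gaussConst_eq_gaussSum hμ hq hψ0 hϖ, mul_pow, h, quadChar_neg_one hq hϖ, qpow_neg, inv_pow, sq,
    qpow_half_mul, residueCard, Nat.card_eq_fintype_card, mul_comm, mul_assoc, mul_inv_cancel₀, mul_one]
  simp

theorem shell_subset (m : ℤ) : shell F m ⊆ pw F m := Set.diff_subset

theorem shell_zero_unit {x : F} (hx : x ∈ shell F 0) : ∃ u : 𝒪[F]ˣ, ((u : 𝒪[F]) : F) = x :=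
  exists_unit_of_ord_eq_zero (mem_shell.1 hx).1 (mem_shell.1 hx).2

theorem quadChar_add_of_mem (hq : Odd (residueCard F)) (hϖ : Irreducible ϖ) {m : ℤ} {x y : F}
    (hx : x ∈ shell F m) (hy : y ∈ pw F (m + 1)) :
    quadChar (ϖ : F) (x + y) = quadChar (ϖ : F) x := by
  obtain ⟨hx0, hxm⟩ := mem_shell.1 hx
  have h1 : y / x ∈ pw F 1 := by simpa using div_mem_pw hy hx0 hxm
  have h2 : x + y = x * (1 + y / x) := by field_simp
  have h3 : 1 + y / x ≠ 0 := (ord_add_of_mem one_ne_zero ord_one (by simpa using h1)).1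
  rw [h2, quadChar_mul hq hϖ hx0 h3, quadChar_of_sub_one_mem hq hϖ (x := 1 + y / x) (by simpa using h1), mul_one]

theorem isCompact_shell (m : ℤ) : IsCompact (shell F m) :=
  (isCompact_pw m).diff (isOpen_pw _)

include hμ in
-- Here $\psi(bx)=1$ throughout, and multiplying $x$ by a non-square unit preserves the shell and
-- changes the sign of $\chi$.
theorem integral_shell_quadChar_of_nonneg (hq : Odd (residueCard F)) (hψ0 : HasOrderZero ψ)
    (hϖ : Irreducible ϖ) {b : F} (hb : b ≠ 0) {m : ℤ} (h : 0 ≤ ord b + m) :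
    ∫ x in shell F m, quadChar (ϖ : F) x * (ψ (b * x) : ℂ) ∂μ = 0 := by
  classical
  have := Fintype.ofFinite 𝓀[F]
  have h1 : ∫ x in shell F m, quadChar (ϖ : F) x * (ψ (b * x) : ℂ) ∂μ =
      ∫ x in shell F m, quadChar (ϖ : F) x ∂μ := by
    refine setIntegral_congr_fun (measurableSet_shell m) fun x hx => ?_
    have hbx : b * x ∈ pw F 0 :=
      pw_mono h (mul_mem_pw ((mem_pw_iff_ord hb).2 le_rfl) hx.1)
    simp [addChar_of_mem hψ0 hbx]
  obtain ⟨a, ha⟩ := quadraticChar_exists_neg_one (ringChar_residue_ne_two hq)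
  obtain ⟨v, rfl⟩ := IsLocalRing.residue_surjective a
  have hv : IsUnit v := by
    by_contra hv
    have : IsLocalRing.residue 𝒪[F] v = 0 := by
      rwa [IsLocalRing.residue_eq_zero_iff, IsLocalRing.mem_maximalIdeal]
    rw [this] at ha; simp at ha
  obtain ⟨u, rfl⟩ := hv
  have h2 := integral_shell_comp_mul hμ (coe_unit_ne_zero u) m (quadChar (ϖ : F))
  rw [ord_unit, zpow_zero, one_mul, add_zero] at h2
  have h3 : ∫ x in shell F m, quadChar (ϖ : F) (u * x) ∂μ =
      ∫ x in shell F m, -quadChar (ϖ : F) x ∂μ := by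
    refine setIntegral_congr_fun (measurableSet_shell m) fun x hx => ?_
    rw [quadChar_mul hq hϖ (coe_unit_ne_zero u) (mem_shell.1 hx).1, quadChar_unit hq hϖ,
      unitSymbol_eq_quadraticChar, ha]
    simp
  rw [h3, integral_neg] at h2
  rw [h1]
  exact self_eq_neg.1 h2.symm

/-- Translation by $y\in\mathfrak p^{m+1}$ leaves $\chi$ unchanged on the shell, while
$\psi(by)\ne1$ for some such $y$. -/
theorem integral_shell_quadChar_of_lt (hq : Odd (residueCard F)) (hψ0 : HasOrderZero ψ)
    (hϖ : Irreducible ϖ) {b : F} (hb : b ≠ 0) {m : ℤ} (h : ord b + m < -1) :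
    ∫ x in shell F m, quadChar (ϖ : F) x * (ψ (b * x) : ℂ) ∂μ = 0 := by
  obtain ⟨y, hy, hy1⟩ := exists_addChar_ne_one hψ0 (a := b) (m := m + 1) (by
    rw [mem_pw_iff_ord hb]; omega)
  have h1 := integral_shell_add (μ := μ) hy (fun x => quadChar (ϖ : F) x * (ψ (b * x) : ℂ))
  have h2 : ∫ x in shell F m, quadChar (ϖ : F) (x + y) * (ψ (b * (x + y)) : ℂ) ∂μ =
      ∫ x in shell F m, (quadChar (ϖ : F) x * (ψ (b * x) : ℂ)) * (ψ (b * y) : ℂ) ∂μ := by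
    refine setIntegral_congr_fun (measurableSet_shell m) fun x hx => ?_
    rw [quadChar_add_of_mem hq hϖ hx hy, mul_add, AddChar.map_add_eq_mul, Circle.coe_mul, mul_assoc]
  rw [h2, integral_mul_const] at h1
  have h3 : (ψ (b * y) : ℂ) ≠ 1 := fun h => hy1 (Circle.ext (by simpa using h))
  by_contra h4
  exact h3 (mul_left_cancel₀ h4 (h1.trans (mul_one _).symm))

include hμ in
theorem integral_shell_zero_quadChar (hq : Odd (residueCard F)) (hψ0 : HasOrderZero ψ)
    (hϖ : Irreducible ϖ) :
    ∫ x in shell F 0, quadChar (ϖ : F) x * (ψ ((ϖ : F)⁻¹ * x) : ℂ) ∂μ =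
      qpow F (-(1 / 2)) * gaussConst μ ψ ϖ := by
  classical
  have := Fintype.ofFinite 𝓀[F]
  set f : F → ℂ := (shell F 0).indicator fun x => quadChar (ϖ : F) x * (ψ ((ϖ : F)⁻¹ * x) : ℂ)
    with hf
  have h1 : ∫ x in shell F 0, quadChar (ϖ : F) x * (ψ ((ϖ : F)⁻¹ * x) : ℂ) ∂μ =
      ∫ x in (pw F 0 : Set F), f x ∂μ := by
    rw [hf, setIntegral_indicator (measurableSet_shell 0),
      Set.inter_eq_self_of_subset_right (shell_subset 0)]
  have hval : ∀ x : 𝒪[F], f x = resQuadChar F (IsLocalRing.residue 𝒪[F] x) *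
      resAddChar hψ0 hϖ (IsLocalRing.residue 𝒪[F] x) := fun x => by
    by_cases hx : (x : F) ∈ shell F 0
    · obtain ⟨u, hu⟩ := shell_zero_unit hx
      have hu' : (u : 𝒪[F]) = x := Subtype.ext hu
      rw [hf, Set.indicator_of_mem hx, resAddChar_residue, ← hu', resQuadChar_residue,
        quadChar_unit hq hϖ]
    · rw [hf, Set.indicator_of_notMem hx]
      have h0 : IsLocalRing.residue 𝒪[F] x = 0 := by
        rw [residue_eq_zero_iff]
        by_contra h
        exact hx ⟨mem_pw_zero.2 x.2, h⟩
      rw [h0, MulChar.map_nonunit _ (by simp), zero_mul]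
  rw [h1, setIntegral_pw_zero_eq_sum hμ, gaussConst_eq_gaussSum hμ hq hψ0 hϖ, ← mul_assoc,
    qpow_neg, ← mul_inv, qpow_half_mul, gaussSum]
  · congr 1
    refine Finset.sum_congr rfl fun a _ => ?_
    have := hval ⟨resRep a, mem_pw_zero.1 (resRep_mem a)⟩
    rw [residue_resRep] at this
    exact this
  · intro x hx y hy
    have h2 := hval (⟨x, mem_pw_zero.1 hx⟩ + ⟨y, mem_pw_zero.1 (pw_mono (by omega) hy)⟩)
    have h3 : IsLocalRing.residue 𝒪[F] ⟨y, mem_pw_zero.1 (pw_mono (by omega) hy)⟩ = 0 :=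
      residue_eq_zero_iff.2 hy
    rw [map_add, h3, add_zero, ← hval] at h2
    exact h2

include hμ in
/-- `∫ χ(x) ψ(b x)` over the elements of order `m`. -/
theorem integral_shell_quadChar (hq : Odd (residueCard F)) (hψ0 : HasOrderZero ψ)
    (hϖ : Irreducible ϖ) {b : F} (hb : b ≠ 0) (m : ℤ) :
    ∫ x in shell F m, quadChar (ϖ : F) x * (ψ (b * x) : ℂ) ∂μ =
      if ord b + m = -1 then
        (residueCard F : ℂ) ^ (-m) * (quadChar (ϖ : F) (-b) * (qpow F (-(1 / 2)) * gaussConst μ ψ ϖ))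
      else 0 := by
  split_ifs with h
  · have hϖ0 := uniformizer_ne_zero hϖ
    have hc0 : ((ϖ : F) * b)⁻¹ ≠ 0 := inv_ne_zero (mul_ne_zero hϖ0 hb)
    have hc : ord ((ϖ : F) * b)⁻¹ = m := by
      rw [ord_inv, ord_mul hϖ0 hb, ord_uniformizer hϖ]; omega
    have h1 := integral_shell_comp_mul hμ hc0 0 fun x => quadChar (ϖ : F) x * (ψ (b * x) : ℂ)
    rw [hc, zero_add] at h1
    have hq0 : (residueCard F : ℂ) ^ m ≠ 0 := zpow_ne_zero _ residueCard_ne_zero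
    rw [_root_.zpow_neg, eq_inv_mul_iff_mul_eq₀ hq0, ← h1, ← integral_shell_zero_quadChar hμ hq hψ0 hϖ,
      ← integral_const_mul]
    refine setIntegral_congr_fun (measurableSet_shell 0) fun x hx => ?_
    rw [quadChar_mul hq hϖ hc0 (mem_shell.1 hx).1, quadChar_inv hq hϖ (mul_ne_zero hϖ0 hb),
      quadChar_mul hq hϖ hϖ0 hb, quadChar_uniformizer hq hϖ, neg_eq_neg_one_mul b,
      quadChar_mul hq hϖ (neg_ne_zero.2 one_ne_zero) hb]
    have e : b * (((ϖ : F) * b)⁻¹ * x) = (ϖ : F)⁻¹ * x := by field_simp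
    rw [e]; ring
  · rcases lt_or_ge (ord b + m) (-1) with h1 | h1
    · exact integral_shell_quadChar_of_lt hq hψ0 hϖ hb h1
    · exact integral_shell_quadChar_of_nonneg hμ hq hψ0 hϖ hb (by omega)

end QuadraticGauss

/-! ### Gaussian integrals in one variable and split binary forms -/

section GaussianIntegrals

variable {F : Type*} [Field F] [ValuativeRel F] [TopologicalSpace F] [IsNonarchimedeanLocalField F]
variable [MeasurableSpace F] [BorelSpace F] {μ : Measure F} [μ.IsAddHaarMeasure]
variable {ψ : AddChar F Circle} {ϖ : 𝒪[F]}

theorem setIntegral_swap_of_isCompact {f : F → F → ℂ} (hf : Continuous (Function.uncurry f))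
    {S T : Set F} (hS : IsCompact S) (hT : IsCompact T) :
    ∫ x in S, ∫ y in T, f x y ∂μ ∂μ = ∫ y in T, ∫ x in S, f x y ∂μ ∂μ := by
  refine integral_integral_swap ?_
  rw [Measure.prod_restrict]
  exact hf.continuousOn.integrableOn_compact (hS.prod hT)

variable (hμ : μ (𝒪[F] : Set F) = 1)

include hμ in
theorem integral_shell_zero_addChar_sq (hq : Odd (residueCard F)) (hψ : Continuous ψ)
    (hψ0 : HasOrderZero ψ) {a : F} (ha : a ≠ 0) (h : ord a ≤ -2) :
    ∫ x in shell F 0, (ψ (a * x ^ 2) : ℂ) ∂μ = 0 := by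
  -- This is the largest exponent for which $y\mapsto\psi(2axy)$ is nontrivial on $\mathfrak p^k$
  -- when $x$ is a unit. The bound on `ord a` makes $k\ge1$ and $ay^2$ integral, so averaging over
  -- translations by $y$ kills the integral.
  set k : ℤ := -ord a - 1 with hk
  have h1 : ∀ y ∈ (pw F k : Set F), ∫ x in shell F 0, (ψ (a * x ^ 2) : ℂ) ∂μ =
      ∫ x in shell F 0, (ψ (a * x ^ 2) : ℂ) * (ψ (2 * a * x * y) : ℂ) ∂μ := fun y hy => by
    rw [← integral_shell_add (pw_mono (by omega : 0 + 1 ≤ k) hy)]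
    refine setIntegral_congr_fun (measurableSet_shell 0) fun x hx => ?_
    have h2 : a * (x + y) ^ 2 = a * x ^ 2 + 2 * a * x * y + a * (y * y) := by ring
    have h3 : a * (y * y) ∈ pw F 0 :=
      pw_mono (by omega) (mul_mem_pw ((mem_pw_iff_ord ha).2 le_rfl) (mul_mem_pw hy hy))
    rw [h2, addChar_add_of_mem hψ0 h3, AddChar.map_add_eq_mul, Circle.coe_mul]
  have h2 : ∫ y in (pw F k : Set F), ∫ x in shell F 0, (ψ (a * x ^ 2) : ℂ) ∂μ ∂μ = 0 := by
    rw [setIntegral_congr_fun (measurableSet_pw k) h1,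
      setIntegral_swap_of_isCompact (by fun_prop) (isCompact_pw k) (isCompact_shell 0)]
    rw [setIntegral_congr_fun (g := fun _ => (0 : ℂ)) (measurableSet_shell 0) fun x hx => ?_]
    · simp
    · simp only
      obtain ⟨hx0, hxo⟩ := mem_shell.1 hx
      have h20 := two_ne_zero_of_odd hq
      rw [integral_const_mul, integral_addChar hμ hψ0, if_neg, mul_zero]
      rw [mem_pw_iff_ord (mul_ne_zero (mul_ne_zero h20 ha) hx0), ord_mul (mul_ne_zero h20 ha) hx0,
        ord_mul h20 ha, ord_two hq, hxo]
      omega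
  rw [setIntegral_const_pw hμ] at h2
  exact (mul_eq_zero.1 h2).resolve_left (zpow_ne_zero _ residueCard_ne_zero)

include hμ in
-- For order at most $-2$ the units contribute nothing, so the integral lives on $\mathfrak p$;
-- rescaling by `ϖ` replaces $a$ by $a\varpi^2$. The descent ends at order $-1$, a Gauss sum, or at
-- a nonnegative order, where the integrand is $1$.
theorem integral_addChar_sq_zero (hq : Odd (residueCard F)) (hψ : Continuous ψ)
    (hψ0 : HasOrderZero ψ) (hϖ : Irreducible ϖ) {a : F} (ha : a ≠ 0) :
    ∫ x in (pw F 0 : Set F), (ψ (a * x ^ 2) : ℂ) ∂μ = qpow F (((min (ord a) 0 : ℤ) : ℂ) / 2) *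
      (if ord a < 0 ∧ Odd (ord a) then gaussConst μ ψ ϖ * quadChar (ϖ : F) (-a) else 1) := by
  have hϖ0 := uniformizer_ne_zero hϖ
  obtain ⟨N, hN⟩ : ∃ N : ℕ, -ord a ≤ N := ⟨(-ord a).toNat, by omega⟩
  induction N using Nat.strong_induction_on generalizing a with
  | _ N ih =>
  rcases lt_or_ge (ord a) 0 with hlt | hge
  swap
  · rw [setIntegral_congr_fun (g := fun _ => (1 : ℂ)) (measurableSet_pw 0) fun x hx => ?_]
    · rw [setIntegral_const_pw hμ, min_eq_right hge, if_neg (by omega)]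
      simp [qpow_zero]
    · have : a * x ^ 2 ∈ pw F 0 := by
        rw [sq]
        exact pw_mono (by omega) (mul_mem_pw ((mem_pw_iff_ord ha).2 le_rfl) (mul_mem_pw hx hx))
      simp [addChar_of_mem hψ0 this]
  by_cases h1 : ord a = -1
  · obtain ⟨u, hu⟩ := exists_unit_mul_zpow hϖ ha
    have h2 := integral_addChar_unit_sq hμ hq hψ0 hϖ u
    have h3 : a = (ϖ : F)⁻¹ * u := by rw [hu, h1, _root_.zpow_neg_one]
    simp only [← mul_assoc, ← h3] at h2
    rw [h2, h1, if_pos ⟨by omega, by decide⟩, min_eq_left (by omega)]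
    have h4 : quadChar (ϖ : F) (-a) = unitSymbol u := by
      rw [h3, neg_eq_neg_one_mul, quadChar_mul hq hϖ (by simp) (by simp [hϖ0]),
        quadChar_mul hq hϖ (inv_ne_zero hϖ0) (coe_unit_ne_zero u),
        quadChar_inv hq hϖ hϖ0, quadChar_uniformizer hq hϖ, ← mul_assoc, quadChar_mul_self, one_mul,
        quadChar_unit hq hϖ]
    have h5 : ((-1 : ℤ) : ℂ) / 2 = -(1 / 2) := by norm_num
    rw [h4, h5]
    ring
  · have h2 := integral_shell_zero_addChar_sq hμ hq hψ hψ0 ha (by omega)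
    rw [integral_shell (integrableOn_pw (by fun_prop) 0), sub_eq_zero, zero_add] at h2
    have h3 := setIntegral_comp_mul hμ hϖ0 0 (fun x => (ψ (a * x ^ 2) : ℂ))
    rw [ord_uniformizer hϖ, zero_add, ← h2, zpow_one] at h3
    have ha' : a * (ϖ : F) ^ 2 ≠ 0 := mul_ne_zero ha (pow_ne_zero 2 hϖ0)
    have hord : ord (a * (ϖ : F) ^ 2) = ord a + 2 := by
      rw [ord_mul ha (pow_ne_zero 2 hϖ0), ord_pow, ord_uniformizer hϖ]; rfl
    have h4 := ih (N - 1) (by omega) ha' (by rw [hord]; omega)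
    simp only [mul_pow, ← mul_assoc] at h3
    rw [h4, hord] at h3
    have h5 : quadChar (ϖ : F) (-(a * (ϖ : F) ^ 2)) = quadChar (ϖ : F) (-a) := by
      rw [← neg_mul, sq, quadChar_mul hq hϖ (neg_ne_zero.2 ha) (mul_ne_zero hϖ0 hϖ0),
        quadChar_mul hq hϖ hϖ0 hϖ0, quadChar_mul_self, mul_one]
    have h6 : (ord a + 2 < 0 ∧ Odd (ord a + 2)) ↔ (ord a < 0 ∧ Odd (ord a)) := by
      constructor
      · rintro ⟨-, h⟩; exact ⟨hlt, by simpa [parity_simps] using h⟩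
      · rintro ⟨-, h⟩
        refine ⟨?_, by simpa [parity_simps] using h⟩
        rcases h with ⟨k, hk⟩; omega
    rw [h5, if_congr h6 rfl rfl, min_eq_left (by omega)] at h3
    rw [min_eq_left hlt.le]
    refine mul_left_cancel₀ (residueCard_ne_zero (F := F)) (h3.symm.trans ?_)
    have h7 : qpow F (((ord a + 2 : ℤ) : ℂ) / 2) = residueCard F * qpow F ((ord a : ℂ) / 2) := by
      have : ((ord a + 2 : ℤ) : ℂ) / 2 = 1 + (ord a : ℂ) / 2 := by push_cast; ring
      rw [this, qpow_add]; simp [qpow]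
    rw [h7, mul_assoc]

include hμ in
/-- The Gaussian integral over a fractional ideal. -/
theorem integral_addChar_sq (hq : Odd (residueCard F)) (hψ : Continuous ψ)
    (hψ0 : HasOrderZero ψ) (hϖ : Irreducible ϖ) {a : F} (ha : a ≠ 0) (m : ℤ) :
    ∫ x in (pw F m : Set F), (ψ (a * x ^ 2) : ℂ) ∂μ =
      qpow F (-m + ((min (ord a + 2 * m) 0 : ℤ) : ℂ) / 2) *
      (if ord a + 2 * m < 0 ∧ Odd (ord a) then gaussConst μ ψ ϖ * quadChar (ϖ : F) (-a) else 1) := by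
  have hϖ0 := uniformizer_ne_zero hϖ
  have hc := zpow_ne_zero m hϖ0
  have ha' : a * ((ϖ : F) ^ m) ^ 2 ≠ 0 := mul_ne_zero ha (pow_ne_zero 2 hc)
  have hord : ord (a * ((ϖ : F) ^ m) ^ 2) = ord a + 2 * m := by
    rw [ord_mul ha (pow_ne_zero 2 hc), ord_pow, ord_uniformizer_zpow hϖ]; rfl
  have h1 := setIntegral_comp_mul hμ hc 0 (fun x => (ψ (a * x ^ 2) : ℂ))
  simp only [mul_pow, ← mul_assoc] at h1
  rw [integral_addChar_sq_zero hμ hq hψ hψ0 hϖ ha', hord, ord_uniformizer_zpow hϖ, zero_add] at h1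
  have h5 : quadChar (ϖ : F) (-(a * ((ϖ : F) ^ m) ^ 2)) = quadChar (ϖ : F) (-a) := by
    rw [← neg_mul, sq, quadChar_mul hq hϖ (neg_ne_zero.2 ha) (mul_ne_zero hc hc),
      quadChar_mul hq hϖ hc hc, quadChar_mul_self, mul_one]
  have h6 : Odd (ord a + 2 * m) ↔ Odd (ord a) := by simp [parity_simps]
  rw [h5] at h1
  simp only [h6] at h1
  rw [qpow_add, qpow_neg_intCast, _root_.zpow_neg, mul_assoc, h1, ← mul_assoc, inv_mul_cancel₀, one_mul]
  exact zpow_ne_zero _ residueCard_ne_zero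

include hμ in
/-- The integral of a character of a split binary quadratic form. -/
theorem integral_addChar_split (hq : Odd (residueCard F)) (hψ : Continuous ψ)
    (hψ0 : HasOrderZero ψ) {A B C : F} {β m k : ℤ} (hB : B ≠ 0) (hβ : ord B = β)
    (hA : A ∈ pw F (β + k - m)) (hC : C ∈ pw F (β + m - k + 1)) :
    ∫ x in (pw F m : Set F), ∫ y in (pw F k : Set F),
      (ψ (A * x ^ 2 + 2 * B * x * y + C * y ^ 2) : ℂ) ∂μ ∂μ =
      qpow F (-m - k + (min (β + m + k) 0 : ℤ)) := by
  have h20 := two_ne_zero_of_odd hq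
  have hd : -(A * C / (B * B)) ∈ pw F 1 := by
    refine neg_mem ?_
    have := div_mem_pw (mul_mem_pw hA hC) (mul_ne_zero hB hB) (ord_mul hB hB)
    exact pw_mono (by omega) this
  -- The square root $\delta$ of the normalized discriminant $1-AC/B^2$ exists by Hensel's lemma,
  -- since the off-diagonal term dominates. This is why the form is split.
  obtain ⟨δ, hδ, hδ1⟩ := exists_sq_eq_one_add hq hd
  obtain ⟨hδ0, hδo⟩ := ord_add_of_mem h20 (ord_two hq) (by simpa using hδ1)
  have hBδ : B * (2 + (δ - 1)) ≠ 0 := mul_ne_zero hB hδ0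
  -- The small root of $At^2+2Bt+C$, written without dividing by $A$, which may be zero.
  -- Substituting $x=s+ty$ removes the $y^2$ term. The expression $2+(\delta-1)$ is $1+\delta$,
  -- shown as a unit plus an element of $\mathfrak p$.
  set t : F := -(C / (B * (2 + (δ - 1)))) with ht
  have htm : t ∈ pw F (m - k + 1) := by
    refine neg_mem ?_
    have := div_mem_pw hC hBδ ((ord_mul hB hδ0).trans (by rw [hβ, hδo]))
    exact pw_mono (by omega) this
  have hroot : A * t ^ 2 + 2 * B * t + C = 0 := by
    have hAC : A * C = (1 - δ ^ 2) * (B * B) := by rw [hδ]; field_simp; ring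
    have h1 : A * t ^ 2 = C * (1 - δ ^ 2) / (2 + (δ - 1)) ^ 2 := by
      rw [ht]; field_simp
      rw [mul_assoc, sq C, ← mul_assoc A, hAC]; ring
    rw [h1, ht]; field_simp; ring
  obtain ⟨hB0', hB'⟩ := ord_add_of_mem (y := A * t) hB hβ (pw_mono (by omega) (mul_mem_pw hA htm))
  set B' := B + A * t with hB'def
  have hquad : ∀ s y : F, A * (s + t * y) ^ 2 + 2 * B * (s + t * y) * y + C * y ^ 2 =
      A * s ^ 2 + 2 * B' * s * y := fun s y => by
    have : A * (s + t * y) ^ 2 + 2 * B * (s + t * y) * y + C * y ^ 2 =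
      A * s ^ 2 + 2 * B' * s * y + (A * t ^ 2 + 2 * B * t + C) * y ^ 2 := by rw [hB'def]; ring
    rw [this, hroot]; ring
  rw [setIntegral_pw_swap (by fun_prop)]
  have h1 : ∀ y ∈ (pw F k : Set F), ∫ x in (pw F m : Set F),
      (ψ (A * x ^ 2 + 2 * B * x * y + C * y ^ 2) : ℂ) ∂μ =
      ∫ s in (pw F m : Set F), (ψ (A * s ^ 2) : ℂ) * (ψ (2 * B' * s * y) : ℂ) ∂μ := fun y hy => by
    have hty : t * y ∈ pw F m := pw_mono (by omega) (mul_mem_pw htm hy)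
    rw [← setIntegral_add_pw hty]
    refine integral_congr_ae (.of_forall fun s => ?_)
    simp only
    rw [hquad, AddChar.map_add_eq_mul, Circle.coe_mul]
  rw [setIntegral_congr_fun (measurableSet_pw k) h1, setIntegral_pw_swap (by fun_prop)]
  simp only [integral_const_mul]
  classical
  -- The form is now linear in $y$: integration over $y$ forces $s$ into $\mathfrak p^{-k-\beta}$,
  -- and there $As^2$ is integral.
  have h2 : ∀ s ∈ (pw F m : Set F), (ψ (A * s ^ 2) : ℂ) *
      ∫ y in (pw F k : Set F), (ψ (2 * B' * s * y) : ℂ) ∂μ =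
      (pw F (-k - β) : Set F).indicator (fun _ => (residueCard F : ℂ) ^ (-k)) s := fun s hs => by
    rw [integral_addChar hμ hψ0]
    have h3 : 2 * B' * s ∈ pw F (-k) ↔ s ∈ (pw F (-k - β) : Set F) := by
      rw [mul_mem_pw_iff (mul_ne_zero h20 hB0') ((ord_mul h20 hB0').trans (by
        rw [ord_two hq, hB', zero_add]))]
      rfl
    by_cases h4 : s ∈ (pw F (-k - β) : Set F)
    · rw [if_pos (h3.2 h4), Set.indicator_of_mem h4]
      have h5 : A * s ^ 2 ∈ pw F 0 := by
        rw [sq]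
        exact pw_mono (by omega) (mul_mem_pw hA (mul_mem_pw hs h4))
      simp [addChar_of_mem hψ0 h5]
    · rw [if_neg (fun h => h4 (h3.1 h)), Set.indicator_of_notMem h4, mul_zero]
  rw [setIntegral_congr_fun (measurableSet_pw m) h2, setIntegral_indicator (measurableSet_pw _)]
  rcases le_total 0 (β + m + k) with h | h
  · rw [Set.inter_eq_self_of_subset_left (pw_mono (by omega)), setIntegral_const_pw hμ,
      min_eq_right h, ← qpow_intCast, ← qpow_intCast, ← qpow_add]
    congr 1; push_cast; ring
  · rw [Set.inter_eq_self_of_subset_right (pw_mono (by omega)), setIntegral_const_pw hμ,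
      min_eq_left h, ← qpow_intCast, ← qpow_intCast, ← qpow_add]
    congr 1; push_cast; ring

end GaussianIntegrals

/-! ### The Weil constant $\alpha_\psi(\pi)$ as a Gauss sum -/

section Weil

variable {F : Type*} [Field F] [ValuativeRel F] [TopologicalSpace F] [IsNonarchimedeanLocalField F]

/-- A locally constant function with compact support is uniformly locally constant. -/
theorem exists_uniform_level {φ : F → ℂ} (hφ : IsLocallyConstant φ) (hc : HasCompactSupport φ) :
    ∃ N : ℕ, (∀ x, x ∉ pw F (-N) → φ x = 0) ∧ ∀ x, ∀ h ∈ pw F N, φ (x + h) = φ x := by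
  obtain ⟨L, hL⟩ : ∃ L : ℕ, ∀ x, x ∉ pw F (-L) → φ x = 0 := by
    obtain ⟨t, ht⟩ := hc.elim_directed_cover (fun m : ℕ => (pw F (-m) : Set F))
      (fun m => isOpen_pw _) (fun x _ => by
        obtain ⟨m, hm⟩ := exists_mem_pw_neg x
        exact Set.mem_iUnion.2 ⟨m, hm⟩)
      (Monotone.directed_le fun a b hab => pw_mono (by omega))
    exact ⟨t, fun x hx => by
      by_contra h
      exact hx (ht (subset_tsupport φ h))⟩
  have h1 : ∀ x : F, ∃ m : ℕ, ∀ h ∈ pw F m, φ (x + h) = φ x := fun x => by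
    have h2 : (fun h => x + h) ⁻¹' (φ ⁻¹' {φ x}) ∈ nhds (0 : F) := by
      refine (((hφ.isOpen_fiber (φ x)).preimage (continuous_const_add x))).mem_nhds ?_
      simp
    obtain ⟨m, hm⟩ := exists_pw_subset h2
    exact ⟨m, fun h hh => hm hh⟩
  choose M hM using h1
  -- Finitely many balls on which $\varphi$ is constant cover the support; their smallest radius
  -- gives the uniform level.
  obtain ⟨t, -, ht⟩ := (isCompact_pw (F := F) (-L)).elim_nhds_subcover
    (fun x => (fun y => y - x) ⁻¹' (pw F (M x) : Set F)) fun x _ =>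
      ((isOpen_pw _).preimage (continuous_id.sub continuous_const)).mem_nhds (by simp)
  refine ⟨L + t.sup M, fun x hx => hL x fun h => hx (pw_mono (by push_cast; omega) h),
    fun x h hh => ?_⟩
  by_cases hx : x ∈ pw F (-L)
  · obtain ⟨y, hy, hxy⟩ := Set.mem_iUnion₂.1 (ht hx)
    have hle : M y ≤ t.sup M := Finset.le_sup hy
    have hh' : h ∈ pw F (M y) := pw_mono (by push_cast; omega) hh
    have e1 := hM y _ hxy
    have e2 := hM y _ (add_mem hxy hh')
    rw [add_sub_cancel] at e1
    rw [← add_assoc, add_sub_cancel] at e2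
    rw [e1, e2]
  · rw [hL x hx, hL]
    intro h'
    have hh' : h ∈ pw F (-L) := pw_mono (by push_cast; omega) hh
    exact hx (by simpa using sub_mem h' hh')

variable [MeasurableSpace F] [BorelSpace F] {μ : Measure F} [μ.IsAddHaarMeasure]
variable {ψ : AddChar F Circle} {ϖ : 𝒪[F]} (hμ : μ (𝒪[F] : Set F) = 1)

theorem normAbs_two_mul_cpow (hq : Odd (residueCard F)) (hϖ : Irreducible ϖ) :
    (normAbs (2 * (ϖ : F)) : ℂ) ^ (-(1 / 2) : ℂ) = qpow F (1 / 2) := by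
  have h20 := two_ne_zero_of_odd hq
  have hϖ0 := uniformizer_ne_zero hϖ
  rw [normAbs_eq (mul_ne_zero h20 hϖ0), ord_mul h20 hϖ0, ord_two hq, ord_uniformizer hϖ, zero_add,
    _root_.zpow_neg_one, qpow]
  push_cast
  have h1 : ((residueCard F : ℂ)).arg ≠ Real.pi := by
    rw [Complex.natCast_arg]; exact Real.pi_pos.ne
  rw [Complex.inv_cpow _ _ h1, ← Complex.cpow_neg, neg_neg]

include hμ in
-- A function supported on $\mathfrak p^{-N}$ and invariant under $\mathfrak p^N$ has its Fourier
-- transform supported on $\mathfrak p^{-N}$. Both integrals then run over a compact set, Fubini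
-- applies, and the shift $x\mapsto x+2\varpi y$ completes the square, leaving a Gaussian integral
-- of order $-1$. The constants match because the square of the Gauss constant is $\chi(-1)$.
theorem isWeilConstant_gaussConst (hq : Odd (residueCard F)) (hψ : Continuous ψ)
    (hψ0 : HasOrderZero ψ) (hϖ : Irreducible ϖ) :
    IsWeilConstant μ ψ (ϖ : F) (gaussConst μ ψ ϖ) := by
  intro φ hφ hc
  have h20 := two_ne_zero_of_odd hq
  have hϖ0 := uniformizer_ne_zero hϖ
  obtain ⟨N, hN, hN'⟩ := exists_uniform_level hφ hc
  have hφc : Continuous φ := hφ.continuous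
  have hfour : ∀ x, x ∉ (pw F (-N) : Set F) → fourierF μ ψ φ x = 0 := fun x hx => by
    obtain ⟨y, hy, hy1⟩ := exists_addChar_ne_one hψ0 hx
    have h1 := integral_add_right_eq_self (μ := μ) (fun z => φ z * (ψ (x * z) : ℂ)) y
    simp only [hN' _ _ hy, mul_add, AddChar.map_add_eq_mul, Circle.coe_mul, ← mul_assoc] at h1
    rw [integral_mul_const] at h1
    have h3 : (ψ (x * y) : ℂ) ≠ 1 := fun h => hy1 (Circle.ext (by simpa using h))
    by_contra h4
    exact h3 (mul_left_cancel₀ h4 (h1.trans (mul_one _).symm))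
  have hsupp : ∀ g : F → ℂ, ∫ y, φ y * g y ∂μ = ∫ y in (pw F (-N) : Set F), φ y * g y ∂μ :=
    fun g => (setIntegral_eq_integral_of_forall_compl_eq_zero fun x hx => by
      rw [hN x hx, zero_mul]).symm
  have ha0 : -(1 / (4 * (ϖ : F))) ≠ 0 := by
    refine neg_ne_zero.2 (one_div_ne_zero (mul_ne_zero ?_ hϖ0))
    rw [show (4 : F) = 2 * 2 by norm_num]; exact mul_ne_zero h20 h20
  have hord : ord (-(1 / (4 * (ϖ : F)))) = -1 := by
    rw [ord_neg, one_div, ord_inv, show (4 : F) = 2 * 2 by norm_num,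
      ord_mul (mul_ne_zero h20 h20) hϖ0, ord_mul h20 h20, ord_two hq, ord_uniformizer hϖ]; rfl
  have hcN : ∫ x in (pw F (-N) : Set F), (ψ (-(1 / (4 * (ϖ : F))) * x ^ 2) : ℂ) ∂μ =
      qpow F (-(1 / 2)) * (gaussConst μ ψ ϖ * quadChar (ϖ : F) (-1)) := by
    rw [integral_addChar_sq hμ hq hψ hψ0 hϖ ha0, hord, if_pos ⟨by omega, by decide⟩,
      min_eq_left (by omega), neg_neg, one_div, quadChar_inv hq hϖ
        (mul_ne_zero (by rw [show (4 : F) = 2 * 2 by norm_num]; exact mul_ne_zero h20 h20) hϖ0),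
      show (4 : F) = 2 * 2 by norm_num, quadChar_mul hq hϖ (mul_ne_zero h20 h20) hϖ0,
      quadChar_mul hq hϖ h20 h20, quadChar_mul_self, one_mul, quadChar_uniformizer hq hϖ]
    congr 2
    push_cast; ring
  have hT : ∀ y ∈ (pw F (-N) : Set F), ∫ x in (pw F (-N) : Set F),
      (ψ (x * y) : ℂ) * (ψ (-(x ^ 2 / (4 * (ϖ : F)))) : ℂ) ∂μ =
      (ψ (ϖ * y ^ 2) : ℂ) * (qpow F (-(1 / 2)) * (gaussConst μ ψ ϖ * quadChar (ϖ : F) (-1))) := by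
    intro y hy
    have hshift : 2 * (ϖ : F) * y ∈ pw F (-N) := by
      have := mul_mem_pw ((mem_pw_iff_ord (mul_ne_zero h20 hϖ0)).2
        ((ord_mul h20 hϖ0).trans (by rw [ord_two hq, ord_uniformizer hϖ])).ge) hy
      exact pw_mono (by omega) this
    rw [← setIntegral_add_pw hshift, ← hcN, ← integral_const_mul]
    refine integral_congr_ae (.of_forall fun x => ?_)
    simp only
    rw [← Circle.coe_mul, ← Circle.coe_mul, ← AddChar.map_add_eq_mul, ← AddChar.map_add_eq_mul]
    congr 2
    have h40 : (4 : F) ≠ 0 := by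
      rw [show (4 : F) = 2 * 2 by norm_num]; exact mul_ne_zero h20 h20
    field_simp
    ring
  have h1 : ∫ x, fourierF μ ψ φ x * (ψ (-(x ^ 2 / (4 * (ϖ : F)))) : ℂ) ∂μ =
      ∫ y in (pw F (-N) : Set F), φ y * ((ψ (ϖ * y ^ 2) : ℂ) *
        (qpow F (-(1 / 2)) * (gaussConst μ ψ ϖ * quadChar (ϖ : F) (-1)))) ∂μ := by
    rw [← setIntegral_eq_integral_of_forall_compl_eq_zero (s := (pw F (-N) : Set F))
      fun x hx => by rw [hfour x hx, zero_mul]]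
    have h2 : ∀ x, fourierF μ ψ φ x * (ψ (-(x ^ 2 / (4 * (ϖ : F)))) : ℂ) =
        ∫ y in (pw F (-N) : Set F),
          φ y * ((ψ (x * y) : ℂ) * (ψ (-(x ^ 2 / (4 * (ϖ : F)))) : ℂ)) ∂μ := fun x => by
      rw [fourierF, hsupp, ← integral_mul_const]
      simp only [mul_assoc]
    simp only [h2]
    rw [setIntegral_pw_swap (by fun_prop)]
    refine setIntegral_congr_fun (measurableSet_pw _) fun y hy => ?_
    rw [integral_const_mul, hT y hy]
  rw [h1, normAbs_two_mul_cpow hq hϖ, hsupp, ← integral_const_mul]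
  congr 1; ext y
  have h3 : qpow F (1 / 2) * qpow F (-(1 / 2)) = 1 := by rw [← qpow_add, add_neg_cancel, qpow_zero]
  have h4 := gaussConst_sq hμ hq hψ0 hϖ
  have h5 := quadChar_mul_self (ϖ : F) (-1)
  calc φ y * (ψ (ϖ * y ^ 2) : ℂ) = φ y * (ψ (ϖ * y ^ 2) : ℂ) *
      ((qpow F (1 / 2) * qpow F (-(1 / 2))) * (gaussConst μ ψ ϖ ^ 2 * quadChar (ϖ : F) (-1))) := by
        rw [h3, h4, h5]; ring
    _ = _ := by ring

include hμ in
/-- The Weil constant `α_ψ(ϖ)` is the normalized quadratic Gauss sum. -/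
theorem weilConstant_uniformizer (hq : Odd (residueCard F)) (hψ : Continuous ψ)
    (hψ0 : HasOrderZero ψ) (hϖ : Irreducible ϖ) :
    weilConstant μ ψ (ϖ : F) = gaussConst μ ψ ϖ := by
  have h1 := isWeilConstant_gaussConst hμ hq hψ hψ0 hϖ
  have h2 : IsWeilConstant μ ψ (ϖ : F) (weilConstant μ ψ (ϖ : F)) :=
    Classical.epsilon_spec (p := IsWeilConstant μ ψ (ϖ : F)) ⟨_, h1⟩
  have hϖ0 := uniformizer_ne_zero hϖ
  -- The defining relation determines the constant as soon as one test function has a nonzero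
  -- Gaussian integral; the indicator of $\mathfrak p^{-1}$ is one.
  have hlc : IsLocallyConstant ((pw F (-1) : Set F).indicator (fun _ => (1 : ℂ))) := by
    have hcl : IsClopen (pw F (-1) : Set F) := ⟨isClosed_pw _, isOpen_pw _⟩
    have h := LocallyConstant.isLocallyConstant (LocallyConstant.charFn ℂ hcl)
    have h' := LocallyConstant.coe_charFn ℂ hcl
    exact h' ▸ h
  have hcs : HasCompactSupport ((pw F (-1) : Set F).indicator (fun _ => (1 : ℂ))) :=
    HasCompactSupport.intro (isCompact_pw (-1)) fun x hx => Set.indicator_of_notMem hx _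
  have e1 := h1 _ hlc hcs
  have e2 := h2 _ hlc hcs
  have hne : ∫ x, (pw F (-1) : Set F).indicator (fun _ => (1 : ℂ)) x * (ψ (ϖ * x ^ 2) : ℂ) ∂μ ≠ 0 := by
    have h3 : ∀ x, (pw F (-1) : Set F).indicator (fun _ => (1 : ℂ)) x * (ψ (ϖ * x ^ 2) : ℂ) =
        (pw F (-1) : Set F).indicator (fun x => (ψ (ϖ * x ^ 2) : ℂ)) x := fun x => by
      by_cases hx : x ∈ (pw F (-1) : Set F) <;> simp [hx]
    simp only [h3]
    rw [integral_indicator (measurableSet_pw _), integral_addChar_sq hμ hq hψ hψ0 hϖ hϖ0,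
      ord_uniformizer hϖ, if_pos ⟨by omega, by decide⟩]
    refine mul_ne_zero (qpow_ne_zero _) (mul_ne_zero (fun h => ?_) (quadChar_ne_zero _ _))
    have := gaussConst_sq hμ hq hψ0 hϖ
    rw [h] at this
    exact quadChar_ne_zero (ϖ : F) (-1) (by rw [← this]; simp)
  rw [e1] at e2
  rw [e1, mul_assoc] at hne
  rw [mul_assoc, mul_assoc] at e2
  exact (mul_right_cancel₀ (right_ne_zero_of_mul hne) e2).symm

end Weil

/-! ### Symmetric matrices supported on an index set, with their Haar measure -/

section SymmetricSupport

variable {n : ℕ} {F : Type*} [Field F]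

variable (F) in
/-- Symmetric matrices supported on `J × J`. -/
def symOn (J : Finset (Fin n)) : Submodule F (Matrix (Fin n) (Fin n) F) where
  carrier := {X | X.IsSymm ∧ ∀ a b, a ∉ J → X a b = 0}
  add_mem' := fun ⟨h1, h2⟩ ⟨h3, h4⟩ => ⟨h1.add h3, fun a b h => by simp [h2 a b h, h4 a b h]⟩
  zero_mem' := ⟨Matrix.isSymm_zero, fun _ _ _ => rfl⟩
  smul_mem' := fun c _ ⟨h1, h2⟩ => ⟨h1.smul c, fun a b h => by simp [h2 a b h]⟩

theorem symOn_symm {J : Finset (Fin n)} (X : symOn F J) (a b : Fin n) : X.1 b a = X.1 a b :=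
  X.2.1.apply a b

theorem symOn_left {J : Finset (Fin n)} (X : symOn F J) {a : Fin n} (ha : a ∉ J) (b : Fin n) :
    X.1 a b = 0 := X.2.2 a b ha

theorem symOn_right {J : Finset (Fin n)} (X : symOn F J) (a : Fin n) {b : Fin n} (hb : b ∉ J) :
    X.1 a b = 0 := by rw [symOn_symm, symOn_left X hb]

section Topology

variable [TopologicalSpace F]

instance (J : Finset (Fin n)) : MeasurableSpace (symOn F J) := borel _

instance (J : Finset (Fin n)) : BorelSpace (symOn F J) := ⟨rfl⟩

@[fun_prop]
theorem continuous_symOn_apply {J : Finset (Fin n)} (a b : Fin n) :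
    Continuous fun X : symOn F J => X.1 a b :=
  continuous_subtype_val.matrix_elem a b

theorem continuous_symOn_mk {α : Type*} [TopologicalSpace α] {J : Finset (Fin n)}
    {f : α → symOn F J} (h : ∀ a b, Continuous fun x => (f x).1 a b) : Continuous f :=
  Continuous.subtype_mk (continuous_pi fun a => continuous_pi fun b => h a b) fun x => (f x).2

end Topology

variable [ValuativeRel F] [TopologicalSpace F] [IsNonarchimedeanLocalField F]

theorem isClosed_symOn (J : Finset (Fin n)) : IsClosed (symOn F J : Set (Matrix (Fin n) (Fin n) F)) := by
  have h : (symOn F J : Set (Matrix (Fin n) (Fin n) F)) =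
      (⋂ a, ⋂ b, {X | X b a = X a b}) ∩ ⋂ a, ⋂ b, {X | a ∉ J → X a b = 0} := by
    ext X
    simp only [Set.mem_inter_iff, Set.mem_iInter, Set.mem_setOf_eq]
    exact and_congr ⟨fun h a b => h.apply a b, fun h => Matrix.IsSymm.ext h⟩ Iff.rfl
  rw [h]
  refine IsClosed.inter (isClosed_iInter fun a => isClosed_iInter fun b =>
    isClosed_eq (continuous_id.matrix_elem b a) (continuous_id.matrix_elem a b))
    (isClosed_iInter fun a => isClosed_iInter fun b => ?_)
  by_cases ha : a ∈ J
  · simp [ha]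
  · simpa [ha] using isClosed_eq (continuous_id.matrix_elem a b) (continuous_const (y := (0 : F)))

instance (J : Finset (Fin n)) : LocallyCompactSpace (symOn F J) :=
  have : LocallyCompactSpace (Matrix (Fin n) (Fin n) F) :=
    inferInstanceAs (LocallyCompactSpace (Fin n → Fin n → F))
  (isClosed_symOn J).isClosedEmbedding_subtypeVal.locallyCompactSpace

instance (J : Finset (Fin n)) : SecondCountableTopology (symOn F J) :=
  have : SecondCountableTopology (Matrix (Fin n) (Fin n) F) :=
    inferInstanceAs (SecondCountableTopology (Fin n → Fin n → F))
  inferInstanceAs (SecondCountableTopology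
    {x // x ∈ (symOn F J : Set (Matrix (Fin n) (Fin n) F))})

variable (F) in
/-- The matrices in `symOn F J` whose `(a, b)` entry lies in `𝔭 ^ (d a b)`. -/
def symBox (J : Finset (Fin n)) (d : Fin n → Fin n → ℤ) : AddSubgroup (symOn F J) where
  carrier := {X | ∀ a b, X.1 a b ∈ pw F (d a b)}
  add_mem' h1 h2 a b := add_mem (h1 a b) (h2 a b)
  zero_mem' _ _ := zero_mem _
  neg_mem' h a b := neg_mem (h a b)

theorem mem_symBox {J : Finset (Fin n)} {d : Fin n → Fin n → ℤ} {X : symOn F J} :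
    X ∈ symBox F J d ↔ ∀ a b, X.1 a b ∈ pw F (d a b) := Iff.rfl

theorem isCompact_symBox (J : Finset (Fin n)) (d : Fin n → Fin n → ℤ) :
    IsCompact (symBox F J d : Set (symOn F J)) := by
  have h : IsCompact (Set.univ.pi fun a => Set.univ.pi fun b => (pw F (d a b) : Set F)) :=
    isCompact_univ_pi fun a => isCompact_univ_pi fun b => isCompact_pw _
  have h2 : (symBox F J d : Set (symOn F J)) =
      Subtype.val ⁻¹' (Set.univ.pi fun a => Set.univ.pi fun b => (pw F (d a b) : Set F) :
        Set (Matrix (Fin n) (Fin n) F)) := by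
    ext X
    exact ⟨fun h a _ b _ => h a b, fun h a b => h a trivial b trivial⟩
  rw [h2]
  exact (isClosed_symOn J).isClosedEmbedding_subtypeVal.isCompact_preimage h

theorem isOpen_symBox (J : Finset (Fin n)) (d : Fin n → Fin n → ℤ) :
    IsOpen (symBox F J d : Set (symOn F J)) := by
  have h2 : (symBox F J d : Set (symOn F J)) =
      ⋂ a, ⋂ b, (fun X : symOn F J => X.1 a b) ⁻¹' (pw F (d a b) : Set F) := by
    ext X
    simp only [Set.mem_iInter, Set.mem_preimage]
    rfl
  rw [h2]
  exact isOpen_iInter_of_finite fun a => isOpen_iInter_of_finite fun b =>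
    (isOpen_pw _).preimage (continuous_symOn_apply a b)

theorem measurableSet_symBox (J : Finset (Fin n)) (d : Fin n → Fin n → ℤ) :
    MeasurableSet (symBox F J d : Set (symOn F J)) := (isOpen_symBox J d).measurableSet

variable (F) in
/-- The integral matrices as a compact set with nonempty interior. -/
def symIntegral (J : Finset (Fin n)) : TopologicalSpace.PositiveCompacts (symOn F J) where
  carrier := symBox F J fun _ _ => 0
  isCompact' := isCompact_symBox J _
  interior_nonempty' := ⟨0, by rw [(isOpen_symBox J _).interior_eq]; exact zero_mem _⟩

variable (F) in
/-- The Haar measure on `symOn F J` for which the integral matrices have volume `1`. -/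
noncomputable def symMeas (J : Finset (Fin n)) : Measure (symOn F J) :=
  Measure.addHaarMeasure (symIntegral F J)

instance (J : Finset (Fin n)) : (symMeas F J).IsAddHaarMeasure := by
  unfold symMeas; infer_instance

theorem symMeas_integral (J : Finset (Fin n)) :
    symMeas F J (symBox F J fun _ _ => 0 : Set (symOn F J)) = 1 :=
  Measure.addHaarMeasure_self (K₀ := symIntegral F J)

/-- A topological isomorphism matching up sets of measure `1` preserves the Haar measures. -/
theorem measurePreserving_of_continuousAddEquiv {G H : Type*} [AddCommGroup G] [TopologicalSpace G]
    [IsTopologicalAddGroup G] [MeasurableSpace G] [BorelSpace G]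
    [AddCommGroup H] [TopologicalSpace H] [IsTopologicalAddGroup H] [LocallyCompactSpace H]
    [SecondCountableTopology H] [MeasurableSpace H] [BorelSpace H]
    {ν : Measure G} [ν.IsAddHaarMeasure] {ν' : Measure H} [ν'.IsAddHaarMeasure] (θ : G ≃+ H)
    (hθ : Continuous θ) (hθ' : Continuous θ.symm) {S : Set H} (hS : MeasurableSet S)
    (h1 : ν' S = 1) (h2 : ν (θ ⁻¹' S) = 1) : MeasurePreserving θ ν ν' := by
  have : (ν.map θ).IsAddHaarMeasure := Measure.isAddHaarMeasure_map ν (θ : G →+ H) hθ θ.surjective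
    (Homeomorph.mk θ.toEquiv hθ hθ').isClosedEmbedding.tendsto_cocompact
  have h := Measure.isAddLeftInvariant_eq_smul (ν.map θ) ν'
  refine ⟨hθ.measurable, ?_⟩
  have h3 := congrArg (fun m : Measure H => m S) h
  simp only [Measure.smul_apply] at h3
  rw [Measure.map_apply hθ.measurable hS, h1, h2, ENNReal.smul_def, smul_eq_mul, mul_one] at h3
  rw [h]
  have h4 : (ν.map θ).addHaarScalarFactor ν' = 1 := by exact_mod_cast h3.symm
  rw [h4, one_smul]

end SymmetricSupport

/-! ### Fubini's theorem with a translated last coordinate -/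

section PivotFubini

/-- Fubini's theorem in coordinates `(p, r, y)`, where `y` is translated by `c p r`. -/
theorem setIntegral_pivot {P R V W K : Type*} [Fintype K] [MeasurableSpace P] [MeasurableSpace R]
    [MeasurableSpace V] [AddCommGroup V] [MeasurableAdd V] [MeasurableSpace W]
    {νP : Measure P} [SigmaFinite νP] {νR : Measure R} [SigmaFinite νR] {νV : Measure V}
    [SigmaFinite νV] [νV.IsAddRightInvariant] {νW : Measure W} {θ : P × (K → R) × V → W}
    (hθ : MeasurePreserving θ (νP.prod ((Measure.pi fun _ => νR).prod νV)) νW)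
    (hθe : MeasurableEmbedding θ) {S : Set W} (hS : MeasurableSet S) {SP : Set P}
    (hSP : MeasurableSet SP) {SR : K → Set R} (hSR : ∀ k, MeasurableSet (SR k)) {SY : Set V}
    (hSY : MeasurableSet SY) {c : P → (K → R) → V}
    (hmem : ∀ p r y, θ (p, r, y + c p r) ∈ S ↔ p ∈ SP ∧ (∀ k, r k ∈ SR k) ∧ y ∈ SY)
    {f : W → ℂ} (hf : IntegrableOn f S νW) {g : P → ℂ} {h : K → P → R → ℂ} {f' : P → V → ℂ}
    (hfac : ∀ p ∈ SP, ∀ r : K → R, (∀ k, r k ∈ SR k) → ∀ y ∈ SY,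
      f (θ (p, r, y + c p r)) = g p * (∏ k, h k p (r k)) * f' p y) :
    ∫ x in S, f x ∂νW =
      ∫ p in SP, g p * (∏ k, ∫ r in SR k, h k p r ∂νR) * ∫ y in SY, f' p y ∂νV ∂νP := by
  have hint : Integrable (fun x => S.indicator f (θ x))
      (νP.prod ((Measure.pi fun _ => νR).prod νV)) :=
    (hθ.integrable_comp_emb hθe).2 ((integrable_indicator_iff hS).2 hf)
  rw [← integral_indicator hS, ← hθ.integral_comp hθe, integral_prod _ hint, ← integral_indicator hSP]
  refine integral_congr_ae ?_
  filter_upwards [hint.prod_right_ae] with p hp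
  rw [integral_prod _ hp]
  have h1 : ∀ r : K → R, ∫ y, S.indicator f (θ (p, r, y)) ∂νV =
      (∏ k, (SR k).indicator (h k p) (r k)) * SP.indicator (fun p => g p * ∫ y in SY, f' p y ∂νV) p := by
    intro r
    -- Invariance of the measure absorbs the translation by the Schur complement; after it the
    -- domain is a product and the integrand factors.
    rw [← integral_add_right_eq_self (fun y => S.indicator f (θ (p, r, y))) (c p r)]
    by_cases hpr : p ∈ SP ∧ ∀ k, r k ∈ SR k
    · have h2 : ∀ y, S.indicator f (θ (p, r, y + c p r)) =
          SY.indicator (fun y => g p * (∏ k, h k p (r k)) * f' p y) y := fun y => by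
        by_cases hy : y ∈ SY
        · rw [Set.indicator_of_mem ((hmem p r y).2 ⟨hpr.1, hpr.2, hy⟩), Set.indicator_of_mem hy,
            hfac p hpr.1 r hpr.2 y hy]
        · rw [Set.indicator_of_notMem (fun h => hy ((hmem p r y).1 h).2.2),
            Set.indicator_of_notMem hy]
      simp only [h2]
      rw [integral_indicator hSY, integral_const_mul, Set.indicator_of_mem hpr.1,
        Finset.prod_congr rfl fun k _ => Set.indicator_of_mem (hpr.2 k) (h k p)]
      ring
    · have h2 : ∀ y, S.indicator f (θ (p, r, y + c p r)) = 0 := fun y =>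
        Set.indicator_of_notMem (fun h => hpr ⟨((hmem p r y).1 h).1, ((hmem p r y).1 h).2.1⟩) _
      simp only [h2, integral_zero]
      by_cases hp : p ∈ SP
      · obtain ⟨k, hk⟩ : ∃ k, r k ∉ SR k := by
          by_contra! h; exact hpr ⟨hp, h⟩
        rw [Finset.prod_eq_zero (Finset.mem_univ k) (Set.indicator_of_notMem hk _), zero_mul]
      · rw [Set.indicator_of_notMem hp, mul_zero]
  simp only [h1]
  rw [integral_mul_const, integral_fintype_prod_eq_prod]
  by_cases hp : p ∈ SP
  · simp only [Set.indicator_of_mem hp, integral_indicator (hSR _)]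
    ring
  · simp only [Set.indicator_of_notMem hp, mul_zero]

end PivotFubini

/-! ### Coordinates: pivot block, pivot columns, complement -/

section PivotCoordinates

variable {n : ℕ} {F : Type*} [Field F] [ValuativeRel F] [TopologicalSpace F]
  [IsNonarchimedeanLocalField F]

/-- Extension by zero. -/
def extendZero {R : Type*} [Zero R] (K : Finset (Fin n)) (r : K → R) (a : Fin n) : R :=
  if h : a ∈ K then r ⟨a, h⟩ else 0

theorem extendZero_of_mem {R : Type*} [Zero R] {K : Finset (Fin n)} (r : K → R) {a : Fin n}
    (h : a ∈ K) : extendZero K r a = r ⟨a, h⟩ := dif_pos h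

theorem extendZero_of_notMem {R : Type*} [Zero R] {K : Finset (Fin n)} (r : K → R) {a : Fin n}
    (h : a ∉ K) : extendZero K r a = 0 := dif_neg h

@[simp]
theorem extendZero_coe {R : Type*} [Zero R] {K : Finset (Fin n)} (r : K → R) (k : K) :
    extendZero K r k = r k := extendZero_of_mem r k.2

theorem extendZero_add {R : Type*} [AddZeroClass R] {K : Finset (Fin n)} (r s : K → R) (a : Fin n) :
    extendZero K (r + s) a = extendZero K r a + extendZero K s a := by
  unfold extendZero; split_ifs <;> simp

theorem continuous_extendZero {R : Type*} [Zero R] [TopologicalSpace R] (K : Finset (Fin n))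
    (a : Fin n) : Continuous fun r : K → R => extendZero K r a := by
  unfold extendZero; split_ifs <;> fun_prop

/-- Coordinates of `symOn F J` adapted to the diagonal position `i ∈ J`. -/
def singleEquiv {J : Finset (Fin n)} {i : Fin n} (hi : i ∈ J) :
    F × (J.erase i → F) × symOn F (J.erase i) ≃+ symOn F J where
  toFun x := ⟨Matrix.of fun a b => if a = i then (if b = i then x.1 else extendZero _ x.2.1 b) else
      if b = i then extendZero _ x.2.1 a else x.2.2.1 a b, by
    refine ⟨Matrix.IsSymm.ext fun a b => ?_, fun a b ha => ?_⟩
    · simp only [of_apply, symOn_symm x.2.2 a b]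
      split_ifs <;> rfl
    · have h1 : a ≠ i := fun h => ha (h ▸ hi)
      have h2 : a ∉ J.erase i := fun h => ha (Finset.mem_of_mem_erase h)
      simp [h1, extendZero_of_notMem _ h2, symOn_left x.2.2 h2]⟩
  invFun X := ⟨X.1 i i, fun k => X.1 k i, ⟨Matrix.of fun a b => if a = i ∨ b = i then 0 else X.1 a b, by
    refine ⟨Matrix.IsSymm.ext fun a b => ?_, fun a b ha => ?_⟩
    · simp only [of_apply, symOn_symm X a b, or_comm]
    · simp only [of_apply, ite_eq_left_iff, not_or]
      exact fun h => symOn_left X (fun h' => ha (Finset.mem_erase.2 ⟨h.1, h'⟩)) b⟩⟩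
  left_inv x := by
    obtain ⟨p, r, Y⟩ := x
    refine Prod.ext ?_ (Prod.ext ?_ ?_)
    · simp
    · ext k
      have : (k : Fin n) ≠ i := (Finset.mem_erase.1 k.2).1
      simp [this]
    · ext a b
      simp only [of_apply]
      by_cases ha : a = i
      · subst ha; simp [symOn_left Y (Finset.notMem_erase a J)]
      · by_cases hb : b = i
        · subst hb; simp [symOn_right Y _ (Finset.notMem_erase b J)]
        · simp [ha, hb]
  right_inv X := by
    ext a b
    simp only [of_apply]
    by_cases ha : a = i
    · subst ha
      by_cases hb : b = a
      · subst hb; simp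
      · by_cases hbJ : b ∈ J
        · simp [hb, extendZero_of_mem _ (Finset.mem_erase.2 ⟨hb, hbJ⟩), symOn_symm X a b]
        · simp [hb, extendZero_of_notMem _ (fun h => hbJ (Finset.mem_of_mem_erase h)),
            symOn_right X a hbJ]
    · by_cases hb : b = i
      · subst hb
        by_cases haJ : a ∈ J
        · simp [ha, extendZero_of_mem _ (Finset.mem_erase.2 ⟨ha, haJ⟩)]
        · simp [ha, extendZero_of_notMem _ (fun h => haJ (Finset.mem_of_mem_erase h)),
            symOn_left X haJ]
      · simp [ha, hb]
  map_add' x y := by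
    ext a b
    simp only [Prod.fst_add, Prod.snd_add, of_apply, extendZero_add, Submodule.coe_add,
      Matrix.add_apply]
    split_ifs <;> rfl

theorem singleEquiv_apply {J : Finset (Fin n)} {i : Fin n} (hi : i ∈ J) (p : F)
    (r : J.erase i → F) (Y : symOn F (J.erase i)) (a b : Fin n) :
    (singleEquiv hi (p, r, Y)).1 a b = if a = i then (if b = i then p else extendZero _ r b) else
      if b = i then extendZero _ r a else Y.1 a b := rfl

theorem continuous_singleEquiv {J : Finset (Fin n)} {i : Fin n} (hi : i ∈ J) :
    Continuous (singleEquiv (F := F) hi) := by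
  refine continuous_symOn_mk fun a b => ?_
  change Continuous fun x : F × (J.erase i → F) × symOn F (J.erase i) =>
    if a = i then (if b = i then x.1 else extendZero _ x.2.1 b) else
      if b = i then extendZero _ x.2.1 a else x.2.2.1 a b
  have h1 := continuous_extendZero (R := F) (J.erase i)
  have h2 : Continuous fun x : F × (J.erase i → F) × symOn F (J.erase i) => x.2.2.1 a b :=
    (continuous_symOn_apply a b).comp (continuous_snd.comp continuous_snd)
  split_ifs <;> first | exact h2 | fun_prop

theorem continuous_singleEquiv_symm {J : Finset (Fin n)} {i : Fin n} (hi : i ∈ J) :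
    Continuous (singleEquiv (F := F) hi).symm := by
  refine Continuous.prodMk (continuous_symOn_apply i i) (Continuous.prodMk
    (continuous_pi fun k => continuous_symOn_apply _ i) (continuous_symOn_mk fun a b => ?_))
  change Continuous fun X : symOn F J => if a = i ∨ b = i then 0 else X.1 a b
  split_ifs <;> fun_prop

/-- Coordinates of `symOn F J` adapted to the off-diagonal position `(i, j)`. -/
def pairEquiv {J : Finset (Fin n)} {i j : Fin n} (hi : i ∈ J) (hj : j ∈ J) (hij : j ≠ i) :
    (F × F × F) × ((J.erase i).erase j → F × F) × symOn F ((J.erase i).erase j) ≃+ symOn F J where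
  toFun x := ⟨Matrix.of fun a b =>
      if a = i then (if b = i then x.1.2.2 else if b = j then x.1.2.1 else (extendZero _ x.2.1 b).2)
      else if a = j then
        (if b = i then x.1.2.1 else if b = j then x.1.1 else (extendZero _ x.2.1 b).1)
      else if b = i then (extendZero _ x.2.1 a).2 else if b = j then (extendZero _ x.2.1 a).1
      else x.2.2.1 a b, by
    refine ⟨Matrix.IsSymm.ext fun a b => ?_, fun a b ha => ?_⟩
    · simp only [of_apply, symOn_symm x.2.2 a b]
      split_ifs <;> first | rfl | (subst_vars; contradiction)
    · have h1 : a ≠ i := fun h => ha (h ▸ hi)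
      have h2 : a ≠ j := fun h => ha (h ▸ hj)
      have h3 : a ∉ (J.erase i).erase j := fun h =>
        ha (Finset.mem_of_mem_erase (Finset.mem_of_mem_erase h))
      simp [h1, h2, extendZero_of_notMem _ h3, symOn_left x.2.2 h3]⟩
  invFun X := ⟨(X.1 j j, X.1 i j, X.1 i i), fun k => (X.1 k j, X.1 k i),
    ⟨Matrix.of fun a b => if a = i ∨ a = j ∨ b = i ∨ b = j then 0 else X.1 a b, by
    refine ⟨Matrix.IsSymm.ext fun a b => ?_, fun a b ha => ?_⟩
    · simp only [of_apply, symOn_symm X a b]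
      exact if_congr (by tauto) rfl rfl
    · simp only [of_apply, ite_eq_left_iff, not_or]
      exact fun h => symOn_left X
        (fun h' => ha (Finset.mem_erase.2 ⟨h.2.1, Finset.mem_erase.2 ⟨h.1, h'⟩⟩)) b⟩⟩
  left_inv x := by
    obtain ⟨⟨p, q, s⟩, r, Y⟩ := x
    refine Prod.ext (Prod.ext ?_ (Prod.ext ?_ ?_)) (Prod.ext ?_ ?_)
    · simp [hij]
    · simp [hij]
    · simp
    · ext k
      all_goals
        have h1 : (k : Fin n) ≠ j := (Finset.mem_erase.1 k.2).1
        have h2 : (k : Fin n) ≠ i := (Finset.mem_erase.1 (Finset.mem_erase.1 k.2).2).1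
        simp [h1, h2, hij]
    · ext a b
      have hjn : j ∉ (J.erase i).erase j := Finset.notMem_erase _ _
      have hin : i ∉ (J.erase i).erase j := fun h => by simp at h
      simp only [of_apply]
      by_cases ha : a = i
      · subst ha; simp [symOn_left Y hin]
      by_cases ha' : a = j
      · subst ha'; simp [symOn_left Y hjn]
      by_cases hb : b = i
      · subst hb; simp [symOn_right Y _ hin]
      by_cases hb' : b = j
      · subst hb'; simp [symOn_right Y _ hjn]
      simp [ha, hb, ha', hb']
  right_inv X := by
    ext a b
    have hK : ∀ c, c ≠ i → c ≠ j → (c ∈ (J.erase i).erase j ↔ c ∈ J) := fun c h1 h2 => by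
      simp [h1, h2]
    have e1 : ∀ c, c ≠ i → c ≠ j → (extendZero ((J.erase i).erase j)
        (fun k => ((X.1 k j, X.1 k i) : F × F)) c) = (X.1 c j, X.1 c i) := fun c h1 h2 => by
      by_cases hc : c ∈ J
      · exact extendZero_of_mem _ ((hK c h1 h2).2 hc)
      · rw [extendZero_of_notMem _ fun h => hc ((hK c h1 h2).1 h), symOn_left X hc, symOn_left X hc]
        rfl
    simp only [of_apply]
    by_cases ha : a = i
    · subst ha
      by_cases hb : b = a
      · subst hb; simp
      by_cases hb' : b = j
      · subst hb'; simp [hij]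
      simp [hb, hb', e1 b hb hb', symOn_symm X a b]
    by_cases ha' : a = j
    · subst ha'
      by_cases hb : b = i
      · subst hb; simp [ha, symOn_symm X a b]
      by_cases hb' : b = a
      · subst hb'; simp [ha]
      simp [ha, hb, hb', e1 b hb hb', symOn_symm X a b]
    by_cases hb : b = i
    · subst hb; simp [ha, ha', e1 a ha ha']
    by_cases hb' : b = j
    · subst hb'; simp [ha, ha', hij, e1 a ha ha']
    simp [ha, ha', hb, hb']
  map_add' x y := by
    ext a b
    simp only [Prod.fst_add, Prod.snd_add, of_apply, extendZero_add, Submodule.coe_add,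
      Matrix.add_apply]
    split_ifs <;> rfl

theorem pairEquiv_apply {J : Finset (Fin n)} {i j : Fin n} (hi : i ∈ J) (hj : j ∈ J) (hij : j ≠ i)
    (p : F × F × F) (r : (J.erase i).erase j → F × F) (Y : symOn F ((J.erase i).erase j))
    (a b : Fin n) :
    (pairEquiv hi hj hij (p, r, Y)).1 a b =
      if a = i then (if b = i then p.2.2 else if b = j then p.2.1 else (extendZero _ r b).2)
      else if a = j then (if b = i then p.2.1 else if b = j then p.1 else (extendZero _ r b).1)
      else if b = i then (extendZero _ r a).2 else if b = j then (extendZero _ r a).1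
      else Y.1 a b := rfl

theorem continuous_pairEquiv {J : Finset (Fin n)} {i j : Fin n} (hi : i ∈ J) (hj : j ∈ J)
    (hij : j ≠ i) : Continuous (pairEquiv (F := F) hi hj hij) := by
  refine continuous_symOn_mk fun a b => ?_
  change Continuous fun x : (F × F × F) × ((J.erase i).erase j → F × F) ×
    symOn F ((J.erase i).erase j) =>
      if a = i then (if b = i then x.1.2.2 else if b = j then x.1.2.1 else (extendZero _ x.2.1 b).2)
      else if a = j then
        (if b = i then x.1.2.1 else if b = j then x.1.1 else (extendZero _ x.2.1 b).1)
      else if b = i then (extendZero _ x.2.1 a).2 else if b = j then (extendZero _ x.2.1 a).1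
      else x.2.2.1 a b
  have h1 := continuous_extendZero (R := F × F) ((J.erase i).erase j)
  have h2 : Continuous fun x : (F × F × F) × ((J.erase i).erase j → F × F) ×
      symOn F ((J.erase i).erase j) => x.2.2.1 a b :=
    (continuous_symOn_apply a b).comp (continuous_snd.comp continuous_snd)
  split_ifs <;> first | exact h2 | fun_prop

theorem continuous_pairEquiv_symm {J : Finset (Fin n)} {i j : Fin n} (hi : i ∈ J) (hj : j ∈ J)
    (hij : j ≠ i) : Continuous (pairEquiv (F := F) hi hj hij).symm := by
  refine Continuous.prodMk (Continuous.prodMk (continuous_symOn_apply j j)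
    (Continuous.prodMk (continuous_symOn_apply i j) (continuous_symOn_apply i i)))
    (Continuous.prodMk (continuous_pi fun k => Continuous.prodMk (continuous_symOn_apply _ j)
      (continuous_symOn_apply _ i)) (continuous_symOn_mk fun a b => ?_))
  change Continuous fun X : symOn F J => if a = i ∨ a = j ∨ b = i ∨ b = j then 0 else X.1 a b
  split_ifs <;> fun_prop

end PivotCoordinates

/-! ### The pivot coordinates preserve Haar measure -/

section PivotMeasure

variable {n : ℕ} {F : Type*} [Field F] [ValuativeRel F] [TopologicalSpace F]
  [IsNonarchimedeanLocalField F] [MeasurableSpace F] [BorelSpace F]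
  {μ : Measure F} [μ.IsAddHaarMeasure]

theorem extendZero_mem_iff {K : Finset (Fin n)} {m : ℤ} {r : K → F} :
    (∀ a, extendZero K r a ∈ pw F m) ↔ ∀ k, r k ∈ pw F m := by
  refine ⟨fun h k => by simpa using h k, fun h a => ?_⟩
  by_cases ha : a ∈ K
  · rw [extendZero_of_mem r ha]; exact h _
  · rw [extendZero_of_notMem r ha]; exact zero_mem _

set_option synthInstance.maxSize 1000 in
theorem measurePreserving_singleEquiv (hμ : μ (𝒪[F] : Set F) = 1) {J : Finset (Fin n)} {i : Fin n}
    (hi : i ∈ J) : MeasurePreserving (singleEquiv (F := F) hi)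
      (μ.prod ((Measure.pi fun _ => μ).prod (symMeas F (J.erase i)))) (symMeas F J) := by
  refine measurePreserving_of_continuousAddEquiv _ (continuous_singleEquiv hi)
    (continuous_singleEquiv_symm hi) (measurableSet_symBox J fun _ _ => 0) (symMeas_integral J) ?_
  have h : singleEquiv (F := F) hi ⁻¹' (symBox F J fun _ _ => 0 : Set (symOn F J)) =
      (pw F 0 : Set F) ×ˢ ((Set.univ.pi fun _ => (pw F 0 : Set F)) ×ˢ
        (symBox F (J.erase i) fun _ _ => 0 : Set (symOn F (J.erase i)))) := by
    ext ⟨p, r, Y⟩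
    simp only [Set.mem_preimage, SetLike.mem_coe, mem_symBox, singleEquiv_apply, Set.mem_prod,
      Set.mem_univ_pi]
    refine ⟨fun h => ⟨by simpa using h i i, fun k => ?_, fun a b => ?_⟩, fun h a b => ?_⟩
    · have hk : (k : Fin n) ≠ i := (Finset.mem_erase.1 k.2).1
      simpa [hk] using h k i
    · by_cases ha : a = i
      · subst ha; rw [symOn_left Y (Finset.notMem_erase _ _)]; exact zero_mem _
      by_cases hb : b = i
      · subst hb; rw [symOn_right Y _ (Finset.notMem_erase _ _)]; exact zero_mem _
      simpa [ha, hb] using h a b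
    · have h2 := extendZero_mem_iff.2 h.2.1
      split_ifs
      exacts [h.1, h2 b, h2 a, h.2.2 a b]
  rw [h, Measure.prod_prod, Measure.prod_prod, Measure.pi_pi, symMeas_integral, measure_pw_zero hμ]
  simp

set_option synthInstance.maxSize 1000 in
theorem measurePreserving_pairEquiv (hμ : μ (𝒪[F] : Set F) = 1) {J : Finset (Fin n)} {i j : Fin n}
    (hi : i ∈ J) (hj : j ∈ J) (hij : j ≠ i) : MeasurePreserving (pairEquiv (F := F) hi hj hij)
      ((μ.prod (μ.prod μ)).prod
        ((Measure.pi fun _ => μ.prod μ).prod (symMeas F ((J.erase i).erase j)))) (symMeas F J) := by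
  refine measurePreserving_of_continuousAddEquiv _ (continuous_pairEquiv hi hj hij)
    (continuous_pairEquiv_symm hi hj hij) (measurableSet_symBox J fun _ _ => 0)
    (symMeas_integral J) ?_
  have hjn : j ∉ (J.erase i).erase j := Finset.notMem_erase _ _
  have hin : i ∉ (J.erase i).erase j := fun h => by simp at h
  have h : pairEquiv (F := F) hi hj hij ⁻¹' (symBox F J fun _ _ => 0 : Set (symOn F J)) =
      ((pw F 0 : Set F) ×ˢ ((pw F 0 : Set F) ×ˢ (pw F 0 : Set F))) ×ˢ
        ((Set.univ.pi fun _ => (pw F 0 : Set F) ×ˢ (pw F 0 : Set F)) ×ˢ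
        (symBox F ((J.erase i).erase j) fun _ _ => 0 : Set (symOn F ((J.erase i).erase j)))) := by
    ext ⟨⟨x, y, z⟩, r, Y⟩
    simp only [Set.mem_preimage, SetLike.mem_coe, mem_symBox, pairEquiv_apply, Set.mem_prod,
      Set.mem_univ_pi]
    refine ⟨fun h => ⟨⟨by simpa [hij] using h j j, by simpa [hij] using h i j,
      by simpa using h i i⟩, fun k => ?_, fun a b => ?_⟩, fun h a b => ?_⟩
    · have h1 : (k : Fin n) ≠ j := (Finset.mem_erase.1 k.2).1
      have h2 : (k : Fin n) ≠ i := (Finset.mem_erase.1 (Finset.mem_erase.1 k.2).2).1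
      exact ⟨by simpa [h1, h2, hij] using h k j, by simpa [h1, h2] using h k i⟩
    · by_cases ha : a = i
      · subst ha; rw [symOn_left Y hin]; exact zero_mem _
      by_cases ha' : a = j
      · subst ha'; rw [symOn_left Y hjn]; exact zero_mem _
      by_cases hb : b = i
      · subst hb; rw [symOn_right Y _ hin]; exact zero_mem _
      by_cases hb' : b = j
      · subst hb'; rw [symOn_right Y _ hjn]; exact zero_mem _
      simpa [ha, hb, ha', hb'] using h a b
    · have h2 : ∀ c, (extendZero ((J.erase i).erase j) r c).1 ∈ pw F 0 ∧
          (extendZero ((J.erase i).erase j) r c).2 ∈ pw F 0 := fun c => by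
        by_cases hc : c ∈ (J.erase i).erase j
        · rw [extendZero_of_mem r hc]; exact h.2.1 ⟨c, hc⟩
        · rw [extendZero_of_notMem r hc]; exact ⟨zero_mem _, zero_mem _⟩
      obtain ⟨⟨h3, h4, h5⟩, -, h6⟩ := h
      split_ifs
      exacts [h5, h4, (h2 b).2, h4, h3, (h2 b).1, (h2 a).2, (h2 a).1, h6 a b]
  rw [h, Measure.prod_prod, Measure.prod_prod, Measure.prod_prod, Measure.prod_prod, Measure.pi_pi,
    symMeas_integral]
  simp [Measure.prod_prod, measure_pw_zero hμ]

theorem measurableEmbedding_singleEquiv {J : Finset (Fin n)} {i : Fin n} (hi : i ∈ J) :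
    MeasurableEmbedding (singleEquiv (F := F) hi) :=
  (Homeomorph.mk (singleEquiv (F := F) hi).toEquiv (continuous_singleEquiv hi)
    (continuous_singleEquiv_symm hi)).measurableEmbedding

theorem measurableEmbedding_pairEquiv {J : Finset (Fin n)} {i j : Fin n} (hi : i ∈ J) (hj : j ∈ J)
    (hij : j ≠ i) : MeasurableEmbedding (pairEquiv (F := F) hi hj hij) :=
  (Homeomorph.mk (pairEquiv (F := F) hi hj hij).toEquiv (continuous_pairEquiv hi hj hij)
    (continuous_pairEquiv_symm hi hj hij)).measurableEmbedding

end PivotMeasure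

/-! ### Matrix algebra of block elimination -/

section BlockElimination

variable {n : ℕ} {ι : Type*} [Fintype ι] [DecidableEq ι] {F : Type*} [Field F]

/-- The diagonal idempotent attached to `J`. -/
def indMat (F : Type*) [Field F] (J : Finset (Fin n)) : Matrix (Fin n) (Fin n) F :=
  Matrix.diagonal fun a => if a ∈ J then 1 else 0

/-- The matrix whose columns are the standard basis vectors indexed by `f`. -/
def colMat (F : Type*) [Field F] (f : ι → Fin n) : Matrix (Fin n) ι F :=
  Matrix.of fun a k => if a = f k then 1 else 0

theorem colMat_transpose_mul {κ : Type*} (f : ι → Fin n) (M : Matrix (Fin n) κ F) :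
    (colMat F f)ᵀ * M = Matrix.of fun k b => M (f k) b := by
  ext k b; simp [Matrix.mul_apply, colMat]

theorem colMat_transpose_mul_self {f : ι → Fin n} (hf : Function.Injective f) :
    (colMat F f)ᵀ * colMat F f = 1 := by
  rw [colMat_transpose_mul]
  ext k l
  simp [colMat, Matrix.one_apply, hf.eq_iff]

theorem colMat_mul_transpose {f : ι → Fin n} (hf : Function.Injective f) {J K : Finset (Fin n)}
    (hfJ : ∀ k, f k ∈ J) (hK : ∀ a, a ∈ K ↔ a ∈ J ∧ ∀ k, a ≠ f k) :
    colMat F f * (colMat F f)ᵀ = indMat F J - indMat F K := by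
  ext a b
  simp only [Matrix.mul_apply, colMat, of_apply, transpose_apply, indMat, Matrix.sub_apply,
    Matrix.diagonal_apply, mul_ite, mul_one, mul_zero]
  by_cases h : ∃ k, a = f k
  · obtain ⟨k, rfl⟩ := h
    have h1 : f k ∉ K := fun h => ((hK _).1 h).2 k rfl
    rw [Finset.sum_eq_single k]
    · simp [hfJ k, h1, eq_comm]
    · intro l _ hl
      have : f k ≠ f l := fun h => hl (hf h.symm)
      simp [this]
    · simp
  · push Not at h
    rw [Finset.sum_eq_zero]
    · by_cases ha : a ∈ J
      · simp [ha, (hK a).2 ⟨ha, h⟩]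
      · have ha' : a ∉ K := fun h => ha ((hK a).1 h).1
        simp [ha, ha']
    · intro k _; simp [h k]

theorem indMat_mul (J : Finset (Fin n)) (M : Matrix (Fin n) ι F) :
    indMat F J * M = Matrix.of fun a b => if a ∈ J then M a b else 0 := by
  ext a b; simp [indMat, Matrix.diagonal_mul]

/-- Completing the square with respect to an invertible block `P`. -/
theorem add_schur_eq_congr {U R : Matrix (Fin n) ι F} {P Q : Matrix ι ι F}
    {D Y : Matrix (Fin n) (Fin n) F} (hU : Uᵀ * U = 1) (hD : Uᵀ * D = 0) (hY : Uᵀ * Y = 0)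
    (hPs : P.IsSymm) (hDs : D.IsSymm) (hYs : Y.IsSymm) (hPQ : P * Q = 1) :
    D + (U * P * Uᵀ + R * Uᵀ + U * Rᵀ + (Y + R * Q * Rᵀ)) =
      (1 + R * Q * Uᵀ) * (D + U * P * Uᵀ + Y) * (1 + R * Q * Uᵀ)ᵀ := by
  have hQP : Q * P = 1 := mul_eq_one_comm.1 hPQ
  have hQs : Qᵀ = Q := by
    have h1 : P * Qᵀ = 1 := by
      rw [← transpose_transpose (P * Qᵀ), transpose_mul, transpose_transpose, hPs.eq, hQP,
        transpose_one]
    calc Qᵀ = (Q * P) * Qᵀ := by rw [hQP, Matrix.one_mul]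
      _ = Q := by rw [Matrix.mul_assoc, h1, Matrix.mul_one]
  have hD' : D * U = 0 := by
    have := congrArg transpose hD
    rwa [transpose_mul, transpose_transpose, hDs.eq, transpose_zero] at this
  have hY' : Y * U = 0 := by
    have := congrArg transpose hY
    rwa [transpose_mul, transpose_transpose, hYs.eq, transpose_zero] at this
  rw [transpose_add, transpose_mul, transpose_mul, transpose_transpose, hQs, transpose_one]
  have h1 : (1 + R * Q * Uᵀ) * (D + U * P * Uᵀ + Y) = D + U * P * Uᵀ + Y + R * Uᵀ := by
    rw [Matrix.add_mul, Matrix.one_mul]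
    congr 1
    have e1 : R * Q * Uᵀ * D = 0 := by rw [Matrix.mul_assoc, hD, Matrix.mul_zero]
    have e2 : R * Q * Uᵀ * Y = 0 := by rw [Matrix.mul_assoc, hY, Matrix.mul_zero]
    have e3 : R * Q * Uᵀ * (U * P * Uᵀ) = R * Uᵀ := by
      calc R * Q * Uᵀ * (U * P * Uᵀ) = R * Q * (Uᵀ * U) * P * Uᵀ := by
            simp only [Matrix.mul_assoc]
        _ = R * (Q * P) * Uᵀ := by rw [hU, Matrix.mul_one]; simp only [Matrix.mul_assoc]
        _ = R * Uᵀ := by rw [hQP, Matrix.mul_one]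
    rw [Matrix.mul_add, Matrix.mul_add, e1, e2, e3, zero_add, add_zero]
  rw [h1, Matrix.mul_add, Matrix.mul_one]
  have e1 : D * (U * (Q * Rᵀ)) = 0 := by rw [← Matrix.mul_assoc, hD', Matrix.zero_mul]
  have e2 : Y * (U * (Q * Rᵀ)) = 0 := by rw [← Matrix.mul_assoc, hY', Matrix.zero_mul]
  have e3 : U * P * Uᵀ * (U * (Q * Rᵀ)) = U * Rᵀ := by
    calc U * P * Uᵀ * (U * (Q * Rᵀ)) = U * P * (Uᵀ * U) * (Q * Rᵀ) := by
          simp only [Matrix.mul_assoc]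
      _ = U * (P * Q) * Rᵀ := by rw [hU, Matrix.mul_one]; simp only [Matrix.mul_assoc]
      _ = U * Rᵀ := by rw [hPQ, Matrix.mul_one]
  have e4 : R * Uᵀ * (U * (Q * Rᵀ)) = R * Q * Rᵀ := by
    calc R * Uᵀ * (U * (Q * Rᵀ)) = R * (Uᵀ * U) * (Q * Rᵀ) := by simp only [Matrix.mul_assoc]
      _ = R * Q * Rᵀ := by rw [hU, Matrix.mul_one]; simp only [Matrix.mul_assoc]
  rw [Matrix.add_mul, Matrix.add_mul, Matrix.add_mul, e1, e2, e3, e4]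
  abel

end BlockElimination

/-! ### The axioms for $\Phi$ and their behaviour under pivoting -/

section SiegelKernel

variable {n : ℕ} {ι : Type*} [Fintype ι] [DecidableEq ι] {F : Type*} [Field F] [ValuativeRel F]
  [TopologicalSpace F] [IsNonarchimedeanLocalField F]

/-- `D` is a symmetric matrix supported off `J`, with an inverse there that is `≡ 0 mod 𝔭`. -/
def RegularOff (J : Finset (Fin n)) (D : Matrix (Fin n) (Fin n) F) : Prop :=
  D.IsSymm ∧ (∀ a ∈ J, ∀ b, D a b = 0) ∧ ∃ D' : Matrix (Fin n) (Fin n) F, D'.IsSymm ∧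
    (∀ a ∈ J, ∀ b, D' a b = 0) ∧ (∀ a b, D' a b ∈ pw F 1) ∧ D * D' = 1 - indMat F J

/-- The properties of `X ↦ f(w_n (1 X; 0 1))` used in the computation of its Fourier transform. -/
structure SiegelKernel (Φ : Matrix (Fin n) (Fin n) F → ℂ) (κ : F → ℂ) (c : ℕ → ℂ) : Prop where
  add_integral : ∀ X Y : Matrix (Fin n) (Fin n) F, X.IsSymm → Y.IsSymm →
    (∀ a b, Y a b ∈ pw F 0) → Φ (X + Y) = Φ X
  congr : ∀ X U V : Matrix (Fin n) (Fin n) F, X.IsSymm → (∀ a b, U a b ∈ pw F 0) →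
    (∀ a b, V a b ∈ pw F 0) → U * V = 1 → Φ (U * X * Uᵀ) = Φ X
  regular : ∀ J D, RegularOff J D → Φ D = κ (D + indMat F J).det * c J.card
  mul : ∀ x y : F, x ≠ 0 → y ≠ 0 → κ (x * y) = κ x * κ y

theorem RegularOff.mul_eq {J : Finset (Fin n)} {D : Matrix (Fin n) (Fin n) F} (h : RegularOff J D) :
    D * indMat F J = 0 := by
  ext a b
  simp only [indMat, Matrix.mul_diagonal, mul_ite, mul_one, mul_zero, Matrix.zero_apply]
  split_ifs with hb
  · rw [← h.1.apply a b]; exact h.2.1 b hb a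
  · rfl

/-- $D+1_J$ and $D'+1_J$ are inverse to each other. -/
theorem RegularOff.det_ne_zero {J : Finset (Fin n)} {D : Matrix (Fin n) (Fin n) F}
    (h : RegularOff J D) : (D + indMat F J).det ≠ 0 := by
  have h0 := h.mul_eq
  obtain ⟨_, _, D', h1, h2, h3, h4⟩ := h
  have h5 : indMat F J * D' = 0 := by
    rw [indMat_mul]; ext a b
    simp only [of_apply, Matrix.zero_apply]
    split_ifs with ha
    · exact h2 a ha b
    · rfl
  have h6 : indMat F J * indMat F J = indMat F J := by
    simp [indMat, Matrix.diagonal_mul_diagonal]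
  have h7 : (D + indMat F J) * (D' + indMat F J) = 1 := by
    rw [Matrix.add_mul, Matrix.mul_add, Matrix.mul_add, h0, h4, h5, h6]; abel
  have := congrArg Matrix.det h7
  rw [Matrix.det_mul, Matrix.det_one] at this
  exact left_ne_zero_of_mul_eq_one this

/-- $D$ is zero on the pivot indices, so adding $UP\,{}^tU$ is an orthogonal direct sum and the
partial inverses add. The determinant comes from $D+UP\,{}^tU+1_K=(D+1_J)(1+U(P-1)\,{}^tU)$ and
$\det(1+XY)=\det(1+YX)$. -/
theorem RegularOff.add_pivot {J K : Finset (Fin n)} {D : Matrix (Fin n) (Fin n) F}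
    (h : RegularOff J D) {f : ι → Fin n} (hf : Function.Injective f) (hfJ : ∀ k, f k ∈ J)
    (hK : ∀ a, a ∈ K ↔ a ∈ J ∧ ∀ k, a ≠ f k) {P Q : Matrix ι ι F} (hP : P.IsSymm) (hQ : Q.IsSymm)
    (hPQ : P * Q = 1) (hQ1 : ∀ k l, Q k l ∈ pw F 1) :
    RegularOff K (D + colMat F f * P * (colMat F f)ᵀ) ∧
      (D + colMat F f * P * (colMat F f)ᵀ + indMat F K).det = (D + indMat F J).det * P.det := by
  set U := colMat F f with hUdef
  have hU : Uᵀ * U = 1 := colMat_transpose_mul_self hf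
  have hUU : U * Uᵀ = indMat F J - indMat F K := colMat_mul_transpose hf hfJ hK
  have hUa : ∀ a ∈ K, ∀ k, U a k = 0 := fun a ha k => by
    simp [hUdef, colMat, ((hK a).1 ha).2 k]
  have hJU : indMat F J * U = U := by
    rw [indMat_mul]; ext a k
    simp only [of_apply, hUdef, colMat]
    split_ifs with h1 h2 h2 <;> first | rfl | (subst h2; exact absurd (hfJ k) h1)
  have hsup : ∀ M : Matrix ι ι F, ∀ a ∈ K, ∀ b, (U * M * Uᵀ) a b = 0 := fun M a ha b => by
    rw [Matrix.mul_assoc, Matrix.mul_apply]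
    exact Finset.sum_eq_zero fun k _ => by rw [hUa a ha k, zero_mul]
  have hsy : ∀ M : Matrix ι ι F, M.IsSymm → (U * M * Uᵀ).IsSymm := fun M hM => by
    rw [Matrix.IsSymm, transpose_mul, transpose_mul, transpose_transpose, hM.eq, Matrix.mul_assoc]
  have hJK : ∀ a ∈ K, a ∈ J := fun a ha => ((hK a).1 ha).1
  have h0 := h.mul_eq
  obtain ⟨hDs, hDJ, D', h1, h2, h3, h4⟩ := h
  have hUD : ∀ M : Matrix (Fin n) (Fin n) F, (∀ a ∈ J, ∀ b, M a b = 0) → Uᵀ * M = 0 :=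
    fun M hM => by
      rw [hUdef, colMat_transpose_mul]; ext k b
      exact hM _ (hfJ k) b
  have hDU : D * U = 0 := by
    have := congrArg transpose (hUD D hDJ)
    rwa [transpose_mul, transpose_transpose, hDs.eq, transpose_zero] at this
  refine ⟨⟨hDs.add (hsy P hP), fun a ha b => ?_, D' + U * Q * Uᵀ, h1.add (hsy Q hQ),
    fun a ha b => ?_, fun a b => ?_, ?_⟩, ?_⟩
  · rw [Matrix.add_apply, hDJ a (hJK a ha), hsup P a ha, add_zero]
  · rw [Matrix.add_apply, h2 a (hJK a ha), hsup Q a ha, add_zero]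
  · refine add_mem (h3 a b) ?_
    rw [Matrix.mul_apply]
    refine sum_mem fun k _ => ?_
    rw [Matrix.mul_apply, transpose_apply]
    have hU0 : ∀ a k, U a k = 0 ∨ U a k = 1 := fun a k => by
      simp only [hUdef, colMat, of_apply]; split_ifs <;> simp
    have h5 : ∑ l, U a l * Q l k ∈ pw F 1 := sum_mem fun l _ => by
      rcases hU0 a l with h | h <;> rw [h]
      · rw [zero_mul]; exact zero_mem _
      · rw [one_mul]; exact hQ1 l k
    rcases hU0 b k with h | h <;> rw [h]
    · rw [mul_zero]; exact zero_mem _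
    · rw [mul_one]; exact h5
  · have e1 : D * (U * Q * Uᵀ) = 0 := by
      rw [Matrix.mul_assoc, ← Matrix.mul_assoc, hDU, Matrix.zero_mul]
    have e2 : U * P * Uᵀ * D' = 0 := by rw [Matrix.mul_assoc, hUD D' h2, Matrix.mul_zero]
    have e3 : U * P * Uᵀ * (U * Q * Uᵀ) = U * Uᵀ := by
      calc U * P * Uᵀ * (U * Q * Uᵀ) = U * P * (Uᵀ * U) * Q * Uᵀ := by
            simp only [Matrix.mul_assoc]
        _ = U * (P * Q) * Uᵀ := by rw [hU, Matrix.mul_one]; simp only [Matrix.mul_assoc]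
        _ = U * Uᵀ := by rw [hPQ, Matrix.mul_one]
    rw [Matrix.add_mul, Matrix.mul_add, Matrix.mul_add, h4, e1, e2, e3, hUU]
    abel
  · have h5 : D + U * P * Uᵀ + indMat F K = (D + indMat F J) * (1 + U * ((P - 1) * Uᵀ)) := by
      rw [Matrix.mul_add, Matrix.mul_one, Matrix.add_mul, ← Matrix.mul_assoc D, hDU,
        Matrix.zero_mul, zero_add, ← Matrix.mul_assoc, hJU, Matrix.sub_mul, Matrix.one_mul,
        Matrix.mul_sub, hUU, Matrix.mul_assoc]
      abel
    rw [h5, Matrix.det_mul, Matrix.det_one_add_mul_comm, Matrix.mul_assoc, hU, Matrix.mul_one,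
      add_sub_cancel]

/-- Completing the square is congruence by $1+RQ\,{}^tU$. It is integral because $RQ$ is, and its
inverse is $1-RQ\,{}^tU$ because ${}^tUR=0$, so `SiegelKernel.congr` applies. -/
theorem SiegelKernel.pivot {Φ : Matrix (Fin n) (Fin n) F → ℂ} {κ : F → ℂ} {c : ℕ → ℂ}
    (hΦ : SiegelKernel Φ κ c) {J K : Finset (Fin n)} {D : Matrix (Fin n) (Fin n) F}
    (h : RegularOff J D) {f : ι → Fin n} (hf : Function.Injective f) (hfJ : ∀ k, f k ∈ J)
    (hK : ∀ a, a ∈ K ↔ a ∈ J ∧ ∀ k, a ≠ f k) {P Q : Matrix ι ι F} (hP : P.IsSymm)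
    (hPQ : P * Q = 1) {R : Matrix (Fin n) ι F} (hR : ∀ a ∉ K, ∀ k, R a k = 0)
    (hRQ : ∀ a k, (R * Q) a k ∈ pw F 0) (Y : symOn F K) :
    Φ (D + (colMat F f * P * (colMat F f)ᵀ + R * (colMat F f)ᵀ + colMat F f * Rᵀ +
      (Y.1 + R * Q * Rᵀ))) = Φ (D + colMat F f * P * (colMat F f)ᵀ + Y.1) := by
  have hfK : ∀ k, f k ∉ K := fun k h => ((hK _).1 h).2 k rfl
  set U := colMat F f with hUdef
  have hU : Uᵀ * U = 1 := colMat_transpose_mul_self hf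
  have hUR : Uᵀ * R = 0 := by
    rw [hUdef, colMat_transpose_mul]; ext k b; exact hR _ (hfK k) b
  have hUY : Uᵀ * Y.1 = 0 := by
    rw [hUdef, colMat_transpose_mul]; ext k b; exact symOn_left Y (hfK k) b
  have hUD : Uᵀ * D = 0 := by
    rw [hUdef, colMat_transpose_mul]; ext k b; exact h.2.1 _ (hfJ k) b
  have hN : ∀ a b, (R * Q * Uᵀ) a b ∈ pw F 0 := fun a b => by
    rw [Matrix.mul_apply]
    refine sum_mem fun k _ => ?_
    simp only [transpose_apply, hUdef, colMat, of_apply]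
    split_ifs
    · rw [mul_one]; exact hRQ a k
    · rw [mul_zero]; exact zero_mem _
  have hone : ∀ a b, (1 : Matrix (Fin n) (Fin n) F) a b ∈ pw F 0 := fun a b => by
    rw [Matrix.one_apply]
    split_ifs
    · exact mem_pw_zero.2 (one_mem _)
    · exact zero_mem _
  rw [add_schur_eq_congr hU hUD hUY hP h.1 Y.2.1 hPQ]
  refine hΦ.congr _ _ (1 - R * Q * Uᵀ) ?_ (fun a b => add_mem (hone a b) (hN a b))
    (fun a b => sub_mem (hone a b) (hN a b)) ?_
  · refine (h.1.add ?_).add Y.2.1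
    rw [Matrix.IsSymm, transpose_mul, transpose_mul, transpose_transpose, hP.eq, Matrix.mul_assoc]
  · have h2 : R * Q * Uᵀ * (R * Q * Uᵀ) = 0 := by
      calc R * Q * Uᵀ * (R * Q * Uᵀ) = R * Q * (Uᵀ * R) * Q * Uᵀ := by
            simp only [Matrix.mul_assoc]
        _ = 0 := by rw [hUR]; simp
    rw [Matrix.add_mul, Matrix.one_mul, Matrix.mul_sub, Matrix.mul_one, h2]
    abel

end SiegelKernel

/-! ### Decomposition of staircase boxes by the position of the pivot -/

section EliminationDomains

variable {n : ℕ} {F : Type*} [Field F] [ValuativeRel F]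
  [TopologicalSpace F] [IsNonarchimedeanLocalField F]

/-- The exponent of the box in which the first `m` rows and columns lie in `𝔭 ^ lam` and the
others in `𝔭 ^ (lam + 1)`. -/
def stairExp (lam : ℤ) (m : ℕ) (a b : Fin n) : ℤ := if (a : ℕ) < m ∧ (b : ℕ) < m then lam else lam + 1

/-- `lam` up to the index `i`, and `lam + 1` beyond it. -/
def stepExp (lam : ℤ) (i k : Fin n) : ℤ := if i < k then lam + 1 else lam

variable (F) in
/-- The part of the box `stairExp lam (i + 1)` where `j` is the last index with
`X i j ∉ 𝔭 ^ (lam + 1)`. -/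
def pivotSet (J : Finset (Fin n)) (lam : ℤ) (i j : Fin n) : Set (symOn F J) :=
  {X | X ∈ symBox F J (stairExp lam (i + 1)) ∧ X.1 i j ∉ pw F (lam + 1) ∧
    ∀ k, j < k → k ≤ i → X.1 i k ∈ pw F (lam + 1)}

theorem measurableSet_pivotSet (J : Finset (Fin n)) (lam : ℤ) (i j : Fin n) :
    MeasurableSet (pivotSet F J lam i j) := by
  have h : ∀ k, MeasurableSet {X : symOn F J | X.1 i k ∈ pw F (lam + 1)} := fun k =>
    ((isOpen_pw (F := F) (lam + 1)).preimage (continuous_symOn_apply i k)).measurableSet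
  have h2 : pivotSet F J lam i j = (symBox F J (stairExp lam (i + 1)) : Set (symOn F J)) ∩
      ({X : symOn F J | X.1 i j ∈ pw F (lam + 1)}ᶜ ∩
        ⋂ k, ⋂ (_ : j < k), ⋂ (_ : k ≤ i), {X : symOn F J | X.1 i k ∈ pw F (lam + 1)}) := by
    ext X
    simp only [pivotSet, Set.mem_inter_iff, Set.mem_iInter, Set.mem_setOf_eq, Set.mem_compl_iff,
      SetLike.mem_coe]
  rw [h2]
  exact (measurableSet_symBox _ _).inter ((h j).compl.inter (MeasurableSet.iInter fun k =>
    MeasurableSet.iInter fun _ => MeasurableSet.iInter fun _ => h k))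

theorem mem_symBox_stairExp_iff {J : Finset (Fin n)} {lam : ℤ} {i : Fin n} {X : symOn F J} :
    X ∈ symBox F J (stairExp lam i) ↔
      X ∈ symBox F J (stairExp lam (i + 1)) ∧ ∀ k ≤ i, X.1 i k ∈ pw F (lam + 1) := by
  constructor
  · intro h
    refine ⟨fun a b => pw_mono ?_ (h a b), fun k _ => ?_⟩
    · unfold stairExp; split_ifs <;> omega
    · have := h i k
      rwa [stairExp, if_neg (by simp)] at this
  · rintro ⟨h1, h2⟩ a b
    by_cases ha : a = i
    · subst ha
      rw [stairExp, if_neg (by simp)]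
      rcases le_or_gt b a with hb | hb
      · exact h2 b hb
      · have := h1 a b
        rwa [stairExp, if_neg (by rw [Fin.lt_def] at hb; omega)] at this
    by_cases hb : b = i
    · subst hb
      rw [stairExp, if_neg (by simp)]
      rcases le_or_gt a b with hb | hb
      · rw [symOn_symm]; exact h2 a hb
      · have := h1 a b
        rwa [stairExp, if_neg (by rw [Fin.lt_def] at hb; omega)] at this
    · have := h1 a b
      rw [← Fin.val_inj] at ha hb
      convert this using 2
      unfold stairExp
      exact if_congr (by omega) rfl rfl

/-- Either row $i$ already lies in $\mathfrak p^{\lambda+1}$ up to the diagonal, or there is a last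
entry that does not. Its column lies in $J$, since the entries outside $J$ vanish. -/
theorem symBox_stairExp_succ (J : Finset (Fin n)) (lam : ℤ) (i : Fin n) :
    (symBox F J (stairExp lam (i + 1)) : Set (symOn F J)) =
      (symBox F J (stairExp lam i) : Set (symOn F J)) ∪
      ⋃ j ∈ J.filter (· ≤ i), pivotSet F J lam i j := by
  ext X
  simp only [Set.mem_union, SetLike.mem_coe, mem_symBox_stairExp_iff (i := i), Set.mem_iUnion,
    Finset.mem_filter, exists_prop]
  constructor
  · intro h
    by_cases h2 : ∀ k ≤ i, X.1 i k ∈ pw F (lam + 1)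
    · exact Or.inl ⟨h, h2⟩
    · right
      classical
      push Not at h2
      let S := Finset.univ.filter fun k : Fin n => k ≤ i ∧ X.1 i k ∉ pw F (lam + 1)
      have hS : S.Nonempty := by
        obtain ⟨k, hk⟩ := h2
        exact ⟨k, Finset.mem_filter.2 ⟨Finset.mem_univ _, hk⟩⟩
      have hm := (Finset.mem_filter.1 (S.max'_mem hS)).2
      refine ⟨S.max' hS, ⟨?_, hm.1⟩, h, hm.2, fun k hk hki => ?_⟩
      · by_contra hJ
        apply hm.2
        rw [symOn_right X i hJ]; exact zero_mem _
      · by_contra hk'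
        exact absurd (S.le_max' k (Finset.mem_filter.2 ⟨Finset.mem_univ _, hki, hk'⟩)) (not_le.2 hk)
  · rintro (h | ⟨j, -, h⟩)
    exacts [h.1, h.1]

theorem disjoint_pivotSet {J : Finset (Fin n)} {lam : ℤ} {i j k : Fin n} (hjk : j < k) (hk : k ≤ i) :
    Disjoint (pivotSet F J lam i j) (pivotSet F J lam i k) :=
  Set.disjoint_left.2 fun _ h1 h2 => h2.2.1 (h1.2.2 k hjk hk)

theorem symBox_stairExp_zero (J : Finset (Fin n)) (lam : ℤ) :
    symBox F J (stairExp lam 0) = symBox F J (stairExp (lam + 1) n) := by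
  unfold stairExp; simp

theorem symBox_stairExp_of_notMem {J : Finset (Fin n)} {lam : ℤ} {i : Fin n} (hi : i ∉ J) :
    symBox F J (stairExp lam (i + 1)) = symBox F J (stairExp lam i) := by
  ext X
  rw [mem_symBox_stairExp_iff, iff_self_and]
  intro _ k _
  rw [symOn_left X hi]; exact zero_mem _

theorem setIntegral_symBox_stairExp_succ [MeasurableSpace F] [BorelSpace F] (J : Finset (Fin n))
    (lam : ℤ) (i : Fin n) {f : symOn F J → ℂ}
    (hf : IntegrableOn f (symBox F J (stairExp lam (i + 1))) (symMeas F J)) :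
    ∫ X in symBox F J (stairExp lam (i + 1)), f X ∂symMeas F J =
      ∫ X in symBox F J (stairExp lam i), f X ∂symMeas F J +
        ∑ j ∈ J.filter (· ≤ i), ∫ X in pivotSet F J lam i j, f X ∂symMeas F J := by
  have hs := symBox_stairExp_succ (F := F) J lam i
  have hms : ∀ j, MeasurableSet (pivotSet F J lam i j) := measurableSet_pivotSet J lam i
  have hU : MeasurableSet (⋃ j ∈ J.filter (· ≤ i), pivotSet F J lam i j) :=
    Finset.measurableSet_biUnion _ fun j _ => hms j
  have hd : Disjoint (symBox F J (stairExp lam i) : Set (symOn F J))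
      (⋃ j ∈ J.filter (· ≤ i), pivotSet F J lam i j) := by
    rw [Set.disjoint_left]
    intro X h1 h2
    simp only [Set.mem_iUnion, Finset.mem_filter, exists_prop] at h2
    obtain ⟨j, ⟨_, hj⟩, h2⟩ := h2
    exact h2.2.1 ((mem_symBox_stairExp_iff.1 h1).2 j hj)
  rw [hs] at hf ⊢
  rw [setIntegral_union hd hU (hf.mono_set Set.subset_union_left)
    (hf.mono_set Set.subset_union_right), integral_biUnion_finset _ (fun j _ => hms j)]
  · intro j hj k hk hjk
    rcases lt_or_gt_of_ne hjk with h | h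
    · exact disjoint_pivotSet h (Finset.mem_filter.1 hk).2
    · exact (disjoint_pivotSet h (Finset.mem_filter.1 hj).2).symm
  · intro j hj
    refine hf.mono_set (Set.subset_union_of_subset_right (Set.subset_biUnion_of_mem
      (u := fun j => pivotSet F J lam i j) (by exact_mod_cast hj)) _)

end EliminationDomains

/-! ### Pivot weights, Schur complements and the pivot domains as products -/

section PivotIntegrals

variable {n : ℕ} {F : Type*} [Field F] [ValuativeRel F]
  [TopologicalSpace F] [IsNonarchimedeanLocalField F]

theorem sum_eq_sum_coe {K : Finset (Fin n)} {M : Type*} [AddCommMonoid M] {g : Fin n → M}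
    (h : ∀ a ∉ K, g a = 0) : ∑ a, g a = ∑ k : K, g k := by
  rw [Finset.sum_coe_sort K g]
  exact (Finset.sum_subset (Finset.subset_univ K) fun a _ ha => h a ha).symm

theorem addChar_neg_sum {ι : Type*} (ψ : AddChar F Circle) (s : Finset ι) (g : ι → F) :
    ((ψ (-∑ i ∈ s, g i) : Circle) : ℂ) = ∏ i ∈ s, ((ψ (-g i) : Circle) : ℂ) := by
  classical
  induction s using Finset.induction_on with
  | empty => simp
  | insert a s ha ih =>
    rw [Finset.sum_insert ha, Finset.prod_insert ha, neg_add, AddChar.map_add_eq_mul,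
      Circle.coe_mul, ih]

theorem addChar_neg_add (ψ : AddChar F Circle) (x y : F) :
    ((ψ (-(x + y)) : Circle) : ℂ) = (ψ (-x) : ℂ) * (ψ (-y) : ℂ) := by
  rw [neg_add, AddChar.map_add_eq_mul, Circle.coe_mul]

/-- The integrand `Φ(D + X) ψ(-∑ b_k X_kk)`. -/
noncomputable def kernelIntegrand (Φ : Matrix (Fin n) (Fin n) F → ℂ) (ψ : AddChar F Circle)
    (b : Fin n → F) (D : Matrix (Fin n) (Fin n) F) {J : Finset (Fin n)} (X : symOn F J) : ℂ :=
  Φ (D + X.1) * (ψ (-∑ k, b k * X.1 k k) : ℂ)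

theorem SiegelKernel.continuous_integrand {Φ : Matrix (Fin n) (Fin n) F → ℂ} {κ : F → ℂ} {c : ℕ → ℂ}
    (hΦ : SiegelKernel Φ κ c) {ψ : AddChar F Circle} (hψ : Continuous ψ) (b : Fin n → F)
    {D : Matrix (Fin n) (Fin n) F} (hD : D.IsSymm) (J : Finset (Fin n)) :
    Continuous (kernelIntegrand Φ ψ b D (J := J)) := by
  refine Continuous.mul ?_ ?_
  · refine IsLocallyConstant.continuous ((IsLocallyConstant.iff_exists_open _).2 fun X => ?_)
    refine ⟨(fun Y => Y - X) ⁻¹' (symBox F J fun _ _ => 0 : Set (symOn F J)),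
      (isOpen_symBox J _).preimage (continuous_id.sub continuous_const), ?_, fun Y hY => ?_⟩
    · simpa using (symBox F J fun _ _ => 0).zero_mem
    · have h : D + Y.1 = D + X.1 + (Y - X).1 := by
        rw [Submodule.coe_sub]; abel
      rw [h]
      exact hΦ.add_integral _ _ (hD.add X.2.1) (Y - X).2.1 hY
  · refine continuous_subtype_val.comp (hψ.comp (Continuous.neg (continuous_finsetSum _ fun k _ =>
      continuous_const.mul (continuous_symOn_apply k k))))

/-- The domain of the pivot block `(X_jj, X_ij, X_ii)`. -/
def pairDomain (F : Type*) [Field F] [ValuativeRel F] [TopologicalSpace F]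
    [IsNonarchimedeanLocalField F] (lam : ℤ) : Set (F × F × F) :=
  (pw F lam : Set F) ×ˢ (shell F lam ×ˢ (pw F (lam + 1) : Set F))

/-- The quadratic form attached to the inverse of `(x y; y z)`. -/
def pairForm (p : F × F × F) (r : F × F) : F :=
  (r.1 * r.1 * p.2.2 - 2 * (r.1 * r.2 * p.2.1) + r.2 * r.2 * p.1) / (p.1 * p.2.2 - p.2.1 ^ 2)

theorem extendZero_mem {K : Finset (Fin n)} {r : K → F} {d : Fin n → ℤ}
    (h : ∀ k : K, r k ∈ pw F (d k)) (a : Fin n) : extendZero K r a ∈ pw F (d a) := by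
  by_cases ha : a ∈ K
  · rw [extendZero_of_mem r ha]; exact h ⟨a, ha⟩
  · rw [extendZero_of_notMem r ha]; exact zero_mem _

/-- The matrix `R P⁻¹ Rᵀ` for a `1 × 1` block `P`. -/
def singleSchur (K : Finset (Fin n)) (p : F) (r : K → F) : symOn F K :=
  ⟨Matrix.of fun a b => extendZero K r a * extendZero K r b / p,
    Matrix.IsSymm.ext fun a b => by simp only [of_apply, mul_comm],
    fun a b ha => by simp [extendZero_of_notMem r ha]⟩

theorem singleSchur_apply (K : Finset (Fin n)) (p : F) (r : K → F) (a b : Fin n) :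
    (singleSchur K p r).1 a b = extendZero K r a * extendZero K r b / p := rfl

/-- Each of $r_a,r_b$ has order at least $\lambda$, one more if its index exceeds $i$, and $p$ has
order exactly $\lambda$. The quotient $r_ar_b/p$ thus meets the staircase bound at row $i$, which
makes the Schur term a harmless translation. -/
theorem singleSchur_mem {K : Finset (Fin n)} {lam : ℤ} {i : Fin n} (hi : i ∉ K) {p : F}
    (hp : p ∈ shell F lam) {r : K → F} (hr : ∀ k : K, r k ∈ pw F (stepExp lam i k)) :
    singleSchur K p r ∈ symBox F K (stairExp lam i) := fun a b => by
  obtain ⟨hp0, hp⟩ := mem_shell.1 hp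
  by_cases ha : a = i
  · rw [symOn_left _ (ha ▸ hi)]; exact zero_mem _
  by_cases hb : b = i
  · rw [symOn_right _ _ (hb ▸ hi)]; exact zero_mem _
  refine pw_mono ?_ (div_mem_pw (mul_mem_pw (extendZero_mem hr a) (extendZero_mem hr b)) hp0 hp)
  unfold stairExp stepExp
  simp only [Fin.lt_def]
  rw [← Fin.val_inj] at ha hb
  split_ifs <;> omega

/-- The matrix `R P⁻¹ Rᵀ` for a symmetric `2 × 2` block `P`. -/
def pairSchur (K : Finset (Fin n)) (p : F × F × F) (r : K → F × F) : symOn F K :=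
  ⟨Matrix.of fun a b => ((extendZero K r a).1 * (extendZero K r b).1 * p.2.2 -
      ((extendZero K r a).1 * (extendZero K r b).2 + (extendZero K r a).2 * (extendZero K r b).1) *
        p.2.1 + (extendZero K r a).2 * (extendZero K r b).2 * p.1) / (p.1 * p.2.2 - p.2.1 ^ 2),
    Matrix.IsSymm.ext fun a b => by simp only [of_apply]; ring,
    fun a b ha => by simp [extendZero_of_notMem r ha]⟩

theorem pairSchur_apply (K : Finset (Fin n)) (p : F × F × F) (r : K → F × F) (a b : Fin n) :
    (pairSchur K p r).1 a b = ((extendZero K r a).1 * (extendZero K r b).1 * p.2.2 -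
      ((extendZero K r a).1 * (extendZero K r b).2 + (extendZero K r a).2 * (extendZero K r b).1) *
        p.2.1 + (extendZero K r a).2 * (extendZero K r b).2 * p.1) / (p.1 * p.2.2 - p.2.1 ^ 2) := rfl

theorem pairDomain_det {lam : ℤ} {p : F × F × F} (hp : p ∈ pairDomain F lam) :
    p.1 * p.2.2 - p.2.1 ^ 2 ≠ 0 ∧ ord (p.1 * p.2.2 - p.2.1 ^ 2) = 2 * lam := by
  obtain ⟨hx, hy, hz⟩ := hp
  obtain ⟨hy0, hy⟩ := mem_shell.1 hy
  rw [sub_eq_neg_add]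
  refine ord_add_of_mem (neg_ne_zero.2 (pow_ne_zero 2 hy0)) ?_ (pw_mono ?_ (mul_mem_pw hx hz))
  · rw [ord_neg, ord_pow, hy]; rfl
  · omega

theorem extendZero_pair_mem {K : Finset (Fin n)} {r : K → F × F} {d d' : Fin n → ℤ}
    (h : ∀ k : K, (r k).1 ∈ pw F (d k) ∧ (r k).2 ∈ pw F (d' k)) (a : Fin n) :
    (extendZero K r a).1 ∈ pw F (d a) ∧ (extendZero K r a).2 ∈ pw F (d' a) := by
  by_cases ha : a ∈ K
  · rw [extendZero_of_mem r ha]; exact h ⟨a, ha⟩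
  · rw [extendZero_of_notMem r ha]; exact ⟨zero_mem _, zero_mem _⟩

theorem pairSchur_mem {K : Finset (Fin n)} {lam : ℤ} {i j : Fin n} (hi : i ∉ K) (hj : j ∉ K)
    (hji : j < i) {p : F × F × F} (hp : p ∈ pairDomain F lam) {r : K → F × F}
    (hr : ∀ k : K, (r k).1 ∈ pw F (stepExp lam i k) ∧ (r k).2 ∈ pw F (stepExp lam j k)) :
    pairSchur K p r ∈ symBox F K (stairExp lam i) := fun a b => by
  obtain ⟨hd0, hd⟩ := pairDomain_det hp
  obtain ⟨hx, hy, hz⟩ := hp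
  by_cases ha : a = i
  · rw [symOn_left _ (ha ▸ hi)]; exact zero_mem _
  by_cases hb : b = i
  · rw [symOn_right _ _ (hb ▸ hi)]; exact zero_mem _
  have ha' := extendZero_pair_mem hr a
  have hb' := extendZero_pair_mem hr b
  rw [← Fin.val_inj] at ha hb
  have hm := hy.1
  have key : stairExp lam i a b + 2 * lam ≤ stepExp lam i a + stepExp lam i b + lam := by
    unfold stairExp stepExp
    simp only [Fin.lt_def]
    split_ifs <;> omega
  -- As $j<i$, the bounds on the second column are at least as strong as those on the first, so the
  -- weaker one serves for all terms of the quadratic expression.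
  have hle : ∀ c : Fin n, stepExp lam i c ≤ stepExp lam j c := fun c => by
    unfold stepExp
    simp only [Fin.lt_def] at hji ⊢
    split_ifs <;> omega
  have h2 : ∀ c : Fin n, (extendZero K r c).2 ∈ pw F (stepExp lam i c) := fun c =>
    pw_mono (hle c) (extendZero_pair_mem hr c).2
  have h := div_mem_pw (m := stairExp lam i a b + 2 * lam) (add_mem (sub_mem
    (pw_mono ?_ (mul_mem_pw (mul_mem_pw ha'.1 hb'.1) hz))
    (pw_mono ?_ (mul_mem_pw (add_mem (mul_mem_pw ha'.1 (h2 b)) (mul_mem_pw (h2 a) hb'.1)) hm)))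
    (pw_mono ?_ (mul_mem_pw (mul_mem_pw (h2 a) (h2 b)) hx))) hd0 hd
  · rwa [add_sub_cancel_right] at h
  all_goals omega

/-- Since the Schur term belongs to the staircase box, the conditions on the pivot, on the pivot
column and on the complement become independent; `setIntegral_pivot` requires such a product domain.
-/
theorem mem_pivotSet_single {J : Finset (Fin n)} {lam : ℤ} {i : Fin n} (hi : i ∈ J) (p : F)
    (r : J.erase i → F) (Y : symOn F (J.erase i)) :
    singleEquiv hi (p, r, Y + singleSchur _ p r) ∈ pivotSet F J lam i i ↔
      p ∈ shell F lam ∧ (∀ k : (J.erase i : Finset (Fin n)), r k ∈ (pw F (stepExp lam i k) : Set F)) ∧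
        Y ∈ (symBox F (J.erase i) (stairExp lam i) : Set (symOn F (J.erase i))) := by
  have hiK : i ∉ J.erase i := Finset.notMem_erase _ _
  have hse : ∀ k : Fin n, stairExp lam (i + 1) k i = stepExp lam i k := fun k => by
    unfold stairExp stepExp
    simp only [Fin.lt_def]
    split_ifs <;> omega
  constructor
  · rintro ⟨h1, h2, -⟩
    have hp : p ∈ shell F lam := by
      refine ⟨?_, by simpa [singleEquiv_apply] using h2⟩
      simpa [singleEquiv_apply, stairExp] using h1 i i
    have hr : ∀ k : J.erase i, r k ∈ pw F (stepExp lam i k) := fun k => by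
      have hk : (k : Fin n) ≠ i := (Finset.mem_erase.1 k.2).1
      simpa [singleEquiv_apply, hk, hse] using h1 k i
    refine ⟨hp, hr, ?_⟩
    rw [SetLike.mem_coe, ← add_mem_cancel_right (singleSchur_mem hiK hp hr)]
    intro a b
    by_cases ha : a = i
    · rw [symOn_left _ (ha ▸ hiK)]; exact zero_mem _
    by_cases hb : b = i
    · rw [symOn_right _ _ (hb ▸ hiK)]; exact zero_mem _
    have h3 := h1 a b
    rw [singleEquiv_apply, if_neg ha, if_neg hb] at h3
    convert h3 using 2
    rw [← Fin.val_inj] at ha hb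
    unfold stairExp
    exact if_congr (by omega) rfl rfl
  · rintro ⟨hp, hr, hY⟩
    have hYc := add_mem hY (singleSchur_mem hiK hp hr)
    refine ⟨fun a b => ?_, ?_, fun k hk hki => absurd hki (not_le.2 hk)⟩
    · rw [singleEquiv_apply]
      split_ifs with ha hb hb
      · subst ha hb
        have := hp.1
        simpa [stairExp] using this
      · subst ha
        have := extendZero_mem hr b
        rwa [← hse, show stairExp lam (a + 1) b a = stairExp lam (a + 1) a b from
          if_congr and_comm rfl rfl] at this
      · subst hb
        rw [hse]
        exact extendZero_mem hr a
      · refine pw_mono ?_ (hYc a b)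
        unfold stairExp; split_ifs <;> omega
    · simpa [singleEquiv_apply] using hp.2

theorem mem_pivotSet_pair {J : Finset (Fin n)} {lam : ℤ} {i j : Fin n} (hi : i ∈ J) (hj : j ∈ J)
    (hji : j < i) (p : F × F × F) (r : (J.erase i).erase j → F × F)
    (Y : symOn F ((J.erase i).erase j)) :
    pairEquiv hi hj hji.ne (p, r, Y + pairSchur _ p r) ∈ pivotSet F J lam i j ↔
      p ∈ pairDomain F lam ∧
        (∀ k : ((J.erase i).erase j : Finset (Fin n)), r k ∈
          (pw F (stepExp lam i k) : Set F) ×ˢ (pw F (stepExp lam j k) : Set F)) ∧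
        Y ∈ (symBox F ((J.erase i).erase j) (stairExp lam i) :
          Set (symOn F ((J.erase i).erase j))) := by
  have hjK : j ∉ (J.erase i).erase j := Finset.notMem_erase _ _
  have hiK : i ∉ (J.erase i).erase j := fun h => by simp at h
  have hij : i ≠ j := hji.ne'
  have hji' : j ≠ i := hji.ne
  have hji2 := Fin.lt_def.1 hji
  constructor
  · rintro ⟨h1, h2, h3⟩
    have hp : p ∈ pairDomain F lam := by
      refine ⟨?_, ⟨?_, ?_⟩, ?_⟩
      · have := h1 j j
        rw [pairEquiv_apply, if_neg hji', if_pos rfl, if_neg hji', if_pos rfl] at this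
        rwa [stairExp, if_pos (by omega)] at this
      · have := h1 i j
        rw [pairEquiv_apply, if_pos rfl, if_neg hji', if_pos rfl] at this
        rwa [stairExp, if_pos (by omega)] at this
      · rwa [pairEquiv_apply, if_pos rfl, if_neg hji', if_pos rfl] at h2
      · have := h3 i hji le_rfl
        rwa [pairEquiv_apply, if_pos rfl, if_pos rfl] at this
    have hr : ∀ k : ((J.erase i).erase j : Finset (Fin n)),
        (r k).1 ∈ pw F (stepExp lam i k) ∧ (r k).2 ∈ pw F (stepExp lam j k) := fun k => by
      have hk1 : (k : Fin n) ≠ j := (Finset.mem_erase.1 k.2).1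
      have hk2 : (k : Fin n) ≠ i := (Finset.mem_erase.1 (Finset.mem_erase.1 k.2).2).1
      have hk1' := hk1
      have hk2' := hk2
      rw [← Fin.val_inj.ne] at hk1' hk2'
      constructor
      · have := h1 k j
        rw [pairEquiv_apply, if_neg hk2, if_neg hk1, if_neg hji', if_pos rfl, extendZero_coe] at this
        refine pw_mono ?_ this
        unfold stairExp stepExp
        simp only [Fin.lt_def]
        split_ifs <;> omega
      -- Between $j$ and $i$ the extra divisibility of row $i$ is not a condition of the box: it
      -- holds because $j$ is the last column with an entry of order $\lambda$.
      · by_cases hk3 : j < (k : Fin n) ∧ (k : Fin n) ≤ i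
        · have := h3 k hk3.1 hk3.2
          rw [pairEquiv_apply, if_pos rfl, if_neg hk2, if_neg hk1, extendZero_coe] at this
          refine pw_mono ?_ this
          unfold stepExp; split_ifs <;> omega
        · have := h1 k i
          rw [pairEquiv_apply, if_neg hk2, if_neg hk1, if_pos rfl, extendZero_coe] at this
          refine pw_mono ?_ this
          simp only [Fin.lt_def, Fin.le_def] at hk3
          unfold stairExp stepExp
          simp only [Fin.lt_def]
          split_ifs <;> omega
    refine ⟨hp, hr, ?_⟩
    rw [SetLike.mem_coe, ← add_mem_cancel_right (pairSchur_mem hiK hjK hji hp hr)]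
    intro a b
    by_cases ha : a = i
    · rw [symOn_left _ (ha ▸ hiK)]; exact zero_mem _
    by_cases hb : b = i
    · rw [symOn_right _ _ (hb ▸ hiK)]; exact zero_mem _
    by_cases ha' : a = j
    · rw [symOn_left _ (ha' ▸ hjK)]; exact zero_mem _
    by_cases hb' : b = j
    · rw [symOn_right _ _ (hb' ▸ hjK)]; exact zero_mem _
    have h3 := h1 a b
    rw [pairEquiv_apply, if_neg ha, if_neg ha', if_neg hb, if_neg hb'] at h3
    convert h3 using 2
    rw [← Fin.val_inj] at ha hb
    unfold stairExp
    exact if_congr (by omega) rfl rfl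
  · rintro ⟨hp, hr, hY⟩
    have hYc := add_mem hY (pairSchur_mem hiK hjK hji hp hr)
    have hr1 := fun c => (extendZero_pair_mem hr c).1
    have hr2 := fun c => (extendZero_pair_mem hr c).2
    obtain ⟨hx, hy, hz⟩ := hp
    have hle : ∀ c : Fin n, c ≠ i → stairExp lam (i + 1) c j ≤ stepExp lam i c ∧
        stairExp lam (i + 1) c i ≤ stepExp lam j c ∧ stairExp lam (i + 1) j c ≤ stepExp lam i c ∧
        stairExp lam (i + 1) i c ≤ stepExp lam j c := fun c hc => by
      rw [← Fin.val_inj.ne] at hc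
      unfold stairExp stepExp
      simp only [Fin.lt_def]
      refine ⟨?_, ?_, ?_, ?_⟩ <;> split_ifs <;> omega
    have hii : stairExp lam (i + 1) i i = lam := if_pos (by omega)
    have hjj : stairExp lam (i + 1) j j = lam := if_pos (by omega)
    have hij' : stairExp lam (i + 1) i j = lam := if_pos (by omega)
    have hji' : stairExp lam (i + 1) j i = lam := if_pos (by omega)
    refine ⟨fun a b => ?_, ?_, fun k hk hki => ?_⟩
    · rw [pairEquiv_apply]
      split_ifs with h1 h2 h3 h4 h5 h6 h7 h8
      · subst h1 h2; rw [hii]; exact pw_mono (by omega) hz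
      · subst h1 h3; rw [hij']; exact hy.1
      · subst h1; exact pw_mono (hle b h2).2.2.2 (hr2 b)
      · subst h4 h5; rw [hji']; exact hy.1
      · subst h4 h6; rw [hjj]; exact hx
      · subst h4; exact pw_mono (hle b h5).2.2.1 (hr1 b)
      · subst h7; exact pw_mono (hle a h1).2.1 (hr2 a)
      · subst h8; exact pw_mono (hle a h1).1 (hr1 a)
      · refine pw_mono ?_ (hYc a b)
        unfold stairExp; split_ifs <;> omega
    · rw [pairEquiv_apply, if_pos rfl, if_neg hji.ne, if_pos rfl]
      exact hy.2
    · rw [pairEquiv_apply, if_pos rfl, if_neg hk.ne']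
      split_ifs with h
      · exact hz
      · refine pw_mono ?_ (hr2 k)
        rw [stepExp, if_pos hk]

variable [MeasurableSpace F] [BorelSpace F]

theorem SiegelKernel.integrableOn {Φ : Matrix (Fin n) (Fin n) F → ℂ} {κ : F → ℂ} {c : ℕ → ℂ}
    (hΦ : SiegelKernel Φ κ c) {ψ : AddChar F Circle} (hψ : Continuous ψ) (b : Fin n → F)
    {D : Matrix (Fin n) (Fin n) F} (hD : D.IsSymm) (J : Finset (Fin n)) (d : Fin n → Fin n → ℤ) :
    IntegrableOn (kernelIntegrand Φ ψ b D) (symBox F J d : Set (symOn F J)) (symMeas F J) :=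
  (hΦ.continuous_integrand hψ b hD J).continuousOn.integrableOn_compact (isCompact_symBox J d)

/-- The contribution of a diagonal pivot at `i`. -/
noncomputable def singleWeight (μ : Measure F) (κ : F → ℂ) (ψ : AddChar F Circle) (b : Fin n → F)
    (lam : ℤ) (K : Finset (Fin n)) (i : Fin n) : ℂ :=
  ∫ p in shell F lam, κ p * (ψ (-(b i * p)) : ℂ) *
    ∏ k ∈ K, ∫ r in pw F (stepExp lam i k), (ψ (-(b k * (r * r / p))) : ℂ) ∂μ ∂μ

/-- The contribution of an off-diagonal pivot at `(i, j)`, `j < i`. -/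
noncomputable def pairWeight (μ : Measure F) (κ : F → ℂ) (ψ : AddChar F Circle) (b : Fin n → F)
    (lam : ℤ) (K : Finset (Fin n)) (i j : Fin n) : ℂ :=
  ∫ p in pairDomain F lam, κ (p.1 * p.2.2 - p.2.1 ^ 2) * (ψ (-(b j * p.1 + b i * p.2.2)) : ℂ) *
    ∏ k ∈ K, ∫ r in (pw F (stepExp lam i k) : Set F) ×ˢ (pw F (stepExp lam j k) : Set F),
      (ψ (-(b k * pairForm p r)) : ℂ) ∂(μ.prod μ) ∂(μ.prod (μ.prod μ))

end PivotIntegrals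

/-! ### One elimination step for the integrals -/

section PivotSteps

variable {n : ℕ} {F : Type*} [Field F] [ValuativeRel F]
  [TopologicalSpace F] [IsNonarchimedeanLocalField F]

theorem singleEquiv_eq {J : Finset (Fin n)} {i : Fin n} (hi : i ∈ J) (p : F) (r : J.erase i → F)
    (Y : symOn F (J.erase i)) :
    (singleEquiv hi (p, r, Y + singleSchur _ p r)).1 =
      colMat F ![i] * !![p] * (colMat F ![i])ᵀ +
        (Matrix.of fun a _ => extendZero _ r a : Matrix (Fin n) (Fin 1) F) * (colMat F ![i])ᵀ +
        colMat F ![i] * (Matrix.of fun a _ => extendZero _ r a : Matrix (Fin n) (Fin 1) F)ᵀ +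
        (Y.1 + (Matrix.of fun a _ => extendZero _ r a : Matrix (Fin n) (Fin 1) F) * !![p⁻¹] *
          (Matrix.of fun a _ => extendZero _ r a : Matrix (Fin n) (Fin 1) F)ᵀ) := by
  have hiK : i ∉ J.erase i := Finset.notMem_erase _ _
  ext a b
  rw [singleEquiv_apply]
  simp only [Matrix.add_apply, Matrix.mul_apply, transpose_apply, of_apply, colMat,
    Finset.univ_unique, Finset.sum_singleton, Fin.default_eq_zero, cons_val_zero,
    Submodule.coe_add, singleSchur_apply, cons_val_fin_one]
  by_cases ha : a = i
  · subst ha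
    by_cases hb : b = a
    · subst hb; simp [extendZero_of_notMem r hiK, symOn_left Y hiK]
    · simp [hb, extendZero_of_notMem r hiK, symOn_left Y hiK]
  · by_cases hb : b = i
    · subst hb; simp [ha, extendZero_of_notMem r hiK, symOn_right Y _ hiK]
    · simp [ha, hb]; ring

theorem trace_singleEquiv {J : Finset (Fin n)} {i : Fin n} (hi : i ∈ J) (p : F) (r : J.erase i → F)
    (Y : symOn F (J.erase i)) (b : Fin n → F) :
    ∑ k, b k * (singleEquiv hi (p, r, Y + singleSchur _ p r)).1 k k =
      b i * p + (∑ k : (J.erase i : Finset (Fin n)), b k * (r k * r k / p) + ∑ k, b k * Y.1 k k) := by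
  have hiK : i ∉ J.erase i := Finset.notMem_erase _ _
  have h1 : ∀ k, b k * (singleEquiv hi (p, r, Y + singleSchur _ p r)).1 k k =
      (if k = i then b i * p else 0) + (b k * (extendZero _ r k * extendZero _ r k / p) +
        b k * Y.1 k k) := fun k => by
    rw [singleEquiv_apply]
    by_cases hk : k = i
    · subst hk; simp [extendZero_of_notMem r hiK, symOn_left Y hiK]
    · simp only [hk, if_false, Submodule.coe_add, Matrix.add_apply, singleSchur_apply]; ring
  simp only [h1]
  rw [Finset.sum_add_distrib, Finset.sum_ite_eq' Finset.univ i, if_pos (Finset.mem_univ i),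
    Finset.sum_add_distrib, sum_eq_sum_coe (K := J.erase i)]
  · simp
  · intro a ha; rw [extendZero_of_notMem r ha]; simp

theorem pairEquiv_eq {J : Finset (Fin n)} {i j : Fin n} (hi : i ∈ J) (hj : j ∈ J) (hij : j ≠ i)
    (p : F × F × F) (hp : p.1 * p.2.2 - p.2.1 ^ 2 ≠ 0) (r : (J.erase i).erase j → F × F)
    (Y : symOn F ((J.erase i).erase j)) :
    let d := p.1 * p.2.2 - p.2.1 ^ 2
    let R : Matrix (Fin n) (Fin 2) F := Matrix.of fun a =>
      ![(extendZero _ r a).1, (extendZero _ r a).2]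
    (pairEquiv hi hj hij (p, r, Y + pairSchur _ p r)).1 =
      colMat F ![j, i] * !![p.1, p.2.1; p.2.1, p.2.2] * (colMat F ![j, i])ᵀ +
        R * (colMat F ![j, i])ᵀ + colMat F ![j, i] * Rᵀ +
        (Y.1 + R * !![p.2.2 / d, -p.2.1 / d; -p.2.1 / d, p.1 / d] * Rᵀ) := by
  intro d R
  have hjK : j ∉ (J.erase i).erase j := Finset.notMem_erase _ _
  have hiK : i ∉ (J.erase i).erase j := fun h => by simp at h
  ext a b
  rw [pairEquiv_apply]
  simp only [Matrix.add_apply, Matrix.mul_apply, transpose_apply, of_apply, colMat,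
    Fin.sum_univ_two, cons_val_zero, cons_val_one, Submodule.coe_add, pairSchur_apply, R]
  by_cases ha : a = i
  · subst ha
    by_cases hb : b = a
    · subst hb; simp [extendZero_of_notMem r hiK, symOn_left Y hiK, hij.symm]
    by_cases hb' : b = j
    · subst hb'
      simp [extendZero_of_notMem r hiK, symOn_left Y hiK, hij, hij.symm, extendZero_of_notMem r hjK]
    · simp [hb, hb', extendZero_of_notMem r hiK, symOn_left Y hiK, hij.symm]
  by_cases ha' : a = j
  · subst ha'
    by_cases hb : b = i
    · subst hb
      simp [extendZero_of_notMem r hiK, symOn_left Y hjK, hij, hij.symm, extendZero_of_notMem r hjK]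
    by_cases hb' : b = a
    · subst hb'; simp [extendZero_of_notMem r hjK, symOn_left Y hjK, hij]
    · simp [hb, hb', extendZero_of_notMem r hjK, symOn_left Y hjK, hij]
  by_cases hb : b = i
  · subst hb; simp [ha, ha', extendZero_of_notMem r hiK, symOn_right Y _ hiK, hij.symm]
  by_cases hb' : b = j
  · subst hb'; simp [ha, ha', extendZero_of_notMem r hjK, symOn_right Y _ hjK, hij]
  simp [ha, ha', hb, hb']
  field_simp
  ring

theorem trace_pairEquiv {J : Finset (Fin n)} {i j : Fin n} (hi : i ∈ J) (hj : j ∈ J) (hij : j ≠ i)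
    (p : F × F × F) (r : (J.erase i).erase j → F × F)
    (Y : symOn F ((J.erase i).erase j)) (b : Fin n → F) :
    ∑ k, b k * (pairEquiv hi hj hij (p, r, Y + pairSchur _ p r)).1 k k =
      (b j * p.1 + b i * p.2.2) + (∑ k : ((J.erase i).erase j : Finset (Fin n)),
        b k * pairForm p (r k) + ∑ k, b k * Y.1 k k) := by
  have hjK : j ∉ (J.erase i).erase j := Finset.notMem_erase _ _
  have hiK : i ∉ (J.erase i).erase j := fun h => by simp at h
  have h0 : pairForm p 0 = 0 := by simp [pairForm]
  have h1 : ∀ k, b k * (pairEquiv hi hj hij (p, r, Y + pairSchur _ p r)).1 k k =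
      ((if k = j then b j * p.1 else 0) + (if k = i then b i * p.2.2 else 0)) +
        (b k * pairForm p (extendZero _ r k) + b k * Y.1 k k) := fun k => by
    rw [pairEquiv_apply]
    by_cases hk : k = i
    · subst hk; simp [extendZero_of_notMem r hiK, symOn_left Y hiK, hij.symm, h0]
    by_cases hk' : k = j
    · subst hk'; simp [extendZero_of_notMem r hjK, symOn_left Y hjK, hij, h0]
    · simp only [hk, hk', if_false, Submodule.coe_add, Matrix.add_apply, pairSchur_apply, pairForm]
      ring
  simp only [h1]
  rw [Finset.sum_add_distrib, Finset.sum_add_distrib, Finset.sum_ite_eq' Finset.univ j,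
    if_pos (Finset.mem_univ j), Finset.sum_ite_eq' Finset.univ i, if_pos (Finset.mem_univ i),
    Finset.sum_add_distrib, sum_eq_sum_coe (K := (J.erase i).erase j)]
  · simp
  · intro a ha; rw [extendZero_of_notMem r ha, h0, mul_zero]

variable [MeasurableSpace F] [BorelSpace F] {μ : Measure F} [μ.IsAddHaarMeasure]
  {Φ : Matrix (Fin n) (Fin n) F → ℂ} {κ : F → ℂ} {c : ℕ → ℂ} {ψ : AddChar F Circle}

/-- After completing the square, the pivot column enters only through $\psi$, one Gaussian factor
per index, and the complement sees $D$ enlarged by the pivot. The hypothesis on the smaller box says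
that its integral depends on $D$ only through $\kappa$ of a determinant. This determinant gains the
factor $p$, so $\kappa(p)$ joins the weight. -/
theorem SiegelKernel.setIntegral_single (hΦ : SiegelKernel Φ κ c) (hμ : μ (𝒪[F] : Set F) = 1)
    (hψ : Continuous ψ) (b : Fin n → F) {J : Finset (Fin n)} {lam : ℤ} (hlam : lam ≤ -1) {i : Fin n}
    (hi : i ∈ J) {D : Matrix (Fin n) (Fin n) F} (hD : RegularOff J D) {R : ℂ}
    (hR : ∀ D', RegularOff (J.erase i) D' →
      ∫ Y in symBox F (J.erase i) (stairExp lam i), kernelIntegrand Φ ψ b D' Y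
        ∂symMeas F (J.erase i) = κ (D' + indMat F (J.erase i)).det * R) :
    ∫ X in pivotSet F J lam i i, kernelIntegrand Φ ψ b D X ∂symMeas F J =
      κ (D + indMat F J).det * (singleWeight μ κ ψ b lam (J.erase i) i * R) := by
  have hf : Function.Injective ![i] := Function.injective_of_subsingleton _
  have hfJ : ∀ k, ![i] k ∈ J := fun k => by simpa using hi
  have hK : ∀ a, a ∈ J.erase i ↔ a ∈ J ∧ ∀ k, a ≠ ![i] k := fun a => by
    simp [and_comm]
  have hP : ∀ p : F, (!![p] : Matrix (Fin 1) (Fin 1) F).IsSymm := fun p =>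
    Matrix.IsSymm.ext fun a b => by rw [Subsingleton.elim a b]
  have hPQ : ∀ p : F, p ≠ 0 → (!![p] : Matrix (Fin 1) (Fin 1) F) * !![p⁻¹] = 1 := fun p hp => by
    ext a b
    rw [Subsingleton.elim a 0, Subsingleton.elim b 0]
    simp [Matrix.mul_apply, hp]
  have hsub : pivotSet F J lam i i ⊆ symBox F J (stairExp lam (i + 1)) := fun X hX => hX.1
  rw [setIntegral_pivot (measurePreserving_singleEquiv hμ hi) (measurableEmbedding_singleEquiv hi)
    (measurableSet_pivotSet J lam i i) (measurableSet_shell lam)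
    (SR := fun k => (pw F (stepExp lam i k) : Set F)) (fun k => measurableSet_pw _)
    (measurableSet_symBox (J.erase i) (stairExp lam i)) (c := singleSchur (J.erase i))
    (mem_pivotSet_single hi) ((hΦ.integrableOn hψ b hD.1 J _).mono_set hsub)
    (g := fun p => (ψ (-(b i * p)) : ℂ)) (h := fun k p r => (ψ (-(b k * (r * r / p))) : ℂ))
    (f' := fun p Y => kernelIntegrand Φ ψ b
      (D + colMat F ![i] * !![p] * (colMat F ![i])ᵀ) Y)]
  · rw [singleWeight, ← integral_mul_const, ← integral_const_mul]
    refine setIntegral_congr_fun (measurableSet_shell lam) fun p hp => ?_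
    obtain ⟨hp0, hpo⟩ := mem_shell.1 hp
    have hreg := hD.add_pivot hf hfJ hK (hP p) (hP p⁻¹) (hPQ p hp0) (fun k l => by
      have : p⁻¹ ∈ pw F 1 := (mem_pw_iff_ord (inv_ne_zero hp0)).2 (by rw [ord_inv, hpo]; omega)
      simpa [Subsingleton.elim k 0, Subsingleton.elim l 0] using this)
    have hp2 : (!![p] : Matrix (Fin 1) (Fin 1) F).det = p := by simp
    beta_reduce
    rw [hR _ hreg.1, hreg.2, hp2, hΦ.mul _ _ hD.det_ne_zero hp0,
      Finset.prod_coe_sort (J.erase i) fun k =>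
        ∫ r in pw F (stepExp lam i k), (ψ (-(b k * (r * r / p))) : ℂ) ∂μ]
    ring
  · intro p hp r hr Y _
    obtain ⟨hp0, hpo⟩ := mem_shell.1 hp
    rw [kernelIntegrand, kernelIntegrand, trace_singleEquiv, addChar_neg_add, addChar_neg_add,
      addChar_neg_sum, singleEquiv_eq, hΦ.pivot hD hf hfJ hK (hP p) (hPQ p hp0)]
    · ring
    · intro a ha k; simp [extendZero_of_notMem r ha]
    · intro a k
      have h1 := div_mem_pw (extendZero_mem hr a) hp0 hpo
      -- The column of $RQ$ has entries $r_a/p$ with $r_a\in\mathfrak p^\lambda$ and $p$ of order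
      -- exactly $\lambda$, hence integral, as `SiegelKernel.pivot` requires.
      rw [Subsingleton.elim k 0]
      have h2 : ((Matrix.of fun a _ => extendZero (J.erase i) r a : Matrix (Fin n) (Fin 1) F) *
          !![p⁻¹]) a 0 = extendZero (J.erase i) r a / p := by
        simp [Matrix.mul_apply, div_eq_mul_inv]
      rw [h2]
      refine pw_mono ?_ h1
      unfold stepExp; split_ifs <;> omega

/-- The same argument with a $2\times2$ block. Its determinant has order exactly $2\lambda$, because
the square of the off-diagonal entry dominates, so the inverse block has entries of order at least
$-\lambda\ge1$. -/
theorem SiegelKernel.setIntegral_pair (hΦ : SiegelKernel Φ κ c) (hμ : μ (𝒪[F] : Set F) = 1)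
    (hψ : Continuous ψ) (b : Fin n → F) {J : Finset (Fin n)} {lam : ℤ} (hlam : lam ≤ -1)
    {i j : Fin n} (hi : i ∈ J) (hj : j ∈ J) (hji : j < i)
    {D : Matrix (Fin n) (Fin n) F} (hD : RegularOff J D) {R : ℂ}
    (hR : ∀ D', RegularOff ((J.erase i).erase j) D' →
      ∫ Y in symBox F ((J.erase i).erase j) (stairExp lam i), kernelIntegrand Φ ψ b D' Y
        ∂symMeas F ((J.erase i).erase j) = κ (D' + indMat F ((J.erase i).erase j)).det * R) :
    ∫ X in pivotSet F J lam i j, kernelIntegrand Φ ψ b D X ∂symMeas F J =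
      κ (D + indMat F J).det * (pairWeight μ κ ψ b lam ((J.erase i).erase j) i j * R) := by
  have hf : Function.Injective ![j, i] := by
    intro a b h
    fin_cases a <;> fin_cases b <;> simp_all [hji.ne, hji.ne']
  have hfJ : ∀ k, ![j, i] k ∈ J := fun k => by fin_cases k <;> simp [hi, hj]
  have hK : ∀ a, a ∈ (J.erase i).erase j ↔ a ∈ J ∧ ∀ k, a ≠ ![j, i] k := fun a => by
    simp only [Finset.mem_erase, Fin.forall_fin_two, cons_val_zero, cons_val_one]
    tauto
  have hP : ∀ x y z : F, (!![x, y; y, z] : Matrix (Fin 2) (Fin 2) F).IsSymm := fun x y z =>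
    Matrix.IsSymm.ext fun a b => by fin_cases a <;> fin_cases b <;> rfl
  have hPQ : ∀ x y z : F, x * z - y ^ 2 ≠ 0 → (!![x, y; y, z] : Matrix (Fin 2) (Fin 2) F) *
      !![z / (x * z - y ^ 2), -y / (x * z - y ^ 2); -y / (x * z - y ^ 2), x / (x * z - y ^ 2)] = 1 :=
    fun x y z h => by
      ext a b
      fin_cases a <;> fin_cases b <;> simp [Matrix.mul_apply, Fin.sum_univ_two] <;> field_simp <;>
        ring
  have hsub : pivotSet F J lam i j ⊆ symBox F J (stairExp lam (i + 1)) := fun X hX => hX.1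
  have hmd : MeasurableSet (pairDomain F lam) :=
    (measurableSet_pw _).prod ((measurableSet_shell _).prod (measurableSet_pw _))
  rw [setIntegral_pivot (measurePreserving_pairEquiv hμ hi hj hji.ne)
    (measurableEmbedding_pairEquiv hi hj hji.ne)
    (measurableSet_pivotSet J lam i j) hmd
    (SR := fun k => (pw F (stepExp lam i k) : Set F) ×ˢ (pw F (stepExp lam j k) : Set F))
    (fun k => (measurableSet_pw _).prod (measurableSet_pw _))
    (measurableSet_symBox ((J.erase i).erase j) (stairExp lam i))
    (c := pairSchur ((J.erase i).erase j))
    (mem_pivotSet_pair hi hj hji) ((hΦ.integrableOn hψ b hD.1 J _).mono_set hsub)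
    (g := fun p => (ψ (-(b j * p.1 + b i * p.2.2)) : ℂ))
    (h := fun k p r => (ψ (-(b k * pairForm p r)) : ℂ))
    (f' := fun p Y => kernelIntegrand Φ ψ b
      (D + colMat F ![j, i] * !![p.1, p.2.1; p.2.1, p.2.2] * (colMat F ![j, i])ᵀ) Y)]
  · rw [pairWeight, ← integral_mul_const, ← integral_const_mul]
    refine setIntegral_congr_fun hmd fun p hp => ?_
    obtain ⟨hp0, hpo⟩ := pairDomain_det hp
    have hp1 := hp.1
    have hp2 := hp.2.1.1
    have hp3 := pw_mono (by omega : lam ≤ lam + 1) hp.2.2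
    have hreg := hD.add_pivot hf hfJ hK (hP p.1 p.2.1 p.2.2) (hP _ _ _) (hPQ _ _ _ hp0)
      (fun k l => by
        have h1 : ∀ x ∈ pw F lam, x / (p.1 * p.2.2 - p.2.1 ^ 2) ∈ pw F 1 := fun x hx =>
          pw_mono (by omega) (div_mem_pw hx hp0 hpo)
        fin_cases k <;> fin_cases l
        exacts [h1 _ hp3, h1 _ (neg_mem hp2), h1 _ (neg_mem hp2), h1 _ hp1])
    have hdet : (!![p.1, p.2.1; p.2.1, p.2.2] : Matrix (Fin 2) (Fin 2) F).det =
        p.1 * p.2.2 - p.2.1 ^ 2 := by rw [Matrix.det_fin_two_of]; ring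
    beta_reduce
    rw [hR _ hreg.1, hreg.2, hdet, hΦ.mul _ _ hD.det_ne_zero hp0,
      Finset.prod_coe_sort ((J.erase i).erase j) fun k =>
        ∫ r in (pw F (stepExp lam i k) : Set F) ×ˢ (pw F (stepExp lam j k) : Set F),
          (ψ (-(b k * pairForm p r)) : ℂ) ∂(μ.prod μ)]
    ring
  · intro p hp r hr Y _
    obtain ⟨hp0, hpo⟩ := pairDomain_det hp
    rw [kernelIntegrand, kernelIntegrand, trace_pairEquiv, addChar_neg_add _ (b j * p.1 + b i * p.2.2),
      addChar_neg_add _ (Finset.sum _ _), addChar_neg_sum, pairEquiv_eq hi hj hji.ne p hp0,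
      hΦ.pivot hD hf hfJ hK (hP p.1 p.2.1 p.2.2) (hPQ _ _ _ hp0)]
    · ring
    · intro a ha k; fin_cases k <;> simp [extendZero_of_notMem r ha]
    · intro a k
      have hle : ∀ m k : Fin n, lam ≤ stepExp lam m k := fun m k => by
        unfold stepExp; split_ifs <;> omega
      have h1 := extendZero_pair_mem (d := fun _ => lam) (d' := fun _ => lam) (fun k =>
        ⟨pw_mono (hle _ _) (hr k).1, pw_mono (hle _ _) (hr k).2⟩) a
      have h2 : ∀ x ∈ pw F lam, x / (p.1 * p.2.2 - p.2.1 ^ 2) ∈ pw F (-lam) := fun x hx =>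
        pw_mono (by omega) (div_mem_pw hx hp0 hpo)
      have hp1 := hp.1
      have hp2 := hp.2.1.1
      have hp3 := pw_mono (by omega : lam ≤ lam + 1) hp.2.2
      rw [Matrix.mul_apply, Fin.sum_univ_two]
      have h3 : ∀ x ∈ pw F lam, ∀ y ∈ pw F (-lam), x * y ∈ pw F 0 := fun x hx y hy =>
        pw_mono (by omega) (mul_mem_pw hx hy)
      fin_cases k
      · exact add_mem (h3 _ h1.1 _ (h2 _ hp3)) (h3 _ h1.2 _ (h2 _ (neg_mem hp2)))
      · exact add_mem (h3 _ h1.1 _ (h2 _ (neg_mem hp2))) (h3 _ h1.2 _ (h2 _ hp1))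

end PivotSteps

/-! ### The recursion for box integrals -/

section Recursion

variable {n : ℕ}

/-- The recursion which removes pivots with row index `< m` at a given level. -/
def levelPass (w : Finset (Fin n) → Fin n → Fin n → ℂ) (g : Finset (Fin n) → ℂ) :
    ℕ → Finset (Fin n) → ℂ
  | 0, J => g J
  | m + 1, J => levelPass w g m J + if h : m < n then (if (⟨m, h⟩ : Fin n) ∈ J then
      ∑ j ∈ J.filter (· ≤ ⟨m, h⟩), w ((J.erase ⟨m, h⟩).erase j) ⟨m, h⟩ j *
        levelPass w g m ((J.erase ⟨m, h⟩).erase j) else 0) else 0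

/-- The recursion over the levels `-l, …, -1`. -/
def levelIter (w : ℤ → Finset (Fin n) → Fin n → Fin n → ℂ) (c : ℕ → ℂ) : ℕ → Finset (Fin n) → ℂ
  | 0, J => c J.card
  | l + 1, J => levelPass (w (-(l + 1 : ℕ))) (levelIter w c l) n J

variable {F : Type*} [Field F] [ValuativeRel F]
  [TopologicalSpace F] [IsNonarchimedeanLocalField F] [MeasurableSpace F]

/-- The contribution of a pivot at `(i, j)`, `j ≤ i`. -/
noncomputable def pivotWeight (μ : Measure F) (κ : F → ℂ) (ψ : AddChar F Circle) (b : Fin n → F)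
    (lam : ℤ) (K : Finset (Fin n)) (i j : Fin n) : ℂ :=
  if j = i then singleWeight μ κ ψ b lam K i else pairWeight μ κ ψ b lam K i j

variable [BorelSpace F] {μ : Measure F} [μ.IsAddHaarMeasure]
  {Φ : Matrix (Fin n) (Fin n) F → ℂ} {κ : F → ℂ} {c : ℕ → ℂ} {ψ : AddChar F Circle}

/-- The induction closes because it is run for all $D$ at once: every box integral is
$\kappa(\det(D+1_J))$ times a quantity that depends on $J$ only. The new row contributes either no
pivot or one at some column $j$ not beyond it. -/
theorem SiegelKernel.setIntegral_levelPass (hΦ : SiegelKernel Φ κ c) (hμ : μ (𝒪[F] : Set F) = 1)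
    (hψ : Continuous ψ) (b : Fin n → F) {lam : ℤ} (hlam : lam ≤ -1) {g : Finset (Fin n) → ℂ}
    (hg : ∀ J D, RegularOff J D → ∫ Y in symBox F J (stairExp lam 0), kernelIntegrand Φ ψ b D Y
        ∂symMeas F J = κ (D + indMat F J).det * g J) :
    ∀ m ≤ n, ∀ J D, RegularOff J D →
      ∫ Y in symBox F J (stairExp lam m), kernelIntegrand Φ ψ b D Y ∂symMeas F J =
        κ (D + indMat F J).det * levelPass (pivotWeight μ κ ψ b lam) g m J := by
  intro m
  induction m with
  | zero => exact fun _ => hg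
  | succ m ih =>
    intro hm J D hD
    have ih' := ih (by omega)
    rw [levelPass, dif_pos (by omega : m < n)]
    set i : Fin n := ⟨m, by omega⟩ with hidef
    have him : (i : ℕ) = m := rfl
    rw [← him]
    split_ifs with hi
    · rw [setIntegral_symBox_stairExp_succ J lam i (hΦ.integrableOn hψ b hD.1 J _), mul_add,
        Finset.mul_sum, him, ih' J D hD]
      congr 1
      refine Finset.sum_congr rfl fun j hj => ?_
      obtain ⟨hjJ, hji⟩ := Finset.mem_filter.1 hj
      rcases hji.lt_or_eq with hji | rfl
      · rw [hΦ.setIntegral_pair hμ hψ b hlam hi hjJ hji hD (ih' _), pivotWeight, if_neg hji.ne]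
      · rw [hΦ.setIntegral_single hμ hψ b hlam hi hD (ih' _), pivotWeight, if_pos rfl,
          Finset.erase_eq_of_notMem (Finset.notMem_erase _ _)]
    · rw [symBox_stairExp_of_notMem hi, add_zero]
      exact ih' J D hD

theorem SiegelKernel.setIntegral_levelIter (hΦ : SiegelKernel Φ κ c) (hμ : μ (𝒪[F] : Set F) = 1)
    (hψ : Continuous ψ) (hψ0 : HasOrderZero ψ) {b : Fin n → F} (hb : ∀ k, b k ∈ 𝒪[F]) (l : ℕ) :
    ∀ J D, RegularOff J D →
      ∫ Y in symBox F J (fun _ _ => -(l : ℤ)), kernelIntegrand Φ ψ b D Y ∂symMeas F J =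
        κ (D + indMat F J).det * levelIter (pivotWeight μ κ ψ b) c l J := by
  have hst : ∀ lam : ℤ, (stairExp lam n : Fin n → Fin n → ℤ) = fun _ _ => lam := fun lam => by
    funext a b; exact if_pos ⟨a.2, b.2⟩
  induction l with
  | zero =>
    intro J D hD
    rw [levelIter, ← hΦ.regular J D hD]
    -- For integral matrices both $\Phi(D+\cdot)$ and $\psi$ are constant; the value at $D$ is the
    -- axiom `regular`.
    have h1 : ∀ Y ∈ (symBox F J (fun _ _ => -((0 : ℕ) : ℤ)) : Set (symOn F J)),
        kernelIntegrand Φ ψ b D Y = Φ D := fun Y hY => by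
      have hY' : ∀ a b, Y.1 a b ∈ pw F 0 := fun a b => by simpa using hY a b
      rw [kernelIntegrand, hΦ.add_integral _ _ hD.1 Y.2.1 hY', addChar_of_mem hψ0]
      · simp
      · refine neg_mem (sum_mem fun k _ => ?_)
        exact mem_pw_zero.2 (mul_mem (hb k) (mem_pw_zero.1 (hY' k k)))
    rw [setIntegral_congr_fun (measurableSet_symBox _ _) h1, setIntegral_const]
    have h2 : symMeas F J (symBox F J fun _ _ => -((0 : ℕ) : ℤ) : Set (symOn F J)) = 1 := by
      simpa using symMeas_integral (F := F) J
    rw [Measure.real, h2]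
    simp
  | succ l ih =>
    intro J D hD
    rw [levelIter, ← hst]
    refine hΦ.setIntegral_levelPass hμ hψ b (by push_cast; omega) (fun J D hD => ?_) n le_rfl J D hD
    -- When every row has been passed at level $\lambda$, what remains is the full box at level
    -- $\lambda+1$: this links consecutive levels.
    rw [symBox_stairExp_zero, hst, ← ih J D hD]
    congr 3
    push_cast
    ring

end Recursion

/-! ### One level as a sum over involutions and stable subsets -/

section PassExpansion

variable {n : ℕ}

/-- Involutions which fix everything outside `J`. -/
def involOn (J : Finset (Fin n)) : Finset (Equiv.Perm (Fin n)) :=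
  Finset.univ.filter fun σ => σ ^ 2 = 1 ∧ ∀ i ∉ J, σ i = i

/-- The `σ`-stable subsets of `J` all of whose elements are `< m`. -/
def stableBelow (σ : Equiv.Perm (Fin n)) (J : Finset (Fin n)) (m : ℕ) : Finset (Finset (Fin n)) :=
  J.powerset.filter fun I => ∀ i ∈ I, σ i ∈ I ∧ (i : ℕ) < m

/-- What is left of `J` after removing the cycles of `σ` in `I` whose largest element is `≥ i`. -/
def remAt (σ : Equiv.Perm (Fin n)) (J I : Finset (Fin n)) (i : Fin n) : Finset (Fin n) :=
  J.filter fun k => k ∉ I ∨ (k < i ∧ σ k < i)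

/-- The product of the weights `w` over the cycles of `σ` in `I`, removed from `J` in decreasing
order of their largest elements. -/
def passWeight (w : Finset (Fin n) → Fin n → Fin n → ℂ) (σ : Equiv.Perm (Fin n))
    (J I : Finset (Fin n)) : ℂ :=
  ∏ i ∈ I.filter (fun i => σ i ≤ i), w (remAt σ J I i) i (σ i)

theorem mem_involOn {J : Finset (Fin n)} {σ : Equiv.Perm (Fin n)} :
    σ ∈ involOn J ↔ (∀ i, σ (σ i) = i) ∧ ∀ i ∉ J, σ i = i := by
  rw [involOn, Finset.mem_filter, sq]
  refine ⟨fun h => ⟨fun i => ?_, h.2.2⟩, fun h => ⟨Finset.mem_univ _, Equiv.ext h.1, h.2⟩⟩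
  rw [← Equiv.Perm.mul_apply, h.2.1, Equiv.Perm.one_apply]

theorem involOn_mem {J : Finset (Fin n)} {σ : Equiv.Perm (Fin n)} (h : σ ∈ involOn J) {i : Fin n}
    (hi : i ∈ J) : σ i ∈ J := by
  by_contra h2
  have h3 := (mem_involOn.1 h).2 _ h2
  rw [(mem_involOn.1 h).1] at h3
  exact h2 (h3 ▸ hi)

theorem mem_stableBelow {σ : Equiv.Perm (Fin n)} {J : Finset (Fin n)} {m : ℕ} {I : Finset (Fin n)} :
    I ∈ stableBelow σ J m ↔ I ⊆ J ∧ ∀ i ∈ I, σ i ∈ I ∧ (i : ℕ) < m := by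
  rw [stableBelow, Finset.mem_filter, Finset.mem_powerset]

theorem passWeight_empty (w : Finset (Fin n) → Fin n → Fin n → ℂ) (σ : Equiv.Perm (Fin n))
    (J : Finset (Fin n)) : passWeight w σ J ∅ = 1 := by simp [passWeight]

theorem stableBelow_zero (σ : Equiv.Perm (Fin n)) (J : Finset (Fin n)) :
    stableBelow σ J 0 = {∅} := by
  ext I
  rw [mem_stableBelow, Finset.mem_singleton]
  refine ⟨fun h => Finset.eq_empty_of_forall_notMem fun i hi => ?_, ?_⟩
  · exact absurd (h.2 i hi).2 (Nat.not_lt_zero _)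
  · rintro rfl; simp

theorem mul_swap_apply_of_ne {σ : Equiv.Perm (Fin n)} {i j k : Fin n} (h1 : k ≠ i) (h2 : k ≠ j) :
    (σ * Equiv.swap i j) k = σ k := by
  rw [Equiv.Perm.mul_apply, Equiv.swap_apply_of_ne_of_ne h1 h2]

/-- Removing the cycle `(i j)` from an involution. -/
theorem mul_swap_mem_involOn {J : Finset (Fin n)} {i j : Fin n} {σ : Equiv.Perm (Fin n)}
    (h : σ ∈ involOn J) (hi : σ i = j) :
    σ * Equiv.swap i j ∈ involOn ((J.erase i).erase j) := by
  obtain ⟨h1, h2⟩ := mem_involOn.1 h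
  have hj : σ j = i := by rw [← hi, h1]
  have e1 : (σ * Equiv.swap i j) i = i := by simp [hj]
  have e2 : (σ * Equiv.swap i j) j = j := by simp [hi]
  refine mem_involOn.2 ⟨fun k => ?_, fun k hk => ?_⟩
  · by_cases hki : k = i
    · subst hki; rw [e1, e1]
    by_cases hkj : k = j
    · subst hkj; rw [e2, e2]
    rw [mul_swap_apply_of_ne hki hkj, mul_swap_apply_of_ne, h1]
    · intro h; apply hkj; rw [← h1 k, h, hi]
    · intro h; apply hki; rw [← h1 k, h, hj]
  · by_cases hki : k = i
    · subst hki; exact e1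
    by_cases hkj : k = j
    · subst hkj; exact e2
    rw [mul_swap_apply_of_ne hki hkj]
    exact h2 k fun h => hk (Finset.mem_erase.2 ⟨hkj, Finset.mem_erase.2 ⟨hki, h⟩⟩)

/-- Adding the cycle `(i j)` to an involution. -/
theorem mul_swap_mem_involOn' {J : Finset (Fin n)} {i j : Fin n} (hi : i ∈ J) (hj : j ∈ J)
    {σ : Equiv.Perm (Fin n)} (h : σ ∈ involOn ((J.erase i).erase j)) :
    σ * Equiv.swap i j ∈ involOn J ∧ (σ * Equiv.swap i j) i = j := by
  obtain ⟨h1, h2⟩ := mem_involOn.1 h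
  have hσi : σ i = i := h2 i (by simp)
  have hσj : σ j = j := h2 j (by simp)
  have e1 : (σ * Equiv.swap i j) i = j := by simp [hσj]
  have e2 : (σ * Equiv.swap i j) j = i := by simp [hσi]
  refine ⟨mem_involOn.2 ⟨fun k => ?_, fun k hk => ?_⟩, e1⟩
  · by_cases hki : k = i
    · subst hki; rw [e1, e2]
    by_cases hkj : k = j
    · subst hkj; rw [e2, e1]
    rw [mul_swap_apply_of_ne hki hkj, mul_swap_apply_of_ne, h1]
    · intro h; apply hki; rw [← h1 k, h, hσi]
    · intro h; apply hkj; rw [← h1 k, h, hσj]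
  · have hki : k ≠ i := fun h => hk (h ▸ hi)
    have hkj : k ≠ j := fun h => hk (h ▸ hj)
    rw [mul_swap_apply_of_ne hki hkj]
    exact h2 k fun h => hk (Finset.mem_of_mem_erase (Finset.mem_of_mem_erase h))

/-- Splitting off the cycle of the largest element. -/
theorem passWeight_insert (w : Finset (Fin n) → Fin n → Fin n → ℂ) {σ : Equiv.Perm (Fin n)}
    {J I : Finset (Fin n)} {i : Fin n} (hI : I ∈ stableBelow σ J (i + 1)) (hi : i ∈ I)
    (hσ : σ ∈ involOn J) :
    passWeight w σ J I = w ((J.erase i).erase (σ i)) i (σ i) *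
      passWeight w (σ * Equiv.swap i (σ i)) ((J.erase i).erase (σ i)) ((I.erase i).erase (σ i)) := by
  obtain ⟨hIJ, hI⟩ := mem_stableBelow.1 hI
  obtain ⟨h1, h2⟩ := mem_involOn.1 hσ
  have hle : ∀ k ∈ I, k ≤ i := fun k hk => by
    have := (hI k hk).2; rw [Fin.le_def]; omega
  have hji : σ i ≤ i := hle _ (hI i hi).1
  rw [passWeight, passWeight, 
    ← Finset.mul_prod_erase (I.filter fun a => σ a ≤ a) _ (Finset.mem_filter.2 ⟨hi, hji⟩)]
  congr 1
  · congr 1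
    ext k
    simp only [remAt, Finset.mem_filter, Finset.mem_erase]
    constructor
    · rintro ⟨hkJ, hk | ⟨hk, hk'⟩⟩
      · exact ⟨fun h => hk (h ▸ (hI i hi).1), fun h => hk (h ▸ hi), hkJ⟩
      · exact ⟨fun h => by rw [h, h1] at hk'; exact lt_irrefl _ hk', hk.ne, hkJ⟩
    · rintro ⟨hkj, hki, hkJ⟩
      refine ⟨hkJ, ?_⟩
      by_cases hkI : k ∈ I
      · refine Or.inr ⟨lt_of_le_of_ne (hle k hkI) hki, lt_of_le_of_ne (hle _ (hI k hkI).1) fun h => ?_⟩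
        apply hkj; rw [← h1 k, h]
      · exact Or.inl hkI
  · have hset : (I.filter fun a => σ a ≤ a).erase i =
        ((I.erase i).erase (σ i)).filter fun a => (σ * Equiv.swap i (σ i)) a ≤ a := by
      ext a
      simp only [Finset.mem_erase, Finset.mem_filter]
      constructor
      · rintro ⟨hai, haI, ha⟩
        have haj : a ≠ σ i := fun h => by
          rw [h, h1] at ha; exact hai (h.trans (le_antisymm hji ha))
        exact ⟨⟨haj, hai, haI⟩, by rwa [mul_swap_apply_of_ne hai haj]⟩
      · rintro ⟨⟨haj, hai, haI⟩, ha⟩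
        exact ⟨hai, haI, by rwa [mul_swap_apply_of_ne hai haj] at ha⟩
    rw [hset]
    refine Finset.prod_congr rfl fun a ha => ?_
    simp only [Finset.mem_erase, Finset.mem_filter] at ha
    obtain ⟨⟨haj, hai, haI⟩, ha⟩ := ha
    rw [mul_swap_apply_of_ne hai haj] at ha ⊢
    congr 1
    ext k
    simp only [remAt, Finset.mem_filter, Finset.mem_erase]
    constructor
    · rintro ⟨hkJ, hk⟩
      have hki : k ≠ i := by
        rintro rfl
        rcases hk with hk | hk
        · exact hk hi
        · exact absurd (hle a haI) (not_le.2 hk.1)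
      have hkj : k ≠ σ i := by
        rintro rfl
        rcases hk with hk | hk
        · exact hk (hI i hi).1
        · rw [h1] at hk; exact absurd (hle a haI) (not_le.2 hk.2)
      refine ⟨⟨hkj, hki, hkJ⟩, ?_⟩
      rw [mul_swap_apply_of_ne hki hkj]
      tauto
    · rintro ⟨⟨hkj, hki, hkJ⟩, hk⟩
      rw [mul_swap_apply_of_ne hki hkj] at hk
      exact ⟨hkJ, by tauto⟩

theorem erase_mem_stableBelow {σ : Equiv.Perm (Fin n)} {J I : Finset (Fin n)} {i : Fin n}
    (hI : I ∈ stableBelow σ J (i + 1)) (hσ : σ ∈ involOn J) :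
    (I.erase i).erase (σ i) ∈
      stableBelow (σ * Equiv.swap i (σ i)) ((J.erase i).erase (σ i)) i := by
  obtain ⟨hIJ, hI⟩ := mem_stableBelow.1 hI
  obtain ⟨h1, h2⟩ := mem_involOn.1 hσ
  refine mem_stableBelow.2 ⟨Finset.erase_subset_erase _ (Finset.erase_subset_erase _ hIJ),
    fun k hk => ?_⟩
  simp only [Finset.mem_erase] at hk ⊢
  obtain ⟨hkj, hki, hkI⟩ := hk
  rw [mul_swap_apply_of_ne hki hkj]
  refine ⟨⟨fun h => hki (σ.injective h), fun h => hkj ?_, (hI k hkI).1⟩, ?_⟩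
  · rw [← h1 k, h]
  · have := (hI k hkI).2
    rw [← Fin.val_inj.ne] at hki
    omega

theorem insert_mem_stableBelow {σ : Equiv.Perm (Fin n)} {J I : Finset (Fin n)} {i : Fin n}
    (hi : i ∈ J) (hσ : σ ∈ involOn J) (hσi : σ i ≤ i)
    (hI : I ∈ stableBelow (σ * Equiv.swap i (σ i)) ((J.erase i).erase (σ i)) i) :
    insert i (insert (σ i) I) ∈ stableBelow σ J (i + 1) ∧
      ((insert i (insert (σ i) I)).erase i).erase (σ i) = I := by
  obtain ⟨hIJ, hI⟩ := mem_stableBelow.1 hI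
  obtain ⟨h1, h2⟩ := mem_involOn.1 hσ
  have hne : ∀ k ∈ I, k ≠ σ i ∧ k ≠ i ∧ k ∈ J := fun k hk => by
    simpa [Finset.mem_erase] using hIJ hk
  refine ⟨mem_stableBelow.2 ⟨?_, fun k hk => ?_⟩, ?_⟩
  · intro k hk
    simp only [Finset.mem_insert] at hk
    rcases hk with rfl | rfl | hk
    exacts [hi, involOn_mem hσ hi, (hne k hk).2.2]
  · simp only [Finset.mem_insert] at hk ⊢
    rw [Fin.le_def] at hσi
    rcases hk with rfl | rfl | hk
    · exact ⟨by simp, by omega⟩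
    · exact ⟨by simp [h1], by omega⟩
    · have := hI k hk
      rw [mul_swap_apply_of_ne (hne k hk).2.1 (hne k hk).1] at this
      exact ⟨by simp [this.1], by omega⟩
  · ext k
    simp only [Finset.mem_erase, Finset.mem_insert]
    constructor
    · tauto
    · intro hk
      exact ⟨(hne k hk).1, (hne k hk).2.1, by tauto⟩

theorem stableBelow_succ_filter {σ : Equiv.Perm (Fin n)} {J : Finset (Fin n)} {i : Fin n} :
    (stableBelow σ J (i + 1)).filter (fun I => i ∉ I) = stableBelow σ J i := by
  ext I
  rw [Finset.mem_filter, mem_stableBelow, mem_stableBelow]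
  constructor
  · rintro ⟨⟨h1, h2⟩, h3⟩
    refine ⟨h1, fun k hk => ⟨(h2 k hk).1, ?_⟩⟩
    have h4 : k ≠ i := fun h => h3 (h ▸ hk)
    rw [← Fin.val_inj.ne] at h4
    have := (h2 k hk).2
    omega
  · rintro ⟨h1, h2⟩
    exact ⟨⟨h1, fun k hk => ⟨(h2 k hk).1, by have := (h2 k hk).2; omega⟩⟩,
      fun hi => absurd (h2 i hi).2 (lt_irrefl _)⟩

/-- The recursion `levelPass` as a sum over involutions and stable subsets. -/
theorem levelPass_eq_sum (w : Finset (Fin n) → Fin n → Fin n → ℂ) {g : Finset (Fin n) → ℂ}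
    {h : Equiv.Perm (Fin n) → Finset (Fin n) → ℂ}
    (hloc : ∀ σ σ' K, (∀ k ∈ K, σ k = σ' k) → h σ K = h σ' K) (m : ℕ) (hm : m ≤ n) :
    ∀ J, (∀ K ⊆ J, g K = ∑ σ ∈ involOn K, h σ K) →
      levelPass w g m J =
        ∑ σ ∈ involOn J, ∑ I ∈ stableBelow σ J m, passWeight w σ J I * h σ (J \ I) := by
  induction m with
  | zero =>
    intro J hg
    simp only [stableBelow_zero, Finset.sum_singleton, passWeight_empty, one_mul,
      Finset.sdiff_empty, levelPass]
    exact hg J subset_rfl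
  | succ m ih =>
    intro J hg
    obtain ⟨i, him⟩ : ∃ i : Fin n, (i : ℕ) = m := ⟨⟨m, by omega⟩, rfl⟩
    subst him
    have ih := ih (by omega)
    rw [levelPass, dif_pos i.2, Fin.eta, ih J hg]
    simp only [← stableBelow_succ_filter]
    have hsplit : ∀ σ, ∑ I ∈ stableBelow σ J (i + 1), passWeight w σ J I * h σ (J \ I) =
        ∑ I ∈ (stableBelow σ J (i + 1)).filter (fun I => i ∉ I), passWeight w σ J I * h σ (J \ I) +
        ∑ I ∈ (stableBelow σ J (i + 1)).filter (fun I => i ∈ I), passWeight w σ J I * h σ (J \ I) :=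
      fun σ => by
        rw [← Finset.sum_filter_add_sum_filter_not (stableBelow σ J (i + 1))
          (fun I : Finset (Fin n) => i ∈ I) fun I => passWeight w σ J I * h σ (J \ I)]
        exact add_comm _ _
    simp only [hsplit, Finset.sum_add_distrib]
    congr 1
    split_ifs with hi
    · have hzero : ∀ σ ∈ involOn J, ¬ σ i ≤ i →
          ∑ I ∈ (stableBelow σ J (i + 1)).filter (fun I => i ∈ I),
            passWeight w σ J I * h σ (J \ I) = 0 := fun σ _ hσ => by
        rw [Finset.sum_eq_zero]
        intro I hI
        obtain ⟨hI, hiI⟩ := Finset.mem_filter.1 hI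
        obtain ⟨_, hI⟩ := mem_stableBelow.1 hI
        have := (hI _ (hI i hiI).1).2
        exact absurd (Fin.le_def.2 (by omega)) hσ
      -- When $i\in I$, the pivot column for row $i$ is $j=\sigma(i)$. Multiplication by the
      -- transposition $(i\ j)$ identifies these involutions with the involutions of
      -- $J\setminus\{i,j\}$, and $I$ with $I\setminus\{i,j\}$.
      rw [← Finset.sum_fiberwise_of_maps_to (s := involOn J) (t := J) (g := fun σ => σ i)
        (fun σ hσ => involOn_mem hσ hi), Finset.sum_filter]
      refine Finset.sum_congr rfl fun j hj => ?_
      split_ifs with hji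
      · rw [ih _ fun K hK => hg K (hK.trans ((Finset.erase_subset _ _).trans
          (Finset.erase_subset _ _))), Finset.mul_sum]
        symm
        refine Finset.sum_nbij' (fun σ => σ * Equiv.swap i j) (fun σ => σ * Equiv.swap i j)
          (fun σ hσ => ?_) (fun σ hσ => ?_) (fun σ _ => ?_) (fun σ _ => ?_) fun σ hσ => ?_
        · obtain ⟨hσ, hσi⟩ := Finset.mem_filter.1 hσ
          exact mul_swap_mem_involOn hσ hσi
        · exact Finset.mem_filter.2 (mul_swap_mem_involOn' hi hj hσ)
        · simp [mul_assoc]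
        · simp [mul_assoc]
        · obtain ⟨hσ', rfl⟩ := Finset.mem_filter.1 hσ
          clear hσ; rename' hσ' => hσ
          rw [Finset.mul_sum]
          refine Finset.sum_nbij' (fun I => (I.erase i).erase (σ i))
            (fun I => insert i (insert (σ i) I)) (fun I hI => ?_) (fun I hI => ?_)
            (fun I hI => ?_) (fun I hI => ?_) fun I hI => ?_
          · exact erase_mem_stableBelow (Finset.mem_filter.1 hI).1 hσ
          · exact Finset.mem_filter.2 ⟨(insert_mem_stableBelow hi hσ hji hI).1, by simp⟩
          · obtain ⟨hI, hiI⟩ := Finset.mem_filter.1 hI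
            have hj' := ((mem_stableBelow.1 hI).2 i hiI).1
            ext k
            simp only [Finset.mem_insert, Finset.mem_erase]
            by_cases hk1 : k = i
            · simp [hk1, hiI]
            by_cases hk2 : k = σ i
            · simp [hk2, hj']
            simp [hk1, hk2]
          · exact (insert_mem_stableBelow hi hσ hji hI).2
          · obtain ⟨hI, hiI⟩ := Finset.mem_filter.1 hI
            have hj' := ((mem_stableBelow.1 hI).2 i hiI).1
            rw [passWeight_insert w hI hiI hσ, mul_assoc]
            have hset : J \ I = ((J.erase i).erase (σ i)) \ ((I.erase i).erase (σ i)) := by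
              ext k
              simp only [Finset.mem_sdiff, Finset.mem_erase]
              by_cases hk1 : k = i
              · simp [hk1, hiI]
              by_cases hk2 : k = σ i
              · simp [hk2, hj']
              simp [hk1, hk2]
            rw [← hset]
            congr 2
            -- Dropping the cycle $(i\ j)$ does not affect the remaining factor, which sees $\sigma$
            -- only on $J\setminus I$.
            refine hloc _ _ _ fun k hk => ?_
            obtain ⟨_, hkI⟩ := Finset.mem_sdiff.1 hk
            have hk1 : k ≠ i := fun h => hkI (h ▸ hiI)
            have hk2 : k ≠ σ i := fun h => hkI (h ▸ hj')
            rw [mul_swap_apply_of_ne hk1 hk2]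
      · rw [Finset.sum_eq_zero]
        intro σ hσ
        obtain ⟨hσ', rfl⟩ := Finset.mem_filter.1 hσ
        clear hσ; rename' hσ' => hσ
        exact hzero σ hσ hji
    · symm
      refine Finset.sum_eq_zero fun σ _ => Finset.sum_eq_zero fun I hI => ?_
      obtain ⟨hI, hiI⟩ := Finset.mem_filter.1 hI
      exact absurd ((mem_stableBelow.1 hI).1 hiI) hi

end PassExpansion

/-! ### The elimination recursion for volumes -/

section VolumeIdentity

variable {n : ℕ}

/-- The weights of the recursion for volumes, where `x = q⁻¹`. -/
def volWeight (x : ℂ) (K : Finset (Fin n)) (i j : Fin n) : ℂ :=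
  if j = i then (1 - x) * x ^ (K.filter (i < ·)).card
  else x * (1 - x) * x ^ ((K.filter (i < ·)).card + (K.filter (j < ·)).card)

/-- The number of positions `(a, b)` in `J × J` with `a ≤ b` and `m ≤ b`. -/
def posCount (J : Finset (Fin n)) (m : ℕ) : ℕ :=
  ∑ b ∈ J.filter (fun b : Fin n => m ≤ (b : ℕ)), (J.filter (· ≤ b)).card

/-- Listed from the largest element downwards the exponents are $0,1,\dots,\#S-1$: a geometric sum.
-/
theorem sum_pow_card_gt (x : ℂ) (S : Finset (Fin n)) :
    (1 - x) * ∑ j ∈ S, x ^ (S.filter (j < ·)).card = 1 - x ^ S.card := by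
  induction S using Finset.induction_on_min with
  | empty => simp
  | insert a s ha ih =>
    have has : a ∉ s := fun h => lt_irrefl _ (ha a h)
    rw [Finset.sum_insert has, Finset.card_insert_of_notMem has, mul_add]
    have h1 : (insert a s).filter (a < ·) = s := by
      ext k
      simp only [Finset.mem_filter, Finset.mem_insert]
      exact ⟨fun h => h.1.resolve_left h.2.ne', fun h => ⟨Or.inr h, ha k h⟩⟩
    have h2 : ∀ j ∈ s, (insert a s).filter (j < ·) = s.filter (j < ·) := fun j hj => by
      ext k
      simp only [Finset.mem_filter, Finset.mem_insert]
      refine ⟨fun h => ⟨h.1.resolve_left fun h' => ?_, h.2⟩, fun h => ⟨Or.inr h.1, h.2⟩⟩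
      rw [h'] at h
      exact lt_asymm h.2 (ha j hj)
    rw [h1, Finset.sum_congr rfl fun j hj => by rw [h2 j hj], ih]
    ring

theorem posCount_succ {J : Finset (Fin n)} {i : Fin n} (hi : i ∈ J) :
    posCount J i = posCount J (i + 1) + (J.filter (· ≤ i)).card := by
  have h : J.filter (fun b : Fin n => (i : ℕ) ≤ (b : ℕ)) =
      insert i (J.filter fun b : Fin n => (i : ℕ) + 1 ≤ (b : ℕ)) := by
    ext b
    simp only [Finset.mem_filter, Finset.mem_insert]
    constructor
    · rintro ⟨h1, h2⟩
      by_cases hb : b = i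
      · exact Or.inl hb
      · rw [← Fin.val_inj] at hb; exact Or.inr ⟨h1, by omega⟩
    · rintro (rfl | ⟨h1, h2⟩)
      exacts [⟨hi, le_rfl⟩, ⟨h1, by omega⟩]
  rw [posCount, h, Finset.sum_insert (by simp), add_comm]
  rfl

theorem posCount_succ_of_notMem {J : Finset (Fin n)} {i : Fin n} (hi : i ∉ J) :
    posCount J i = posCount J (i + 1) := by
  rw [posCount, posCount]
  congr 1
  ext b
  simp only [Finset.mem_filter]
  refine and_congr_right fun hb => ?_
  have : b ≠ i := fun h => hi (h ▸ hb)
  rw [← Fin.val_inj.ne] at this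
  omega

/-- Removing an index below `m`. -/
theorem posCount_erase {J : Finset (Fin n)} {i : Fin n} (hi : i ∈ J) {m : ℕ} (him : (i : ℕ) < m) :
    posCount (J.erase i) m + (J.filter fun b : Fin n => m ≤ (b : ℕ)).card = posCount J m := by
  have h : (J.erase i).filter (fun b : Fin n => m ≤ (b : ℕ)) = J.filter fun b : Fin n => m ≤ (b : ℕ) := by
    ext b
    simp only [Finset.mem_filter, Finset.mem_erase]
    refine ⟨fun h => ⟨h.1.2, h.2⟩, fun h => ⟨⟨fun hb => ?_, h.1⟩, h.2⟩⟩
    rw [hb] at h; omega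
  rw [posCount, posCount, h, Finset.card_eq_sum_ones, ← Finset.sum_add_distrib]
  refine Finset.sum_congr rfl fun b hb => ?_
  have hb2 := (Finset.mem_filter.1 hb).2
  rw [Finset.filter_erase, Finset.card_erase_add_one]
  exact Finset.mem_filter.2 ⟨hi, Fin.le_def.2 (by omega)⟩

/-- For $x=q^{-1}$, $x^{\mathrm{posCount}\,J\,m}$ is the volume of the box where the first $m$ rows
and columns are integral and the rest lies in $\mathfrak p$, and the recursion is its decomposition
by pivots at level $0$. The proof is combinatorial and valid for every $x$: the columns $j<i$ give a
geometric sum which the diagonal pivot completes. -/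
theorem levelPass_volWeight (x : ℂ) (m : ℕ) (hm : m ≤ n) : ∀ J : Finset (Fin n),
    levelPass (volWeight x) (fun J => x ^ posCount J 0) m J = x ^ posCount J m := by
  induction m with
  | zero => exact fun J => rfl
  | succ m ih =>
    intro J
    obtain ⟨i, him⟩ : ∃ i : Fin n, (i : ℕ) = m := ⟨⟨m, by omega⟩, rfl⟩
    subst him
    have ih := ih (by omega)
    rw [levelPass, dif_pos i.2, Fin.eta]
    simp only [ih]
    split_ifs with hi
    · set u := (J.filter fun b : Fin n => (i : ℕ) + 1 ≤ (b : ℕ)).card with hu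
      have hu1 : (J.filter (i < ·)).card = u := by
        rw [hu]; congr 1
      have hfil : J.filter (· ≤ i) = insert i (J.filter (· < i)) := by
        ext k
        simp only [Finset.mem_filter, Finset.mem_insert]
        constructor
        · rintro ⟨h1, h2⟩
          rcases h2.lt_or_eq with h | h
          exacts [Or.inr ⟨h1, h⟩, Or.inl h]
        · rintro (rfl | h)
          exacts [⟨hi, le_rfl⟩, ⟨h.1, h.2.le⟩]
      have hsing : volWeight x ((J.erase i).erase i) i i * x ^ posCount ((J.erase i).erase i) i =
          (1 - x) * x ^ posCount J (i + 1) := by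
        rw [Finset.erase_eq_of_notMem (Finset.notMem_erase i J), volWeight, if_pos rfl,
          ← posCount_erase hi (Nat.lt_succ_self i), posCount_succ_of_notMem (Finset.notMem_erase i J),
          ← hu, Finset.filter_erase, Finset.erase_eq_of_notMem (by simp), hu1]
        ring
      have hpair : ∀ j ∈ J.filter (· < i),
          volWeight x ((J.erase i).erase j) i j * x ^ posCount ((J.erase i).erase j) i =
            x * (1 - x) * x ^ posCount J (i + 1) *
              x ^ ((J.filter (· < i)).filter (j < ·)).card := fun j hj => by
        obtain ⟨hjJ, hji⟩ := Finset.mem_filter.1 hj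
        have hji' := Fin.lt_def.1 hji
        have h1 : ((J.erase i).erase j).filter (i < ·) = J.filter (i < ·) := by
          ext k
          simp only [Finset.mem_filter, Finset.mem_erase]
          exact ⟨fun h => ⟨h.1.2.2, h.2⟩, fun h => ⟨⟨(hji.trans h.2).ne', h.2.ne', h.1⟩, h.2⟩⟩
        have h2 : (((J.erase i).erase j).filter (j < ·)).card =
            u + ((J.filter (· < i)).filter (j < ·)).card := by
          rw [← hu1, ← Finset.card_union_of_disjoint]
          · congr 1
            ext k
            simp only [Finset.mem_filter, Finset.mem_erase, Finset.mem_union]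
            constructor
            · rintro ⟨⟨h1, h2, h3⟩, h4⟩
              rcases lt_or_gt_of_ne h2 with h | h
              exacts [Or.inr ⟨⟨h3, h⟩, h4⟩, Or.inl ⟨h3, h⟩]
            · rintro (⟨h1, h2⟩ | ⟨⟨h1, h2⟩, h3⟩)
              exacts [⟨⟨(hji.trans h2).ne', h2.ne', h1⟩, hji.trans h2⟩, ⟨⟨h3.ne', h2.ne, h1⟩, h3⟩]
          · refine Finset.disjoint_left.2 fun k h1 h2 => ?_
            simp only [Finset.mem_filter] at h1 h2
            exact lt_asymm h1.2 h2.1.2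
        have h3 : posCount ((J.erase i).erase j) i + u + u = posCount J (i + 1) := by
          rw [← posCount_erase hi (Nat.lt_succ_self i), ← hu,
            ← posCount_erase (Finset.mem_erase.2 ⟨hji.ne, hjJ⟩) (by omega : (j : ℕ) < i + 1),
            posCount_succ_of_notMem (by simp)]
          congr 2
          rw [hu]
          congr 1
          ext k
          simp only [Finset.mem_filter, Finset.mem_erase]
          refine ⟨fun h => ⟨⟨fun hk => ?_, h.1⟩, h.2⟩, fun h => ⟨h.1.2, h.2⟩⟩
          rw [hk] at h; omega
        rw [volWeight, if_neg hji.ne, h1, h2, hu1, ← h3]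
        ring
      rw [hfil, Finset.sum_insert (by simp), hsing, Finset.sum_congr rfl hpair, ← Finset.mul_sum,
        posCount_succ hi, hfil, Finset.card_insert_of_notMem (by simp)]
      have h := sum_pow_card_gt x (J.filter (· < i))
      rw [pow_add, pow_succ]
      linear_combination x * x ^ posCount J (i + 1) * h
    · rw [add_zero, posCount_succ_of_notMem hi]

theorem posCount_zero (J : Finset (Fin n)) : posCount J 0 = J.card * (J.card + 1) / 2 := by
  have h : ∀ J : Finset (Fin n), posCount J 0 * 2 = J.card * (J.card + 1) := fun J => by
    induction J using Finset.induction_on_max with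
    | empty => simp [posCount]
    | insert a s ha ih =>
      have has : a ∉ s := fun h => lt_irrefl _ (ha a h)
      simp only [posCount, Nat.zero_le, Finset.filter_true] at ih ⊢
      rw [Finset.sum_insert has, Finset.card_insert_of_notMem has]
      have h1 : (insert a s).filter (· ≤ a) = insert a s := by
        refine Finset.filter_true_of_mem fun k hk => ?_
        rcases Finset.mem_insert.1 hk with rfl | h
        exacts [le_rfl, (ha k h).le]
      have h2 : ∀ j ∈ s, (insert a s).filter (· ≤ j) = s.filter (· ≤ j) := fun j hj => by
        rw [Finset.filter_insert, if_neg (not_le.2 (ha j hj))]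
      rw [h1, Finset.card_insert_of_notMem has, Finset.sum_congr rfl fun j hj => by rw [h2 j hj],
        add_mul, ih]
      ring
  rw [← h J, Nat.mul_div_cancel _ two_pos]

theorem posCount_top (J : Finset (Fin n)) : posCount J n = 0 := by
  rw [posCount, Finset.filter_false_of_mem, Finset.sum_empty]
  intro b _; omega

end VolumeIdentity

/-! ### Ordered partitions and increasing sequences of levels -/

section OrderedPartitions

variable {n : ℕ}

/-- Ordered partitions of `J` into nonempty `σ`-stable blocks, the elements of the `l`-th block
being mapped to `l + 1` and the elements outside `J` to `0`. -/
def orderedParts (σ : Equiv.Perm (Fin n)) (J : Finset (Fin n)) : Finset (Fin n → ℕ) :=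
  (Fintype.piFinset fun _ => Finset.range (n + 1)).filter fun p =>
    (∀ i, 0 < p i ↔ i ∈ J) ∧ (∀ i ∈ J, p (σ i) = p i) ∧
      ∀ i, ∀ l < p i, ∃ i', p i' = l + 1

/-- The union of the blocks from the `l`-th on. -/
def upperPart (p : Fin n → ℕ) (l : ℕ) : Finset (Fin n) := Finset.univ.filter fun i => l < p i

/-- The `l`-th block. -/
def blockAt (p : Fin n → ℕ) (l : ℕ) : Finset (Fin n) := Finset.univ.filter fun i => p i = l + 1

/-- The number of blocks. -/
def blockNum (p : Fin n → ℕ) : ℕ := Finset.univ.sup p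

/-- Putting a new block `J \ supp p` in front. -/
def consPart (J : Finset (Fin n)) (p : Fin n → ℕ) (i : Fin n) : ℕ := if i ∈ J then p i + 1 else 0

/-- The bound in the definition, needed only for finiteness, is automatic: the values $1,\dots,p(i)$
are all attained, and there are only $n$ indices. -/
theorem mem_orderedParts {σ : Equiv.Perm (Fin n)} {J : Finset (Fin n)} {p : Fin n → ℕ} :
    p ∈ orderedParts σ J ↔ (∀ i, 0 < p i ↔ i ∈ J) ∧ (∀ i ∈ J, p (σ i) = p i) ∧
      ∀ i, ∀ l < p i, ∃ i', p i' = l + 1 := by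
  rw [orderedParts, Finset.mem_filter, and_iff_right_iff_imp]
  rintro ⟨-, -, h⟩
  rw [Fintype.mem_piFinset]
  intro i
  rw [Finset.mem_range, Nat.lt_succ_iff]
  have h1 : Finset.Icc 1 (p i) ⊆ Finset.univ.image p := fun l hl => by
    rw [Finset.mem_Icc] at hl
    obtain ⟨i', hi'⟩ := h i (l - 1) (by omega)
    exact Finset.mem_image.2 ⟨i', Finset.mem_univ _, by omega⟩
  have h2 := (Finset.card_le_card h1).trans Finset.card_image_le
  simpa using h2

theorem orderedParts_congr {σ σ' : Equiv.Perm (Fin n)} {J : Finset (Fin n)}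
    (h : ∀ k ∈ J, σ k = σ' k) : orderedParts σ J = orderedParts σ' J := by
  ext p
  rw [mem_orderedParts, mem_orderedParts]
  refine and_congr_right fun _ => and_congr_left fun _ => ?_
  exact forall₂_congr fun i hi => by rw [h i hi]

theorem orderedParts_empty (σ : Equiv.Perm (Fin n)) : orderedParts σ ∅ = {0} := by
  ext p
  rw [mem_orderedParts, Finset.mem_singleton]
  constructor
  · rintro ⟨h, -, -⟩
    funext i
    have := h i
    simpa using this
  · rintro rfl; simp

theorem mem_upperPart {p : Fin n → ℕ} {l : ℕ} {i : Fin n} : i ∈ upperPart p l ↔ l < p i := by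
  simp [upperPart]

theorem mem_blockAt {p : Fin n → ℕ} {l : ℕ} {i : Fin n} : i ∈ blockAt p l ↔ p i = l + 1 := by
  simp [blockAt]

theorem upperPart_consPart_zero (J : Finset (Fin n)) (p : Fin n → ℕ) :
    upperPart (consPart J p) 0 = J := by
  ext i
  rw [mem_upperPart, consPart]
  split_ifs with h <;> simp [h]

theorem upperPart_consPart_succ {J : Finset (Fin n)} {p : Fin n → ℕ} (hp : ∀ i, 0 < p i → i ∈ J)
    (l : ℕ) : upperPart (consPart J p) (l + 1) = upperPart p l := by
  ext i
  rw [mem_upperPart, mem_upperPart, consPart]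
  split_ifs with h
  · omega
  · have : p i = 0 := by
      by_contra h2; exact h (hp i (Nat.pos_of_ne_zero h2))
    omega

theorem blockAt_consPart_zero {J I : Finset (Fin n)} (hI : I ⊆ J) {p : Fin n → ℕ}
    (hp : ∀ i, 0 < p i ↔ i ∈ J \ I) : blockAt (consPart J p) 0 = I := by
  ext i
  rw [mem_blockAt, consPart]
  have h1 := hp i
  rw [Finset.mem_sdiff] at h1
  split_ifs with h
  · constructor
    · intro h2; by_contra h3; have := h1.2 ⟨h, h3⟩; omega
    · intro h2; by_contra h3; exact (h1.1 (by omega)).2 h2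
  · exact ⟨fun h2 => by simp at h2, fun h2 => absurd (hI h2) h⟩

theorem blockAt_consPart_succ {J : Finset (Fin n)} {p : Fin n → ℕ} (hp : ∀ i, 0 < p i → i ∈ J)
    (l : ℕ) : blockAt (consPart J p) (l + 1) = blockAt p l := by
  ext i
  rw [mem_blockAt, mem_blockAt, consPart]
  split_ifs with h
  · omega
  · have : p i = 0 := by
      by_contra h2; exact h (hp i (Nat.pos_of_ne_zero h2))
    simp [this]

theorem blockNum_consPart {J : Finset (Fin n)} (hJ : J.Nonempty) {p : Fin n → ℕ}
    (hp : ∀ i, 0 < p i → i ∈ J) : blockNum (consPart J p) = blockNum p + 1 := by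
  apply le_antisymm
  · refine Finset.sup_le fun i _ => ?_
    have : p i ≤ blockNum p := Finset.le_sup (Finset.mem_univ i)
    unfold consPart
    split_ifs <;> omega
  · have h1 : ∀ i, consPart J p i ≤ blockNum (consPart J p) := fun i =>
      Finset.le_sup (Finset.mem_univ i)
    obtain ⟨j, hj⟩ := hJ
    have h2 : 1 ≤ blockNum (consPart J p) := by
      have := h1 j
      rw [consPart, if_pos hj] at this
      omega
    have h3 : blockNum p ≤ blockNum (consPart J p) - 1 := Finset.sup_le fun i _ => by
      by_cases hi : 0 < p i
      · have := h1 i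
        rw [consPart, if_pos (hp i hi)] at this
        omega
      · omega
    omega

/-- Summation over the first block of an ordered partition. -/
theorem sum_orderedParts {M : Type*} [AddCommMonoid M] (σ : Equiv.Perm (Fin n))
    {J : Finset (Fin n)} (hJ : J.Nonempty) (hσ : ∀ i ∈ J, σ (σ i) = i) (f : (Fin n → ℕ) → M) :
    ∑ p ∈ orderedParts σ J, f p = ∑ I ∈ (stableBelow σ J n).erase ∅,
      ∑ p ∈ orderedParts σ (J \ I), f (consPart J p) := by
  rw [Finset.sum_sigma']
  symm
  refine Finset.sum_nbij' (fun x => consPart J x.2) (fun p => ⟨blockAt p 0, fun i => p i - 1⟩)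
    ?_ ?_ ?_ ?_ ?_
  · rintro ⟨I, p⟩ h
    simp only [Finset.mem_sigma, Finset.mem_erase, mem_stableBelow, mem_orderedParts] at h
    -- The nonemptiness of the new block is what keeps the labels $1,2,\dots$ without gaps.
    obtain ⟨⟨hne, hIJ, hI⟩, h1, h2, h3⟩ := h
    have hpJ : ∀ i, 0 < p i → i ∈ J := fun i hi => (Finset.mem_sdiff.1 ((h1 i).1 hi)).1
    have hIst : ∀ i ∈ J, σ i ∈ J → (i ∈ I ↔ σ i ∈ I) := fun i hi _ =>
      ⟨fun h => (hI i h).1, fun h => by have := (hI _ h).1; rwa [hσ i hi] at this⟩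
    refine mem_orderedParts.2 ⟨fun i => ?_, fun i hi => ?_, fun i l hl => ?_⟩
    · dsimp only [consPart]; split_ifs with h <;> simp [h]
    · dsimp only [consPart]
      by_cases hiI : i ∈ I
      · have hs := (hI i hiI).1
        have e1 : p i = 0 := by
          by_contra h; exact (Finset.mem_sdiff.1 ((h1 i).1 (Nat.pos_of_ne_zero h))).2 hiI
        have e2 : p (σ i) = 0 := by
          by_contra h; exact (Finset.mem_sdiff.1 ((h1 _).1 (Nat.pos_of_ne_zero h))).2 hs
        rw [if_pos (hIJ hs), if_pos hi, e1, e2]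
      · have e1 := h2 i (Finset.mem_sdiff.2 ⟨hi, hiI⟩)
        have e2 : 0 < p (σ i) := by rw [e1]; exact (h1 i).2 (Finset.mem_sdiff.2 ⟨hi, hiI⟩)
        rw [if_pos (hpJ _ e2), if_pos hi, e1]
    · dsimp only [consPart] at hl ⊢
      split_ifs at hl with hi
      · rcases l with _ | l
        · obtain ⟨j, hj⟩ := Finset.nonempty_iff_ne_empty.2 hne
          refine ⟨j, ?_⟩
          have e1 : p j = 0 := by
            by_contra h; exact (Finset.mem_sdiff.1 ((h1 j).1 (Nat.pos_of_ne_zero h))).2 hj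
          rw [if_pos (hIJ hj), e1]
        · obtain ⟨j, hj⟩ := h3 i l (by omega)
          exact ⟨j, by rw [if_pos (hpJ j (by omega)), hj]⟩
      · omega
  · intro p hp
    obtain ⟨h1, h2, h3⟩ := mem_orderedParts.1 hp
    simp only [Finset.mem_sigma, Finset.mem_erase, mem_stableBelow, mem_orderedParts, blockAt,
      Finset.mem_sdiff, Finset.mem_filter, Finset.mem_univ, true_and]
    refine ⟨⟨?_, fun i hi => ?_, fun i hi => ?_⟩, fun i => ?_, fun i hi => ?_, fun i l hl => ?_⟩
    · obtain ⟨j, hj⟩ := hJ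
      obtain ⟨i, hi⟩ := h3 j 0 ((h1 j).2 hj)
      exact Finset.nonempty_iff_ne_empty.1 ⟨i, by simpa using hi⟩
    · rw [Finset.mem_filter] at hi
      exact (h1 i).1 (by omega)
    · exact ⟨by rw [h2 i ((h1 i).1 (by omega))]; exact hi, i.2⟩
    · rw [← h1 i]; omega
    · rw [h2 i hi.1]
    · obtain ⟨j, hj⟩ := h3 i (l + 1) (by omega)
      exact ⟨j, by omega⟩
  · rintro ⟨I, p⟩ h
    simp only [Finset.mem_sigma, Finset.mem_erase, mem_stableBelow, mem_orderedParts] at h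
    obtain ⟨⟨hne, hIJ, hI⟩, h1, h2, h3⟩ := h
    have e1 := blockAt_consPart_zero hIJ h1
    have e2 : (fun i => consPart J p i - 1) = p := by
      funext i
      dsimp only [consPart]
      split_ifs with h
      · omega
      · have : p i = 0 := by
          by_contra h2; exact h (Finset.mem_sdiff.1 ((h1 i).1 (Nat.pos_of_ne_zero h2))).1
        omega
    dsimp only
    rw [e1, e2]
  · intro p hp
    obtain ⟨h1, -, -⟩ := mem_orderedParts.1 hp
    funext i
    dsimp only [consPart]
    have := h1 i
    split_ifs with h
    · have := this.2 h; omega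
    · by_contra h2; exact h (this.1 (by omega))
  · exact fun _ _ => rfl

/-- Strictly increasing sequences in `[-L, -1]`. -/
noncomputable def levelSeqs (L k : ℕ) : Finset (Fin k → ℤ) := by
  classical exact (Fintype.piFinset fun _ => Finset.Icc (-(L : ℤ)) (-1)).filter StrictMono

theorem mem_levelSeqs {L k : ℕ} {a : Fin k → ℤ} :
    a ∈ levelSeqs L k ↔ (∀ l, -(L : ℤ) ≤ a l ∧ a l ≤ -1) ∧ StrictMono a := by
  classical
  rw [levelSeqs, Finset.mem_filter, Fintype.mem_piFinset]
  simp only [Finset.mem_Icc]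

theorem sum_levelSeqs_zero {M : Type*} [AddCommMonoid M] (L : ℕ) (f : (Fin 0 → ℤ) → M) :
    ∑ a ∈ levelSeqs L 0, f a = f Fin.elim0 := by
  have : levelSeqs L 0 = {Fin.elim0} := by
    ext a
    rw [mem_levelSeqs, Finset.mem_singleton]
    exact ⟨fun _ => Subsingleton.elim _ _, fun _ => ⟨fun l => l.elim0, fun l => l.elim0⟩⟩
  rw [this, Finset.sum_singleton]

theorem levelSeqs_zero_succ (k : ℕ) : levelSeqs 0 (k + 1) = ∅ := by
  ext a
  rw [mem_levelSeqs]
  simp only [Finset.notMem_empty, iff_false, not_and]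
  intro h
  have := h 0
  simp only [Nat.cast_zero] at this
  omega

/-- The first term of an increasing sequence is its smallest; the two sums are the cases where it is
above $-(L+1)$ or equal to it. -/
theorem sum_levelSeqs_succ {M : Type*} [AddCommMonoid M] (L k : ℕ) (f : (Fin (k + 1) → ℤ) → M) :
    ∑ a ∈ levelSeqs (L + 1) (k + 1), f a = ∑ a ∈ levelSeqs L (k + 1), f a +
      ∑ a ∈ levelSeqs L k, f (Fin.cons (-((L + 1 : ℕ) : ℤ)) a) := by
  classical
  rw [← Finset.sum_filter_add_sum_filter_not _ (fun a => -(L : ℤ) ≤ a 0)]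
  congr 1
  · refine Finset.sum_congr ?_ fun _ _ => rfl
    ext a
    rw [Finset.mem_filter, mem_levelSeqs, mem_levelSeqs]
    constructor
    · rintro ⟨⟨h1, h2⟩, h3⟩
      exact ⟨fun l => ⟨h3.trans (h2.monotone (Fin.zero_le l)), (h1 l).2⟩, h2⟩
    · rintro ⟨h1, h2⟩
      exact ⟨⟨fun l => ⟨by have := (h1 l).1; push_cast; omega, (h1 l).2⟩, h2⟩, (h1 0).1⟩
  · refine Finset.sum_nbij' (fun a l => a l.succ) (fun a => Fin.cons (-((L + 1 : ℕ) : ℤ)) a)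
      ?_ ?_ ?_ ?_ ?_
    · intro a ha
      rw [Finset.mem_filter, mem_levelSeqs] at ha
      obtain ⟨⟨h1, h2⟩, h3⟩ := ha
      refine mem_levelSeqs.2 ⟨fun l => ⟨?_, (h1 _).2⟩, fun l l' h => h2 (Fin.succ_lt_succ_iff.2 h)⟩
      have e1 : a 0 < a l.succ := h2 (Fin.succ_pos l)
      have e2 := (h1 0).1
      push_cast at e2
      omega
    · intro a ha
      obtain ⟨h1, h2⟩ := mem_levelSeqs.1 ha
      refine Finset.mem_filter.2 ⟨mem_levelSeqs.2 ⟨fun l => ?_, ?_⟩, ?_⟩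
      · refine Fin.cases ?_ (fun l => ?_) l
        · simp only [Fin.cons_zero]; push_cast; omega
        · simp only [Fin.cons_succ]
          have := h1 l
          push_cast; omega
      · intro l l'
        refine Fin.cases ?_ (fun l => ?_) l <;> refine Fin.cases ?_ (fun l' => ?_) l'
        · simp
        · intro _
          have := h1 l'
          simp only [Fin.cons_zero, Fin.cons_succ]
          push_cast; omega
        · intro h; exact absurd h (Fin.not_lt_zero _)
        · intro h
          simp only [Fin.cons_succ]
          exact h2 (Fin.succ_lt_succ_iff.1 h)
      · simp only [Fin.cons_zero]; push_cast; omega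
    · intro a ha
      rw [Finset.mem_filter, mem_levelSeqs] at ha
      obtain ⟨⟨h1, h2⟩, h3⟩ := ha
      have e0 : a 0 = -((L + 1 : ℕ) : ℤ) := by
        have := (h1 0).1
        push_cast at this ⊢; omega
      rw [← e0]
      exact Fin.cons_self_tail a
    · intro a _; rfl
    · intro a ha
      rw [Finset.mem_filter, mem_levelSeqs] at ha
      obtain ⟨⟨h1, h2⟩, h3⟩ := ha
      have e0 : a 0 = -((L + 1 : ℕ) : ℤ) := by
        have := (h1 0).1
        push_cast at this ⊢; omega
      rw [← e0]
      exact congrArg f (Fin.cons_self_tail a).symm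

end OrderedPartitions

/-! ### Sums over chains of blocks; the leftover set contributes 1 -/

section ChainSums

variable {n : ℕ}

theorem remAt_congr {σ σ' : Equiv.Perm (Fin n)} {J I : Finset (Fin n)}
    (h : ∀ k ∈ I, σ k = σ' k) (i : Fin n) : remAt σ J I i = remAt σ' J I i := by
  refine Finset.filter_congr fun k _ => ?_
  by_cases hk : k ∈ I
  · rw [h k hk]
  · simp [hk]

theorem passWeight_congr (w : Finset (Fin n) → Fin n → Fin n → ℂ) {σ σ' : Equiv.Perm (Fin n)}
    {J I : Finset (Fin n)} (h : ∀ k ∈ I, σ k = σ' k) :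
    passWeight w σ J I = passWeight w σ' J I := by
  unfold passWeight
  rw [Finset.filter_congr (q := fun i => σ' i ≤ i) fun i hi => by rw [h i hi]]
  refine Finset.prod_congr rfl fun i hi => ?_
  rw [h i (Finset.mem_filter.1 hi).1, remAt_congr h]

theorem blockAt_subset_upperPart (p : Fin n → ℕ) (l : ℕ) : blockAt p l ⊆ upperPart p l :=
  fun i hi => by rw [mem_blockAt] at hi; rw [mem_upperPart]; omega

/-- The product over the blocks from the `k`-th on. -/
noncomputable def tailProd (zf : Finset (Fin n) → Finset (Fin n) → ℂ) (p : Fin n → ℕ) (k : ℕ) : ℂ :=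
  ∏ l ∈ Finset.Ico k (blockNum p), zf (upperPart p l) (blockAt p l)

/-- The product over the blocks before the `k`-th, at the levels `a`. -/
noncomputable def headProd (W : ℤ → Finset (Fin n) → Finset (Fin n) → ℂ) (p : Fin n → ℕ) {k : ℕ}
    (a : Fin k → ℤ) : ℂ :=
  ∏ l : Fin k, W (a l) (upperPart p l) (blockAt p l)

/-- The sum of `tailProd` over all ordered partitions of `J`. -/
noncomputable def tailSum (σ : Equiv.Perm (Fin n)) (zf : Finset (Fin n) → Finset (Fin n) → ℂ)
    (J : Finset (Fin n)) : ℂ := ∑ p ∈ orderedParts σ J, tailProd zf p 0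

/-- The sum over ordered partitions of `J` whose last blocks have `t` elements altogether, and over
the levels of the remaining blocks. -/
noncomputable def chainSum (σ : Equiv.Perm (Fin n)) (W : ℤ → Finset (Fin n) → Finset (Fin n) → ℂ)
    (zf : Finset (Fin n) → Finset (Fin n) → ℂ) (t L : ℕ) (J : Finset (Fin n)) : ℂ :=
  ∑ p ∈ orderedParts σ J,
    ∑ k ∈ (Finset.range (blockNum p + 1)).filter (fun k => (upperPart p k).card = t),
      ∑ a ∈ levelSeqs L k, headProd W p a * tailProd zf p k

theorem consPart_supp {σ : Equiv.Perm (Fin n)} {J I : Finset (Fin n)} {p : Fin n → ℕ}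
    (hp : p ∈ orderedParts σ (J \ I)) (i : Fin n) (hi : 0 < p i) : i ∈ J :=
  (Finset.mem_sdiff.1 (((mem_orderedParts.1 hp).1 i).1 hi)).1

theorem tailProd_consPart_succ (zf : Finset (Fin n) → Finset (Fin n) → ℂ)
    {J : Finset (Fin n)} (hJ : J.Nonempty) {p : Fin n → ℕ} (hp : ∀ i, 0 < p i → i ∈ J) (k : ℕ) :
    tailProd zf (consPart J p) (k + 1) = tailProd zf p k := by
  rw [tailProd, tailProd, blockNum_consPart hJ hp,
    ← Finset.prod_Ico_add' (fun l => zf (upperPart (consPart J p) l) (blockAt (consPart J p) l))]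
  exact Finset.prod_congr rfl fun l _ => by
    rw [upperPart_consPart_succ hp, blockAt_consPart_succ hp]

theorem tailProd_consPart_zero (zf : Finset (Fin n) → Finset (Fin n) → ℂ)
    {J I : Finset (Fin n)} (hJ : J.Nonempty) (hI : I ⊆ J) {p : Fin n → ℕ}
    (hp : ∀ i, 0 < p i ↔ i ∈ J \ I) :
    tailProd zf (consPart J p) 0 = zf J I * tailProd zf p 0 := by
  have hp' : ∀ i, 0 < p i → i ∈ J := fun i hi => (Finset.mem_sdiff.1 ((hp i).1 hi)).1
  rw [← tailProd_consPart_succ zf hJ hp', tailProd, tailProd, Finset.prod_eq_prod_Ico_succ_bot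
    (by rw [blockNum_consPart hJ hp']; omega), upperPart_consPart_zero, blockAt_consPart_zero hI hp]

theorem tailSum_empty (σ : Equiv.Perm (Fin n)) (zf : Finset (Fin n) → Finset (Fin n) → ℂ) :
    tailSum σ zf ∅ = 1 := by
  rw [tailSum, orderedParts_empty, Finset.sum_singleton, tailProd, blockNum]
  have : Finset.univ.sup (0 : Fin n → ℕ) = 0 := by
    rw [← Nat.bot_eq_zero]; exact Finset.sup_eq_bot_iff _ _ |>.2 fun _ _ => rfl
  rw [this]
  simp

theorem tailSum_eq (σ : Equiv.Perm (Fin n)) (zf : Finset (Fin n) → Finset (Fin n) → ℂ)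
    {J : Finset (Fin n)} (hJ : J.Nonempty) (hσ : ∀ i ∈ J, σ (σ i) = i) :
    tailSum σ zf J = ∑ I ∈ (stableBelow σ J n).erase ∅, zf J I * tailSum σ zf (J \ I) := by
  rw [tailSum, sum_orderedParts σ hJ hσ]
  refine Finset.sum_congr rfl fun I hI => ?_
  rw [tailSum, Finset.mul_sum]
  refine Finset.sum_congr rfl fun p hp => ?_
  exact tailProd_consPart_zero zf hJ (mem_stableBelow.1 (Finset.mem_of_mem_erase hI)).1
    (mem_orderedParts.1 hp).1

theorem tailProd_congr {zf zf' : Finset (Fin n) → Finset (Fin n) → ℂ} {J : Finset (Fin n)}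
    (h : ∀ K I, I ⊆ J → zf K I = zf' K I) {p : Fin n → ℕ} (hp : ∀ i, 0 < p i → i ∈ J) (k : ℕ) :
    tailProd zf p k = tailProd zf' p k :=
  Finset.prod_congr rfl fun l _ => h _ _ fun i hi => hp i (by rw [mem_blockAt] at hi; omega)

theorem chainSum_congr {σ σ' : Equiv.Perm (Fin n)}
    {W W' : ℤ → Finset (Fin n) → Finset (Fin n) → ℂ} {zf zf' : Finset (Fin n) → Finset (Fin n) → ℂ}
    {J : Finset (Fin n)} (hσ : ∀ k ∈ J, σ k = σ' k) (hW : ∀ a K I, I ⊆ J → W a K I = W' a K I)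
    (h : ∀ K I, I ⊆ J → zf K I = zf' K I) (t L : ℕ) :
    chainSum σ W zf t L J = chainSum σ' W' zf' t L J := by
  rw [chainSum, chainSum, orderedParts_congr hσ]
  refine Finset.sum_congr rfl fun p hp => Finset.sum_congr rfl fun k _ =>
    Finset.sum_congr rfl fun a _ => ?_
  have hp' : ∀ i, 0 < p i → i ∈ J := fun i hi => ((mem_orderedParts.1 hp).1 i).1 hi
  rw [tailProd_congr h hp']
  congr 1
  exact Finset.prod_congr rfl fun l _ => hW _ _ _ fun i hi => hp' i (by
    rw [mem_blockAt] at hi; omega)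

/-- Separating the first block. -/
theorem chainSum_eq (σ : Equiv.Perm (Fin n)) (W : ℤ → Finset (Fin n) → Finset (Fin n) → ℂ)
    (zf : Finset (Fin n) → Finset (Fin n) → ℂ) (t L : ℕ) {J : Finset (Fin n)} (hJ : J.Nonempty)
    (hσ : ∀ i ∈ J, σ (σ i) = i) :
    chainSum σ W zf t L J = (if J.card = t then tailSum σ zf J else 0) +
      ∑ I ∈ (stableBelow σ J n).erase ∅, ∑ p ∈ orderedParts σ (J \ I),
        ∑ k ∈ (Finset.range (blockNum p + 1)).filter (fun k => (upperPart p k).card = t),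
          ∑ a ∈ levelSeqs L (k + 1), W (a 0) J I * headProd W p (Fin.tail a) * tailProd zf p k := by
  have h1 : ∀ p ∈ orderedParts σ J,
      ∑ k ∈ (Finset.range (blockNum p + 1)).filter (fun k => (upperPart p k).card = t),
        ∑ a ∈ levelSeqs L k, headProd W p a * tailProd zf p k =
      (if J.card = t then tailProd zf p 0 else 0) +
      ∑ k ∈ Finset.range (blockNum p), if (upperPart p (k + 1)).card = t then
        ∑ a ∈ levelSeqs L (k + 1), headProd W p a * tailProd zf p (k + 1) else 0 := fun p hp => by
    rw [Finset.sum_filter, Finset.sum_range_succ', add_comm]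
    congr 1
    have h2 : upperPart p 0 = J := by
      ext i; rw [mem_upperPart]; exact (mem_orderedParts.1 hp).1 i
    rw [h2, sum_levelSeqs_zero, headProd]
    simp
  rw [chainSum, Finset.sum_congr rfl h1, Finset.sum_add_distrib]
  congr 1
  · split_ifs
    · rfl
    · exact Finset.sum_const_zero
  · rw [sum_orderedParts σ hJ hσ]
    refine Finset.sum_congr rfl fun I hI => Finset.sum_congr rfl fun p hp => ?_
    have hsupp := consPart_supp hp
    rw [blockNum_consPart hJ hsupp, Finset.sum_filter]
    refine Finset.sum_congr rfl fun k _ => ?_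
    rw [upperPart_consPart_succ hsupp]
    refine if_congr Iff.rfl (Finset.sum_congr rfl fun a _ => ?_) rfl
    rw [tailProd_consPart_succ zf hJ hsupp, headProd, Fin.prod_univ_succ, Fin.val_zero,
      upperPart_consPart_zero, blockAt_consPart_zero
        (mem_stableBelow.1 (Finset.mem_of_mem_erase hI)).1 (mem_orderedParts.1 hp).1]
    congr 2
    refine Finset.prod_congr rfl fun l _ => ?_
    rw [Fin.val_succ, upperPart_consPart_succ hsupp, blockAt_consPart_succ hsupp]
    rfl

theorem stableBelow_empty (σ : Equiv.Perm (Fin n)) (m : ℕ) : stableBelow σ ∅ m = {∅} := by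
  ext I
  rw [mem_stableBelow, Finset.mem_singleton, Finset.subset_empty]
  exact ⟨fun h => h.1, fun h => ⟨h, by simp [h]⟩⟩

theorem blockNum_zero : blockNum (0 : Fin n → ℕ) = 0 := by
  rw [blockNum, ← Nat.bot_eq_zero]; exact Finset.sup_eq_bot_iff _ _ |>.2 fun _ _ => rfl

theorem chainSum_empty (σ : Equiv.Perm (Fin n)) (W : ℤ → Finset (Fin n) → Finset (Fin n) → ℂ)
    (zf : Finset (Fin n) → Finset (Fin n) → ℂ) (t L : ℕ) :
    chainSum σ W zf t L ∅ = if t = 0 then 1 else 0 := by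
  have h : upperPart (0 : Fin n → ℕ) 0 = ∅ := by ext i; simp [mem_upperPart]
  rw [chainSum, orderedParts_empty, Finset.sum_singleton, blockNum_zero, Finset.sum_filter,
    zero_add, Finset.sum_range_one, h, sum_levelSeqs_zero, headProd, tailProd, blockNum_zero]
  simp [eq_comm]

theorem chainSum_zero (σ : Equiv.Perm (Fin n)) (W : ℤ → Finset (Fin n) → Finset (Fin n) → ℂ)
    (zf : Finset (Fin n) → Finset (Fin n) → ℂ) (t : ℕ) {J : Finset (Fin n)}
    (hσ : ∀ i ∈ J, σ (σ i) = i) :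
    chainSum σ W zf t 0 J = if J.card = t then tailSum σ zf J else 0 := by
  rcases J.eq_empty_or_nonempty with rfl | hJ
  · rw [chainSum_empty, tailSum_empty]; simp [eq_comm]
  · rw [chainSum_eq σ W zf t 0 hJ hσ]
    simp [levelSeqs_zero_succ]

/-- Either the lowest level $-(L+1)$ is not used, which is the term $I=\emptyset$, or $I$ is the
first block and sits at that level. -/
theorem chainSum_succ (σ : Equiv.Perm (Fin n)) {W : ℤ → Finset (Fin n) → Finset (Fin n) → ℂ}
    (hW : ∀ a K, W a K ∅ = 1) (zf : Finset (Fin n) → Finset (Fin n) → ℂ) (t L : ℕ)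
    {J : Finset (Fin n)} (hσ : ∀ i ∈ J, σ (σ i) = i) :
    chainSum σ W zf t (L + 1) J = ∑ I ∈ stableBelow σ J n,
      W (-((L + 1 : ℕ) : ℤ)) J I * chainSum σ W zf t L (J \ I) := by
  rcases J.eq_empty_or_nonempty with rfl | hJ
  · rw [stableBelow_empty, Finset.sum_singleton, hW, one_mul, Finset.sdiff_empty, chainSum_empty,
      chainSum_empty]
  · have hmem : ∅ ∈ stableBelow σ J n := mem_stableBelow.2 ⟨by simp, by simp⟩
    rw [← Finset.add_sum_erase _ _ hmem, hW, one_mul, Finset.sdiff_empty,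
      chainSum_eq σ W zf t (L + 1) hJ hσ, chainSum_eq σ W zf t L hJ hσ, add_assoc]
    congr 1
    rw [← Finset.sum_add_distrib]
    refine Finset.sum_congr rfl fun I _ => ?_
    rw [chainSum, Finset.mul_sum, ← Finset.sum_add_distrib]
    refine Finset.sum_congr rfl fun p _ => ?_
    rw [Finset.mul_sum, ← Finset.sum_add_distrib]
    refine Finset.sum_congr rfl fun k _ => ?_
    rw [sum_levelSeqs_succ, Finset.mul_sum]
    congr 1
    refine Finset.sum_congr rfl fun a _ => ?_
    rw [Fin.cons_zero, Fin.tail_cons]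
    ring

/-- The factors of the last blocks. -/
noncomputable def tailFactor (x : ℂ) (σ : Equiv.Perm (Fin n)) (J I : Finset (Fin n)) : ℂ :=
  passWeight (volWeight x) σ J I * x ^ posCount (J \ I) 0 / (1 - x ^ posCount J 0)

theorem tailSum_congr {x : ℂ} {σ σ' : Equiv.Perm (Fin n)} {J : Finset (Fin n)}
    (h : ∀ k ∈ J, σ k = σ' k) :
    tailSum σ (tailFactor x σ) J = tailSum σ' (tailFactor x σ') J := by
  rw [tailSum, tailSum, orderedParts_congr h]
  refine Finset.sum_congr rfl fun p hp => tailProd_congr (J := J) (fun K I hI => ?_)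
    (fun i hi => ((mem_orderedParts.1 hp).1 i).1 hi) 0
  rw [tailFactor, tailFactor, passWeight_congr _ fun k hk => h k (hI hk)]

/-- Expand the identity of `levelPass_volWeight` at $m=n$ over involutions and sets $I$, and insert
the claim for the proper subsets $J\setminus I$. With $N=\mathrm{posCount}\,J\,0$, the term
$I=\emptyset$ gives $x^N$ and the others give $1-x^N$ times the sum in question, while the total is
$1$. -/
theorem sum_tailSum {x : ℂ} (hx : ∀ k, 0 < k → x ^ k ≠ 1) (J : Finset (Fin n)) :
    ∑ σ ∈ involOn J, tailSum σ (tailFactor x σ) J = 1 := by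
  induction J using Finset.strongInduction with
  | H J ih =>
    rcases J.eq_empty_or_nonempty with rfl | hJ
    · simp only [tailSum_empty]
      have : involOn (∅ : Finset (Fin n)) = {1} := by
        ext σ
        rw [mem_involOn, Finset.mem_singleton]
        exact ⟨fun h => Equiv.ext fun i => h.2 i (by simp), fun h => by simp [h]⟩
      rw [this]; simp
    · have hone : (1 : Equiv.Perm (Fin n)) ∈ involOn J := mem_involOn.2 ⟨by simp, by simp⟩
      have hpos : 0 < posCount J 0 := by
        rw [posCount_zero]
        have := hJ.card_pos
        refine Nat.div_pos ?_ two_pos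
        nlinarith
      have hden : 1 - x ^ posCount J 0 ≠ 0 := sub_ne_zero.2 (hx _ hpos).symm
      -- On proper subsets this is the decomposition given by the induction hypothesis. On $J$
      -- itself all the weight is put on the identity, so that the sum over $\sigma$ is $x^N$
      -- without using the claim being proved.
      let h : Equiv.Perm (Fin n) → Finset (Fin n) → ℂ := fun σ K =>
        x ^ posCount K 0 * if K ⊂ J then tailSum σ (tailFactor x σ) K else
          if ∀ k ∈ K, σ k = k then 1 else 0
      have hloc : ∀ σ σ' K, (∀ k ∈ K, σ k = σ' k) → h σ K = h σ' K := fun σ σ' K hK => by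
        have h2 : (∀ k ∈ K, σ k = k) ↔ ∀ k ∈ K, σ' k = k :=
          forall₂_congr fun k hk => by rw [hK k hk]
        simp only [h, tailSum_congr hK, h2]
      have hg : ∀ K ⊆ J, x ^ posCount K 0 = ∑ σ ∈ involOn K, h σ K := fun K hK => by
        rcases hK.eq_or_ssubset with rfl | hK
        · simp only [h, if_neg (ssubset_irrefl _)]
          rw [← Finset.mul_sum, Finset.sum_eq_single_of_mem 1 hone]
          · simp
          · intro σ hσ hσ1
            refine if_neg fun h' => hσ1 (Equiv.ext fun k => ?_)
            by_cases hk : k ∈ K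
            exacts [h' k hk, (mem_involOn.1 hσ).2 k hk]
        · simp only [h, if_pos hK]
          rw [← Finset.mul_sum, ih K hK, mul_one]
      have hmain := levelPass_volWeight x n le_rfl J
      rw [levelPass_eq_sum _ hloc n le_rfl J hg, posCount_top, pow_zero] at hmain
      have hsplit : ∀ σ ∈ involOn J, ∑ I ∈ stableBelow σ J n,
          passWeight (volWeight x) σ J I * h σ (J \ I) =
          h σ J + (1 - x ^ posCount J 0) * tailSum σ (tailFactor x σ) J := fun σ hσ => by
        have hmem : ∅ ∈ stableBelow σ J n := mem_stableBelow.2 ⟨by simp, by simp⟩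
        rw [← Finset.add_sum_erase _ _ hmem, passWeight_empty, one_mul, Finset.sdiff_empty,
          tailSum_eq σ _ hJ fun i _ => (mem_involOn.1 hσ).1 i, Finset.mul_sum]
        congr 1
        refine Finset.sum_congr rfl fun I hI => ?_
        obtain ⟨hI0, hI⟩ := Finset.mem_erase.1 hI
        have hIJ := (mem_stableBelow.1 hI).1
        have hss : J \ I ⊂ J := Finset.sdiff_ssubset hIJ (Finset.nonempty_iff_ne_empty.2 hI0)
        simp only [h, if_pos hss]
        rw [tailFactor]
        field_simp
      rw [Finset.sum_congr rfl hsplit, Finset.sum_add_distrib, ← hg J subset_rfl,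
        ← Finset.mul_sum] at hmain
      refine mul_left_cancel₀ hden ?_
      linear_combination hmain

/-- The recursion over the levels as a sum over involutions, ordered partitions and levels. -/
theorem levelIter_eq_sum {x : ℂ} (hx : ∀ k, 0 < k → x ^ k ≠ 1)
    (w : ℤ → Finset (Fin n) → Fin n → Fin n → ℂ) (t L : ℕ) (J : Finset (Fin n)) :
    levelIter w (fun k => if k = t then 1 else 0) L J =
      ∑ σ ∈ involOn J, chainSum σ (fun a => passWeight (w a) σ) (tailFactor x σ) t L J := by
  induction L generalizing J with
  | zero =>
    rw [levelIter, Finset.sum_congr rfl fun σ hσ =>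
      chainSum_zero σ _ _ t fun i _ => (mem_involOn.1 hσ).1 i]
    split_ifs
    · exact (sum_tailSum hx J).symm
    · exact Finset.sum_const_zero.symm
  | succ L ih =>
    rw [levelIter, levelPass_eq_sum _ (h := fun σ K => chainSum σ (fun a => passWeight (w a) σ)
      (tailFactor x σ) t L K) ?_ n le_rfl J fun K _ => ih K]
    · refine Finset.sum_congr rfl fun σ hσ => ?_
      rw [chainSum_succ σ (fun a K => passWeight_empty _ _ _) _ t L fun i _ =>
        (mem_involOn.1 hσ).1 i]
    · intro σ σ' K hK
      refine chainSum_congr hK (fun a K' I hI => passWeight_congr _ fun k hk => hK k (hI hk))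
        (fun K' I hI => ?_) t L
      rw [tailFactor, tailFactor, passWeight_congr _ fun k hk => hK k (hI hk)]

end ChainSums

/-! ### Evaluation of the weight of a diagonal pivot -/

section ClosedWeights

variable {n : ℕ} {F : Type*} [Field F] [ValuativeRel F] [TopologicalSpace F]
  [IsNonarchimedeanLocalField F]

/-- The factor `χ(x) |x| ^ (-s)`. -/
noncomputable def siegelKappa (ϖ : F) (s : ℂ) (x : F) : ℂ := quadChar ϖ x * qpow F (ord x * s)

/-- The diagonal entries `α_k ϖ ^ e_k`. -/
def diagEntry (ϖ : 𝒪[F]) (α : Fin n → 𝒪[F]ˣ) (e : Fin n → ℕ) (k : Fin n) : F :=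
  ((α k : 𝒪[F]) : F) * (ϖ : F) ^ e k

/-- The indices in `K` that contribute a Gauss sum. -/
def gaussIndices (e : Fin n → ℕ) (K : Finset (Fin n)) (i : Fin n) (lam : ℤ) : Finset (Fin n) :=
  K.filter fun k => (e k : ℤ) + (if i < k then 2 else 0) + lam < 0 ∧ Odd ((e k : ℤ) - lam)

/-- `xiFactor` with an arbitrary set of indices. -/
noncomputable def xiOn (q : ℕ) (χ : F → ℂ) (v : Fin n → F) (e : Fin n → ℕ) (A : Finset (Fin n))
    (i : Fin n) (lam : ℤ) : ℂ :=
  (∏ k ∈ A, χ (v k)) *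
    (if 0 ≤ (e i : ℤ) + lam then
      (if Even A.card then 0 else (1 - (q : ℂ)⁻¹) * χ (-1) ^ (A.card / 2 + 1))
    else if (e i : ℤ) + lam = -1 then
      (if Even A.card then χ (v i) * χ (-1) ^ (A.card / 2 + 1)
        else -(q : ℂ) ^ (-(1 / 2) : ℂ) * χ (-1) ^ (A.card / 2 + 1))
    else 0)

theorem xiFactor_eq_xiOn (q : ℕ) (χ : F → ℂ) (v : Fin n → F) (e : Fin n → ℕ) (i : Fin n) (lam : ℤ) :
    xiFactor q χ v e i lam = xiOn q χ v e (BSet e i lam) i lam := rfl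

variable {ϖ : 𝒪[F]} {α : Fin n → 𝒪[F]ˣ} {e : Fin n → ℕ}

theorem diagEntry_ne_zero (hϖ : Irreducible ϖ) (k : Fin n) : diagEntry ϖ α e k ≠ 0 :=
  mul_ne_zero (coe_unit_ne_zero _) (pow_ne_zero _ (uniformizer_ne_zero hϖ))

theorem ord_diagEntry (hϖ : Irreducible ϖ) (k : Fin n) : ord (diagEntry ϖ α e k) = e k := by
  rw [diagEntry, ord_mul (coe_unit_ne_zero _) (pow_ne_zero _ (uniformizer_ne_zero hϖ)), ord_unit,
    ord_pow, ord_uniformizer hϖ]; ring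

theorem diagEntry_mem (ϖ : 𝒪[F]) (α : Fin n → 𝒪[F]ˣ) (e : Fin n → ℕ) (k : Fin n) :
    diagEntry ϖ α e k ∈ 𝒪[F] :=
  mul_mem (SetLike.coe_mem _) (pow_mem (SetLike.coe_mem _) _)

theorem quadChar_diagEntry (hq : Odd (residueCard F)) (hϖ : Irreducible ϖ) (k : Fin n) :
    quadChar (ϖ : F) (diagEntry ϖ α e k) =
      quadChar (ϖ : F) (-1) ^ (e k : ℤ) * quadChar (ϖ : F) (α k) := by
  rw [← quadChar_eq_zpow hq hϖ, diagEntry, mul_comm, zpow_natCast]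

theorem quadChar_zpow_even (a x : F) {m : ℤ} (h : Even m) : quadChar a x ^ m = 1 := by
  rcases quadChar_eq a x with h1 | h1 <;> simp [h1, h.neg_one_zpow]

theorem quadChar_zpow_congr (a x : F) {m k : ℤ} (h : Even (m - k)) :
    quadChar a x ^ m = quadChar a x ^ k := by
  have h1 : m = (m - k) + k := by ring
  rw [h1, zpow_add₀ (quadChar_ne_zero a x), quadChar_zpow_even a x h, one_mul]

theorem sum_stepExp (K : Finset (Fin n)) (lam : ℤ) (i : Fin n) :
    ∑ k ∈ K, stepExp lam i k = lam * K.card + (K.filter (i < ·)).card := by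
  simp only [stepExp, Finset.card_filter, Nat.cast_sum, Nat.cast_ite, Nat.cast_one, Nat.cast_zero]
  rw [Finset.card_eq_sum_ones, Nat.cast_sum, Finset.mul_sum, ← Finset.sum_add_distrib]
  refine Finset.sum_congr rfl fun k _ => ?_
  split_ifs <;> simp

variable [MeasurableSpace F] [BorelSpace F] {μ : Measure F} [μ.IsAddHaarMeasure]
  {ψ : AddChar F Circle}

/-- One Gaussian integral for each remaining index. The coefficient of $r^2$ has order $e_k-\lambda$
and $r$ runs over $\mathfrak p^\lambda$ or $\mathfrak p^{\lambda+1}$, so the effective order is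
$e_k+\lambda$ or $e_k+\lambda+2$. A Gauss sum occurs exactly when it is negative and odd. -/
theorem gauss_prod (hμ : μ (𝒪[F] : Set F) = 1) (hq : Odd (residueCard F))
    (hψ : Continuous ψ) (hψ0 : HasOrderZero ψ) (hϖ : Irreducible ϖ) (lam : ℤ)
    (K : Finset (Fin n)) (i : Fin n) {p : F} (hp : p ∈ shell F lam) :
    ∏ k ∈ K, ∫ r in pw F (stepExp lam i k),
        (ψ (-(diagEntry ϖ α e k * (r * r / p))) : ℂ) ∂μ =
      qpow F (-(lam * K.card + (K.filter (i < ·)).card) +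
        (∑ k ∈ K, ((min ((e k : ℤ) + (if i < k then 2 else 0) + lam) 0 : ℤ) : ℂ)) / 2) *
      (gaussConst μ ψ ϖ ^ (gaussIndices e K i lam).card *
        (∏ k ∈ gaussIndices e K i lam, quadChar (ϖ : F) (α k)) *
        quadChar (ϖ : F) (-1) ^ ((lam + 1) * (gaussIndices e K i lam).card) *
        quadChar (ϖ : F) p ^ (gaussIndices e K i lam).card) := by
  obtain ⟨hp0, hpl⟩ := mem_shell.1 hp
  have key : ∀ k ∈ K, ∫ r in pw F (stepExp lam i k),
        (ψ (-(diagEntry ϖ α e k * (r * r / p))) : ℂ) ∂μ =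
      qpow F (-(stepExp lam i k : ℤ) +
        ((min ((e k : ℤ) + (if i < k then 2 else 0) + lam) 0 : ℤ) : ℂ) / 2) *
      (if (e k : ℤ) + (if i < k then 2 else 0) + lam < 0 ∧ Odd ((e k : ℤ) - lam) then
        gaussConst μ ψ ϖ * (quadChar (ϖ : F) (-1) ^ (lam + 1) * quadChar (ϖ : F) (α k) *
          quadChar (ϖ : F) p) else 1) := fun k _ => by
    have hb := diagEntry_ne_zero (α := α) (e := e) hϖ k
    have ha : -(diagEntry ϖ α e k * p⁻¹) ≠ 0 := neg_ne_zero.2 (mul_ne_zero hb (inv_ne_zero hp0))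
    have hord : ord (-(diagEntry ϖ α e k * p⁻¹)) = e k - lam := by
      rw [ord_neg, ord_mul hb (inv_ne_zero hp0), ord_inv, hpl, ord_diagEntry hϖ]; ring
    have h1 := integral_addChar_sq hμ hq hψ hψ0 hϖ ha (stepExp lam i k)
    have h2 : (e k : ℤ) - lam + 2 * stepExp lam i k = e k + (if i < k then 2 else 0) + lam := by
      rw [stepExp]; split_ifs <;> ring
    rw [hord, h2, neg_neg, quadChar_mul hq hϖ hb (inv_ne_zero hp0), quadChar_inv hq hϖ hp0,
      quadChar_diagEntry hq hϖ] at h1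
    have h3 : ∀ r : F, -(diagEntry ϖ α e k * (r * r / p)) = -(diagEntry ϖ α e k * p⁻¹) * r ^ 2 :=
      fun r => by rw [div_eq_mul_inv]; ring
    simp only [h3]
    rw [h1]
    congr 1
    -- Where a Gauss sum occurs, $e_k$ and $\lambda+1$ have the same parity, so the sign depends on
    -- $\lambda$ alone and can be collected over all $k$.
    refine if_ctx_congr Iff.rfl (fun h4 => ?_) fun _ => rfl
    rw [quadChar_zpow_congr (ϖ : F) (-1) (m := e k) (k := lam + 1)]
    have := h4.2.sub_odd odd_one
    rwa [sub_sub] at this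
  rw [Finset.prod_congr rfl key, Finset.prod_mul_distrib, ← qpow_sum, Finset.sum_add_distrib,
    ← Finset.sum_div, Finset.sum_neg_distrib, ← Int.cast_sum, sum_stepExp]
  congr 1
  · push_cast; rfl
  · rw [Finset.prod_ite, Finset.prod_const_one, mul_one]
    change ∏ k ∈ gaussIndices e K i lam, _ = _
    rw [Finset.prod_mul_distrib, Finset.prod_mul_distrib, Finset.prod_mul_distrib,
      Finset.prod_const, Finset.prod_const, Finset.prod_const, _root_.zpow_mul, zpow_natCast]
    ring

theorem gaussConst_pow (hμ : μ (𝒪[F] : Set F) = 1) (hq : Odd (residueCard F))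
    (hψ0 : HasOrderZero ψ) (hϖ : Irreducible ϖ) (m : ℕ) :
    gaussConst μ ψ ϖ ^ m = (if Even m then 1 else gaussConst μ ψ ϖ) *
      quadChar (ϖ : F) (-1) ^ (m / 2) := by
  rw [← gaussConst_sq hμ hq hψ0 hϖ, ← pow_mul]
  split_ifs with h
  · rw [Nat.mul_div_cancel' h.two_dvd, one_mul]
  · rw [← pow_succ', Nat.two_mul_div_two_add_one_of_odd (Nat.not_even_iff_odd.1 h)]

/-- Each Gauss sum brings a factor $\chi(p)$ and $\kappa(p)$ brings one more, so the pivot is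
integrated against $\chi(p)^{\#A+1}\psi(-b_ip)$. For $\#A$ even this is a Gauss sum, nonzero only if
$e_i+\lambda=-1$; for $\#A$ odd it is an additive integral, nonzero if $e_i+\lambda\ge-1$. These are
the four cases of $\xi_{i,\lambda}$. -/
theorem singleWeight_eq (hμ : μ (𝒪[F] : Set F) = 1) (hq : Odd (residueCard F))
    (hψ : Continuous ψ) (hψ0 : HasOrderZero ψ) (hϖ : Irreducible ϖ) (s : ℂ) (lam : ℤ)
    (K : Finset (Fin n)) (i : Fin n) :
    singleWeight μ (siegelKappa (ϖ : F) s) ψ (diagEntry ϖ α e) lam K i =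
      gaussConst μ ψ ϖ * quadChar (ϖ : F) (-1) ^ lam *
      qpow F (lam * (s - 1 - K.card) - (K.filter (i < ·)).card +
        (∑ k ∈ K, ((min ((e k : ℤ) + (if i < k then 2 else 0) + lam) 0 : ℤ) : ℂ)) / 2 +
          ((min ((e i : ℤ) + lam) 0 : ℤ) : ℂ) / 2) *
      xiOn (residueCard F) (quadChar (ϖ : F)) (fun k => ((α k : 𝒪[F]) : F)) e
        (gaussIndices e K i lam) i lam := by
  set A := gaussIndices e K i lam with hA
  set γ := gaussConst μ ψ ϖ with hγ
  set η := quadChar (ϖ : F) (-1) with hη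
  have hb := diagEntry_ne_zero (α := α) (e := e) hϖ i
  have hb' := neg_ne_zero.2 hb
  have hob : ord (-(diagEntry ϖ α e i)) = e i := by rw [ord_neg, ord_diagEntry hϖ]
  have hη0 : η ≠ 0 := quadChar_ne_zero _ _
  set E : ℂ := -(lam * K.card + (K.filter (i < ·)).card) +
        (∑ k ∈ K, ((min ((e k : ℤ) + (if i < k then 2 else 0) + lam) 0 : ℤ) : ℂ)) / 2 with hE
  have h1 : singleWeight μ (siegelKappa (ϖ : F) s) ψ (diagEntry ϖ α e) lam K i =
      qpow F E * qpow F (lam * s) * (γ ^ A.card * (∏ k ∈ A, quadChar (ϖ : F) (α k)) *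
        η ^ ((lam + 1) * A.card)) * ∫ p in shell F lam, quadChar (ϖ : F) p ^ (A.card + 1) *
          (ψ (-(diagEntry ϖ α e i) * p) : ℂ) ∂μ := by
    rw [singleWeight, ← integral_const_mul]
    refine setIntegral_congr_fun (measurableSet_shell lam) fun p hp => ?_
    rw [gauss_prod hμ hq hψ hψ0 hϖ lam K i hp, siegelKappa, (mem_shell.1 hp).2, neg_mul]
    ring
  have h2 : qpow F (lam * (s - 1 - K.card) - (K.filter (i < ·)).card +
        (∑ k ∈ K, ((min ((e k : ℤ) + (if i < k then 2 else 0) + lam) 0 : ℤ) : ℂ)) / 2 +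
          ((min ((e i : ℤ) + lam) 0 : ℤ) : ℂ) / 2) = qpow F E * qpow F (lam * s) *
        (residueCard F : ℂ) ^ (-lam) * qpow F (((min ((e i : ℤ) + lam) 0 : ℤ) : ℂ) / 2) := by
    rw [← qpow_neg_intCast, ← qpow_add, ← qpow_add, ← qpow_add, hE]
    congr 1; ring
  have h3 : qpow F (-(1 / 2)) * qpow F (-(1 / 2)) = (residueCard F : ℂ)⁻¹ := by
    rw [← qpow_half_mul, mul_inv, qpow_neg]
  rw [h1, h2, xiOn, gaussConst_pow hμ hq hψ0 hϖ, ← hγ]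
  rcases Nat.even_or_odd A.card with hev | hod
  · have h4 : ∀ p : F, quadChar (ϖ : F) p ^ (A.card + 1) = quadChar (ϖ : F) p := fun p => by
      obtain ⟨c, hc⟩ := hev.two_dvd
      rw [pow_succ, hc, pow_mul, quadChar_sq, one_pow, one_mul]
    simp only [h4, if_pos hev]
    rw [integral_shell_quadChar hμ hq hψ0 hϖ hb', hob, neg_neg, quadChar_diagEntry hq hϖ,
      quadChar_zpow_even (ϖ : F) (-1) (m := (lam + 1) * A.card) (by
        exact ((Int.even_coe_nat _).2 hev).mul_left _)]
    by_cases h5 : (e i : ℤ) + lam = -1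
    · rw [if_pos h5, if_neg (by omega), if_pos h5, h5,
        quadChar_zpow_congr (ϖ : F) (-1) (m := e i) (k := lam + 1) ⟨-1 - lam, by omega⟩,
        zpow_add_one₀ hη0, pow_succ]
      have : (((min (-1) 0 : ℤ) : ℂ) / 2) = -(1 / 2) := by norm_num
      rw [this]; ring
    · rw [if_neg h5, if_neg h5]; split_ifs <;> simp
  · have hnev := Nat.not_even_iff_odd.2 hod
    have h4 : ∀ p : F, quadChar (ϖ : F) p ^ (A.card + 1) = 1 := fun p => by
      obtain ⟨c, hc⟩ := hod.add_one.two_dvd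
      rw [hc, pow_mul, quadChar_sq, one_pow]
    simp only [h4, if_neg hnev, one_mul]
    rw [integral_shell_addChar hμ hψ hψ0 hb', hob,
      quadChar_zpow_congr (ϖ : F) (-1) (m := (lam + 1) * A.card) (k := lam + 1) (by
        have : (lam + 1) * (A.card : ℤ) - (lam + 1) = (lam + 1) * ((A.card : ℤ) - 1) := by ring
        rw [this]
        exact (((Int.odd_coe_nat _).2 hod).sub_odd odd_one).mul_left _), zpow_add_one₀ hη0, pow_succ]
    by_cases h5 : 0 ≤ (e i : ℤ) + lam
    · rw [if_pos h5, if_pos h5, min_eq_right h5, Int.cast_zero, zero_div, qpow_zero]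
      ring
    · rw [if_neg h5, if_neg h5]
      by_cases h6 : (e i : ℤ) + lam = -1
      · rw [if_pos h6, if_pos h6, h6]
        have h7 : (((min (-1) 0 : ℤ) : ℂ) / 2) = -(1 / 2) := by norm_num
        have h8 : (residueCard F : ℂ) ^ (-(1 / 2) : ℂ) = qpow F (-(1 / 2)) := rfl
        rw [h7, h8, ← h3]; ring
      · rw [if_neg h6, if_neg h6]; simp

end ClosedWeights

/-! ### Evaluation of the weight of an off-diagonal pivot -/

section ClosedPairWeight

variable {n : ℕ} {F : Type*} [Field F] [ValuativeRel F] [TopologicalSpace F]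
  [IsNonarchimedeanLocalField F] {ϖ : 𝒪[F]} {α : Fin n → 𝒪[F]ˣ} {e : Fin n → ℕ}

theorem stepExp_add (lam : ℤ) (i k : Fin n) : stepExp lam i k = lam + if i < k then 1 else 0 := by
  rw [stepExp]; split_ifs <;> simp

variable [MeasurableSpace F] [BorelSpace F] {μ : Measure F} [μ.IsAddHaarMeasure]
  {ψ : AddChar F Circle}

/-- On the domain the determinant is $-y^2$ plus a term of larger order, and $\chi(y^2)=1$. -/
theorem quadChar_pairDomain (hq : Odd (residueCard F)) (hϖ : Irreducible ϖ) {lam : ℤ}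
    {p : F × F × F} (hp : p ∈ pairDomain F lam) :
    quadChar (ϖ : F) (p.1 * p.2.2 - p.2.1 ^ 2) = quadChar (ϖ : F) (-1) := by
  obtain ⟨hx, hy, hz⟩ := hp
  obtain ⟨hy0, hyl⟩ := mem_shell.1 hy
  have h1 : -(p.2.1 * p.2.1) ∈ shell F (2 * lam) :=
    mem_shell.2 ⟨neg_ne_zero.2 (mul_ne_zero hy0 hy0), by rw [ord_neg, ord_mul hy0 hy0, hyl]; ring⟩
  have h2 : p.1 * p.2.2 ∈ pw F (2 * lam + 1) := pw_mono (by omega) (mul_mem_pw hx hz)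
  have h3 : p.1 * p.2.2 - p.2.1 ^ 2 = -1 * (p.2.1 * p.2.1) + p.1 * p.2.2 := by ring
  rw [h3, quadChar_add_of_mem hq hϖ (by rwa [neg_one_mul]) h2, quadChar_mul hq hϖ (by simp)
    (mul_ne_zero hy0 hy0), quadChar_mul hq hϖ hy0 hy0, quadChar_mul_self, mul_one]

/-- The inverse of the pivot block is again dominated by its off-diagonal entry, so this binary form
is split and `integral_addChar_split` gives a pure power of $q$. -/
theorem integral_pairForm (hμ : μ (𝒪[F] : Set F) = 1) (hq : Odd (residueCard F))
    (hψ : Continuous ψ) (hψ0 : HasOrderZero ψ) {b : F} (hb : b ≠ 0) {lam : ℤ} {i j k : Fin n}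
    (hij : j < i) {p : F × F × F} (hp : p ∈ pairDomain F lam) :
    ∫ r in (pw F (stepExp lam i k) : Set F) ×ˢ (pw F (stepExp lam j k) : Set F),
        (ψ (-(b * pairForm p r)) : ℂ) ∂(μ.prod μ) =
      qpow F (-(stepExp lam i k : ℤ) - (stepExp lam j k : ℤ) +
        (min (ord b + (if i < k then 1 else 0) + (if j < k then 1 else 0) + lam) 0 : ℤ)) := by
  obtain ⟨hd0, hd⟩ := pairDomain_det hp
  obtain ⟨hx, hy, hz⟩ := hp
  obtain ⟨hy0, hyl⟩ := mem_shell.1 hy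
  set d := p.1 * p.2.2 - p.2.1 ^ 2 with hd_def
  have hbm : b ∈ pw F (ord b) := (mem_pw_iff_ord hb).2 le_rfl
  have hB : b * p.2.1 / d ≠ 0 := div_ne_zero (mul_ne_zero hb hy0) hd0
  have hβ : ord (b * p.2.1 / d) = ord b - lam := by
    rw [div_eq_mul_inv, ord_mul (mul_ne_zero hb hy0) (inv_ne_zero hd0), ord_inv, hd,
      ord_mul hb hy0, hyl]; ring
  have hA : -(b * p.2.2 / d) ∈ pw F (ord b - lam + 1) :=
    neg_mem (pw_mono (by omega) (div_mem_pw (mul_mem_pw hbm hz) hd0 hd))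
  have hC : -(b * p.1 / d) ∈ pw F (ord b - lam) :=
    neg_mem (pw_mono (by omega) (div_mem_pw (mul_mem_pw hbm hx) hd0 hd))
  have hf : ∀ r : F × F, -(b * pairForm p r) = -(b * p.2.2 / d) * r.1 ^ 2 +
      2 * (b * p.2.1 / d) * r.1 * r.2 + -(b * p.1 / d) * r.2 ^ 2 := fun r => by
    rw [pairForm, ← hd_def]; ring
  simp only [hf]
  rw [setIntegral_prod _ (ContinuousOn.integrableOn_compact
    ((isCompact_pw _).prod (isCompact_pw _)) (by fun_prop))]
  -- `integral_addChar_split` needs one additional power of $\mathfrak p$ in its last coefficient,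
  -- relative to the two ranges. For $k$ between $j$ and $i$ the ranges differ and the given order
  -- of variables satisfies this; otherwise the ranges agree and the variables are exchanged, since
  -- it is the $r_1^2$ coefficient that carries the extra power.
  by_cases h : j < k ∧ ¬ i < k
  · rw [integral_addChar_split hμ hq hψ hψ0 hB hβ (pw_mono _ hA) (pw_mono _ hC)]
    · congr 3
      simp only [stepExp, if_pos h.1, if_neg h.2]; ring_nf
    · simp only [stepExp, if_pos h.1, if_neg h.2]; omega
    · simp only [stepExp, if_pos h.1, if_neg h.2]; omega
  · have he : stepExp lam i k = stepExp lam j k := by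
      simp only [stepExp]; split_ifs with h1 h2 h2
      · rfl
      · exact absurd (hij.trans h1) h2
      · exact absurd ⟨h2, h1⟩ h
      · rfl
    rw [setIntegral_pw_swap (by fun_prop)]
    have hg : ∀ x y : F, -(b * p.2.2 / d) * x ^ 2 + 2 * (b * p.2.1 / d) * x * y +
        -(b * p.1 / d) * y ^ 2 = -(b * p.1 / d) * y ^ 2 + 2 * (b * p.2.1 / d) * y * x +
        -(b * p.2.2 / d) * x ^ 2 := fun x y => by ring
    simp only [hg]
    rw [integral_addChar_split hμ hq hψ hψ0 hB hβ (pw_mono (by omega) hC) (pw_mono (by omega) hA),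
      stepExp_add, stepExp_add]
    congr 1
    have h5 : ∀ a c : ℤ, ord b - lam + (lam + a) + (lam + c) = ord b + c + a + lam :=
      fun a c => by ring
    rw [h5]; push_cast; ring

/-- $\kappa$ of the determinant and all the binary integrals are constant on the domain, so only
three independent integrals remain: two additive characters and the volume of a shell. -/
theorem pairWeight_eq (hμ : μ (𝒪[F] : Set F) = 1) (hq : Odd (residueCard F))
    (hψ : Continuous ψ) (hψ0 : HasOrderZero ψ) (hϖ : Irreducible ϖ) (s : ℂ) (lam : ℤ)
    (K : Finset (Fin n)) {i j : Fin n} (hij : j < i) :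
    pairWeight μ (siegelKappa (ϖ : F) s) ψ (diagEntry ϖ α e) lam K i j =
      gaussConst μ ψ ϖ ^ 2 *
      qpow F (lam * (2 * s - 3 - 2 * K.card) - 1 - (K.filter (i < ·)).card -
        (K.filter (j < ·)).card + ∑ k ∈ K, ((min ((e k : ℤ) + (if i < k then 1 else 0) +
          (if j < k then 1 else 0) + lam) 0 : ℤ) : ℂ)) * (1 - (residueCard F : ℂ)⁻¹) *
      (if 0 ≤ (e j : ℤ) + lam ∧ -1 ≤ (e i : ℤ) + lam then 1 else 0) := by
  have hb := fun k => diagEntry_ne_zero (α := α) (e := e) hϖ k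
  set E : ℂ := -(lam * K.card + (K.filter (i < ·)).card) - (lam * K.card + (K.filter (j < ·)).card) +
    ∑ k ∈ K, ((min ((e k : ℤ) + (if i < k then 1 else 0) +
          (if j < k then 1 else 0) + lam) 0 : ℤ) : ℂ) with hE
  have h1 : pairWeight μ (siegelKappa (ϖ : F) s) ψ (diagEntry ϖ α e) lam K i j =
      ∫ p in pairDomain F lam, (quadChar (ϖ : F) (-1) * qpow F (2 * lam * s) * qpow F E) *
        ((ψ (-(diagEntry ϖ α e j) * p.1) : ℂ) * (1 * (ψ (-(diagEntry ϖ α e i) * p.2.2) : ℂ)))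
        ∂(μ.prod (μ.prod μ)) := by
    refine setIntegral_congr_fun ((measurableSet_pw lam).prod
      ((measurableSet_shell lam).prod (measurableSet_pw (lam + 1)))) fun p hp => ?_
    rw [Finset.prod_congr rfl fun k _ => integral_pairForm hμ hq hψ hψ0 (hb k) hij hp, ← qpow_sum]
    simp only [ord_diagEntry hϖ]
    have hs : ∀ x y : F, -(x + y) = -x + -y := fun x y => neg_add x y
    rw [Finset.sum_add_distrib, Finset.sum_sub_distrib, Finset.sum_neg_distrib, ← Int.cast_sum,
      ← Int.cast_sum, sum_stepExp, sum_stepExp, siegelKappa, quadChar_pairDomain hq hϖ hp,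
      (pairDomain_det hp).2, neg_add, AddChar.map_add_eq_mul, Circle.coe_mul, neg_mul, neg_mul, one_mul, hE]
    push_cast
    ring
  have h2 : (quadChar (ϖ : F) (-1)) = gaussConst μ ψ ϖ ^ 2 := (gaussConst_sq hμ hq hψ0 hϖ).symm
  have h3 : ∫ _p in shell F lam, (1 : ℂ) ∂μ =
      (residueCard F : ℂ) ^ (-lam) * (1 - (residueCard F : ℂ)⁻¹) := by
    rw [integral_shell (integrableOn_pw (by fun_prop) lam), setIntegral_const_pw hμ,
      setIntegral_const_pw hμ, neg_add, zpow_add₀ residueCard_ne_zero, _root_.zpow_neg_one]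
    ring
  rw [h1, integral_const_mul, pairDomain,
    setIntegral_prod_mul (fun x => (ψ (-(diagEntry ϖ α e j) * x) : ℂ))
      (fun r : F × F => 1 * (ψ (-(diagEntry ϖ α e i) * r.2) : ℂ)),
    setIntegral_prod_mul (fun _ => (1 : ℂ)) (fun z => (ψ (-(diagEntry ϖ α e i) * z) : ℂ)), h3,
    integral_addChar hμ hψ0, integral_addChar hμ hψ0, neg_mem_iff, neg_mem_iff,
    mem_pw_iff_ord (hb j), mem_pw_iff_ord (hb i), ord_diagEntry hϖ, ord_diagEntry hϖ, h2,
    ← qpow_neg_intCast, ← qpow_neg_intCast]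
  have h4 : qpow F (lam * (2 * s - 3 - 2 * K.card) - 1 - (K.filter (i < ·)).card -
        (K.filter (j < ·)).card + ∑ k ∈ K, ((min ((e k : ℤ) + (if i < k then 1 else 0) +
          (if j < k then 1 else 0) + lam) 0 : ℤ) : ℂ)) =
      qpow F (2 * lam * s) * qpow F E * qpow F (-lam) * qpow F (-lam) *
        qpow F (-((lam + 1 : ℤ) : ℂ)) := by
    rw [← qpow_add, ← qpow_add, ← qpow_add, ← qpow_add, hE]
    congr 1
    push_cast; ring
  rw [h4]
  by_cases ha : -lam ≤ (e j : ℤ)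
  · by_cases hc : -(lam + 1) ≤ (e i : ℤ)
    · rw [if_pos ha, if_pos hc, if_pos ⟨by omega, by omega⟩]; ring
    · rw [if_neg hc, if_neg (c := _ ∧ _) (by omega)]; ring
  · rw [if_neg ha, if_neg (c := _ ∧ _) (by omega)]; ring

end ClosedPairWeight

/-! ### The weight of a whole block: telescoping over its cycles -/

section BlockWeights

variable {n : ℕ} {σ : Equiv.Perm (Fin n)} {J I : Finset (Fin n)}

theorem prod_lt_apply {M : Type*} [CommMonoid M] (hσ : ∀ i, σ (σ i) = i) (hI : ∀ i ∈ I, σ i ∈ I)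
    (g : Fin n → M) : ∏ i ∈ I.filter (fun i => i < σ i), g i =
      ∏ i ∈ I.filter (fun i => σ i < i), g (σ i) := by
  symm
  refine Finset.prod_nbij' (fun i => σ i) (fun i => σ i) ?_ ?_ ?_ ?_ ?_
  · exact fun i hi => by
      obtain ⟨h1, h2⟩ := Finset.mem_filter.1 hi
      exact Finset.mem_filter.2 ⟨hI i h1, by rwa [hσ]⟩
  · exact fun i hi => by
      obtain ⟨h1, h2⟩ := Finset.mem_filter.1 hi
      exact Finset.mem_filter.2 ⟨hI i h1, by rwa [hσ]⟩
  · exact fun i _ => hσ i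
  · exact fun i _ => hσ i
  · exact fun i _ => rfl

theorem prod_filter_le_apply {M : Type*} [CommMonoid M] (g h : Fin n → M) :
    ∏ i ∈ I.filter (fun i => σ i ≤ i), (if σ i = i then g i else h i) =
      (∏ i ∈ I.filter (fun i => σ i = i), g i) * ∏ i ∈ I.filter (fun i => σ i < i), h i := by
  rw [Finset.prod_ite, Finset.filter_filter, Finset.filter_filter]
  congr 1 <;>
  · refine Finset.prod_congr (Finset.filter_congr fun i _ => ?_) fun _ _ => rfl
    first
      | exact ⟨fun h => h.2, fun h => ⟨h.le, h⟩⟩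
      | exact ⟨fun h => lt_of_le_of_ne h.1 h.2, fun h => ⟨h.le, h.ne⟩⟩

theorem prod_cycles {M : Type*} [CommMonoid M] (hσ : ∀ i, σ (σ i) = i) (hI : ∀ i ∈ I, σ i ∈ I)
    (g : Fin n → M) :
    ∏ i ∈ I.filter (fun i => σ i ≤ i), (if σ i = i then g i else g i * g (σ i)) =
      ∏ i ∈ I, g i := by
  rw [prod_filter_le_apply, Finset.prod_mul_distrib, ← prod_lt_apply hσ hI g,
    ← Finset.prod_filter_mul_prod_filter_not I (fun i => σ i = i)]
  congr 1
  rw [← Finset.prod_filter_mul_prod_filter_not (I.filter fun i => ¬σ i = i) (fun i => σ i < i),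
    Finset.filter_filter, Finset.filter_filter]
  congr 1 <;>
  · refine Finset.prod_congr (Finset.filter_congr fun i _ => ?_) fun _ _ => rfl
    first
      | exact ⟨fun h => ⟨h.ne, h⟩, fun h => h.2⟩
      | exact ⟨fun h => ⟨h.ne', h.not_gt⟩, fun h => lt_of_le_of_ne (not_lt.1 h.2) (Ne.symm h.1)⟩

theorem card_ne_eq (hσ : ∀ i, σ (σ i) = i) (hI : ∀ i ∈ I, σ i ∈ I) :
    I.card = (I.filter fun i => σ i = i).card + 2 * (I.filter fun i => σ i < i).card := by
  have h := prod_cycles (M := Multiplicative ℕ) hσ hI (fun _ => Multiplicative.ofAdd 1)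
  rw [prod_filter_le_apply] at h
  simp only [Finset.prod_const, ← ofAdd_add, ← ofAdd_nsmul] at h
  have := Multiplicative.ofAdd.injective h
  simp at this
  omega

/-- What is left of `J` after removing the cycles of `σ` in `I` whose largest element is `≥ m`. -/
def remBelow (σ : Equiv.Perm (Fin n)) (J I : Finset (Fin n)) (m : ℕ) : Finset (Fin n) :=
  J.filter fun k => k ∉ I ∨ ((k : ℕ) < m ∧ (σ k : ℕ) < m)

theorem remBelow_coe (i : Fin n) : remBelow σ J I i = remAt σ J I i := rfl

theorem notMem_remAt {i : Fin n} (hi : i ∈ I) : i ∉ remAt σ J I i := fun h => by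
  rcases (Finset.mem_filter.1 h).2 with h | h
  · exact h hi
  · exact lt_irrefl _ h.1

theorem card_remBelow_succ (hσ : ∀ i, σ (σ i) = i) (hIJ : I ⊆ J) (hI : ∀ i ∈ I, σ i ∈ I)
    {i : Fin n} (hi : i ∈ I) (hσi : σ i ≤ i) :
    (remBelow σ J I (i + 1)).card = (remAt σ J I i).card + if σ i = i then 1 else 2 := by
  have hni := notMem_remAt (σ := σ) (J := J) hi
  have hnσ : σ i ∉ remAt σ J I i := fun h => by
    rcases (Finset.mem_filter.1 h).2 with h | h
    · exact h (hI i hi)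
    · rw [hσ] at h; exact lt_irrefl _ h.2
  have h1 : remBelow σ J I (i + 1) = insert i (insert (σ i) (remAt σ J I i)) := by
    ext k
    simp only [remBelow, remAt, Finset.mem_filter, Finset.mem_insert]
    constructor
    · rintro ⟨h1, h2⟩
      by_cases hk : k = i
      · exact Or.inl hk
      by_cases hk2 : k = σ i
      · exact Or.inr (Or.inl hk2)
      refine Or.inr (Or.inr ⟨h1, h2.imp_right fun h => ?_⟩)
      have hk3 : σ k ≠ i := fun h => hk2 (by rw [← h, hσ])
      rw [Fin.lt_def, Fin.lt_def]
      rw [← Fin.val_inj] at hk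
      rw [← Fin.val_inj.ne] at hk3
      omega
    · rw [Fin.le_def] at hσi
      rintro (rfl | rfl | ⟨h1, h2⟩)
      · exact ⟨hIJ hi, Or.inr ⟨by omega, by omega⟩⟩
      · exact ⟨hIJ (hI i hi), Or.inr ⟨by omega, by rw [hσ]; omega⟩⟩
      · exact ⟨h1, h2.imp_right fun h => by rw [Fin.lt_def, Fin.lt_def] at h; omega⟩
  rw [h1]
  split_ifs with h
  · rw [h, Finset.insert_idem, Finset.card_insert_of_notMem hni]
  · rw [Finset.card_insert_of_notMem, Finset.card_insert_of_notMem hnσ]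
    rw [Finset.mem_insert, not_or]
    exact ⟨fun h' => h h'.symm, hni⟩

theorem remBelow_succ_of_not (hσ : ∀ i, σ (σ i) = i) (hI : ∀ i ∈ I, σ i ∈ I) {i : Fin n}
    (h : ¬(i ∈ I ∧ σ i ≤ i)) : remBelow σ J I (i + 1) = remBelow σ J I i := by
  refine Finset.filter_congr fun k _ => ?_
  by_cases hk : k ∈ I
  · simp only [hk, not_true_eq_false, false_or]
    refine ⟨fun h1 => ?_, fun h1 => by omega⟩
    have h2 : (k : ℕ) ≠ i := fun h3 => by
      rw [Fin.val_inj] at h3; subst h3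
      exact h ⟨hk, by rw [Fin.le_def]; omega⟩
    have h3 : (σ k : ℕ) ≠ i := fun h3 => by
      rw [Fin.val_inj] at h3; subst h3
      exact h ⟨hI k hk, by rw [hσ, Fin.le_def]; omega⟩
    omega
  · simp [hk]

/-- The cycles are removed one after another, each lowering the cardinality by 1 or 2, so the sum
telescopes. It is applied to $N(m)=sm-m(m+1)/2$, turning the exponents of single pivots into the
difference that appears in the formula. -/
theorem sum_remAt_sub (hσ : ∀ i, σ (σ i) = i) (hIJ : I ⊆ J) (hI : ∀ i ∈ I, σ i ∈ I) (N : ℕ → ℂ) :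
    ∑ i ∈ I.filter (fun i => σ i ≤ i),
      (N ((remAt σ J I i).card + if σ i = i then 1 else 2) - N (remAt σ J I i).card) =
      N J.card - N (J \ I).card := by
  have h0 : remBelow σ J I 0 = J \ I := by
    ext k; simp [remBelow, Finset.mem_sdiff]
  have hn : remBelow σ J I n = J :=
    Finset.filter_true_of_mem fun k _ => Or.inr ⟨k.2, (σ k).2⟩
  have htel := Finset.sum_range_sub (fun m => N (remBelow σ J I m).card) n
  rw [h0, hn] at htel
  rw [← htel, Finset.sum_range,
    ← Finset.sum_subset (Finset.subset_univ (I.filter fun i => σ i ≤ i))]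
  · refine Finset.sum_congr rfl fun i hi => ?_
    obtain ⟨h1, h2⟩ := Finset.mem_filter.1 hi
    rw [card_remBelow_succ hσ hIJ hI h1 h2, remBelow_coe]
  · intro i _ hi
    rw [remBelow_succ_of_not hσ hI fun h => hi (Finset.mem_filter.2 h), sub_self]

/-- The number of elements beyond `i` that are still there when the cycle of `i` is removed. -/
def crossCount (σ : Equiv.Perm (Fin n)) (J I : Finset (Fin n)) (i : Fin n) : ℕ :=
  ((remAt σ J I (max i (σ i))).filter (i < ·)).card

theorem crossCount_of_le {i : Fin n} (h : σ i ≤ i) :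
    crossCount σ J I i = ((remAt σ J I i).filter (i < ·)).card := by
  rw [crossCount, max_eq_left h]

theorem crossCount_apply_of_le (hσ : ∀ i, σ (σ i) = i) {i : Fin n} (h : σ i ≤ i) :
    crossCount σ J I (σ i) = ((remAt σ J I i).filter (σ i < ·)).card := by
  rw [crossCount, hσ, max_eq_right h]

theorem passWeight_volWeight (hσ : ∀ i, σ (σ i) = i) (hI : ∀ i ∈ I, σ i ∈ I) (x : ℂ) :
    passWeight (volWeight x) σ J I = x ^ (∑ i ∈ I, crossCount σ J I i) *
      (1 - x) ^ (I.filter fun i => σ i = i).card *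
      (x * (1 - x)) ^ (I.filter fun i => σ i < i).card := by
  have h : ∀ i ∈ I.filter (fun i => σ i ≤ i), volWeight x (remAt σ J I i) i (σ i) =
      (if σ i = i then x ^ crossCount σ J I i else
        x ^ crossCount σ J I i * x ^ crossCount σ J I (σ i)) *
        (if σ i = i then 1 - x else x * (1 - x)) := fun i hi => by
    have hle := (Finset.mem_filter.1 hi).2
    rw [volWeight, crossCount_of_le hle, crossCount_apply_of_le hσ hle]
    split_ifs
    · ring
    · rw [pow_add]; ring
  rw [passWeight, Finset.prod_congr rfl h, Finset.prod_mul_distrib, prod_cycles hσ hI,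
    prod_filter_le_apply, Finset.prod_pow_eq_pow_sum, Finset.prod_const, Finset.prod_const, mul_assoc]

theorem eShift_eq (i k : Fin n) :
    eShift σ i k = (if i < k then 1 else 0) + if σ i < k then 1 else 0 := by
  rw [eShift]
  split_ifs <;> first | rfl | (simp only [Fin.le_def, Fin.lt_def] at *; omega)

theorem eShift_apply (hσ : ∀ i, σ (σ i) = i) (i k : Fin n) : eShift σ (σ i) k = eShift σ i k := by
  rw [eShift_eq, eShift_eq, hσ, add_comm]

variable {e : Fin n → ℕ} {lam : ℤ}

/-- Indices already removed contribute nothing, so sums over the remaining set extend to all $k$, as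
in $\tilde\rho$. For $k\notin J$ one has $e_k+\lambda\ge0$. For $k\in I$, either $k<\sigma(k)$ and
again $e_k+\lambda\ge0$, or $k$ is the largest element of its cycle; then $k\ge i$, the shift is at
least 1, and $e_k+1+\lambda\ge0$. -/
theorem eShift_nonneg_of_notMem (hI' : ∀ i ∈ I, 0 ≤ (e i : ℤ) + (if i < σ i then 0 else 1) + lam)
    (hJ : ∀ k ∉ J, 0 ≤ (e k : ℤ) + lam) {i k : Fin n} (hσi : σ i ≤ i) (hk : k ∉ remAt σ J I i)
    (hki : k ≠ i ∨ σ i ≠ i) : 0 ≤ (e k : ℤ) + eShift σ i k + lam := by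
  have hs : 0 ≤ eShift σ i k := by rw [eShift_eq]; split_ifs <;> norm_num
  by_cases hkJ : k ∈ J
  swap
  · have := hJ k hkJ; omega
  by_cases hkI : k ∈ I
  swap
  · exact absurd (Finset.mem_filter.2 ⟨hkJ, Or.inl hkI⟩) hk
  have h1 := hI' k hkI
  have h2 : ¬(k < i ∧ σ k < i) := fun h => hk (Finset.mem_filter.2 ⟨hkJ, Or.inr h⟩)
  rw [eShift_eq]
  rw [← Fin.val_inj.ne, ← Fin.val_inj.ne] at hki
  simp only [Fin.le_def, Fin.lt_def] at *
  split_ifs at h1 ⊢ <;> omega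

/-- The exponent `2 ρ̃`, for one index `i`. -/
def rhoAt (σ : Equiv.Perm (Fin n)) (e : Fin n → ℕ) (lam : ℤ) (i : Fin n) : ℂ :=
  ∑ k : Fin n, ((min ((e k : ℤ) + eShift σ i k + lam) 0 : ℤ) : ℂ)

theorem rhoAt_single (hI' : ∀ i ∈ I, 0 ≤ (e i : ℤ) + (if i < σ i then 0 else 1) + lam)
    (hJ : ∀ k ∉ J, 0 ≤ (e k : ℤ) + lam) {i : Fin n} (hi : i ∈ I) (hσi : σ i = i) :
    rhoAt σ e lam i = ∑ k ∈ remAt σ J I i,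
      ((min ((e k : ℤ) + (if i < k then 2 else 0) + lam) 0 : ℤ) : ℂ) +
        ((min ((e i : ℤ) + lam) 0 : ℤ) : ℂ) := by
  have hs : ∀ k, eShift σ i k = if i < k then 2 else 0 := fun k => by
    rw [eShift_eq, hσi]; split_ifs <;> rfl
  rw [rhoAt, ← Finset.sum_subset (Finset.subset_univ (insert i (remAt σ J I i))),
    Finset.sum_insert (notMem_remAt hi), add_comm, hs i, if_neg (lt_irrefl i), add_zero]
  · simp only [hs]
  · intro k _ hk
    rw [Finset.mem_insert, not_or] at hk
    rw [min_eq_right (eShift_nonneg_of_notMem hI' hJ hσi.le hk.2 (Or.inl hk.1)), Int.cast_zero]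

theorem rhoAt_pair (hI' : ∀ i ∈ I, 0 ≤ (e i : ℤ) + (if i < σ i then 0 else 1) + lam)
    (hJ : ∀ k ∉ J, 0 ≤ (e k : ℤ) + lam) {i : Fin n} (hσi : σ i < i) :
    rhoAt σ e lam i = ∑ k ∈ remAt σ J I i, ((min ((e k : ℤ) + (if i < k then 1 else 0) +
      (if σ i < k then 1 else 0) + lam) 0 : ℤ) : ℂ) := by
  rw [rhoAt, ← Finset.sum_subset (Finset.subset_univ (remAt σ J I i))]
  · simp only [eShift_eq, add_assoc]
  · intro k _ hk
    rw [min_eq_right (eShift_nonneg_of_notMem hI' hJ hσi.le hk (Or.inr hσi.ne)), Int.cast_zero]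

theorem gaussIndices_eq (hI' : ∀ i ∈ I, 0 ≤ (e i : ℤ) + (if i < σ i then 0 else 1) + lam)
    (hJ : ∀ k ∉ J, 0 ≤ (e k : ℤ) + lam) {i : Fin n} (hi : i ∈ I) (hσi : σ i = i) :
    gaussIndices e (remAt σ J I i) i lam = BSet e i lam := by
  ext k
  have hpar : Odd ((e k : ℤ) - lam) ↔ ¬(e k : ℤ) ≡ lam [ZMOD 2] := by
    rw [Int.odd_iff, Int.ModEq]; omega
  rw [gaussIndices, BSet, Finset.mem_filter, Finset.mem_filter, hpar, ← and_assoc, ← and_assoc]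
  refine and_congr_left fun _ => ?_
  by_cases hk : k = i
  · rw [hk]
    simp [notMem_remAt hi]
  by_cases hkr : k ∈ remAt σ J I i
  · simp only [hkr, true_and, Finset.mem_univ]
    rw [← Fin.val_inj] at hk
    simp only [Fin.lt_def]
    split_ifs <;> omega
  · have h := eShift_nonneg_of_notMem hI' hJ hσi.le hkr (Or.inl hk)
    rw [eShift_eq, hσi] at h
    simp only [hkr, false_and, false_iff, Finset.mem_univ, true_and]
    rw [← Fin.val_inj] at hk
    simp only [Fin.lt_def] at *
    split_ifs at h <;> omega

variable {F : Type*} [Field F] [ValuativeRel F] [TopologicalSpace F]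
  [IsNonarchimedeanLocalField F] {ϖ : 𝒪[F]} {α : Fin n → 𝒪[F]ˣ}
  [MeasurableSpace F] [BorelSpace F] {μ : Measure F} [μ.IsAddHaarMeasure] {ψ : AddChar F Circle}

/-- This is the origin of the bound $-b_l(\sigma,B)$: a pivot at too low a level integrates a
nontrivial character to zero. The larger element of a 2-cycle and a fixed point tolerate one level
more than the smaller element, because the corresponding entry ranges over $\mathfrak p^{\lambda+1}$
or admits a Gauss sum. -/
theorem passWeight_pivotWeight_eq_zero (hμ : μ (𝒪[F] : Set F) = 1) (hq : Odd (residueCard F))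
    (hψ : Continuous ψ) (hψ0 : HasOrderZero ψ) (hϖ : Irreducible ϖ) (s : ℂ)
    (hσ : ∀ i, σ (σ i) = i) (hI : ∀ i ∈ I, σ i ∈ I) {i : Fin n} (hi : i ∈ I)
    (h : (e i : ℤ) + (if i < σ i then 0 else 1) + lam < 0) :
    passWeight (pivotWeight μ (siegelKappa (ϖ : F) s) ψ (diagEntry ϖ α e) lam) σ J I = 0 := by
  rcases lt_trichotomy (σ i) i with h1 | h1 | h1
  · refine Finset.prod_eq_zero (Finset.mem_filter.2 ⟨hi, h1.le⟩) ?_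
    rw [pivotWeight, if_neg h1.ne, pairWeight_eq hμ hq hψ hψ0 hϖ s lam _ h1, if_neg, mul_zero]
    rw [if_neg h1.not_gt] at h
    omega
  · refine Finset.prod_eq_zero (Finset.mem_filter.2 ⟨hi, h1.le⟩) ?_
    rw [if_neg (by rw [h1]; exact lt_irrefl _)] at h
    rw [pivotWeight, if_pos h1, singleWeight_eq hμ hq hψ hψ0 hϖ s lam _ i, xiOn, if_neg (by omega),
      if_neg (by omega), mul_zero, mul_zero]
  · refine Finset.prod_eq_zero (i := σ i) (Finset.mem_filter.2 ⟨hI i hi, by rw [hσ]; exact h1.le⟩) ?_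
    rw [if_pos h1] at h
    rw [pivotWeight, hσ, if_neg h1.ne, pairWeight_eq hμ hq hψ hψ0 hϖ s lam _ h1, if_neg, mul_zero]
    omega

/-- Three kinds of factors are separated: those distributed over the elements of $I$ (Gauss
constant, crossings, $\tilde\rho$), those that telescope with the number of remaining indices, and
those specific to fixed points or to 2-cycles. -/
theorem passWeight_pivotWeight (hμ : μ (𝒪[F] : Set F) = 1) (hq : Odd (residueCard F))
    (hψ : Continuous ψ) (hψ0 : HasOrderZero ψ) (hϖ : Irreducible ϖ) (s : ℂ)
    (hσ : ∀ i, σ (σ i) = i) (hIJ : I ⊆ J) (hI : ∀ i ∈ I, σ i ∈ I)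
    (hI' : ∀ i ∈ I, 0 ≤ (e i : ℤ) + (if i < σ i then 0 else 1) + lam)
    (hJ : ∀ k ∉ J, 0 ≤ (e k : ℤ) + lam) :
    passWeight (pivotWeight μ (siegelKappa (ϖ : F) s) ψ (diagEntry ϖ α e) lam) σ J I =
      gaussConst μ ψ ϖ ^ I.card * quadChar (ϖ : F) (-1) ^ (lam * I.card) *
      (residueCard F : ℂ)⁻¹ ^ (∑ i ∈ I, crossCount σ J I i) *
      ((residueCard F : ℂ)⁻¹ * (1 - (residueCard F : ℂ)⁻¹)) ^ (I.filter fun i => σ i < i).card *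
      (qpow F (lam * ((s * J.card - (J.card * (J.card + 1) / 2)) -
        (s * (J \ I).card - ((J \ I).card * ((J \ I).card + 1) / 2)))) *
      qpow F (1 / 2 * ∑ i ∈ I, rhoAt σ e lam i)) *
      ∏ i ∈ I.filter (fun i => σ i = i), xiFactor (residueCard F) (quadChar (ϖ : F))
        (fun k => ((α k : 𝒪[F]) : F)) e i lam := by
  set x := (residueCard F : ℂ)⁻¹ with hx
  set γ := gaussConst μ ψ ϖ with hγ
  set η := quadChar (ϖ : F) (-1) with hη
  set N : ℕ → ℂ := fun m => s * m - m * (m + 1) / 2 with hN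
  have hx1 : ∀ m : ℕ, qpow F (-m) = x ^ m := fun m => by
    rw [hx, inv_pow, qpow_neg, ← zpow_natCast, ← qpow_intCast]; rfl
  -- A 2-cycle contributes $g(i)g(\sigma(i))$, half of its $\rho$-exponent coming from each element;
  -- the product over cycles becomes a product over $I$.
  set g : Fin n → ℂ := fun i => γ * x ^ crossCount σ J I i * qpow F (1 / 2 * rhoAt σ e lam i) with hg
  have key : ∀ i ∈ I.filter (fun i => σ i ≤ i),
      pivotWeight μ (siegelKappa (ϖ : F) s) ψ (diagEntry ϖ α e) lam (remAt σ J I i) i (σ i) =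
      (if σ i = i then g i else g i * g (σ i)) *
      qpow F (lam * (N ((remAt σ J I i).card + if σ i = i then 1 else 2) - N (remAt σ J I i).card)) *
      (if σ i = i then η ^ lam * xiFactor (residueCard F) (quadChar (ϖ : F))
        (fun k => ((α k : 𝒪[F]) : F)) e i lam else x * (1 - x)) := fun i hi => by
    obtain ⟨hi, hle⟩ := Finset.mem_filter.1 hi
    by_cases h : σ i = i
    · simp only [if_pos h, pivotWeight]
      rw [singleWeight_eq hμ hq hψ hψ0 hϖ s lam _ i, gaussIndices_eq hI' hJ hi h, ← xiFactor_eq_xiOn,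
        ← hγ, ← hη, hg]
      have h3 : (lam * (s - 1 - (remAt σ J I i).card) - ((remAt σ J I i).filter (i < ·)).card +
        (∑ k ∈ remAt σ J I i, ((min ((e k : ℤ) + (if i < k then 2 else 0) + lam) 0 : ℤ) : ℂ)) / 2 +
          ((min ((e i : ℤ) + lam) 0 : ℤ) : ℂ) / 2) =
          -((crossCount σ J I i : ℕ) : ℂ) + (1 / 2 * rhoAt σ e lam i) +
          (lam * (N ((remAt σ J I i).card + 1) - N (remAt σ J I i).card)) := by
        rw [crossCount_of_le hle, rhoAt_single hI' hJ hi h, hN]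
        push_cast; ring
      rw [h3, qpow_add, qpow_add, hx1]
      ring
    · have hlt := lt_of_le_of_ne hle h
      simp only [if_neg h, pivotWeight]
      rw [pairWeight_eq hμ hq hψ hψ0 hϖ s lam _ hlt, ← hγ, if_pos, hg]
      · have h3 : (lam * (2 * s - 3 - 2 * (remAt σ J I i).card) - 1 -
            ((remAt σ J I i).filter (i < ·)).card - ((remAt σ J I i).filter (σ i < ·)).card +
            ∑ k ∈ remAt σ J I i, ((min ((e k : ℤ) + (if i < k then 1 else 0) +
          (if σ i < k then 1 else 0) + lam) 0 : ℤ) : ℂ)) =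
          -((1 : ℕ) : ℂ) + -((crossCount σ J I i : ℕ) : ℂ) + -((crossCount σ J I (σ i) : ℕ) : ℂ) +
          (1 / 2 * rhoAt σ e lam i) + (1 / 2 * rhoAt σ e lam (σ i)) +
          (lam * (N ((remAt σ J I i).card + 2) - N (remAt σ J I i).card)) := by
          have h4 : rhoAt σ e lam (σ i) = rhoAt σ e lam i := by simp only [rhoAt, eShift_apply hσ]
          rw [crossCount_of_le hle, crossCount_apply_of_le hσ hle, h4, rhoAt_pair hI' hJ hlt, hN]
          push_cast; ring
        rw [h3, qpow_add, qpow_add, qpow_add, qpow_add, qpow_add, hx1, hx1, hx1]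
        ring
      · have h1 := hI' i hi
        have h2 := hI' (σ i) (hI i hi)
        rw [if_neg hlt.not_gt] at h1
        rw [hσ, if_pos hlt] at h2
        omega
  -- 2-cycles contribute even powers of $\chi(-1)$, so only the fixed points count.
  have hη2 : η ^ (lam * I.card) = (η ^ lam) ^ (I.filter fun i => σ i = i).card := by
    rw [_root_.zpow_mul, zpow_natCast, card_ne_eq hσ hI, pow_add, pow_mul, ← zpow_natCast (η ^ lam) 2,
      ← _root_.zpow_mul, hη, quadChar_zpow_even _ _ (m := lam * (2 : ℕ)) (by simp), one_pow, mul_one]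
  rw [passWeight, Finset.prod_congr rfl key, Finset.prod_mul_distrib, Finset.prod_mul_distrib,
    prod_cycles hσ hI, prod_filter_le_apply, ← qpow_sum, ← Finset.mul_sum,
    sum_remAt_sub hσ hIJ hI N, Finset.prod_mul_distrib, Finset.prod_mul_distrib,
    Finset.prod_mul_distrib, ← qpow_sum, ← Finset.mul_sum, Finset.prod_pow_eq_pow_sum,
    Finset.prod_const, Finset.prod_const, Finset.prod_const, hη2]
  simp only [hN]
  ring

end BlockWeights

/-! ### Levels as partial sums of the increments $\nu$ -/

section PartialSums

variable {k : ℕ}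

theorem partialSum_eq_sum_range (ν : Fin k → ℤ) (l : Fin k) :
    partialSum ν l = ∑ j ∈ Finset.range (l + 1), if h : j < k then ν ⟨j, h⟩ else 0 := by
  refine Finset.sum_bij (fun j _ => (j : ℕ)) (fun j hj => ?_) (fun _ _ _ _ h => Fin.ext h)
    (fun j hj => ?_) fun j _ => ?_
  · have := Finset.mem_Iic.1 hj
    rw [Finset.mem_range]; exact Nat.lt_succ_of_le this
  · have h1 := Finset.mem_range.1 hj
    exact ⟨⟨j, by omega⟩, Finset.mem_Iic.2 (Fin.le_def.2 (Nat.le_of_lt_succ h1)), rfl⟩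
  · rw [dif_pos j.2]

theorem sum_mul_sub_range {R : Type*} [CommRing R] (g f : ℕ → R) (k : ℕ) :
    ∑ l ∈ Finset.range k, g l * (f l - f k) =
      ∑ l ∈ Finset.range k, (∑ j ∈ Finset.range (l + 1), g j) * (f l - f (l + 1)) := by
  induction k with
  | zero => simp
  | succ k ih =>
    rw [Finset.sum_range_succ, Finset.sum_range_succ, ← ih, Finset.sum_range_succ g, add_mul,
      Finset.sum_mul, ← add_assoc, ← Finset.sum_add_distrib]
    congr 1
    exact Finset.sum_congr rfl fun l _ => by ring

/-- Summation by parts. -/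
theorem sum_mul_sub_eq {R : Type*} [CommRing R] (ν : Fin k → ℤ) (f : ℕ → R) :
    ∑ l : Fin k, (ν l : R) * (f l - f k) =
      ∑ l : Fin k, (partialSum ν l : R) * (f l - f (l + 1)) := by
  have h := sum_mul_sub_range (fun j => if h : j < k then (ν ⟨j, h⟩ : R) else 0) f k
  rw [Finset.sum_range, Finset.sum_range] at h
  convert h using 2 with l _ l _
  · simp
  · rw [partialSum_eq_sum_range, Int.cast_sum]
    congr 1
    exact Finset.sum_congr rfl fun j _ => by split_ifs <;> simp

/-- The values `a (m - 1)` of a finite sequence, with `0` at `m = 0`. -/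
def shiftSeq (a : Fin k → ℤ) (m : ℕ) : ℤ := if h : 0 < m ∧ m - 1 < k then a ⟨m - 1, h.2⟩ else 0

theorem shiftSeq_succ (a : Fin k → ℤ) (l : Fin k) : shiftSeq a (l + 1) = a l := by
  rw [shiftSeq, dif_pos ⟨by omega, by simp⟩]; rfl

theorem partialSum_sub_shiftSeq (a : Fin k → ℤ) :
    partialSum (fun l => a l - shiftSeq a l) = a := by
  funext l
  rw [partialSum_eq_sum_range, ← shiftSeq_succ a l]
  have h0 : shiftSeq a 0 = 0 := by simp [shiftSeq]
  rw [← sub_zero (shiftSeq a (l + 1)), ← h0, ← Finset.sum_range_sub (shiftSeq a)]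
  refine Finset.sum_congr rfl fun j hj => ?_
  have := Finset.mem_range.1 hj
  have hj : j < k := by omega
  rw [dif_pos hj, ← shiftSeq_succ a ⟨j, hj⟩]

theorem shiftSeq_partialSum (ν : Fin k → ℤ) (l : Fin k) :
    partialSum ν l - shiftSeq (partialSum ν) l = ν l := by
  obtain ⟨l, hl⟩ := l
  cases l with
  | zero =>
    rw [partialSum_eq_sum_range]
    simp [shiftSeq, hl]
  | succ l =>
    have h := shiftSeq_succ (partialSum ν) ⟨l, by omega⟩
    simp only at h
    rw [h, partialSum_eq_sum_range, partialSum_eq_sum_range, Finset.sum_range_succ,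
      add_sub_cancel_left, dif_pos hl]

theorem strictMono_partialSum_iff (ν : Fin k → ℤ) :
    StrictMono (partialSum ν) ↔ ∀ l : Fin k, 0 < (l : ℕ) → 0 < ν l := by
  constructor
  · intro h l hl
    rw [← shiftSeq_partialSum ν l, sub_pos]
    have h1 := shiftSeq_succ (partialSum ν) ⟨l - 1, by omega⟩
    rw [show (((⟨(l : ℕ) - 1, by omega⟩ : Fin k) : ℕ) + 1) = l by simp; omega] at h1
    rw [h1]
    exact h (Fin.lt_def.2 (by simp; omega))
  · intro h a b hab
    rw [← sub_pos, partialSum_eq_sum_range, partialSum_eq_sum_range,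
      ← Finset.sum_Ico_eq_sub _ (by have := Fin.lt_def.1 hab; omega)]
    refine Finset.sum_pos (fun j hj => ?_) ⟨b, Finset.mem_Ico.2 ⟨Fin.lt_def.1 hab, by omega⟩⟩
    have hj' := Finset.mem_Ico.1 hj
    rw [dif_pos (by omega : j < k)]
    exact h _ (by simp; omega)

end PartialSums

/-! ### Statistics of ordered partitions -/

section PartitionStatistics

variable {n : ℕ} {σ : Equiv.Perm (Fin n)} {p : Fin n → ℕ}

theorem upperPart_sdiff_blockAt (p : Fin n → ℕ) (l : ℕ) :
    upperPart p l \ blockAt p l = upperPart p (l + 1) := by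
  ext i
  rw [Finset.mem_sdiff, mem_upperPart, mem_blockAt, mem_upperPart]; omega

theorem card_upperPart (p : Fin n → ℕ) (l : ℕ) :
    (upperPart p l).card = (blockAt p l).card + (upperPart p (l + 1)).card := by
  rw [← upperPart_sdiff_blockAt, Finset.card_sdiff_of_subset (blockAt_subset_upperPart p l)]
  have := Finset.card_le_card (blockAt_subset_upperPart p l)
  omega

theorem upperPart_zero (hp : ∀ i, 0 < p i) : upperPart p 0 = Finset.univ :=
  Finset.filter_true_of_mem fun i _ => hp i

theorem upperPart_blockNum (p : Fin n → ℕ) : upperPart p (blockNum p) = ∅ :=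
  Finset.filter_false_of_mem fun i hi => not_lt.2 (Finset.le_sup (f := p) hi)

theorem sum_card_blockAt (hp : ∀ i, 0 < p i) (k : ℕ) :
    ∑ l : Fin k, (blockAt p l).card = n - (upperPart p k).card := by
  have h : ∀ k, ∑ l ∈ Finset.range k, (blockAt p l).card + (upperPart p k).card = n := fun k => by
    induction k with
    | zero => simp [upperPart_zero hp]
    | succ k ih => rw [Finset.sum_range_succ, add_assoc, ← card_upperPart, ih]
  have := h k
  rw [Finset.sum_range] at this; omega

theorem prod_blocks {M : Type*} [CommMonoid M] (hp : ∀ i, 0 < p i) (f : ℕ → Fin n → M) :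
    ∏ l ∈ Finset.range (blockNum p), ∏ i ∈ blockAt p l, f l i = ∏ i, f (p i - 1) i := by
  rw [← Finset.prod_fiberwise_of_maps_to (s := Finset.univ) (t := Finset.range (blockNum p))
    (g := fun i => p i - 1) (fun i hi => ?_)]
  · refine Finset.prod_congr rfl fun l _ => ?_
    have : blockAt p l = Finset.univ.filter (fun i => p i - 1 = l) :=
      Finset.filter_congr fun i _ => by have := hp i; omega
    rw [this]
    exact Finset.prod_congr rfl fun i hi => by rw [(Finset.mem_filter.1 hi).2]
  · have h1 : p i ≤ blockNum p := Finset.le_sup (f := p) hi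
    have := hp i
    rw [Finset.mem_range]; omega

variable {m : ℕ} {r : Fin n → Fin m}

theorem filter_eq_blockAt (r : Fin n → Fin m) (l : ℕ) :
    (Finset.univ.filter fun i => (r i : ℕ) = l) = blockAt (fun i => (r i : ℕ) + 1) l :=
  Finset.filter_congr fun i _ => by simp only; omega

theorem nUpper_eq (r : Fin n → Fin m) (k : ℕ) :
    nUpper r k = (upperPart (fun i => (r i : ℕ) + 1) k).card := by
  rw [nUpper, Finset.card_eq_sum_card_fiberwise (f := fun i => (r i : ℕ)) (t := Finset.Ico k m)]
  · refine Finset.sum_congr rfl fun l hl => ?_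
    have hl := Finset.mem_Ico.1 hl
    rw [blockCard, upperPart, Finset.filter_filter]
    congr 1
    exact Finset.filter_congr fun i _ => by omega
  · intro i hi
    have := mem_upperPart.1 (Finset.mem_coe.1 hi)
    exact Finset.mem_coe.2 (Finset.mem_Ico.2 ⟨Nat.le_of_lt_succ this, (r i).2⟩)

theorem blockNum_eq (hr : Function.Surjective r) (hm : 0 < m) :
    blockNum (fun i => (r i : ℕ) + 1) = m := by
  refine le_antisymm (Finset.sup_le fun i _ => (r i).2) ?_
  obtain ⟨i, hi⟩ := hr ⟨m - 1, by omega⟩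
  have := Finset.le_sup (f := fun i => (r i : ℕ) + 1) (Finset.mem_univ i)
  simp only [hi] at this
  rw [blockNum]; omega

/-- The indices beyond $i$ still present when the cycle of $i$ is removed are those in later blocks,
counted by $\tau$, and those $k$ of the same block with $i<k<\sigma(i)$ and $\sigma(k)<\sigma(i)$,
counted by $t$. -/
theorem sum_crossCount (r : Fin n → Fin m) :
    ∑ i, crossCount σ (upperPart (fun i => (r i : ℕ) + 1) (r i))
      (blockAt (fun i => (r i : ℕ) + 1) (r i)) i = tauPart r + tPart σ r := by
  rw [tauPart, tPart, Finset.card_filter, Finset.card_filter, Fintype.sum_prod_type_right,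
    Fintype.sum_prod_type, ← Finset.sum_add_distrib]
  refine Finset.sum_congr rfl fun i _ => ?_
  rw [crossCount, remAt, Finset.filter_filter, upperPart, Finset.filter_filter, Finset.card_filter,
    ← Finset.sum_add_distrib]
  refine Finset.sum_congr rfl fun k _ => ?_
  simp only [mem_blockAt, Fin.lt_def, Fin.coe_max, ← Fin.val_inj]
  split_ifs <;> omega

theorem cTwo_eq (hσ : ∀ i, σ (σ i) = i) :
    cTwo σ = (Finset.univ.filter fun i => σ i < i).card := by
  have h1 := card_ne_eq hσ (I := Finset.univ) fun i _ => Finset.mem_univ _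
  have h2 := Finset.card_filter_add_card_filter_not (s := Finset.univ) (fun i => σ i = i)
  rw [cTwo]
  simp only [ne_eq]
  omega

end PartitionStatistics

/-! ### The contribution of one involution and one partition -/

section TermComparison

variable {n : ℕ} {σ : Equiv.Perm (Fin n)} {p : Fin n → ℕ}

/-- The powers of `x` contributed by the `l`-th block. -/
noncomputable def blockFactor (x : ℂ) (σ : Equiv.Perm (Fin n)) (p : Fin n → ℕ) (l : ℕ) : ℂ :=
  x ^ (∑ i ∈ blockAt p l, crossCount σ (upperPart p l) (blockAt p l) i) *
    (x * (1 - x)) ^ ((blockAt p l).filter fun i => σ i < i).card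

theorem apply_mem_blockAt (hp : ∀ i, p (σ i) = p i) (l : ℕ) : ∀ i ∈ blockAt p l, σ i ∈ blockAt p l :=
  fun i hi => by rw [mem_blockAt, hp]; exact mem_blockAt.1 hi

theorem prod_blockFactor (x : ℂ) (hp : ∀ i, 0 < p i) :
    ∏ l ∈ Finset.range (blockNum p), blockFactor x σ p l =
      x ^ (∑ i, crossCount σ (upperPart p (p i - 1)) (blockAt p (p i - 1)) i) *
        (x * (1 - x)) ^ (Finset.univ.filter fun i => σ i < i).card := by
  have h := fun l => Finset.prod_pow_eq_pow_sum (blockAt p l)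
    (fun i => if σ i < i then 1 else 0) (x * (1 - x))
  simp only [blockFactor]
  rw [Finset.prod_mul_distrib]
  simp only [Finset.card_filter, ← Finset.prod_pow_eq_pow_sum]
  rw [prod_blocks hp (fun l i => x ^ crossCount σ (upperPart p l) (blockAt p l) i),
    prod_blocks hp (fun _ i => (x * (1 - x)) ^ (if σ i < i then 1 else 0))]

theorem prod_Ico_mul_inv {K : Type*} [Field K] (f : ℕ → K) (hf : ∀ l, f l ≠ 0) {k m : ℕ}
    (hkm : k ≤ m) : ∏ l ∈ Finset.Ico k m, f l * (f (l + 1))⁻¹ = f k * (f m)⁻¹ := by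
  induction m, hkm using Nat.le_induction with
  | base => simp [mul_inv_cancel₀ (hf k)]
  | succ m hkm ih =>
    rw [Finset.prod_Ico_succ_top hkm, ih, mul_assoc, ← mul_assoc (f m)⁻¹, inv_mul_cancel₀ (hf m),
      one_mul]

/-- Writing $1-q^{-n(l)}=q^{-n(l)}(q^{n(l)}-1)$, the powers $q^{n(l)-n(l+1)}$ telescope to
$q^{n(k)}$, because nothing is left after the last block. -/
theorem tailProd_tailFactor {q : ℂ} (hq : q ≠ 0) (hσ : ∀ i, σ (σ i) = i)
    (hp : ∀ i, p (σ i) = p i) {k : ℕ} (hk : k ≤ blockNum p) :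
    tailProd (tailFactor q⁻¹ σ) p k = (∏ l ∈ Finset.Ico k (blockNum p), blockFactor q⁻¹ σ p l) *
      ((1 - q⁻¹) ^ (∑ l ∈ Finset.Ico k (blockNum p), ((blockAt p l).filter fun i => σ i = i).card) *
        q ^ ((upperPart p k).card * ((upperPart p k).card + 1) / 2) /
        ∏ l ∈ Finset.Ico k (blockNum p),
          (q ^ ((upperPart p l).card * ((upperPart p l).card + 1) / 2) - 1)) := by
  set T : ℕ → ℕ := fun l => (upperPart p l).card * ((upperPart p l).card + 1) / 2 with hT
  have hT0 : T (blockNum p) = 0 := by simp [hT, upperPart_blockNum]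
  have h1 : ∀ l, tailFactor q⁻¹ σ (upperPart p l) (blockAt p l) = blockFactor q⁻¹ σ p l *
      ((1 - q⁻¹) ^ ((blockAt p l).filter fun i => σ i = i).card *
        (q ^ T l * (q ^ T (l + 1))⁻¹) * (q ^ T l - 1)⁻¹) := fun l => by
    rw [tailFactor, passWeight_volWeight hσ (apply_mem_blockAt hp l), upperPart_sdiff_blockAt,
      posCount_zero, posCount_zero, blockFactor]
    change _ * q⁻¹ ^ T (l + 1) / (1 - q⁻¹ ^ T l) = _
    have h2 : 1 - q⁻¹ ^ T l = (q ^ T l - 1) * (q ^ T l)⁻¹ := by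
      rw [sub_mul, mul_inv_cancel₀ (pow_ne_zero _ hq), inv_pow, one_mul]
    rw [h2, inv_pow q (T (l + 1)), div_eq_mul_inv, mul_inv, inv_inv]
    ring
  rw [tailProd, Finset.prod_congr rfl fun l _ => h1 l, Finset.prod_mul_distrib,
    Finset.prod_mul_distrib, Finset.prod_mul_distrib,
    prod_Ico_mul_inv (fun l => q ^ T l) (fun l => pow_ne_zero _ hq) hk, hT0, pow_zero, inv_one,
    mul_one, Finset.prod_pow_eq_pow_sum, Finset.prod_inv_distrib, div_eq_mul_inv]

/-- The levels `a` satisfy the lower bounds given by `b_l(σ, B)`. -/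
def ValidLevels (σ : Equiv.Perm (Fin n)) (e : Fin n → ℕ) (p : Fin n → ℕ) {k : ℕ}
    (a : Fin k → ℤ) : Prop :=
  ∀ l : Fin k, ∀ i ∈ blockAt p l, 0 ≤ (e i : ℤ) + (if i < σ i then 0 else 1) + a l

variable {F : Type*} [Field F] [ValuativeRel F] [TopologicalSpace F]
  [IsNonarchimedeanLocalField F] {ϖ : 𝒪[F]} {α : Fin n → 𝒪[F]ˣ} {e : Fin n → ℕ}
  [MeasurableSpace F] [BorelSpace F] {μ : Measure F} [μ.IsAddHaarMeasure] {ψ : AddChar F Circle}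

theorem headProd_eq_zero (hμ : μ (𝒪[F] : Set F) = 1) (hq : Odd (residueCard F))
    (hψ : Continuous ψ) (hψ0 : HasOrderZero ψ) (hϖ : Irreducible ϖ) (s : ℂ)
    (hσ : ∀ i, σ (σ i) = i) (hp : ∀ i, p (σ i) = p i) {k : ℕ} {a : Fin k → ℤ}
    (ha : ¬ValidLevels σ e p a) :
    headProd (fun a => passWeight (pivotWeight μ (siegelKappa (ϖ : F) s) ψ (diagEntry ϖ α e) a) σ)
      p a = 0 := by
  simp only [ValidLevels, not_forall, not_le] at ha
  obtain ⟨l, i, hi, h⟩ := ha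
  exact Finset.prod_eq_zero (Finset.mem_univ l)
    (passWeight_pivotWeight_eq_zero hμ hq hψ hψ0 hϖ s hσ (apply_mem_blockAt hp l) hi h)

theorem headProd_eq (hμ : μ (𝒪[F] : Set F) = 1) (hq : Odd (residueCard F))
    (hψ : Continuous ψ) (hψ0 : HasOrderZero ψ) (hϖ : Irreducible ϖ) (s : ℂ)
    (hσ : ∀ i, σ (σ i) = i) (hp : ∀ i, p (σ i) = p i) (hp0 : ∀ i, 0 < p i) {k : ℕ} {a : Fin k → ℤ}
    (ha : ValidLevels σ e p a) (ham : StrictMono a) :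
    headProd (fun a => passWeight (pivotWeight μ (siegelKappa (ϖ : F) s) ψ (diagEntry ϖ α e) a) σ)
      p a = gaussConst μ ψ ϖ ^ (n - (upperPart p k).card) *
      (∏ l ∈ Finset.range k, blockFactor (residueCard F : ℂ)⁻¹ σ p l) *
      ∏ l : Fin k, (quadChar (ϖ : F) (-1) ^ (a l * (blockAt p l).card) *
        (qpow F (a l * ((s * (upperPart p l).card -
            ((upperPart p l).card * ((upperPart p l).card + 1) / 2)) -
          (s * (upperPart p (l + 1)).card -
            ((upperPart p (l + 1)).card * ((upperPart p (l + 1)).card + 1) / 2)))) *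
        qpow F (1 / 2 * ∑ i ∈ blockAt p l, rhoAt σ e (a l) i)) *
        ∏ i ∈ (blockAt p l).filter (fun i => σ i = i), xiFactor (residueCard F) (quadChar (ϖ : F))
          (fun k => ((α k : 𝒪[F]) : F)) e i (a l)) := by
  rw [headProd, Finset.prod_range, ← sum_card_blockAt hp0, ← Finset.prod_pow_eq_pow_sum,
    ← Finset.prod_mul_distrib, ← Finset.prod_mul_distrib]
  refine Finset.prod_congr rfl fun l _ => ?_
  rw [passWeight_pivotWeight hμ hq hψ hψ0 hϖ s hσ (blockAt_subset_upperPart p l)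
    (apply_mem_blockAt hp l) (ha l), upperPart_sdiff_blockAt, blockFactor]
  · ring
  -- An index outside the upper part belongs to an earlier block, at a strictly lower level;
  -- admissibility there leaves at most the allowance of one, so $e_i$ plus the present level is
  -- nonnegative.
  · intro i hi
    rw [mem_upperPart, not_lt] at hi
    have h0 := hp0 i
    have h1 := ha ⟨p i - 1, by omega⟩ i (by rw [mem_blockAt]; simp only; omega)
    have h2 := ham (a := ⟨p i - 1, by omega⟩) (b := l) (Fin.lt_def.2 (by simp only; omega))
    split_ifs at h1 <;> omega

/-- Once $L$ exceeds every $e_i$, the truncation at level $-L$ follows from the bounds $-b_l$, and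
positivity of the increments means that the levels strictly increase. -/
theorem mem_nuSet_iff {m k : ℕ} {r : Fin n → Fin m} (hr : Function.Surjective r) (hk : k ≤ m)
    {L : ℕ} (hL : ∀ i, e i + 1 ≤ L) {ν : Fin k → ℤ} :
    ν ∈ nuSet σ e r k ↔ partialSum ν ∈ levelSeqs L k ∧
      ValidLevels σ e (fun i => (r i : ℕ) + 1) (partialSum ν) := by
  have hb : ∀ l : Fin k, -(bMin σ e r l : ℤ) ≤ partialSum ν l ↔
      ∀ i ∈ blockAt (fun i => (r i : ℕ) + 1) l,
        0 ≤ (e i : ℤ) + (if i < σ i then 0 else 1) + partialSum ν l := fun l => by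
    rw [← filter_eq_blockAt]
    constructor
    · intro h i hi
      have h1 : bMin σ e r l ≤ if i < σ i then e i else e i + 1 :=
        Nat.sInf_le ⟨i, (Finset.mem_filter.1 hi).2, rfl⟩
      split_ifs at h1 ⊢ <;> omega
    · intro h
      obtain ⟨i, hi⟩ := hr ⟨l, by omega⟩
      obtain ⟨j, hj, hj'⟩ := Nat.sInf_mem (s := (fun i => if i < σ i then e i else e i + 1) ''
        {i | (r i : ℕ) = l}) ⟨_, i, by simp [hi], rfl⟩
      have h1 := h j (Finset.mem_filter.2 ⟨Finset.mem_univ _, hj⟩)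
      rw [bMin, ← hj']
      split_ifs at h1 ⊢ <;> push_cast <;> omega
  rw [nuSet, Set.mem_setOf_eq, mem_levelSeqs, strictMono_partialSum_iff, ValidLevels]
  refine ⟨fun h => ⟨⟨fun l => ⟨?_, (h.2 l).2⟩, h.1⟩, fun l => (hb l).1 (h.2 l).1⟩,
    fun h => ⟨h.1.2, fun l => ⟨(hb l).2 (h.2 l), (h.1.1 l).2⟩⟩⟩
  obtain ⟨i, hi⟩ := hr ⟨l, by omega⟩
  have h1 := (hb l).1 (h.2 l).1 i (by rw [mem_blockAt]; simp [hi])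
  have := hL i
  split_ifs at h1 <;> omega

theorem sum_nuSet {m k : ℕ} {r : Fin n → Fin m} (hr : Function.Surjective r) (hk : k ≤ m)
    {L : ℕ} (hL : ∀ i, e i + 1 ≤ L) {f : (Fin k → ℤ) → ℂ}
    (hf : ∀ a, ¬ValidLevels σ e (fun i => (r i : ℕ) + 1) a → f a = 0) :
    ∑ a ∈ levelSeqs L k, f a = ∑ ν ∈ (nuSet_finite σ e r k).toFinset, f (partialSum ν) := by
  classical
  rw [← Finset.sum_filter_add_sum_filter_not _ (fun a =>
    ValidLevels σ e (fun i => (r i : ℕ) + 1) a), Finset.sum_eq_zero (s := Finset.filter (fun a => ¬ _) _)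
    fun a ha => hf a (Finset.mem_filter.1 ha).2, add_zero]
  symm
  refine Finset.sum_nbij' partialSum (fun a l => a l - shiftSeq a l) ?_ ?_ ?_ ?_ ?_
  · intro ν hν
    rw [Set.Finite.mem_toFinset, mem_nuSet_iff hr hk hL] at hν
    exact Finset.mem_filter.2 hν
  · intro a ha
    rw [Set.Finite.mem_toFinset, mem_nuSet_iff hr hk hL, partialSum_sub_shiftSeq]
    exact Finset.mem_filter.1 ha
  · exact fun ν _ => funext fun l => shiftSeq_partialSum ν l
  · exact fun a _ => partialSum_sub_shiftSeq a
  · exact fun _ _ => rfl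

theorem cast_nTri {m : ℕ} (r : Fin n → Fin m) (l : ℕ) :
    (nTri r l : ℂ) = (nUpper r l : ℂ) * (nUpper r l + 1) / 2 := by
  rw [nTri, Nat.cast_div (Nat.even_mul_succ_self _).two_dvd (by norm_num)]
  push_cast; rfl

/-- The powers of $q^{-1}$ from crossings and 2-cycles are spread over head and tail; multiplied
over all blocks they give the global factors with $\tau$, $t$ and $c_2$. -/
theorem sum_headProd_tailProd (hμ : μ (𝒪[F] : Set F) = 1) (hq : Odd (residueCard F))
    (hψ : Continuous ψ) (hψ0 : HasOrderZero ψ) (hϖ : Irreducible ϖ) (s : ℂ)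
    (hσ : ∀ i, σ (σ i) = i) {m k : ℕ} (hm : 0 < m) {r : Fin n → Fin m}
    (hr : Function.Surjective r) (hrσ : ∀ i, r (σ i) = r i) (hk : k ≤ m) {L : ℕ}
    (hL : ∀ i, e i + 1 ≤ L) :
    ∑ a ∈ levelSeqs L k,
      headProd (fun a => passWeight (pivotWeight μ (siegelKappa (ϖ : F) s) ψ (diagEntry ϖ α e) a) σ)
        (fun i => (r i : ℕ) + 1) a *
        tailProd (tailFactor (residueCard F : ℂ)⁻¹ σ) (fun i => (r i : ℕ) + 1) k =
    gaussConst μ ψ ϖ ^ (n - nUpper r k) *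
      ((1 - (residueCard F : ℂ)⁻¹) ^ cTwo σ * (residueCard F : ℂ) ^ (-(cTwo σ : ℤ)) *
      ((residueCard F : ℂ) ^ (-(tauPart r : ℤ) - (tPart σ r : ℤ)) *
        ((1 - (residueCard F : ℂ)⁻¹) ^ (∑ l ∈ Finset.Ico k m, cOne σ r l) *
          (residueCard F : ℂ) ^ nTri r k /
          ∏ l ∈ Finset.Ico k m, ((residueCard F : ℂ) ^ nTri r l - 1)) *
        ∑ ν ∈ (nuSet_finite σ e r k).toFinset,
          ∏ l : Fin k,
            (quadChar (ϖ : F) (-1) ^ (ν l * ((nUpper r l : ℤ) - (nUpper r k : ℤ))) *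
            (residueCard F : ℂ) ^ ((ν l : ℂ) * ((s * (nUpper r l : ℂ) - (nTri r l : ℂ)) -
                (s * (nUpper r k : ℂ) - (nTri r k : ℂ))) +
              rhoTilde σ e r l (partialSum ν l)) *
            ∏ i ∈ Finset.univ.filter (fun i => (r i : ℕ) = l ∧ σ i = i),
              xiFactor (residueCard F) (quadChar (ϖ : F))
                (fun i => ((α i : 𝒪[F]) : F)) e i (partialSum ν l)))) := by
  set p : Fin n → ℕ := fun i => (r i : ℕ) + 1 with hp_def
  set q : ℂ := (residueCard F : ℂ) with hq_def
  have hq0 : q ≠ 0 := residueCard_ne_zero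
  have hp0 : ∀ i, 0 < p i := fun i => Nat.succ_pos _
  have hp : ∀ i, p (σ i) = p i := fun i => by simp only [hp_def, hrσ]
  have hbn : blockNum p = m := blockNum_eq hr hm
  have hU : ∀ l, nUpper r l = (upperPart p l).card := nUpper_eq r
  have hfix : ∀ l : ℕ, (Finset.univ.filter fun i => (r i : ℕ) = l ∧ σ i = i) =
      (blockAt p l).filter fun i => σ i = i := fun l => by
    rw [← filter_eq_blockAt, Finset.filter_filter]
  have hpre : (∏ l ∈ Finset.range m, blockFactor q⁻¹ σ p l) =
      (1 - q⁻¹) ^ cTwo σ * q ^ (-(cTwo σ : ℤ)) * q ^ (-(tauPart r : ℤ) - (tPart σ r : ℤ)) := by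
    have h1 := prod_blockFactor (σ := σ) q⁻¹ hp0
    have h2 : ∀ i, p i - 1 = (r i : ℕ) := fun i => rfl
    simp only [h2] at h1
    rw [hbn, sum_crossCount, ← cTwo_eq hσ] at h1
    rw [h1, mul_pow, ← neg_add', ← Nat.cast_add, _root_.zpow_neg, _root_.zpow_neg, zpow_natCast,
      zpow_natCast, inv_pow, inv_pow]
    ring
  rw [← Finset.sum_mul, sum_nuSet hr hk hL fun a ha => headProd_eq_zero hμ hq hψ hψ0 hϖ s hσ hp ha,
    tailProd_tailFactor hq0 hσ hp (hk.trans_eq hbn.symm), hbn]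
  have key : ∀ ν ∈ (nuSet_finite σ e r k).toFinset,
      headProd (fun a => passWeight (pivotWeight μ (siegelKappa (ϖ : F) s) ψ (diagEntry ϖ α e) a) σ)
        p (partialSum ν) = gaussConst μ ψ ϖ ^ (n - nUpper r k) *
      (∏ l ∈ Finset.range k, blockFactor q⁻¹ σ p l) * ∏ l : Fin k,
            (quadChar (ϖ : F) (-1) ^ (ν l * ((nUpper r l : ℤ) - (nUpper r k : ℤ))) *
            q ^ ((ν l : ℂ) * ((s * (nUpper r l : ℂ) - (nTri r l : ℂ)) -
                (s * (nUpper r k : ℂ) - (nTri r k : ℂ))) +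
              rhoTilde σ e r l (partialSum ν l)) *
            ∏ i ∈ Finset.univ.filter (fun i => (r i : ℕ) = l ∧ σ i = i),
              xiFactor (residueCard F) (quadChar (ϖ : F))
                (fun i => ((α i : 𝒪[F]) : F)) e i (partialSum ν l)) := fun ν hν => by
    rw [Set.Finite.mem_toFinset, mem_nuSet_iff hr hk hL] at hν
    rw [headProd_eq hμ hq hψ hψ0 hϖ s hσ hp hp0 hν.2 (mem_levelSeqs.1 hν.1).2, ← hU k]
    congr 1
    simp only [Finset.prod_mul_distrib, hfix]
    congr 1
    have hη : ∀ f : Fin k → ℤ, ∏ l, quadChar (ϖ : F) (-1) ^ f l =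
        quadChar (ϖ : F) (-1) ^ ∑ l, f l := fun f => by
      have h0 := quadChar_ne_zero (ϖ : F) (-1)
      induction (Finset.univ : Finset (Fin k)) using Finset.induction_on with
      | empty => simp
      | insert i t hi ih => rw [Finset.prod_insert hi, Finset.sum_insert hi, ih, zpow_add₀ h0]
    rw [hη, hη]
    congr 1
    -- Summation by parts: $\lambda_l$ times a difference of consecutive values becomes $\nu_l$
    -- times the difference from the value at $k$. The same device treats the powers of $q$ below.
    · have h1 := sum_mul_sub_eq (R := ℤ) ν (fun l => (nUpper r l : ℤ))
      simp only [Int.cast_id] at h1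
      rw [h1]
      congr 1
      refine Finset.sum_congr rfl fun l _ => ?_
      rw [hU, hU, card_upperPart]; push_cast; ring
    · have h1 := sum_mul_sub_eq (R := ℂ) ν (fun l => s * (nUpper r l : ℂ) - (nTri r l : ℂ))
      change _ = ∏ l : Fin k, qpow F _
      rw [← qpow_sum, ← qpow_sum, ← qpow_sum, ← qpow_add, Finset.sum_add_distrib, h1]
      congr 2
      · refine Finset.sum_congr rfl fun l _ => ?_
        rw [cast_nTri, cast_nTri, hU, hU]
      · refine Finset.sum_congr rfl fun l _ => ?_
        rw [rhoTilde, filter_eq_blockAt]; rfl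
  rw [Finset.sum_congr rfl key, ← Finset.mul_sum]
  have hc : ∀ l, cOne σ r l = ((blockAt p l).filter fun i => σ i = i).card := fun l => by
    rw [cOne, hfix]
  have ht : ∀ l, nTri r l = (upperPart p l).card * ((upperPart p l).card + 1) / 2 := fun l => by
    rw [nTri, hU]
  simp only [← hc, ← ht]
  rw [← Finset.prod_range_mul_prod_Ico _ hk] at hpre
  generalize hS : (∑ ν ∈ (nuSet_finite σ e r k).toFinset, _ : ℂ) = S
  generalize ((1 - q⁻¹) ^ (∑ l ∈ Finset.Ico k m, cOne σ r l) * q ^ nTri r k /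
          ∏ l ∈ Finset.Ico k m, (q ^ nTri r l - 1)) = T
  linear_combination (gaussConst μ ψ ϖ ^ (n - nUpper r k) * S * T) * hpre

end TermComparison

/-! ### Assembling the explicit formula -/

section FormulaComparison

variable {n : ℕ}

theorem sum_orderedParts_univ {M : Type*} [AddCommMonoid M] (hn : 1 ≤ n) (σ : Equiv.Perm (Fin n))
    (f : (Fin n → ℕ) → M) :
    ∑ p ∈ orderedParts σ Finset.univ, f p = ∑ m ∈ Finset.Icc 1 n,
      ∑ r ∈ Finset.univ.filter
        (fun r : Fin n → Fin m => Function.Surjective r ∧ ∀ i, r (σ i) = r i),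
        f fun i => (r i : ℕ) + 1 := by
  have hpos : ∀ p ∈ orderedParts σ Finset.univ, ∀ i, 0 < p i := fun p hp i =>
    ((mem_orderedParts.1 hp).1 i).2 (Finset.mem_univ i)
  have hle : ∀ p : Fin n → ℕ, ∀ i, p i ≤ blockNum p := fun p i =>
    Finset.le_sup (f := p) (Finset.mem_univ i)
  rw [← Finset.sum_fiberwise_of_maps_to (g := blockNum) (t := Finset.Icc 1 n) fun p hp => ?_]
  · refine Finset.sum_congr rfl fun m hm => ?_
    have hm0 : 0 < m := (Finset.mem_Icc.1 hm).1
    symm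
    refine Finset.sum_bij' (fun r _ i => (r i : ℕ) + 1) (fun p hp i => ⟨p i - 1, ?_⟩) ?_ ?_ ?_ ?_ ?_
    · obtain ⟨hp, hpm⟩ := Finset.mem_filter.1 hp
      have h1 := hle p i
      have h2 := hpos p hp i
      omega
    · intro r hr
      obtain ⟨-, hr, hrσ⟩ := Finset.mem_filter.1 hr
      refine Finset.mem_filter.2 ⟨mem_orderedParts.2 ⟨fun i => by simp, fun i _ => by rw [hrσ],
        fun i l hl => ?_⟩, blockNum_eq hr hm0⟩
      obtain ⟨j, hj⟩ := hr ⟨l, by have := (r i).2; omega⟩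
      exact ⟨j, by rw [hj]⟩
    · intro p hp
      obtain ⟨hp, hpm⟩ := Finset.mem_filter.1 hp
      obtain ⟨-, h2, h3⟩ := mem_orderedParts.1 hp
      refine Finset.mem_filter.2 ⟨Finset.mem_univ _, fun l => ?_, fun i => ?_⟩
      · obtain ⟨i, -, hi⟩ := Finset.exists_mem_eq_sup Finset.univ ⟨⟨0, hn⟩, Finset.mem_univ _⟩ p
        obtain ⟨j, hj⟩ := h3 i l (by rw [← hi]; exact l.2.trans_eq hpm.symm)
        exact ⟨j, Fin.ext (by simp [hj])⟩
      · exact Fin.ext (by simp only; rw [h2 i (Finset.mem_univ i)])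
    · exact fun r _ => funext fun i => Fin.ext rfl
    · intro p hp
      funext i
      have h2 := hpos p (Finset.mem_filter.1 hp).1 i
      simp only; omega
    · exact fun _ _ => rfl
  · have h1 := hpos p hp ⟨0, hn⟩
    have h2 := hle p ⟨0, hn⟩
    refine Finset.mem_Icc.2 ⟨by omega, Finset.sup_le fun i _ => ?_⟩
    rw [orderedParts, Finset.mem_filter, Fintype.mem_piFinset] at hp
    have := hp.1 i
    rw [Finset.mem_range] at this
    omega

variable {F : Type*} [Field F] [ValuativeRel F] [TopologicalSpace F]
  [IsNonarchimedeanLocalField F] {ϖ : 𝒪[F]} {α : Fin n → 𝒪[F]ˣ} {e : Fin n → ℕ}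
  [MeasurableSpace F] [BorelSpace F] {μ : Measure F} [μ.IsAddHaarMeasure] {ψ : AddChar F Circle}

theorem levelIter_eq_siegelFormula (hn : 1 ≤ n) (hμ : μ (𝒪[F] : Set F) = 1)
    (hq : Odd (residueCard F)) (hψ : Continuous ψ) (hψ0 : HasOrderZero ψ) (hϖ : Irreducible ϖ)
    (t : ℕ) (s : ℂ) {L : ℕ} (hL : ∀ i, e i + 1 ≤ L) :
    levelIter (pivotWeight μ (siegelKappa (ϖ : F) s) ψ (diagEntry ϖ α e))
      (fun k => if k = t then 1 else 0) L Finset.univ =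
      siegelFormula n (residueCard F) (gaussConst μ ψ ϖ) (quadChar (ϖ : F))
        (fun i => ((α i : 𝒪[F]) : F)) e t s := by
  -- As $q>1$, the denominators of the tail factors do not vanish.
  have hx : ∀ k, 0 < k → (residueCard F : ℂ)⁻¹ ^ k ≠ 1 := fun k hk h => by
    have h1 : ‖(residueCard F : ℂ)⁻¹ ^ k‖ < 1 := by
      rw [norm_pow, norm_inv, Complex.norm_natCast]
      refine pow_lt_one₀ (by positivity) (inv_lt_one_of_one_lt₀ ?_) hk.ne'
      exact_mod_cast one_lt_residueCard (F := F)
    rw [h, norm_one] at h1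
    exact lt_irrefl _ h1
  have hset : involOn Finset.univ = Finset.univ.filter (fun σ : Equiv.Perm (Fin n) => σ ^ 2 = 1) := by
    refine Finset.filter_congr fun σ _ => ?_
    simp
  rw [levelIter_eq_sum hx, siegelFormula, hset, Finset.mul_sum]
  refine Finset.sum_congr rfl fun σ hσ => ?_
  have hσ' : ∀ i, σ (σ i) = i := (mem_involOn.1 (hset.symm ▸ hσ : σ ∈ involOn Finset.univ)).1
  rw [chainSum, sum_orderedParts_univ hn, Finset.mul_sum, Finset.mul_sum]
  refine Finset.sum_congr rfl fun m hm => ?_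
  have hm0 : 0 < m := (Finset.mem_Icc.1 hm).1
  rw [Finset.mul_sum, Finset.mul_sum]
  refine Finset.sum_congr rfl fun r hr => ?_
  obtain ⟨-, hr, hrσ⟩ := Finset.mem_filter.1 hr
  rw [blockNum_eq hr hm0, Finset.mul_sum, Finset.mul_sum,
    Finset.filter_congr fun k _ => by rw [← nUpper_eq r k]]
  refine Finset.sum_congr rfl fun k hk => ?_
  obtain ⟨hk1, hk2⟩ := Finset.mem_filter.1 hk
  have hk1 := Nat.le_of_lt_succ (Finset.mem_range.1 hk1)
  rw [sum_headProd_tailProd hμ hq hψ hψ0 hϖ s hσ' hm0 hr hrσ hk1 hL, hk2]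

end FormulaComparison

/-! ### $f_t$ on the big cell satisfies the axioms for $\Phi$ -/

section SymplecticElements

variable {n : ℕ} {F : Type*} [Field F]

theorem sp_eq_fromBlocks (g : Sp n F) : g.1 = Matrix.fromBlocks g.1.toBlocks₁₁ g.1.toBlocks₁₂
    g.1.toBlocks₂₁ g.1.toBlocks₂₂ := (Matrix.fromBlocks_toBlocks _).symm

theorem sp_mul_toBlocks (g h : Sp n F) :
    (g * h).1.toBlocks₂₁ =
      g.1.toBlocks₂₁ * h.1.toBlocks₁₁ + g.1.toBlocks₂₂ * h.1.toBlocks₂₁ ∧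
    (g * h).1.toBlocks₂₂ =
      g.1.toBlocks₂₁ * h.1.toBlocks₁₂ + g.1.toBlocks₂₂ * h.1.toBlocks₂₂ := by
  have h1 : (g * h).1 = g.1 * h.1 := rfl
  rw [h1, sp_eq_fromBlocks g, sp_eq_fromBlocks h, Matrix.fromBlocks_multiply]
  simp

theorem sp_relations (g : Sp n F) :
    g.1.toBlocks₁₁ * g.1.toBlocks₂₂ᵀ - g.1.toBlocks₁₂ * g.1.toBlocks₂₁ᵀ = 1 ∧
      g.1.toBlocks₂₁ * g.1.toBlocks₂₂ᵀ = g.1.toBlocks₂₂ * g.1.toBlocks₂₁ᵀ := by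
  have h := SymplecticGroup.mem_iff.1 g.2
  rw [sp_eq_fromBlocks g, Matrix.J, Matrix.fromBlocks_transpose, Matrix.fromBlocks_multiply,
    Matrix.fromBlocks_multiply, Matrix.fromBlocks_inj] at h
  obtain ⟨-, h2, -, h4⟩ := h
  simp only [Matrix.mul_zero, Matrix.mul_one, zero_add, Matrix.mul_neg, add_zero, Matrix.neg_mul] at h2 h4
  exact ⟨by rw [← neg_neg (1 : Matrix (Fin n) (Fin n) F), ← h2]; abel,
    (sub_eq_zero.1 (by rw [sub_eq_add_neg]; exact h4)).symm⟩

/-- Elements with proportional bottom rows are in the same coset of the Siegel parabolic. -/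
theorem exists_parabolic {g h : Sp n F} {M : Matrix (Fin n) (Fin n) F}
    (hC : g.1.toBlocks₂₁ = M * h.1.toBlocks₂₁) (hD : g.1.toBlocks₂₂ = M * h.1.toBlocks₂₂) :
    ∃ p : Sp n F, p.1.toBlocks₂₁ = 0 ∧ p.1.toBlocks₁₁ * Mᵀ = 1 ∧ g = p * h := by
  have h1 := sp_mul_toBlocks g h⁻¹
  have h2 := sp_mul_toBlocks h h⁻¹
  rw [hC, hD, Matrix.mul_assoc, Matrix.mul_assoc, ← Matrix.mul_add, ← h2.1, Matrix.mul_assoc,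
    Matrix.mul_assoc, ← Matrix.mul_add, ← h2.2, mul_inv_cancel] at h1
  have h3 : (1 : Sp n F).1.toBlocks₂₁ = 0 ∧ (1 : Sp n F).1.toBlocks₂₂ = 1 := by
    have : (1 : Sp n F).1 = Matrix.fromBlocks 1 0 0 1 := Matrix.fromBlocks_one.symm
    rw [this, Matrix.toBlocks_fromBlocks₂₁, Matrix.toBlocks_fromBlocks₂₂]; exact ⟨rfl, rfl⟩
  rw [h3.1, h3.2, Matrix.mul_zero, Matrix.mul_one] at h1
  refine ⟨g * h⁻¹, h1.1, ?_, by rw [inv_mul_cancel_right]⟩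
  have h4 := (sp_relations (g * h⁻¹)).1
  rwa [h1.1, h1.2, transpose_zero, Matrix.mul_zero, sub_zero] at h4

/-- The element `w_S`. -/
def weylSet (F : Type*) [Field F] (S : Finset (Fin n)) : Sp n F :=
  ⟨Matrix.fromBlocks (1 - indMat F S) (-indMat F S) (indMat F S) (1 - indMat F S), by
    have h : indMat F S * indMat F S = indMat F S := by simp [indMat, Matrix.diagonal_mul_diagonal]
    have ht : (indMat F S)ᵀ = indMat F S := Matrix.diagonal_transpose _
    rw [SymplecticGroup.mem_iff, Matrix.J, Matrix.fromBlocks_transpose,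
      Matrix.fromBlocks_multiply, Matrix.fromBlocks_multiply, Matrix.fromBlocks_inj]
    simp only [transpose_sub, transpose_one, transpose_neg, ht, Matrix.mul_zero, Matrix.mul_one,
      zero_add, Matrix.mul_neg, add_zero, Matrix.neg_mul, Matrix.mul_sub, Matrix.sub_mul, h,
      Matrix.one_mul, neg_sub, sub_self]
    refine ⟨?_, ?_, ?_, ?_⟩
    all_goals first | trivial | abel1⟩

/-- The element `(1 0; X 1)`. -/
def lowElt (X : Matrix (Fin n) (Fin n) F) (hX : X.IsSymm) : Sp n F :=
  ⟨Matrix.fromBlocks 1 0 X 1, by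
    rw [SymplecticGroup.mem_iff, Matrix.J, Matrix.fromBlocks_transpose,
      Matrix.fromBlocks_multiply, Matrix.fromBlocks_multiply, Matrix.fromBlocks_inj]
    simp [hX.eq]⟩

/-- The element `(U 0; 0 U⁻ᵀ)`. -/
def leviElt (U V : Matrix (Fin n) (Fin n) F) (h : U * V = 1) : Sp n F :=
  ⟨Matrix.fromBlocks U 0 0 Vᵀ, by
    have h2 : Vᵀ * Uᵀ = 1 := by rw [← transpose_mul, h, transpose_one]
    rw [SymplecticGroup.mem_iff, Matrix.J, Matrix.fromBlocks_transpose,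
      Matrix.fromBlocks_multiply, Matrix.fromBlocks_multiply, Matrix.fromBlocks_inj]
    simp [h, h2]⟩

/-- The last `i` indices. -/
def lastSet (n i : ℕ) : Finset (Fin n) := Finset.univ.filter fun j => n - i ≤ (j : ℕ)

theorem card_lastSet {i : ℕ} (hi : i ≤ n) : (lastSet n i).card = i := by
  have h1 : (lastSet n i).card + (Finset.univ.filter fun j : Fin n => (j : ℕ) < n - i).card = n := by
    have h := Finset.card_filter_add_card_filter_not (s := Finset.univ)
      (fun j : Fin n => n - i ≤ (j : ℕ))
    simp only [not_le, Finset.card_univ, Fintype.card_fin] at h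
    exact h
  rw [Fin.card_filter_val_lt] at h1
  omega

theorem weylElt_eq (i : ℕ) : weylElt n F i = weylSet F (lastSet n i) := by
  refine Subtype.ext ?_
  have h1 : (Matrix.diagonal fun j : Fin n => if (j : ℕ) < n - i then (0 : F) else 1) =
      indMat F (lastSet n i) := by
    refine congrArg _ (funext fun j => ?_)
    simp only [lastSet, Finset.mem_filter, Finset.mem_univ, true_and]
    split_ifs <;> first | rfl | omega
  have h2 : (Matrix.diagonal fun j : Fin n => if (j : ℕ) < n - i then (1 : F) else 0) =
      1 - indMat F (lastSet n i) := by
    rw [← h1, ← Matrix.diagonal_one, Matrix.diagonal_sub]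
    refine congrArg _ (funext fun j => ?_)
    split_ifs <;> simp
  rw [weylElt, weylSet]
  simp only [h1, h2]

theorem weylElt_self : weylElt n F n = weylSet F Finset.univ := by
  rw [weylElt_eq]
  congr 1
  exact Finset.filter_true_of_mem fun j _ => by omega

theorem indMat_univ : indMat F (Finset.univ : Finset (Fin n)) = 1 := by simp [indMat]

variable [ValuativeRel F] [TopologicalSpace F] [IsNonarchimedeanLocalField F]

theorem valuation_lt_one_of_mem {x : F} (h : x ∈ pw F 1) : valuation F x < 1 := by
  by_cases h0 : x = 0
  · rw [h0]; simp
  · rw [← ordVal_lt_one_iff, ordVal_eq_exp h0, ← WithZero.exp_zero, WithZero.exp_lt_exp]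
    have := (mem_pw_iff_ord h0).1 h
    omega

theorem lowElt_mem_gammaSet {X : Matrix (Fin n) (Fin n) F} (hX : X.IsSymm)
    (h : ∀ a b, X a b ∈ pw F 1) : lowElt X hX ∈ gammaSet n F := by
  have hv : ∀ a b, valuation F (X a b) < 1 := fun a b => valuation_lt_one_of_mem (h a b)
  refine ⟨?_, hv⟩
  rintro (i | i) (j | j)
  · change (1 : Matrix (Fin n) (Fin n) F) i j ∈ _
    rw [Matrix.one_apply]; split_ifs <;> simp
  · exact zero_mem _
  · exact (hv i j).le
  · change (1 : Matrix (Fin n) (Fin n) F) i j ∈ _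
    rw [Matrix.one_apply]; split_ifs <;> simp

theorem leviElt_mem_gammaSet {U V : Matrix (Fin n) (Fin n) F} (h : U * V = 1)
    (hU : ∀ a b, U a b ∈ 𝒪[F]) (hV : ∀ a b, V a b ∈ 𝒪[F]) : leviElt U V h ∈ gammaSet n F := by
  refine ⟨?_, fun i j => ?_⟩
  · rintro (i | i) (j | j)
    exacts [hU i j, zero_mem _, zero_mem _, hV j i]
  · change valuation F 0 < 1
    simp

theorem unipElt_mem_gammaSet {X : SymMat n F}
    (h : ∀ a b, (X : Matrix (Fin n) (Fin n) F) a b ∈ 𝒪[F]) : unipElt X ∈ gammaSet n F := by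
  refine ⟨?_, fun i j => ?_⟩
  · rintro (i | i) (j | j)
    · change (1 : Matrix (Fin n) (Fin n) F) i j ∈ _
      rw [Matrix.one_apply]; split_ifs <;> simp
    · exact h i j
    · exact zero_mem _
    · change (1 : Matrix (Fin n) (Fin n) F) i j ∈ _
      rw [Matrix.one_apply]; split_ifs <;> simp
  · change valuation F 0 < 1
    simp

theorem normAbs_cpow {x : F} (hx : x ≠ 0) (s : ℂ) : (normAbs x : ℂ) ^ s = qpow F (-(ord x) * s) := by
  have h1 : Complex.log (residueCard F : ℂ) = (Real.log (residueCard F) : ℝ) := Complex.natCast_log.symm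
  have h2 : (Complex.log (residueCard F : ℂ) * (-(ord x : ℂ))).im = 0 := by
    rw [h1, ← Int.cast_neg, ← Complex.ofReal_intCast, ← Complex.ofReal_mul, Complex.ofReal_im]
  rw [normAbs_eq hx, qpow, Complex.cpow_mul _ (by rw [h2]; exact neg_lt_zero.2 Real.pi_pos)
    (by rw [h2]; exact Real.pi_pos.le), ← Int.cast_neg, Complex.cpow_intCast]
  push_cast; rfl

variable {ϖ : 𝒪[F]} {s : ℂ} {f : Sp n F → ℂ}

/-- Modulo the unipotent radical only the bottom rows matter. The parabolic factor has $\det A=(\det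
M)^{-1}$, which turns $\chi(\det A)|\det A|^s$ into $\kappa(\det M)$. -/
theorem MemInduced.apply_of_bottom (hq : Odd (residueCard F)) (hϖ : Irreducible ϖ)
    (hf : MemInduced (quadChar (ϖ : F)) (s - ((n : ℂ) + 1) / 2) f) {g h : Sp n F}
    {M : Matrix (Fin n) (Fin n) F} (hC : g.1.toBlocks₂₁ = M * h.1.toBlocks₂₁)
    (hD : g.1.toBlocks₂₂ = M * h.1.toBlocks₂₂) : f g = siegelKappa (ϖ : F) s M.det * f h := by
  obtain ⟨p, hp0, hpM, rfl⟩ := exists_parabolic hC hD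
  have h1 : p.1.toBlocks₁₁.det * M.det = 1 := by
    rw [← Matrix.det_transpose M, ← Matrix.det_mul, hpM, Matrix.det_one]
  have h2 : M.det ≠ 0 := right_ne_zero_of_mul_eq_one h1
  rw [hf.2 p h hp0, eq_inv_of_mul_eq_one_left h1, quadChar_inv hq hϖ h2, normAbs_cpow (inv_ne_zero h2),
    ord_inv, siegelKappa, sub_add_cancel, Int.cast_neg, neg_neg]

theorem siegelKappa_mul (hq : Odd (residueCard F)) (hϖ : Irreducible ϖ) (s : ℂ) {x y : F}
    (hx : x ≠ 0) (hy : y ≠ 0) :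
    siegelKappa (ϖ : F) s (x * y) = siegelKappa (ϖ : F) s x * siegelKappa (ϖ : F) s y := by
  rw [siegelKappa, siegelKappa, siegelKappa, quadChar_mul hq hϖ hx hy, ord_mul hx hy, Int.cast_add,
    add_mul, qpow_add]
  ring

theorem siegelKappa_of_ord_eq_zero {x : F} (hx : ord x = 0) :
    siegelKappa (ϖ : F) s x = quadChar (ϖ : F) x := by
  rw [siegelKappa, hx, Int.cast_zero, zero_mul, qpow_zero, mul_one]

theorem ord_eq_zero_of_mul_eq_one {x y : F} (hx : x ∈ 𝒪[F]) (hy : y ∈ 𝒪[F]) (h : x * y = 1) :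
    ord x = 0 := by
  have hx0 := left_ne_zero_of_mul_eq_one h
  have hy0 := right_ne_zero_of_mul_eq_one h
  have h1 := ord_mul hx0 hy0
  rw [h, ord_one] at h1
  rw [← mem_pw_zero, mem_pw_iff_ord hx0] at hx
  rw [← mem_pw_zero, mem_pw_iff_ord hy0] at hy
  omega

theorem det_mem_integer {M : Matrix (Fin n) (Fin n) F} (h : ∀ a b, M a b ∈ 𝒪[F]) : M.det ∈ 𝒪[F] := by
  rw [Matrix.det_apply]
  exact sum_mem fun σ _ => zsmul_mem (prod_mem fun i _ => h _ _) _

variable (hq : Odd (residueCard F)) (hϖ : Irreducible ϖ)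

include hq hϖ in
/-- `f(w_S)` depends only on `#S`. -/
theorem apply_weylSet {t : ℕ} (hf : IsBasisVector (quadChar (ϖ : F)) t s f) (S : Finset (Fin n)) :
    f (weylSet F S) = if S.card = t then 1 else 0 := by
  have hS : S.card ≤ n := by simpa using S.card_le_univ
  rw [← hf.2 _ hS, weylElt_eq]
  set T := lastSet n S.card
  have e : S ≃ T := Finset.equivOfCardEq (card_lastSet hS).symm
  -- The permutation matrix carrying $S$ to the last indices lies both in $P$ and, through the Levi
  -- subgroup, in $\Gamma$; the two factors $\chi(\det P)$ cancel.
  set π : Equiv.Perm (Fin n) := Equiv.extendSubtype e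
  have hπ : ∀ k, π k ∈ T ↔ k ∈ S := fun k => ⟨fun h => by
    by_contra hk; exact Equiv.extendSubtype_not_mem e k hk h, fun h => Equiv.extendSubtype_mem e k h⟩
  set P := colMat F π
  have hPP : P * Pᵀ = 1 := mul_eq_one_comm.1 (colMat_transpose_mul_self π.injective)
  have hP : ∀ a b, P a b ∈ 𝒪[F] := fun a b => by
    simp only [P, colMat, of_apply]; split_ifs <;> simp
  have hE : indMat F T * P = P * indMat F S := by
    ext a b
    simp only [indMat_mul, indMat, Matrix.mul_diagonal, of_apply, P, colMat]
    by_cases hab : a = π b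
    · subst hab; simp [hπ]
    · simp [hab]
  have hb : (weylSet F T * leviElt P Pᵀ hPP).1.toBlocks₂₁ = P * (weylSet F S).1.toBlocks₂₁ ∧
      (weylSet F T * leviElt P Pᵀ hPP).1.toBlocks₂₂ = P * (weylSet F S).1.toBlocks₂₂ := by
    rw [(sp_mul_toBlocks _ _).1, (sp_mul_toBlocks _ _).2]
    simp [weylSet, leviElt, hE, Matrix.sub_mul, Matrix.mul_sub]
  have hdet : P.det * P.det = 1 := by
    have := congrArg Matrix.det hPP
    rwa [Matrix.det_mul, Matrix.det_transpose, Matrix.det_one] at this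
  have h1 := hf.1.1.apply_of_bottom hq hϖ hb.1 hb.2
  rw [siegelKappa_of_ord_eq_zero (ord_eq_zero_of_mul_eq_one (det_mem_integer hP)
    (det_mem_integer hP) hdet), hf.1.2 _ _ (leviElt_mem_gammaSet hPP hP fun a b => hP b a)] at h1
  have h2 : (leviElt P Pᵀ hPP).1.toBlocks₂₂ = P := by simp [leviElt]
  rw [h2] at h1
  exact (mul_left_cancel₀ (quadChar_ne_zero _ _) h1).symm

include hq hϖ in
/-- The restriction of `f_t` to the big cell, in terms of the symmetric matrix `X`. -/
theorem siegelKernel_of_isBasisVector {t : ℕ} (hf : IsBasisVector (quadChar (ϖ : F)) t s f) :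
    SiegelKernel (fun X : Matrix (Fin n) (Fin n) F =>
      open scoped Classical in
      if hX : X.IsSymm then f (weylElt n F n * unipElt ⟨X, hX⟩) else 0)
      (siegelKappa (ϖ : F) s) fun k => if k = t then 1 else 0 where
  mul _ _ := siegelKappa_mul hq hϖ s
  add_integral X Y hX hY hYi := by
    have hYm : unipElt ⟨Y, hY⟩ ∈ gammaSet n F := unipElt_mem_gammaSet fun a b => mem_pw_zero.1 (hYi a b)
    have h1 : unipElt ⟨X + Y, hX.add hY⟩ = unipElt ⟨X, hX⟩ * unipElt (⟨Y, hY⟩ : SymMat n F) := by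
      refine Subtype.ext ?_
      change fromBlocks _ _ _ _ = fromBlocks _ _ _ _ * fromBlocks _ _ _ _
      rw [Matrix.fromBlocks_multiply]
      simp [add_comm]
    have h2 : (unipElt (⟨Y, hY⟩ : SymMat n F)).1.toBlocks₂₂ = 1 := by simp [unipElt]
    rw [dif_pos (hX.add hY), dif_pos hX, h1, ← mul_assoc, hf.1.2 _ _ hYm, h2, Matrix.det_one,
      quadChar_one, one_mul]
  congr X U V hX hU hV hUV := by
    have hX' : (U * X * Uᵀ).IsSymm := by
      rw [Matrix.IsSymm, transpose_mul, transpose_mul, transpose_transpose, hX.eq, Matrix.mul_assoc]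
    have hVU : V * U = 1 := mul_eq_one_comm.1 hUV
    have hVt : Uᵀ * Vᵀ = 1 := by rw [← transpose_mul, hVU, transpose_one]
    have hb := sp_mul_toBlocks (weylElt n F n * unipElt ⟨X, hX⟩) (leviElt V U hVU)
    have hb2 := fun X : SymMat n F => sp_mul_toBlocks (weylElt n F n) (unipElt X)
    have hw : (weylElt n F n).1.toBlocks₂₁ = 1 ∧ (weylElt n F n).1.toBlocks₂₂ = 0 := by
      rw [weylElt_self]; simp [weylSet, indMat_univ]
    have hlev : (leviElt V U hVU).1.toBlocks₂₂ = Uᵀ := by simp [leviElt]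
    simp only [hb2, hw, Matrix.one_mul, Matrix.zero_mul, add_zero] at hb
    -- The bottom rows on the left are $(V,\ X\,{}^tU)=V\,(1,\ UX\,{}^tU)$, because $VU=1$.
    have h1 := hf.1.1.apply_of_bottom hq hϖ (g := weylElt n F n * unipElt ⟨X, hX⟩ * leviElt V U hVU)
      (h := weylElt n F n * unipElt ⟨_, hX'⟩) (M := V)
      (by rw [hb.1, (hb2 _).1, hw.1, hw.2]; simp [unipElt, leviElt])
      (by rw [hb.2, (hb2 _).2, hw.1, hw.2]
          simp [unipElt, leviElt, ← Matrix.mul_assoc, hVU])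
    have hdet : V.det * U.det = 1 := by rw [← Matrix.det_mul, hVU, Matrix.det_one]
    have hUi := fun a b => mem_pw_zero.1 (hU a b)
    have hVi := fun a b => mem_pw_zero.1 (hV a b)
    rw [hf.1.2 _ _ (leviElt_mem_gammaSet hVU hVi hUi), hlev, Matrix.det_transpose,
      siegelKappa_of_ord_eq_zero (ord_eq_zero_of_mul_eq_one (det_mem_integer hVi)
      (det_mem_integer hUi) hdet), eq_inv_of_mul_eq_one_left hdet,
      quadChar_inv hq hϖ (right_ne_zero_of_mul_eq_one hdet)] at h1
    rw [dif_pos hX', dif_pos hX]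
    exact (mul_left_cancel₀ (quadChar_ne_zero _ _) h1).symm
  regular J D hD := by
    have hDE := hD.mul_eq
    obtain ⟨hs, hJ, D', hs', hJ', hp, hDD⟩ := hD
    have hED : indMat F J * D' = 0 := by
      rw [indMat_mul]; ext a b
      simp only [of_apply, Matrix.zero_apply]
      split_ifs with h
      exacts [hJ' a h b, rfl]
    have hEE : indMat F J * indMat F J = indMat F J := by simp [indMat, Matrix.diagonal_mul_diagonal]
    have hw : (weylElt n F n).1.toBlocks₂₁ = 1 ∧ (weylElt n F n).1.toBlocks₂₂ = 0 := by
      rw [weylElt_self]; simp [weylSet, indMat_univ]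
    -- With $M=D+1_J$ one has $M(1_J+(1-1_J)D')=1_J+DD'=1$ and $M(1-1_J)=D$, so the bottom rows
    -- $(1,D)$ are $M$ times those of $w_J(1\ 0;D'\ 1)$. The last factor lies in $\Gamma$ as
    -- $D'\equiv0$ mod $\mathfrak p$.
    have h1 := hf.1.1.apply_of_bottom hq hϖ (g := weylElt n F n * unipElt ⟨D, hs⟩)
      (h := weylSet F J * lowElt D' hs') (M := D + indMat F J)
      (by rw [(sp_mul_toBlocks _ _).1, (sp_mul_toBlocks _ _).1, hw.1, hw.2]
          simp [weylSet, lowElt, unipElt, Matrix.mul_add, Matrix.add_mul, Matrix.sub_mul, hDE, hED,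
            hDD, hEE])
      (by rw [(sp_mul_toBlocks _ _).2, (sp_mul_toBlocks _ _).2, hw.1, hw.2]
          simp [weylSet, lowElt, unipElt, Matrix.mul_sub, Matrix.add_mul, hDE, hEE])
    have h2 : (lowElt D' hs').1.toBlocks₂₂ = 1 := by simp [lowElt]
    rw [dif_pos hs, h1, hf.1.2 _ _ (lowElt_mem_gammaSet hs' hp), h2, Matrix.det_one, quadChar_one,
      one_mul, apply_weylSet hq hϖ hf]

end SymplecticElements

/-! ### The double cosets $P\backslash G/\Gamma$ and uniqueness of $f_t$ -/

section DoubleCosets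

variable {n : ℕ} {F : Type*} [Field F]

/-- The minor of `(C D)` with the columns of `C` in `S` and those of `D` outside `S`. -/
def mixedMat (g : Sp n F) (S : Finset (Fin n)) : Matrix (Fin n) (Fin n) F :=
  g.1.toBlocks₂₁ * indMat F S + g.1.toBlocks₂₂ * (1 - indMat F S)

theorem indMat_mul_self (S : Finset (Fin n)) : indMat F S * indMat F S = indMat F S := by
  simp [indMat, Matrix.diagonal_mul_diagonal]

theorem mixedMat_apply (g : Sp n F) (S : Finset (Fin n)) (a b : Fin n) :
    mixedMat g S a b = if b ∈ S then g.1.toBlocks₂₁ a b else g.1.toBlocks₂₂ a b := by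
  rw [mixedMat, Matrix.mul_sub, Matrix.mul_one]
  simp only [indMat, Matrix.add_apply, Matrix.sub_apply, Matrix.mul_diagonal]
  split_ifs <;> simp

/-- Let $S$ index a basis of the column space of $C$. If $v$ annihilates the mixed matrix, then
$vC=0$ and $u=vD$ is supported on $S$; from $C\,{}^tD=D\,{}^tC$ one gets $Cu=0$, so $u=0$ by
independence. As $(C\ D)$ has full rank, $v=0$. -/
theorem exists_det_mixedMat_ne_zero (g : Sp n F) : ∃ S, (mixedMat g S).det ≠ 0 := by
  classical
  set C := g.1.toBlocks₂₁ with hC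
  set D := g.1.toBlocks₂₂ with hD
  obtain ⟨b, -, -, hspan, hli⟩ := exists_linearIndepOn_extension (K := F) (v := fun j a => C a j)
    (linearIndepOn_empty F _) (Set.empty_subset Set.univ)
  refine ⟨Finset.univ.filter (· ∈ b), fun h0 => ?_⟩
  obtain ⟨v, hv0, hv⟩ := Matrix.exists_vecMul_eq_zero_iff.2 h0
  have hvM : ∀ j, ∑ a, v a * mixedMat g (Finset.univ.filter (· ∈ b)) a j = 0 := fun j => congrFun hv j
  simp only [mixedMat_apply, Finset.mem_filter, Finset.mem_univ, true_and] at hvM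
  have hvC : v ᵥ* C = 0 := by
    funext j
    have h1 := hspan ⟨j, Set.mem_univ j, rfl⟩
    change ∑ a, v a * C a j = 0
    have h2 : ∀ w ∈ Submodule.span F ((fun j a => C a j) '' b), ∑ a, v a * w a = 0 := fun w hw => by
      induction hw using Submodule.span_induction with
      | mem w hw =>
        obtain ⟨k, hk, rfl⟩ := hw
        have := hvM k
        simpa only [if_pos hk] using this
      | zero => simp
      | add x y _ _ hx hy => simp only [Pi.add_apply, mul_add, Finset.sum_add_distrib, hx, hy, add_zero]
      | smul c x _ hx =>
        simp only [Pi.smul_apply, smul_eq_mul, mul_left_comm _ c, ← Finset.mul_sum, hx, mul_zero]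
    exact h2 _ h1
  have hu : ∀ j ∉ b, (v ᵥ* D) j = 0 := fun j hj => by
    have := hvM j
    simp only [if_neg hj] at this
    exact this
  have hCu : C *ᵥ (v ᵥ* D) = 0 := by
    rw [← Matrix.mulVec_transpose D, Matrix.mulVec_mulVec, (sp_relations g).2, ← Matrix.mulVec_mulVec,
      Matrix.mulVec_transpose, hvC, Matrix.mulVec_zero]
  have hvD : v ᵥ* D = 0 := by
    rw [linearIndepOn_iff'] at hli
    funext j
    by_cases hj : j ∈ b
    · refine hli (Finset.univ.filter (· ∈ b)) (v ᵥ* D) (fun i hi => (Finset.mem_filter.1 hi).2) ?_ j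
        (Finset.mem_filter.2 ⟨Finset.mem_univ _, hj⟩)
      funext a
      rw [Finset.sum_apply, Finset.sum_filter_of_ne fun j _ hj => ?_]
      · refine (Finset.sum_congr rfl fun j _ => ?_).trans (congrFun hCu a)
        simp only [Pi.smul_apply, smul_eq_mul]; exact mul_comm _ _
      · by_contra hjb
        exact hj (by simp [hu j hjb])
    · exact hu j hj
  have h1 := congrArg Matrix.transpose (sp_relations g).1
  rw [transpose_sub, transpose_mul, transpose_mul, transpose_transpose, transpose_transpose,
    transpose_one] at h1
  refine hv0 ?_
  rw [← Matrix.vecMul_one v, ← h1, Matrix.vecMul_sub, ← Matrix.vecMul_vecMul, ← Matrix.vecMul_vecMul,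
    ← hC, ← hD, hvC, hvD, Matrix.zero_vecMul, Matrix.zero_vecMul, sub_zero]

theorem coe_weylSet_inv (S : Finset (Fin n)) : ((weylSet F S)⁻¹).1 =
    fromBlocks (1 - indMat F S) (indMat F S) (-indMat F S) (1 - indMat F S) := by
  have ht : (indMat F S)ᵀ = indMat F S := Matrix.diagonal_transpose _
  change (-Matrix.J _ F) * (fromBlocks _ _ _ _)ᵀ * Matrix.J _ F = _
  rw [Matrix.J, Matrix.fromBlocks_transpose, Matrix.fromBlocks_neg, Matrix.fromBlocks_multiply,
    Matrix.fromBlocks_multiply]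
  simp [ht]

/-- Principal minors of `Y`, as determinants of full size. -/
theorem det_one_add_mul_indMat {m : ℕ} (f : Fin m → Fin n) (hf : Function.Injective f)
    (Y : Matrix (Fin n) (Fin n) F) :
    (1 + (Y - 1) * indMat F (Finset.univ.image f)).det = (Y.submatrix f f).det := by
  have h1 := colMat_mul_transpose (F := F) hf (J := Finset.univ.image f) (K := ∅) (by simp)
    (fun a => by simp [eq_comm])
  have h2 : indMat F (∅ : Finset (Fin n)) = 0 := by simp [indMat]
  rw [h2, sub_zero] at h1
  rw [← h1, ← Matrix.mul_assoc, Matrix.det_one_add_mul_comm]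
  congr 1
  rw [Matrix.sub_mul, Matrix.one_mul, Matrix.mul_sub, colMat_transpose_mul_self hf, add_sub_cancel]
  ext k l
  rw [colMat_transpose_mul]
  simp [Matrix.mul_apply, colMat]

variable [ValuativeRel F] [TopologicalSpace F] [IsNonarchimedeanLocalField F]

/-- A square has even order, so order at least $2m-1$ already means at least $2m$. -/
theorem mem_pw_of_mul_self {x : F} {m : ℤ} (h : x * x ∈ pw F (2 * m - 1)) : x ∈ pw F m := by
  by_cases hx : x = 0
  · rw [hx]; exact zero_mem _
  · rw [mem_pw_iff_ord (mul_ne_zero hx hx), ord_mul hx hx] at h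
    rw [mem_pw_iff_ord hx]; omega

/-- `G` is the union of the cosets `P w_S (1 0; X 1) ∩ P w_S Γ`. -/
theorem exists_reduced (g : Sp n F) : ∃ S : Finset (Fin n), ∃ X : Matrix (Fin n) (Fin n) F,
    ∃ hX : X.IsSymm, ∃ M : Matrix (Fin n) (Fin n) F,
      g.1.toBlocks₂₁ = M * (lowElt X hX * weylSet F S).1.toBlocks₂₁ ∧
      g.1.toBlocks₂₂ = M * (lowElt X hX * weylSet F S).1.toBlocks₂₂ ∧
      (∀ a b, X a b ∈ pw F 0) ∧ ∀ a ∉ S, ∀ b ∉ S, X a b ∈ pw F 1 := by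
  classical
  -- A lexicographic choice: first the smallest order of the minor, then the largest $S$. The factor
  -- $n+1$ exceeds every cardinality, so the order takes precedence.
  obtain ⟨S, hS, hmin⟩ := Finset.exists_min_image
    (Finset.univ.filter fun S => (mixedMat g S).det ≠ 0)
    (fun S => ord (mixedMat g S).det * ((n : ℤ) + 1) - S.card) (by
      obtain ⟨S, hS⟩ := exists_det_mixedMat_ne_zero g
      exact ⟨S, Finset.mem_filter.2 ⟨Finset.mem_univ _, hS⟩⟩)
  have hS := (Finset.mem_filter.1 hS).2
  set C := g.1.toBlocks₂₁ with hC
  set D := g.1.toBlocks₂₂ with hD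
  set E := indMat F S with hE
  have hEE : E * E = E := indMat_mul_self S
  set M := mixedMat g S with hM
  have hMu : IsUnit M.det := isUnit_iff_ne_zero.2 hS
  have hg0 := sp_mul_toBlocks g (weylSet F S)⁻¹
  rw [coe_weylSet_inv] at hg0
  simp only [toBlocks_fromBlocks₁₁, toBlocks_fromBlocks₁₂, toBlocks_fromBlocks₂₁,
    toBlocks_fromBlocks₂₂, ← hE, ← hC, ← hD] at hg0
  set C0 := C * (1 - E) + D * -E with hC0
  have hMD : C * E + D * (1 - E) = M := rfl
  rw [hMD] at hg0
  have hsym := (sp_relations (g * (weylSet F S)⁻¹)).2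
  rw [hg0.1, hg0.2] at hsym
  set X := M⁻¹ * C0 with hXdef
  have hMX : M * X = C0 := Matrix.mul_nonsing_inv_cancel_left _ _ hMu
  have hX : X.IsSymm := by
    rw [Matrix.IsSymm, hXdef, transpose_mul, transpose_nonsing_inv]
    have hMt : IsUnit Mᵀ.det := by rwa [Matrix.det_transpose]
    calc C0ᵀ * (Mᵀ)⁻¹ = M⁻¹ * (M * C0ᵀ) * (Mᵀ)⁻¹ := by
          rw [Matrix.nonsing_inv_mul_cancel_left _ _ hMu]
      _ = M⁻¹ * C0 := by rw [← hsym, Matrix.mul_assoc, Matrix.mul_nonsing_inv_cancel_right _ _ hMt]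
  have hCX : C = M * (X * (1 - E) + E) := by
    rw [Matrix.mul_add, ← Matrix.mul_assoc, hMX, hC0, ← hMD]
    simp only [Matrix.add_mul, Matrix.mul_sub, Matrix.sub_mul, Matrix.mul_one, Matrix.mul_assoc, hEE,
      Matrix.mul_neg, Matrix.neg_mul]
    abel
  have hDX : D = M * (X * -E + (1 - E)) := by
    rw [Matrix.mul_add, ← Matrix.mul_assoc, hMX, hC0, ← hMD]
    simp only [Matrix.add_mul, Matrix.mul_sub, Matrix.sub_mul, Matrix.mul_one, Matrix.mul_assoc, hEE,
      Matrix.mul_neg, Matrix.neg_mul]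
    abel
  -- $X$ with the columns in $S$ negated; this absorbs the sign of $w_S$, and its minors agree with
  -- those of $X$ up to sign.
  set Y : Matrix (Fin n) (Fin n) F := X * (1 - 2 • E) with hY
  have hYa : ∀ a b, Y a b = if b ∈ S then -X a b else X a b := fun a b => by
    have : (1 - 2 • E) = Matrix.diagonal fun b => if b ∈ S then (-1 : F) else 1 := by
      rw [hE, indMat, ← Matrix.diagonal_one, ← Matrix.diagonal_smul, Matrix.diagonal_sub]
      congr 1; funext b
      simp only [Pi.smul_apply]
      split_ifs <;> norm_num
    rw [hY, this, Matrix.mul_diagonal]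
    split_ifs <;> simp
  have hdet : ∀ T : Finset (Fin n), (mixedMat g (symmDiff S T)).det =
      M.det * (1 + (Y - 1) * indMat F T).det := fun T => by
    rw [← Matrix.det_mul]
    congr 1
    have hEST : indMat F (symmDiff S T) = E + indMat F T - 2 • (E * indMat F T) := by
      rw [hE, indMat, indMat, indMat, Matrix.diagonal_mul_diagonal, Matrix.diagonal_add,
        ← Matrix.diagonal_smul, Matrix.diagonal_sub]
      congr 1; funext b
      simp only [Finset.mem_symmDiff, Pi.smul_apply]
      by_cases h1 : b ∈ S <;> by_cases h2 : b ∈ T <;> simp [h1, h2]; norm_num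
    have hEN : E * (E * indMat F T) = E * indMat F T := by rw [← Matrix.mul_assoc, hEE]
    rw [mixedMat, ← hC, ← hD, hEST, hCX, hDX, Matrix.mul_assoc M, Matrix.mul_assoc M, ← Matrix.mul_add M,
      hY]
    congr 1
    simp only [Matrix.add_mul, Matrix.mul_sub, Matrix.sub_mul, Matrix.mul_one, Matrix.one_mul,
      Matrix.mul_assoc, hEE, hEN, Matrix.mul_add, Matrix.mul_neg, Matrix.neg_mul, Matrix.smul_mul,
      Matrix.mul_smul]
    abel
  -- Exchanging the columns in $T$ multiplies the chosen minor by the principal minor of $Y$ on $T$.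
  -- By minimality this is integral; a unit minor on a nonempty $T$ disjoint from $S$ would allow a
  -- larger $S$ at the same order.
  have hminor : ∀ {m : ℕ} (f : Fin m → Fin n), Function.Injective f →
      (Y.submatrix f f).det ∈ pw F 0 ∧ ((∀ k, f k ∉ S) → 0 < m → (Y.submatrix f f).det ∈ pw F 1) :=
      fun {m} f hf => by
    by_cases h0 : (Y.submatrix f f).det = 0
    · rw [h0]; exact ⟨zero_mem _, fun _ _ => zero_mem _⟩
    have h1 := hdet (Finset.univ.image f)
    rw [det_one_add_mul_indMat f hf] at h1
    have h2 := hmin (symmDiff S (Finset.univ.image f)) (Finset.mem_filter.2 ⟨Finset.mem_univ _, by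
      rw [h1]; exact mul_ne_zero hS h0⟩)
    rw [h1, ord_mul hS h0] at h2
    have h3 : S.card ≤ n := by simpa using S.card_le_univ
    rw [mem_pw_iff_ord h0, mem_pw_iff_ord h0]
    refine ⟨?_, fun h4 h5 => ?_⟩
    · by_contra h6
      have : ord (Y.submatrix f f).det * ((n : ℤ) + 1) ≤ (-1) * ((n : ℤ) + 1) :=
        mul_le_mul_of_nonneg_right (by omega) (by omega)
      rw [add_mul] at h2
      omega
    · by_contra h6
      have : ord (Y.submatrix f f).det * ((n : ℤ) + 1) ≤ 0 * ((n : ℤ) + 1) :=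
        mul_le_mul_of_nonneg_right (by omega) (by omega)
      have hdisj : Disjoint S (Finset.univ.image f) := by
        rw [Finset.disjoint_right]
        intro a ha
        obtain ⟨k, -, rfl⟩ := Finset.mem_image.1 ha
        exact h4 k
      rw [hdisj.symmDiff_eq_sup, Finset.sup_eq_union, Finset.card_union_of_disjoint hdisj,
        Finset.card_image_of_injective _ hf, Finset.card_univ, Fintype.card_fin, add_mul] at h2
      push_cast at h2
      omega
  have hYm : ∀ a b m, Y a b ∈ pw F m ↔ X a b ∈ pw F m := fun a b m => by
    rw [hYa]; split_ifs
    · exact neg_mem_iff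
    · rfl
  have hdiag : ∀ a, X a a ∈ pw F 0 ∧ (a ∉ S → X a a ∈ pw F 1) := fun a => by
    have := hminor (fun _ : Fin 1 => a) (fun _ _ _ => Subsingleton.elim _ _)
    rw [Matrix.det_fin_one, Matrix.submatrix_apply, hYm, hYm] at this
    exact ⟨this.1, fun h => this.2 (fun _ => h) one_pos⟩
  -- The $2\times2$ principal minors control $x_{ab}^2$ once the diagonal is known, so principal
  -- minors of size at most 2 suffice.
  have hoff : ∀ a b, a ≠ b → X a a * X b b - X a b * X a b ∈ pw F 0 ∧
      (a ∉ S → b ∉ S → X a a * X b b - X a b * X a b ∈ pw F 1) := fun a b hab => by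
    have := hminor ![a, b] (fun i j hij => by
      fin_cases i <;> fin_cases j <;> first | rfl | exact absurd hij hab | exact absurd hij.symm hab)
    have h2 : ∀ m, (Y.submatrix ![a, b] ![a, b]).det ∈ pw F m ↔
        X a a * X b b - X a b * X a b ∈ pw F m := fun m => by
      rw [Matrix.det_fin_two]
      simp only [Matrix.submatrix_apply, Matrix.cons_val_zero, Matrix.cons_val_one, hYa]
      rw [hX.apply a b]
      split_ifs
      · rw [neg_mul_neg, neg_mul_neg]
      · rw [neg_mul, mul_neg, ← neg_sub', neg_mem_iff]
      · rw [neg_mul, mul_neg, ← neg_sub', neg_mem_iff]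
      · rfl
    rw [h2, h2] at this
    refine ⟨this.1, fun ha hb => this.2 (fun k => ?_) two_pos⟩
    fin_cases k
    exacts [ha, hb]
  refine ⟨S, X, hX, M, ?_, ?_, fun a b => ?_, fun a ha b hb => ?_⟩
  · rw [(sp_mul_toBlocks _ _).1]
    simpa [lowElt, weylSet] using hCX
  · rw [(sp_mul_toBlocks _ _).2]
    simpa [lowElt, weylSet] using hDX
  · rcases eq_or_ne a b with rfl | hab
    · exact (hdiag a).1
    · refine mem_pw_of_mul_self (pw_mono (by norm_num : (2 * 0 - 1 : ℤ) ≤ 0) ?_)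
      have h1 := mul_mem_pw (hdiag a).1 (hdiag b).1
      rw [add_zero] at h1
      rw [← sub_sub_cancel (X a a * X b b) (X a b * X a b)]
      exact sub_mem h1 (hoff a b hab).1
  · rcases eq_or_ne a b with rfl | hab
    · exact (hdiag a).2 ha
    · refine mem_pw_of_mul_self (m := 1) ?_
      have h1 := mul_mem_pw ((hdiag a).2 ha) (hdiag b).1
      rw [add_zero] at h1
      rw [← sub_sub_cancel (X a a * X b b) (X a b * X a b)]
      exact sub_mem h1 ((hoff a b hab).2 ha hb)

/-- Conjugation by $w_S$ leaves in the lower left block only the entries of $X$ with both indices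
outside $S$, which lie in $\mathfrak p$. -/
theorem lowElt_mul_weylSet {S : Finset (Fin n)} {X : Matrix (Fin n) (Fin n) F} (hX : X.IsSymm)
    (h0 : ∀ a b, X a b ∈ pw F 0) (h1 : ∀ a ∉ S, ∀ b ∉ S, X a b ∈ pw F 1) :
    ∃ k ∈ gammaSet n F, lowElt X hX * weylSet F S = weylSet F S * k := by
  refine ⟨(weylSet F S)⁻¹ * (lowElt X hX * weylSet F S), ?_, by rw [mul_inv_cancel_left]⟩
  set E := indMat F S with hE
  have hEE : E * E = E := indMat_mul_self S
  have hk : ((weylSet F S)⁻¹ * (lowElt X hX * weylSet F S)).1 = fromBlocks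
      (1 + E * X * (1 - E)) (-(E * X * E)) ((1 - E) * X * (1 - E)) (1 - (1 - E) * X * E) := by
    change ((weylSet F S)⁻¹).1 * (fromBlocks _ _ _ _ * fromBlocks _ _ _ _) = _
    rw [coe_weylSet_inv, fromBlocks_multiply, fromBlocks_multiply, fromBlocks_inj, ← hE]
    simp only [Matrix.mul_add, Matrix.add_mul, Matrix.mul_sub, Matrix.sub_mul, Matrix.mul_one,
      Matrix.one_mul, Matrix.zero_mul, Matrix.mul_neg, Matrix.neg_mul, Matrix.mul_assoc, hEE, add_zero]
    refine ⟨?_, ?_, ?_, ?_⟩ <;> abel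
  have hi : ∀ a b, (1 : Matrix (Fin n) (Fin n) F) a b ∈ 𝒪[F] := fun a b => by
    rw [Matrix.one_apply]; split_ifs <;> simp
  have hX0 := fun a b => mem_pw_zero.1 (h0 a b)
  have hEd : ∀ (d d' : Fin n → F) (a b : Fin n),
      (Matrix.diagonal d * X * Matrix.diagonal d') a b = d a * X a b * d' b := fun d d' a b => by
    rw [Matrix.mul_diagonal, Matrix.diagonal_mul]
  have hE1 : 1 - E = Matrix.diagonal fun a => if a ∈ S then (0 : F) else 1 := by
    rw [hE, indMat, ← Matrix.diagonal_one, Matrix.diagonal_sub]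
    congr 1; funext b; split_ifs <;> simp
  have hm : ∀ (P : Prop) [Decidable P] (x y : F), x ∈ 𝒪[F] → y ∈ 𝒪[F] → (if P then x else y) ∈ 𝒪[F] :=
    fun P _ x y hx hy => by split_ifs <;> assumption
  have h01 : (0 : F) ∈ 𝒪[F] ∧ (1 : F) ∈ 𝒪[F] := ⟨zero_mem _, one_mem _⟩
  refine ⟨?_, fun i j => ?_⟩
  · rw [hk, hE1, hE, indMat]
    rintro (i | i) (j | j)
    · simp only [fromBlocks_apply₁₁, Matrix.add_apply, hEd]
      exact add_mem (hi i j) (mul_mem (mul_mem (hm _ _ _ h01.2 h01.1) (hX0 i j)) (hm _ _ _ h01.1 h01.2))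
    · simp only [fromBlocks_apply₁₂, Matrix.neg_apply, hEd]
      exact neg_mem (mul_mem (mul_mem (hm _ _ _ h01.2 h01.1) (hX0 i j)) (hm _ _ _ h01.2 h01.1))
    · simp only [fromBlocks_apply₂₁, hEd]
      exact mul_mem (mul_mem (hm _ _ _ h01.1 h01.2) (hX0 i j)) (hm _ _ _ h01.1 h01.2)
    · simp only [fromBlocks_apply₂₂, Matrix.sub_apply, hEd]
      exact sub_mem (hi i j) (mul_mem (mul_mem (hm _ _ _ h01.1 h01.2) (hX0 i j)) (hm _ _ _ h01.2 h01.1))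
  · rw [hk, toBlocks_fromBlocks₂₁, hE1, hEd]
    by_cases hij : i ∈ S ∨ j ∈ S
    · rcases hij with h | h <;> simp [h]
    · rw [not_or] at hij
      rw [if_neg hij.1, if_neg hij.2, one_mul, mul_one]
      exact valuation_lt_one_of_mem (h1 i hij.1 j hij.2)

variable {ϖ : 𝒪[F]} {s : ℂ}

theorem isBasisVector_unique (hq : Odd (residueCard F)) (hϖ : Irreducible ϖ) {t : ℕ}
    {f f' : Sp n F → ℂ} (hf : IsBasisVector (quadChar (ϖ : F)) t s f)
    (hf' : IsBasisVector (quadChar (ϖ : F)) t s f') : f = f' := by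
  funext g
  obtain ⟨S, X, hX, M, hC, hD, h0, h1⟩ := exists_reduced g
  obtain ⟨k, hk, hkk⟩ := lowElt_mul_weylSet hX h0 h1
  rw [hf.1.1.apply_of_bottom hq hϖ hC hD, hf'.1.1.apply_of_bottom hq hϖ hC hD, hkk,
    hf.1.2 _ _ hk, hf'.1.2 _ _ hk, apply_weylSet hq hϖ hf, apply_weylSet hq hϖ hf']

end DoubleCosets

/-- Equivariant functions supported on one double coset `P w Γ`. -/
theorem exists_equivariant_of_doubleCoset {G : Type*} [Group G] (P Γ : Subgroup G) (κ : P →* ℂ)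
    (c : Γ →* ℂ) (w : G) (hc : ∀ k, c k * c k = 1)
    (h : ∀ (p : P) (k : Γ), (p : G) * w = w * k → κ p = c k) :
    ∃ f : G → ℂ, (∀ (p : P) (g : G), f ((p : G) * g) = κ p * f g) ∧
      (∀ (g : G) (k : Γ), f (g * (k : G)) = c k * f g) ∧
      f w = 1 ∧ ∀ g : G, (∀ (p : P) (k : Γ), (p : G) * w ≠ g * k) → f g = 0 := by
  classical
  let f : G → ℂ := fun g =>
    if h : ∃ x : P × Γ, g * x.2 = x.1 * w then κ h.choose.1 * c h.choose.2 else 0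
  have hf : ∀ (g : G) (p : P) (k : Γ), g * k = p * w → f g = κ p * c k := fun g p k hg => by
    have hex : ∃ x : P × Γ, g * x.2 = x.1 * w := ⟨(p, k), hg⟩
    have h1 := hex.choose_spec
    simp only [f, dif_pos hex]
    set x := hex.choose
    have h2 := h (x.1⁻¹ * p) (x.2⁻¹ * k) (by
      push_cast
      rw [mul_assoc, ← hg, ← mul_assoc w, eq_mul_inv_of_mul_eq (h1.symm.trans rfl)]
      · group)
    rw [map_mul, map_mul] at h2
    have h3 : c x.2 * c x.2⁻¹ = 1 := by rw [← map_mul, mul_inv_cancel, map_one]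
    have h4 : κ x.1 * κ x.1⁻¹ = 1 := by rw [← map_mul, mul_inv_cancel, map_one]
    linear_combination κ x.1 * (c x.2⁻¹ * hc x.2 - c x.2 * h3) - κ x.1 * c x.2⁻¹ * hc k
      - κ x.1 * c k * h2 + κ p * c k * h4
  have hf0 : ∀ g : G, (¬ ∃ x : P × Γ, g * (x.2 : G) = (x.1 : G) * w) → f g = 0 := fun g hg => dif_neg hg
  refine ⟨f, fun p g => ?_, fun g k => ?_, ?_, fun g hg => hf0 g ?_⟩
  · by_cases hg : ∃ x : P × Γ, g * x.2 = x.1 * w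
    · obtain ⟨x, hx⟩ := hg
      rw [hf g _ _ hx, hf (p * g) (p * x.1) x.2 (by push_cast; rw [mul_assoc, hx, mul_assoc]), map_mul,
        mul_assoc]
    · rw [hf0 g hg, hf0, mul_zero]
      rintro ⟨x, hx⟩
      exact hg ⟨(p⁻¹ * x.1, x.2), by push_cast; rw [mul_assoc, ← hx]; group⟩
  · by_cases hg : ∃ x : P × Γ, g * x.2 = x.1 * w
    · obtain ⟨x, hx⟩ := hg
      have h3 : c k * c k⁻¹ = 1 := by rw [← map_mul, mul_inv_cancel, map_one]
      have h5 : c k⁻¹ = c k := by linear_combination c k * h3 - c k⁻¹ * hc k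
      rw [hf g _ _ hx, hf (g * k) x.1 (k⁻¹ * x.2) (by push_cast; rw [← hx]; group), map_mul, h5]
      ring
    · rw [hf0 g hg, hf0, mul_zero]
      rintro ⟨x, hx⟩
      exact hg ⟨(x.1, k * x.2), by push_cast; rw [← hx]; group⟩
  · rw [hf w 1 1 (by simp), map_one, map_one, one_mul]
  · rintro ⟨x, hx⟩
    exact hg x.1 x.2 hx.symm

/-! ### Matrix relations over the residue field -/

section ParahoricRelation

variable {n : ℕ} {K : Type*} [CommRing K] {E A B D N : Matrix (Fin n) (Fin n) K}

theorem det_one_add_corner (hE : E * E = E) (Y : Matrix (Fin n) (Fin n) K) :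
    (1 + E * Y * (1 - E)).det = 1 := by
  rw [Matrix.mul_assoc, Matrix.det_one_add_mul_comm, Matrix.mul_assoc, Matrix.sub_mul, Matrix.one_mul,
    hE, sub_self, Matrix.mul_zero, add_zero, Matrix.det_one]

/-- With respect to $E$ the matrices $N$ and $D$ are block triangular with the same block off $E$.
Their blocks on $E$ are those of $A$ and $D$, whose determinants are inverse to each other because
$A\,{}^tD=1$. -/
theorem exists_det_mul_det_eq_sq (hE : E * E = E) (hEt : Eᵀ = E) (hAD : A * Dᵀ = 1)
    (h1 : N * E = E * A) (h2 : N * (1 - E) = E * B + (1 - E) * D) :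
    ∃ x y : K, N.det * D.det = x ^ 2 ∧ D.det = x * y := by
  have hEz : ∀ X, E * (E * X) = E * X := fun X => by rw [← Matrix.mul_assoc, hE]
  have h3 : E * A * E = E * A := by rw [← h1, Matrix.mul_assoc, hE]
  have h4 : E * B * E + (1 - E) * D * E = 0 := by
    rw [← Matrix.add_mul, ← h2, Matrix.mul_assoc, Matrix.sub_mul, hE]; simp
  have h5 : (1 - E) * D * E = 0 := by
    have := congrArg (fun X => (1 - E) * X) h4
    simpa [Matrix.mul_add, Matrix.sub_mul, Matrix.mul_sub, Matrix.mul_assoc, hE, hEz] using this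
  have h6 : E * B * E = 0 := by simpa [h5] using h4
  have h9 : E * (D * E) = D * E := by
    rw [Matrix.sub_mul, Matrix.sub_mul, Matrix.one_mul, Matrix.mul_assoc] at h5
    exact (sub_eq_zero.1 h5).symm
  have h9z : ∀ X, E * (D * (E * X)) = D * (E * X) := fun X => by
    rw [← Matrix.mul_assoc D, ← Matrix.mul_assoc, h9]
  have hcorner : ∀ X Y : Matrix (Fin n) (Fin n) K, (1 + E * Y * (1 - E)) * (E * X * E + (1 - E)) =
      E * X * E + (1 - E) + E * Y * (1 - E) := fun X Y => by
    simp only [Matrix.mul_add, Matrix.add_mul, Matrix.mul_sub, Matrix.sub_mul, Matrix.mul_one,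
      Matrix.one_mul, Matrix.mul_assoc, hE, hEz, sub_self, add_zero, zero_add, sub_zero]
    abel
  set P := (1 - E) * D * (1 - E) + E with hP
  have hN : N = P * ((1 + E * B * (1 - E)) * (E * A * E + (1 - E))) := by
    have : N = N * E + N * (1 - E) := by simp [Matrix.mul_sub]
    rw [this, h1, h2, hP, hcorner, h3]
    simp only [Matrix.mul_assoc] at h3 h6
    simp only [Matrix.mul_add, Matrix.add_mul, Matrix.mul_sub, Matrix.sub_mul, Matrix.mul_one,
      Matrix.one_mul, Matrix.mul_assoc, hE, hEz, h3, h6, h9, h9z, sub_self, add_zero, zero_add, sub_zero, Matrix.mul_zero]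
    abel
  have hD : D = P * ((1 + E * D * (1 - E)) * (E * D * E + (1 - E))) := by
    rw [hP, hcorner]
    simp only [Matrix.mul_add, Matrix.add_mul, Matrix.mul_sub, Matrix.sub_mul, Matrix.mul_one,
      Matrix.one_mul, Matrix.mul_assoc, hE, hEz, h9, h9z, sub_self, add_zero, zero_add, sub_zero]
    abel
  have hQ : (E * A * E + (1 - E)).det * (E * D * E + (1 - E)).det = 1 := by
    rw [← Matrix.det_transpose (E * D * E + (1 - E)), ← Matrix.det_mul, ← Matrix.det_one (n := Fin n)]
    congr 1
    rw [h3, transpose_add, transpose_sub, transpose_one, transpose_mul, transpose_mul, hEt]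
    have h7 : E * A * (E * (Dᵀ * E)) = E := by
      rw [← Matrix.mul_assoc, h3, ← Matrix.mul_assoc, Matrix.mul_assoc E, hAD, Matrix.mul_one, hE]
    have h8 : E * A * (1 - E) = 0 := by rw [Matrix.mul_sub, h3]; simp
    rw [Matrix.add_mul, Matrix.mul_add, Matrix.mul_add, h7, h8, Matrix.mul_sub]
    simp [Matrix.sub_mul, hE, hEz]
  refine ⟨P.det, (E * D * E + (1 - E)).det, ?_, ?_⟩
  · rw [hN, congrArg Matrix.det hD]
    rw [Matrix.det_mul, Matrix.det_mul, Matrix.det_mul, Matrix.det_mul, det_one_add_corner hE,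
      det_one_add_corner hE]
    linear_combination P.det ^ 2 * hQ
  · nth_rw 1 [hD]
    rw [Matrix.det_mul, Matrix.det_mul, det_one_add_corner hE, one_mul]

theorem rank_indMat {K : Type*} [Field K] (S : Finset (Fin n)) : (indMat K S).rank = S.card := by
  classical
  rw [indMat, Matrix.rank_diagonal]
  simp [Fintype.card_subtype]

theorem rank_one_sub_indMat {K : Type*} [Field K] (S : Finset (Fin n)) :
    (1 - indMat K S).rank = n - S.card := by
  have : (1 - indMat K S) = indMat K Sᶜ := by
    rw [indMat, indMat, ← Matrix.diagonal_one, Matrix.diagonal_sub]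
    congr 1; funext a
    by_cases h : a ∈ S <;> simp [h]
  rw [this, rank_indMat, Finset.card_compl, Fintype.card_fin]

/-- Comparing ranks in the first relation gives $\#T\le\#S$; in the second, restricted off $T$, it
gives $n-\#T\le n-\#S$. -/
theorem card_eq_of_relations {K : Type*} [Field K] {A B D N : Matrix (Fin n) (Fin n) K}
    {S T : Finset (Fin n)} (hAD : A * Dᵀ = 1) (h1 : N * indMat K S = indMat K T * A)
    (h2 : N * (1 - indMat K S) = indMat K T * B + (1 - indMat K T) * D) : S.card = T.card := by
  have hA : IsUnit A.det := Matrix.isUnit_det_of_right_inverse hAD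
  have hD : IsUnit D.det := by
    rw [← Matrix.det_transpose]; exact Matrix.isUnit_det_of_left_inverse hAD
  have hE := indMat_mul_self (F := K) T
  have h3 : (1 - indMat K T) * (N * (1 - indMat K S)) = (1 - indMat K T) * D := by
    rw [h2]
    simp [Matrix.mul_add, Matrix.sub_mul, ← Matrix.mul_assoc, hE, Matrix.mul_sub]
  have h4 := Matrix.rank_mul_le_right N (indMat K S)
  rw [h1, Matrix.rank_mul_eq_left_of_isUnit_det _ _ hA, rank_indMat, rank_indMat] at h4
  have h5 := Matrix.rank_mul_le_right ((1 - indMat K T) * N) (1 - indMat K S)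
  rw [Matrix.mul_assoc, h3, Matrix.rank_mul_eq_left_of_isUnit_det _ _ hD, rank_one_sub_indMat,
    rank_one_sub_indMat] at h5
  have h6 : S.card ≤ n := by simpa using S.card_le_univ
  have h7 : T.card ≤ n := by simpa using T.card_le_univ
  omega

end ParahoricRelation

/-! ### The characters of $P$ and $\Gamma$ and existence of $f_t$ -/

section Existence

variable {n : ℕ} {F : Type*} [Field F]

/-- The Siegel parabolic subgroup. -/
def siegelParabolic (n : ℕ) (F : Type*) [Field F] : Subgroup (Sp n F) where
  carrier := {p | p.1.toBlocks₂₁ = 0}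
  one_mem' := by
    have : (1 : Sp n F).1 = Matrix.fromBlocks 1 0 0 1 := Matrix.fromBlocks_one.symm
    rw [Set.mem_setOf_eq, this, Matrix.toBlocks_fromBlocks₂₁]
  mul_mem' {p p'} hp hp' := by
    rw [Set.mem_setOf_eq, (sp_mul_toBlocks p p').1, show _ = _ from hp, show _ = _ from hp',
      Matrix.zero_mul, Matrix.mul_zero, add_zero]
  inv_mem' {p} hp := by
    have h1 := (sp_mul_toBlocks p p⁻¹)
    have h3 := (sp_relations p).1
    have hp0 : p.1.toBlocks₂₁ = 0 := hp
    have : (1 : Sp n F).1 = Matrix.fromBlocks 1 0 0 1 := Matrix.fromBlocks_one.symm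
    rw [mul_inv_cancel, this, Matrix.toBlocks_fromBlocks₂₁, hp0, Matrix.zero_mul, zero_add] at h1
    rw [hp0, transpose_zero, Matrix.mul_zero, sub_zero] at h3
    have h4 : IsUnit p.1.toBlocks₂₂.det := by
      rw [← Matrix.det_transpose]; exact Matrix.isUnit_det_of_left_inverse h3
    rw [Set.mem_setOf_eq, ← Matrix.nonsing_inv_mul_cancel_left (A := p.1.toBlocks₂₂) (p⁻¹).1.toBlocks₂₁ h4,
      ← h1.1, Matrix.mul_zero]

theorem det_toBlocks_of_parabolic {p : Sp n F} (hp : p ∈ siegelParabolic n F) :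
    p.1.toBlocks₁₁.det * p.1.toBlocks₂₂.det = 1 := by
  have h3 := (sp_relations p).1
  rw [show p.1.toBlocks₂₁ = 0 from hp, transpose_zero, Matrix.mul_zero, sub_zero] at h3
  rw [← Matrix.det_transpose p.1.toBlocks₂₂, ← Matrix.det_mul, h3, Matrix.det_one]

theorem coe_sp_inv (g : Sp n F) : (g⁻¹).1 = fromBlocks g.1.toBlocks₂₂ᵀ (-g.1.toBlocks₁₂ᵀ)
    (-g.1.toBlocks₂₁ᵀ) g.1.toBlocks₁₁ᵀ := by
  change (-Matrix.J _ F) * g.1ᵀ * Matrix.J _ F = _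
  rw [sp_eq_fromBlocks g, Matrix.J, Matrix.fromBlocks_transpose, Matrix.fromBlocks_neg,
    Matrix.fromBlocks_multiply, Matrix.fromBlocks_multiply]
  simp

variable [ValuativeRel F] [TopologicalSpace F] [IsNonarchimedeanLocalField F]

theorem valuation_lt_one_iff {x : F} : valuation F x < 1 ↔ x ∈ pw F 1 := by
  refine ⟨fun h => ?_, valuation_lt_one_of_mem⟩
  have hx : x ∈ 𝒪[F] := h.le
  rw [show x = ((⟨x, hx⟩ : 𝒪[F]) : F) from rfl, ← residue_eq_zero_iff, IsLocalRing.residue_eq_zero_iff,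
    IsLocalRing.mem_maximalIdeal, mem_nonunits_iff, Valuation.Integer.not_isUnit_iff_valuation_lt_one]
  exact h

variable (n F) in
/-- The subgroup `Γ`. -/
def gammaSubgroup : Subgroup (Sp n F) where
  carrier := gammaSet n F
  one_mem' := by
    have h := unipElt_mem_gammaSet (n := n) (F := F) (X := 0) fun _ _ => zero_mem _
    have h1 : unipElt (0 : SymMat n F) = 1 := Subtype.ext Matrix.fromBlocks_one
    rwa [h1] at h
  mul_mem' {g h} hg hh := by
    refine ⟨fun i j => ?_, fun i j => ?_⟩
    · change (g.1 * h.1) i j ∈ _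
      rw [Matrix.mul_apply]
      exact sum_mem fun k _ => mul_mem (hg.1 i k) (hh.1 k j)
    · rw [valuation_lt_one_iff, (sp_mul_toBlocks g h).1, Matrix.add_apply, Matrix.mul_apply,
        Matrix.mul_apply]
      refine add_mem (sum_mem fun k _ => ?_) (sum_mem fun k _ => ?_)
      · have := mul_mem_pw (valuation_lt_one_iff.1 (hg.2 i k))
          (mem_pw_zero.2 (hh.1 (Sum.inl k) (Sum.inl j)))
        rwa [add_zero] at this
      · have := mul_mem_pw (mem_pw_zero.2 (hg.1 (Sum.inr i) (Sum.inr k)))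
          (valuation_lt_one_iff.1 (hh.2 k j))
        rwa [zero_add] at this
  inv_mem' {g} hg := by
    change g⁻¹ ∈ gammaSet n F
    refine ⟨?_, fun i j => ?_⟩
    · rw [coe_sp_inv]
      rintro (i | i) (j | j)
      exacts [hg.1 _ _, neg_mem (hg.1 _ _), neg_mem (hg.1 _ _), hg.1 _ _]
    · rw [coe_sp_inv, toBlocks_fromBlocks₂₁, Matrix.neg_apply, Valuation.map_neg]
      exact hg.2 j i

/-- Inclusion of integral matrices. -/
noncomputable abbrev intMat (n : ℕ) (F : Type*) [Field F] [ValuativeRel F] :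
    Matrix (Fin n) (Fin n) 𝒪[F] →+* Matrix (Fin n) (Fin n) F := (algebraMap 𝒪[F] F).mapMatrix

/-- Reduction of integral matrices. -/
noncomputable abbrev resMat (n : ℕ) (F : Type*) [Field F] [ValuativeRel F] :
    Matrix (Fin n) (Fin n) 𝒪[F] →+* Matrix (Fin n) (Fin n) 𝓀[F] :=
  (IsLocalRing.residue 𝒪[F]).mapMatrix

theorem intMat_injective : Function.Injective (intMat n F) := fun A B h => by
  ext a b
  exact congrFun (congrFun h a) b

theorem exists_intMat_eq {M : Matrix (Fin n) (Fin n) F} (h : ∀ a b, M a b ∈ 𝒪[F]) :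
    ∃ M', intMat n F M' = M := ⟨Matrix.of fun a b => ⟨M a b, h a b⟩, rfl⟩

variable (F) in
theorem exists_lift_indMat (S : Finset (Fin n)) :
    ∃ E, intMat n F E = indMat F S ∧ resMat n F E = indMat 𝓀[F] S := by
  refine ⟨Matrix.diagonal fun a => if a ∈ S then 1 else 0, ?_, ?_⟩ <;>
  · ext a b
    simp only [indMat, RingHom.mapMatrix_apply, Matrix.map_apply, Matrix.diagonal_apply]
    split_ifs <;> simp

theorem exists_lift_of_mem_gammaSet {k : Sp n F} (hk : k ∈ gammaSet n F) :
    ∃ A B C D, intMat n F A = k.1.toBlocks₁₁ ∧ intMat n F B = k.1.toBlocks₁₂ ∧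
      intMat n F C = k.1.toBlocks₂₁ ∧ intMat n F D = k.1.toBlocks₂₂ ∧ resMat n F C = 0 ∧
      resMat n F A * (resMat n F D)ᵀ = 1 := by
  obtain ⟨A, hA⟩ := exists_intMat_eq (M := k.1.toBlocks₁₁) fun a b => hk.1 _ _
  obtain ⟨B, hB⟩ := exists_intMat_eq (M := k.1.toBlocks₁₂) fun a b => hk.1 _ _
  obtain ⟨C, hC⟩ := exists_intMat_eq (M := k.1.toBlocks₂₁) fun a b => hk.1 _ _
  obtain ⟨D, hD⟩ := exists_intMat_eq (M := k.1.toBlocks₂₂) fun a b => hk.1 _ _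
  have hC0 : resMat n F C = 0 := by
    ext a b
    refine residue_eq_zero_iff.2 (valuation_lt_one_iff.1 ?_)
    have := hk.2 a b
    rwa [← hC] at this
  refine ⟨A, B, C, D, hA, hB, hC, hD, hC0, ?_⟩
  have h1 : A * Dᵀ - B * Cᵀ = 1 := intMat_injective (by
    rw [map_sub, map_mul, map_mul, map_one, ← (sp_relations k).1, ← hA, ← hB, ← hC, ← hD]; rfl)
  have h2 := congrArg (resMat n F) h1
  have h3 : resMat n F Cᵀ = (resMat n F C)ᵀ := rfl
  rw [map_sub, map_mul, map_mul, map_one, h3, hC0, transpose_zero, Matrix.mul_zero, sub_zero] at h2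
  exact h2

theorem det_intMat (M : Matrix (Fin n) (Fin n) 𝒪[F]) : (intMat n F M).det = ((M.det : 𝒪[F]) : F) :=
  (RingHom.map_det _ _).symm

theorem det_resMat (M : Matrix (Fin n) (Fin n) 𝒪[F]) :
    (resMat n F M).det = IsLocalRing.residue 𝒪[F] M.det := (RingHom.map_det _ _).symm

variable {ϖ : 𝒪[F]} (hq : Odd (residueCard F)) (hϖ : Irreducible ϖ)

include hq hϖ in
theorem quadChar_eq_of_residue {x y : 𝒪[F]} {c : 𝓀[F]} (hc : c ≠ 0)
    (h : IsLocalRing.residue 𝒪[F] x * IsLocalRing.residue 𝒪[F] y = c ^ 2) :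
    quadChar (ϖ : F) (x : F) = quadChar (ϖ : F) (y : F) := by
  obtain ⟨w, rfl⟩ := IsLocalRing.residue_surjective c
  have hu : IsUnit (x * y) := by
    rw [← IsLocalRing.residue_ne_zero_iff_isUnit, map_mul, h]
    exact pow_ne_zero 2 hc
  obtain ⟨z, hz, -⟩ := exists_sq_eq_of_residue hq hu.unit w (by rw [hu.unit_spec, map_mul, h])
  rw [hu.unit_spec] at hz
  have h0 : (x : F) * y ≠ 0 := fun h0 => hu.ne_zero (Subtype.ext h0)
  have hz1 : (z : F) * z = x * y := by rw [← pow_two]; exact congrArg Subtype.val hz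
  have hz0 : (z : F) ≠ 0 := fun hz0 => h0 (by rw [← hz1, hz0, mul_zero])
  have h1 := quadChar_mul hq hϖ hz0 hz0
  rw [hz1, quadChar_mul hq hϖ (left_ne_zero_of_mul h0) (right_ne_zero_of_mul h0),
    quadChar_mul_self] at h1
  exact mul_right_cancel₀ (quadChar_ne_zero (ϖ : F) (y : F)) (h1.trans (quadChar_mul_self _ _).symm)

/-- The character `χ(det D)` of `Γ`. -/
noncomputable def gammaChar : gammaSubgroup n F →* ℂ where
  toFun k := quadChar (ϖ : F) k.1.1.toBlocks₂₂.det
  map_one' := by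
    have : (1 : Sp n F).1 = Matrix.fromBlocks 1 0 0 1 := Matrix.fromBlocks_one.symm
    rw [OneMemClass.coe_one, this, Matrix.toBlocks_fromBlocks₂₂, Matrix.det_one, quadChar_one]
  map_mul' k k' := by
    obtain ⟨A, B, C, D, hA, hB, hC, hD, hC0, hAD⟩ := exists_lift_of_mem_gammaSet k.2
    obtain ⟨A', B', C', D', hA', hB', hC', hD', hC0', hAD'⟩ := exists_lift_of_mem_gammaSet k'.2
    have hDu : ∀ {A D : Matrix (Fin n) (Fin n) 𝒪[F]}, resMat n F A * (resMat n F D)ᵀ = 1 →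
        (resMat n F D).det ≠ 0 := fun {A D} h => by
      rw [← Matrix.det_transpose]
      exact (Matrix.isUnit_det_of_left_inverse h).ne_zero
    -- On $\Gamma$ the map $k\mapsto D$ is multiplicative modulo $\mathfrak p$, and $\chi$ of a unit
    -- depends only on its residue.
    have h1 : resMat n F (C * B' + D * D') = resMat n F (D * D') := by
      rw [map_add, map_mul, hC0, Matrix.zero_mul, zero_add]
    have hne : (resMat n F (D * D')).det ≠ 0 := by
      rw [map_mul, Matrix.det_mul]; exact mul_ne_zero (hDu hAD) (hDu hAD')
    rw [Subgroup.coe_mul, (sp_mul_toBlocks _ _).2, ← hC, ← hB', ← hD, ← hD', ← map_mul, ← map_mul,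
      ← map_add, det_intMat, quadChar_eq_of_residue hq hϖ (y := (D * D').det) hne (by
        rw [← det_resMat, ← det_resMat, h1, pow_two]), Matrix.det_mul, det_intMat, det_intMat]
    rw [det_resMat, Matrix.det_mul, map_mul] at hne
    exact quadChar_mul hq hϖ (fun h => hne (by simp [show D.det = 0 from Subtype.ext h]))
      (fun h => hne (by simp [show D'.det = 0 from Subtype.ext h]))

/-- The character `χ(det A) |det A|^s` of the Siegel parabolic. -/
noncomputable def parabolicChar (s : ℂ) : siegelParabolic n F →* ℂ where
  toFun p := siegelKappa (ϖ : F) s p.1.1.toBlocks₂₂.det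
  map_one' := by
    have : (1 : Sp n F).1 = Matrix.fromBlocks 1 0 0 1 := Matrix.fromBlocks_one.symm
    rw [OneMemClass.coe_one, this, Matrix.toBlocks_fromBlocks₂₂, Matrix.det_one,
      siegelKappa_of_ord_eq_zero ord_one, quadChar_one]
  map_mul' p p' := by
    rw [Subgroup.coe_mul, (sp_mul_toBlocks _ _).2, show p.1.1.toBlocks₂₁ = 0 from p.2, Matrix.zero_mul,
      zero_add, Matrix.det_mul, siegelKappa_mul hq hϖ s
      (right_ne_zero_of_mul_eq_one (det_toBlocks_of_parabolic p.2))
      (right_ne_zero_of_mul_eq_one (det_toBlocks_of_parabolic p'.2))]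

include hq hϖ in
/-- Comparison of `p w_S = w_T k`. -/
theorem weylSet_relation (s : ℂ) {S T : Finset (Fin n)} {p k : Sp n F} (hp : p ∈ siegelParabolic n F)
    (hk : k ∈ gammaSet n F) (h : p * weylSet F S = weylSet F T * k) : S.card = T.card ∧
      (S = T → siegelKappa (ϖ : F) s p.1.toBlocks₂₂.det = quadChar (ϖ : F) k.1.toBlocks₂₂.det) := by
  obtain ⟨A, B, C, D, hA, hB, hC, hD, hC0, hAD⟩ := exists_lift_of_mem_gammaSet hk
  obtain ⟨ES, hES, hES'⟩ := exists_lift_indMat F S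
  obtain ⟨ET, hET, hET'⟩ := exists_lift_indMat F T
  have hp0 : p.1.toBlocks₂₁ = 0 := hp
  have h1 := sp_mul_toBlocks p (weylSet F S)
  have h2 := sp_mul_toBlocks (weylSet F T) k
  rw [h, hp0, Matrix.zero_mul, zero_add, Matrix.zero_mul, zero_add, h2.1, h2.2, ← hA, ← hB, ← hC,
    ← hD] at h1
  simp only [weylSet, toBlocks_fromBlocks₂₁, toBlocks_fromBlocks₂₂, ← hES, ← hET,
    ← map_one (intMat n F), ← map_sub, ← map_mul, ← map_add] at h1
  -- The block $D_p$ is integral although $p$ is only parabolic: both $D_p1_S$ and $D_p(1-1_S)$ are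
  -- read off from $w_Tk$, and $D_p$ is their sum.
  obtain ⟨N, hN⟩ := exists_intMat_eq (M := p.1.toBlocks₂₂) (fun a b => by
    have : p.1.toBlocks₂₂ = intMat n F (ET * A + (1 - ET) * C +
        (ET * B + (1 - ET) * D)) := by
      rw [map_add, h1.1, h1.2, map_sub, map_one, Matrix.mul_sub, add_sub_cancel, Matrix.mul_one]
    rw [this]
    exact Subtype.mem _)
  rw [← hN, ← map_mul, ← map_mul] at h1
  have h3 := congrArg (resMat n F) (intMat_injective h1.1)
  have h4 := congrArg (resMat n F) (intMat_injective h1.2)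
  simp only [map_add, map_mul, map_sub, map_one, hES', hET', hC0, Matrix.mul_zero, add_zero] at h3 h4
  refine ⟨card_eq_of_relations hAD h3.symm h4.symm, ?_⟩
  rintro rfl
  obtain ⟨x, y, hx, hy⟩ := exists_det_mul_det_eq_sq (indMat_mul_self S) (Matrix.diagonal_transpose _) hAD
    h3.symm h4.symm
  have hD0 : (resMat n F D).det ≠ 0 := by
    rw [← Matrix.det_transpose]; exact (Matrix.isUnit_det_of_left_inverse hAD).ne_zero
  have hx0 : x ≠ 0 := left_ne_zero_of_mul (hy ▸ hD0)
  have hN0 : (resMat n F N).det ≠ 0 := left_ne_zero_of_mul (hx ▸ pow_ne_zero 2 hx0)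
  rw [det_resMat, det_resMat] at hx
  have hNu : IsUnit N.det := by rwa [← IsLocalRing.residue_ne_zero_iff_isUnit, ← det_resMat]
  obtain ⟨v, hv⟩ := hNu.exists_right_inv
  rw [← hN, ← hD, det_intMat, det_intMat, siegelKappa_of_ord_eq_zero
    (ord_eq_zero_of_mul_eq_one N.det.2 v.2 (congrArg Subtype.val hv))]
  exact quadChar_eq_of_residue hq hϖ hx0 hx

include hq hϖ in
theorem exists_isBasisVector {t : ℕ} (ht : t ≤ n) (s : ℂ) :
    ∃ f : Sp n F → ℂ, IsBasisVector (quadChar (ϖ : F)) t s f := by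
  obtain ⟨f, hP, hΓ, h1, h0⟩ := exists_equivariant_of_doubleCoset (siegelParabolic n F)
    (gammaSubgroup n F) (parabolicChar hq hϖ s) (gammaChar hq hϖ) (weylElt n F t)
    (fun k => quadChar_mul_self _ _) (fun p k h => by
      rw [weylElt_eq] at h
      exact (weylSet_relation hq hϖ s p.2 k.2 h).2 rfl)
  refine ⟨f, ⟨⟨?_, fun p g hp => ?_⟩, fun g k hk => hΓ g ⟨k, hk⟩⟩, fun j hj => ?_⟩
  · rw [IsLocallyConstant.iff_eventually_eq]
    intro g
    have hc : Continuous fun g' : Sp n F => (g⁻¹ * g').1 := by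
      change Continuous fun g' : Sp n F => (g⁻¹).1 * g'.1
      exact continuous_const.matrix_mul continuous_subtype_val
    -- Local constancy: for $g'$ near $g$ the quotient $g^{-1}g'$ lies in $\Gamma$ and is $\equiv1$
    -- mod $\mathfrak p$, where the character $\chi(\det D)$ is trivial.
    have hev : ∀ i j, ∀ᶠ g' in nhds g, (g⁻¹ * g').1 i j - (1 : Matrix _ _ F) i j ∈ pw F 1 := fun i j => by
      have hc' : Continuous fun g' : Sp n F => (g⁻¹ * g').1 i j - (1 : Matrix _ _ F) i j :=
        (hc.matrix_elem i j).sub continuous_const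
      refine hc'.continuousAt.eventually_mem (IsOpen.mem_nhds (isOpen_pw 1) ?_)
      rw [inv_mul_cancel]
      change (1 : Matrix _ _ F) i j - _ ∈ _
      rw [sub_self]
      exact zero_mem _
    have hev' : ∀ᶠ g' in nhds g, ∀ i j, (g⁻¹ * g').1 i j - (1 : Matrix _ _ F) i j ∈ pw F 1 :=
      Filter.eventually_all.2 fun i => Filter.eventually_all.2 fun j => hev i j
    filter_upwards [hev'] with g' hg'
    have hk : g⁻¹ * g' ∈ gammaSet n F := by
      refine ⟨fun i j => ?_, fun i j => ?_⟩
      · have h2 := add_mem (mem_pw_zero.1 (pw_mono zero_le_one (hg' i j)))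
          (show (1 : Matrix (Fin n ⊕ Fin n) (Fin n ⊕ Fin n) F) i j ∈ 𝒪[F] by
            rw [Matrix.one_apply]; split_ifs <;> simp)
        rwa [sub_add_cancel] at h2
      · have := hg' (Sum.inr i) (Sum.inl j)
        rw [Matrix.one_apply_ne (by simp), sub_zero] at this
        exact valuation_lt_one_of_mem this
    have h2 : f (g * (g⁻¹ * g')) = gammaChar hq hϖ ⟨_, hk⟩ * f g := hΓ g ⟨_, hk⟩
    rw [mul_inv_cancel_left] at h2
    obtain ⟨A, B, C, D, -, -, -, hD, -, -⟩ := exists_lift_of_mem_gammaSet hk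
    have h3 : resMat n F D = 1 := by
      ext a b
      rw [← sub_eq_zero, ← map_one (resMat n F), ← Matrix.sub_apply, ← map_sub]
      refine residue_eq_zero_iff.2 ?_
      have := hg' (Sum.inr a) (Sum.inr b)
      rw [show (g⁻¹ * g').1 (Sum.inr a) (Sum.inr b) = intMat n F D a b by rw [hD]; rfl] at this
      convert this using 1
      rw [Matrix.sub_apply]
      push_cast
      congr 1
      simp only [Matrix.one_apply, Sum.inr.injEq]
      split_ifs <;> rfl
    have h4 : gammaChar hq hϖ ⟨_, hk⟩ = 1 := by
      change quadChar (ϖ : F) (g⁻¹ * g').1.toBlocks₂₂.det = 1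
      rw [← hD, det_intMat, quadChar_eq_of_residue hq hϖ (y := 1) one_ne_zero (by
        rw [← det_resMat, h3]; simp)]
      exact quadChar_one _
    rw [h2, h4, one_mul]
  · have h2 := det_toBlocks_of_parabolic (p := p) hp
    have h3 := hP ⟨p, hp⟩ g
    rw [h3]
    change siegelKappa (ϖ : F) s p.1.toBlocks₂₂.det * _ = _
    have h4 := right_ne_zero_of_mul_eq_one h2
    rw [eq_inv_of_mul_eq_one_left h2, quadChar_inv hq hϖ h4, normAbs_cpow (inv_ne_zero h4), ord_inv,
      siegelKappa, sub_add_cancel, Int.cast_neg, neg_neg]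
  · split_ifs with hjt
    · rw [hjt, h1]
    · refine h0 _ fun p k h => hjt ?_
      rw [weylElt_eq, weylElt_eq] at h
      have := (weylSet_relation hq hϖ s p.2 k.2 h).1
      rw [card_lastSet ht, card_lastSet hj] at this
      exact this.symm

end Existence

/-! ### Absolute convergence for $\mathrm{Re}\,s>n$ -/

section Convergence

variable {n : ℕ}

theorem norm_levelPass_le {w : Finset (Fin n) → Fin n → Fin n → ℂ} {g : Finset (Fin n) → ℂ}
    {ε M : ℝ} (hε : 0 ≤ ε) (hM : 0 ≤ M) (hw : ∀ K i j, i ∉ K → j ∉ K → ‖w K i j‖ ≤ ε)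
    (hg : ∀ J, ‖g J‖ ≤ M) (m : ℕ) (J : Finset (Fin n)) : ‖levelPass w g m J‖ ≤ (1 + n * ε) ^ m * M := by
  induction m generalizing J with
  | zero => simpa [levelPass] using hg J
  | succ m ih =>
    have hB : 0 ≤ (1 + n * ε) ^ m * M := by positivity
    rw [levelPass, pow_succ, mul_right_comm, mul_add, mul_one]
    refine (norm_add_le _ _).trans (add_le_add (ih J) ?_)
    split_ifs with h1 h2
    · refine (norm_sum_le_of_le _ fun j _ => show _ ≤ ε * ((1 + n * ε) ^ m * M) from ?_).trans ?_
      · rw [norm_mul]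
        exact mul_le_mul (hw _ _ _ (by simp) (by simp)) (ih _) (norm_nonneg _) hε
      · rw [Finset.sum_const, nsmul_eq_mul]
        have h3 : ((J.filter (· ≤ (⟨m, h1⟩ : Fin n))).card : ℝ) ≤ n := by
          exact_mod_cast (Finset.card_le_univ _).trans (Fintype.card_fin n).le
        calc _ ≤ (n : ℝ) * (ε * ((1 + n * ε) ^ m * M)) := by gcongr
          _ = _ := by ring
    · rw [norm_zero]; positivity
    · rw [norm_zero]; positivity

/-- A pass at level $-(l+1)$ multiplies the bound by at most $(1+nr^l)^n\le\exp(n^2r^l)$, and the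
exponents form a convergent geometric series. -/
theorem norm_levelIter_le {w : ℤ → Finset (Fin n) → Fin n → Fin n → ℂ} {c : ℕ → ℂ} {r : ℝ}
    (hr0 : 0 ≤ r) (hr1 : r < 1) (hw : ∀ l : ℕ, ∀ K i j, i ∉ K → j ∉ K → ‖w (-(l + 1 : ℕ)) K i j‖ ≤ r ^ l)
    (hc : ∀ k, ‖c k‖ ≤ 1) (l : ℕ) (J : Finset (Fin n)) :
    ‖levelIter w c l J‖ ≤ Real.exp ((n * n) * (1 - r)⁻¹) := by
  have h : ∀ l J, ‖levelIter w c l J‖ ≤ Real.exp ((n * n) * ∑ k ∈ Finset.range l, r ^ k) := by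
    intro l
    induction l with
    | zero => intro J; simpa [levelIter] using hc J.card
    | succ l ih =>
      intro J
      refine (norm_levelPass_le (pow_nonneg hr0 l) (Real.exp_pos _).le (hw l) ih n J).trans ?_
      rw [Finset.sum_range_succ, mul_add, Real.exp_add, mul_comm]
      refine mul_le_mul_of_nonneg_left ?_ (Real.exp_pos _).le
      rw [mul_assoc, Real.exp_nat_mul]
      refine pow_le_pow_left₀ (by positivity) ?_ n
      rw [add_comm]
      exact Real.add_one_le_exp _
  refine (h l J).trans (Real.exp_le_exp.2 (mul_le_mul_of_nonneg_left ?_ (by positivity)))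
  rw [← tsum_geometric_of_lt_one hr0 hr1]
  exact (summable_geometric_of_lt_one hr0 hr1).sum_le_tsum _ fun k _ => pow_nonneg hr0 k

variable {F : Type*} [Field F] [ValuativeRel F] [TopologicalSpace F] [IsNonarchimedeanLocalField F]

/-- Hence the recursion computes the integrals of $|\Phi|$ as well, which is how integrability is
obtained. -/
theorem SiegelKernel.norm {Φ : Matrix (Fin n) (Fin n) F → ℂ} {κ : F → ℂ} {c : ℕ → ℂ}
    (hΦ : SiegelKernel Φ κ c) :
    SiegelKernel (fun X => (‖Φ X‖ : ℂ)) (fun x => (‖κ x‖ : ℂ)) fun k => (‖c k‖ : ℂ) where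
  add_integral X Y hX hY h := by rw [hΦ.add_integral X Y hX hY h]
  congr X U V hX hU hV h := by rw [hΦ.congr X U V hX hU hV h]
  regular J D h := by rw [hΦ.regular J D h, norm_mul, Complex.ofReal_mul]
  mul x y hx hy := by rw [hΦ.mul x y hx hy, norm_mul, Complex.ofReal_mul]

variable [MeasurableSpace F] [BorelSpace F] {μ : Measure F} [μ.IsAddHaarMeasure]
  {ψ : AddChar F Circle} {κ : F → ℂ} {σ : ℝ}

theorem measureReal_pw (hμ : μ (𝒪[F] : Set F) = 1) (m : ℤ) :
    μ.real (pw F m : Set F) = (residueCard F : ℝ) ^ (-(m : ℝ)) := by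
  rw [measure_pw hμ, ← Int.cast_neg, Real.rpow_intCast]

theorem norm_setIntegral_addChar_le {α : Type*} [MeasurableSpace α] {m : Measure α} {s : Set α}
    (hs : m s < ⊤) (f : α → F) : ‖∫ r in s, (ψ (f r) : ℂ) ∂m‖ ≤ m.real s := by
  have := norm_setIntegral_le_of_norm_le_const (f := fun r => (ψ (f r) : ℂ)) (C := 1) hs
    fun x _ => (Circle.norm_coe _).le
  rwa [one_mul] at this

theorem stepExp_ge (lam : ℤ) (i k : Fin n) : lam ≤ stepExp lam i k := by
  unfold stepExp; split_ifs <;> omega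

theorem measureReal_pw_stepExp_le (hμ : μ (𝒪[F] : Set F) = 1) (lam : ℤ) (i k : Fin n) :
    μ.real (pw F (stepExp lam i k) : Set F) ≤ (residueCard F : ℝ) ^ (-(lam : ℝ)) := by
  rw [measureReal_pw hμ]
  refine Real.rpow_le_rpow_of_exponent_le (by exact_mod_cast residueCard_pos) (neg_le_neg ?_)
  exact_mod_cast stepExp_ge lam i k

theorem norm_singleWeight_le (hμ : μ (𝒪[F] : Set F) = 1)
    (hκ : ∀ x, x ≠ 0 → ‖κ x‖ ≤ (residueCard F : ℝ) ^ (ord x * σ)) (b : Fin n → F) {lam : ℤ}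
    (hlam : lam ≤ -1) {K : Finset (Fin n)} {i : Fin n} (hi : i ∉ K) :
    ‖singleWeight μ κ ψ b lam K i‖ ≤ (residueCard F : ℝ) ^ (lam * (σ - n)) := by
  have hq1 : (1 : ℝ) ≤ residueCard F := by exact_mod_cast residueCard_pos
  have hq0 : (0 : ℝ) < residueCard F := zero_lt_one.trans_le hq1
  have hlam' : (lam : ℝ) ≤ 0 := by exact_mod_cast hlam.trans (by norm_num)
  have hK : ((K.card : ℝ) + 1) ≤ n := by
    have := (Finset.card_insert_of_notMem hi).symm.le.trans (Finset.card_le_univ _)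
    rw [Fintype.card_fin] at this
    exact_mod_cast this
  have hsub : shell F lam ⊆ pw F lam := Set.diff_subset
  have hfin : μ (shell F lam) < ⊤ := (measure_mono hsub).trans_lt (isCompact_pw lam).measure_lt_top
  rw [singleWeight]
  refine (norm_setIntegral_le_of_norm_le_const (C := (residueCard F : ℝ) ^ (lam * σ) *
    ((residueCard F : ℝ) ^ (-(lam : ℝ))) ^ K.card) hfin fun p hp => ?_).trans ?_
  · rw [norm_mul, norm_mul, Circle.norm_coe, mul_one, norm_prod]
    refine mul_le_mul ?_ ?_ (Finset.prod_nonneg fun _ _ => norm_nonneg _) (by positivity)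
    · have := hκ p (mem_shell.1 hp).1
      rwa [(mem_shell.1 hp).2] at this
    · rw [← Finset.prod_const]
      exact Finset.prod_le_prod (fun _ _ => norm_nonneg _) fun k _ =>
        (norm_setIntegral_addChar_le (isCompact_pw _).measure_lt_top _).trans
          (measureReal_pw_stepExp_le hμ lam i k)
  · have h1 : μ.real (shell F lam) ≤ (residueCard F : ℝ) ^ (-(lam : ℝ)) := by
      rw [← measureReal_pw hμ]
      exact measureReal_mono hsub (isCompact_pw lam).measure_lt_top.ne
    refine (mul_le_mul_of_nonneg_left h1 (by positivity)).trans ?_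
    rw [← Real.rpow_mul_natCast hq0.le, ← Real.rpow_add hq0, ← Real.rpow_add hq0]
    refine Real.rpow_le_rpow_of_exponent_le hq1 ?_
    nlinarith

/-- Trivial volume bounds give the exponent $\lambda(2\sigma-3-2\#K)$. With $\#K+2\le n$ and
$\sigma\ge n$ the bracket is at least $\sigma-n$, and $\lambda$ is negative. -/
theorem norm_pairWeight_le (hμ : μ (𝒪[F] : Set F) = 1)
    (hκ : ∀ x, x ≠ 0 → ‖κ x‖ ≤ (residueCard F : ℝ) ^ (ord x * σ)) (hσ : n ≤ σ) (b : Fin n → F) {lam : ℤ}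
    (hlam : lam ≤ -1) {K : Finset (Fin n)} {i j : Fin n} (hi : i ∉ K) (hj : j ∉ K) (hij : j ≠ i) :
    ‖pairWeight μ κ ψ b lam K i j‖ ≤ (residueCard F : ℝ) ^ (lam * (σ - n)) := by
  have hq1 : (1 : ℝ) ≤ residueCard F := by exact_mod_cast residueCard_pos
  have hq0 : (0 : ℝ) < residueCard F := zero_lt_one.trans_le hq1
  have hlam' : (lam : ℝ) ≤ 0 := by exact_mod_cast hlam.trans (by norm_num)
  have hK : ((K.card : ℝ) + 2) ≤ n := by
    have h1 := Finset.card_le_univ (insert j (insert i K))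
    rw [Finset.card_insert_of_notMem (by simp [hij, hj]), Finset.card_insert_of_notMem hi,
      Fintype.card_fin] at h1
    have h2 : K.card + 2 ≤ n := h1
    exact_mod_cast h2
  set V : Set (F × F × F) := (pw F lam : Set F) ×ˢ ((pw F lam : Set F) ×ˢ (pw F lam : Set F))
  have hsub : pairDomain F lam ⊆ V := Set.prod_mono le_rfl
    (Set.prod_mono Set.diff_subset (pw_mono (by omega)))
  have hV : (μ.prod (μ.prod μ)) V < ⊤ :=
    ((isCompact_pw lam).prod ((isCompact_pw lam).prod (isCompact_pw lam))).measure_lt_top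
  rw [pairWeight]
  refine (norm_setIntegral_le_of_norm_le_const (C := (residueCard F : ℝ) ^ (2 * lam * σ) *
    ((residueCard F : ℝ) ^ (-(2 * lam : ℝ))) ^ K.card) ((measure_mono hsub).trans_lt hV)
    fun p hp => ?_).trans ?_
  · rw [norm_mul, norm_mul, Circle.norm_coe, mul_one, norm_prod]
    refine mul_le_mul ?_ ?_ (Finset.prod_nonneg fun _ _ => norm_nonneg _) (by positivity)
    · have := hκ _ (pairDomain_det hp).1
      rwa [(pairDomain_det hp).2, Int.cast_mul, Int.cast_ofNat] at this
    · rw [← Finset.prod_const]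
      refine Finset.prod_le_prod (fun _ _ => norm_nonneg _) fun k _ =>
        (norm_setIntegral_addChar_le ((isCompact_pw _).prod (isCompact_pw _)).measure_lt_top _).trans ?_
      rw [measureReal_prod_prod]
      refine (mul_le_mul (measureReal_pw_stepExp_le hμ lam i k) (measureReal_pw_stepExp_le hμ lam j k)
        measureReal_nonneg (by positivity)).trans_eq ?_
      rw [← Real.rpow_add hq0]
      congr 1; ring
  · have h1 : (μ.prod (μ.prod μ)).real (pairDomain F lam) ≤ (residueCard F : ℝ) ^ (-(3 * lam : ℝ)) := by
      refine (measureReal_mono hsub hV.ne).trans_eq ?_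
      rw [measureReal_prod_prod, measureReal_prod_prod, measureReal_pw hμ, ← Real.rpow_add hq0,
        ← Real.rpow_add hq0]
      congr 1; ring
    refine (mul_le_mul_of_nonneg_left h1 (by positivity)).trans ?_
    rw [← Real.rpow_mul_natCast hq0.le, ← Real.rpow_add hq0, ← Real.rpow_add hq0]
    refine Real.rpow_le_rpow_of_exponent_le hq1 ?_
    nlinarith

theorem norm_pivotWeight_le (hμ : μ (𝒪[F] : Set F) = 1)
    (hκ : ∀ x, x ≠ 0 → ‖κ x‖ ≤ (residueCard F : ℝ) ^ (ord x * σ)) (hσ : n ≤ σ) (b : Fin n → F) {lam : ℤ}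
    (hlam : lam ≤ -1) (K : Finset (Fin n)) (i j : Fin n) (hi : i ∉ K) (hj : j ∉ K) :
    ‖pivotWeight μ κ ψ b lam K i j‖ ≤ (residueCard F : ℝ) ^ (lam * (σ - n)) := by
  rw [pivotWeight]
  split_ifs with h
  · exact norm_singleWeight_le hμ hκ b hlam hi
  · exact norm_pairWeight_le hμ hκ hσ b hlam hi hj h

theorem aecover_symBox (J : Finset (Fin n)) :
    AECover (symMeas F J) Filter.atTop fun l : ℕ => (symBox F J fun _ _ => -(l : ℤ) : Set (symOn F J)) where
  ae_eventually_mem := by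
    refine Filter.Eventually.of_forall fun X => ?_
    have h1 : ∀ a b, ∀ᶠ l : ℕ in Filter.atTop, X.1 a b ∈ pw F (-(l : ℤ)) := fun a b => by
      by_cases h0 : X.1 a b = 0
      · rw [h0]; exact Filter.Eventually.of_forall fun l => zero_mem _
      · filter_upwards [Filter.eventually_ge_atTop (-ord (X.1 a b)).toNat] with l hl
        rw [mem_pw_iff_ord h0]
        omega
    exact Filter.eventually_all.2 fun a => Filter.eventually_all.2 fun b => h1 a b
  measurableSet l := measurableSet_symBox _ _

theorem regularOff_univ : RegularOff Finset.univ (0 : Matrix (Fin n) (Fin n) F) :=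
  ⟨Matrix.isSymm_zero, fun _ _ _ => rfl, 0, Matrix.isSymm_zero, fun _ _ _ => rfl, fun _ _ => zero_mem _, by
    rw [indMat_univ, Matrix.zero_mul, sub_self]⟩

theorem norm_kernelIntegrand (Φ : Matrix (Fin n) (Fin n) F → ℂ) (ψ : AddChar F Circle) (b : Fin n → F)
    (D : Matrix (Fin n) (Fin n) F) {J : Finset (Fin n)} (X : symOn F J) :
    (‖kernelIntegrand Φ ψ b D X‖ : ℂ) = kernelIntegrand (fun X => (‖Φ X‖ : ℂ)) ψ 0 D X := by
  rw [kernelIntegrand, kernelIntegrand, norm_mul, Circle.norm_coe, mul_one]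
  simp

/-- The boxes exhaust the space, and the recursion for $|\Phi|$ with trivial character bounds their
integrals uniformly, with ratio $r=q^{-(\sigma-n)}<1$. -/
theorem SiegelKernel.integrable {Φ : Matrix (Fin n) (Fin n) F → ℂ} {c : ℕ → ℂ}
    (hΦ : SiegelKernel Φ κ c) (hμ : μ (𝒪[F] : Set F) = 1) (hψ : Continuous ψ) (hψ0 : HasOrderZero ψ)
    (hκ : ∀ x, x ≠ 0 → ‖κ x‖ ≤ (residueCard F : ℝ) ^ (ord x * σ)) (hσ : n < σ) (hc : ∀ k, ‖c k‖ ≤ 1)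
    (b : Fin n → F) : Integrable (kernelIntegrand Φ ψ b 0 (J := Finset.univ)) (symMeas F Finset.univ) := by
  have hq1 : (1 : ℝ) < residueCard F := by exact_mod_cast one_lt_residueCard
  have hq0 : (0 : ℝ) < residueCard F := zero_lt_one.trans hq1
  set r : ℝ := (residueCard F : ℝ) ^ (-(σ - n)) with hr
  have hr0 : 0 ≤ r := by positivity
  have hr1 : r < 1 := Real.rpow_lt_one_of_one_lt_of_neg hq1 (by linarith)
  refine (aecover_symBox Finset.univ).integrable_of_integral_norm_bounded
    (‖κ 1‖ * Real.exp ((n * n) * (1 - r)⁻¹))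
    (fun l => hΦ.integrableOn hψ b Matrix.isSymm_zero _ _) (Filter.Eventually.of_forall fun l => ?_)
  have h1 := hΦ.norm.setIntegral_levelIter hμ hψ hψ0 (b := 0) (fun _ => zero_mem _) l _ _ regularOff_univ
  simp only [← norm_kernelIntegrand Φ ψ b] at h1
  rw [integral_complex_ofReal, indMat_univ, zero_add, Matrix.det_one] at h1
  refine (le_abs_self _).trans ?_
  rw [← Real.norm_eq_abs, ← Complex.norm_real, h1, norm_mul, Complex.norm_real, norm_norm]
  refine mul_le_mul_of_nonneg_left (norm_levelIter_le hr0 hr1 (fun l K i j hi hj => ?_) (fun k => ?_) l _)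
    (norm_nonneg _)
  · refine (norm_pivotWeight_le (σ := σ) hμ (fun x hx => ?_) hσ.le 0 (by push_cast; omega) K i j hi
      hj).trans ?_
    · rw [Complex.norm_real, norm_norm]; exact hκ x hx
    · rw [hr, ← Real.rpow_mul_natCast hq0.le]
      refine Real.rpow_le_rpow_of_exponent_le hq1.le ?_
      push_cast
      nlinarith
  · rw [Complex.norm_real, norm_norm]; exact hc k

end Convergence

theorem norm_quadChar {F : Type*} [Field F] [ValuativeRel F] [TopologicalSpace F]
    [IsNonarchimedeanLocalField F] (a x : F) : ‖quadChar a x‖ = 1 := by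
  rcases quadChar_eq a x with h | h <;> simp [h]

/-! ### The Siegel integral in the domain of convergence -/

section SiegelIntegral

variable {n : ℕ} {F : Type*} [Field F]

variable (n F) in
/-- Symmetric matrices as symmetric matrices supported on all indices. -/
def symMatEquiv : SymMat n F ≃+ symOn F (Finset.univ : Finset (Fin n)) where
  toFun X := ⟨X.1, X.2, fun a _ h => absurd (Finset.mem_univ a) h⟩
  invFun X := ⟨X.1, X.2.1⟩
  left_inv _ := rfl
  right_inv _ := rfl
  map_add' _ _ := rfl

variable [ValuativeRel F] [TopologicalSpace F] [IsNonarchimedeanLocalField F]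
  [MeasurableSpace F] [BorelSpace F] {ν : Measure (SymMat n F)} [ν.IsAddHaarMeasure]

theorem continuous_symMatEquiv : Continuous (symMatEquiv n F) := continuous_subtype_val.subtype_mk _

theorem continuous_symMatEquiv_symm : Continuous (symMatEquiv n F).symm :=
  continuous_subtype_val.subtype_mk _

theorem measurePreserving_symMatEquiv
    (hν : ν {X : SymMat n F | ∀ i j, (X : Matrix (Fin n) (Fin n) F) i j ∈ 𝒪[F]} = 1) :
    MeasurePreserving (symMatEquiv n F) ν (symMeas F Finset.univ) := by
  refine measurePreserving_of_continuousAddEquiv (symMatEquiv n F) continuous_symMatEquiv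
    continuous_symMatEquiv_symm (measurableSet_symBox Finset.univ fun _ _ => 0) (symMeas_integral _) ?_
  rw [← hν]
  congr 1
  ext X
  exact forall_congr' fun i => forall_congr' fun j => mem_pw_zero

theorem measurableEmbedding_symMatEquiv : MeasurableEmbedding (symMatEquiv n F) :=
  (Homeomorph.mk (symMatEquiv n F).toEquiv continuous_symMatEquiv
    continuous_symMatEquiv_symm).measurableEmbedding

variable {ϖ : 𝒪[F]} {μ : Measure F} [μ.IsAddHaarMeasure] {ψ : AddChar F Circle} {s : ℂ}

theorem siegelIntegral (hq : Odd (residueCard F)) (hϖ : Irreducible ϖ) (hμ : μ (𝒪[F] : Set F) = 1)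
    (hψ : Continuous ψ) (hψ0 : HasOrderZero ψ) (hn : 1 ≤ n)
    (hν : ν {X : SymMat n F | ∀ i j, (X : Matrix (Fin n) (Fin n) F) i j ∈ 𝒪[F]} = 1)
    (α : Fin n → 𝒪[F]ˣ) (e : Fin n → ℕ) {t : ℕ} (hs : (n : ℝ) < s.re) {f : Sp n F → ℂ}
    (hf : IsBasisVector (quadChar (ϖ : F)) t s f) :
    Integrable (siegelIntegrand ψ (Matrix.diagonal (diagEntry ϖ α e)) f) ν ∧
      ∫ X, siegelIntegrand ψ (Matrix.diagonal (diagEntry ϖ α e)) f X ∂ν =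
        siegelFormula n (residueCard F) (gaussConst μ ψ ϖ) (quadChar (ϖ : F))
          (fun i => ((α i : 𝒪[F]) : F)) e t s := by
  have hΦ := siegelKernel_of_isBasisVector hq hϖ hf
  set Φ : Matrix (Fin n) (Fin n) F → ℂ := fun X => open scoped Classical in
    if hX : X.IsSymm then f (weylElt n F n * unipElt ⟨X, hX⟩) else 0 with hΦdef
  have h1 : siegelIntegrand ψ (Matrix.diagonal (diagEntry ϖ α e)) f =
      kernelIntegrand Φ ψ (diagEntry ϖ α e) 0 (J := Finset.univ) ∘ symMatEquiv n F := by
    funext X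
    have hX : (X : Matrix (Fin n) (Fin n) F).IsSymm := X.2
    have h2 : Φ (symMatEquiv n F X).1 = f (weylElt n F n * unipElt X) := dif_pos hX
    rw [siegelIntegrand, Function.comp_apply, kernelIntegrand, zero_add, h2, Matrix.trace]
    simp only [Matrix.diag_apply, Matrix.diagonal_mul]
    rfl
  have hint := hΦ.integrable (σ := s.re) hμ hψ hψ0 (fun x hx => by
      rw [siegelKappa, norm_mul, norm_quadChar, one_mul, norm_qpow, ← Complex.ofReal_intCast,
        Complex.re_ofReal_mul]) hs (fun k => by split_ifs <;> simp) (diagEntry ϖ α e)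
  rw [h1]
  refine ⟨(measurePreserving_symMatEquiv hν).integrable_comp_of_integrable hint, ?_⟩
  have h3 : ∫ X, (kernelIntegrand Φ ψ (diagEntry ϖ α e) 0 (J := Finset.univ) ∘ symMatEquiv n F) X ∂ν =
      ∫ X, kernelIntegrand Φ ψ (diagEntry ϖ α e) 0 X ∂symMeas F Finset.univ :=
    (measurePreserving_symMatEquiv hν).integral_comp measurableEmbedding_symMatEquiv _
  rw [h3]
  refine (aecover_symBox Finset.univ).integral_eq_of_tendsto _ hint (tendsto_const_nhds.congr' ?_)
  -- The sum is a convenient bound for all $e_i+1$ at once. From there on every box integral equals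
  -- the explicit expression, which is therefore the limit.
  filter_upwards [Filter.eventually_ge_atTop (∑ i, (e i + 1))] with l hl
  rw [hΦ.setIntegral_levelIter hμ hψ hψ0 (diagEntry_mem ϖ α e) l _ _ regularOff_univ, indMat_univ,
    zero_add, Matrix.det_one, siegelKappa_of_ord_eq_zero ord_one, quadChar_one, one_mul,
    levelIter_eq_siegelFormula hn hμ hq hψ hψ0 hϖ t s fun i =>
      (Finset.single_le_sum (f := fun i => e i + 1) (fun _ _ => Nat.zero_le _) (Finset.mem_univ i)).trans hl]

end SiegelIntegral

/-! ### Analytic continuation in $s$ and the theorem -/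

section Continuation

theorem differentiable_siegelFormula {F : Type*} [Field F] {n q : ℕ} (hq : q ≠ 0) (αψ : ℂ) (χ : F → ℂ)
    (v : Fin n → F) (e : Fin n → ℕ) (t : ℕ) : Differentiable ℂ (siegelFormula n q αψ χ v e t) := by
  unfold siegelFormula
  have hq' : (q : ℂ) ≠ 0 := Nat.cast_ne_zero.2 hq
  fun_prop (disch := simp [hq'])

/-- A meromorphic function in normal form that agrees with an entire function on a half plane is equal
to it. -/
theorem eq_of_meromorphicNFOn_of_eqOn_halfPlane {S g : ℂ → ℂ} (hS : MeromorphicNFOn S Set.univ)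
    (hg : Differentiable ℂ g) (c : ℝ) (h : ∀ s : ℂ, c < s.re → S s = g s) : S = g := by
  have hgN : MeromorphicNFOn g Set.univ := AnalyticOnNhd.meromorphicNFOn fun z _ =>
    hg.analyticAt z
  have hsub : MeromorphicOn (S - g) Set.univ := hS.meromorphicOn.sub hgN.meromorphicOn
  funext z
  have h0 : meromorphicOrderAt (S - g) ((c + 1 : ℝ) : ℂ) = ⊤ := by
    rw [meromorphicOrderAt_eq_top_iff]
    refine Filter.Eventually.filter_mono nhdsWithin_le_nhds ?_
    filter_upwards [(isOpen_lt continuous_const Complex.continuous_re).mem_nhds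
      (show c < (((c + 1 : ℝ) : ℂ)).re by rw [Complex.ofReal_re]; linarith)] with s hs
    rw [Pi.sub_apply, h s hs, sub_self]
  have hz : meromorphicOrderAt (S - g) z = ⊤ := by
    by_contra hne
    exact hsub.meromorphicOrderAt_ne_top_of_isPreconnected isPreconnected_univ (Set.mem_univ z)
      (Set.mem_univ _) hne h0
  rw [meromorphicOrderAt_eq_top_iff] at hz
  refine (((hS (Set.mem_univ z)).eventuallyEq_nhdsNE_iff_eventuallyEq_nhds
    (hgN (Set.mem_univ z))).1 ?_).self_of_nhds
  filter_upwards [hz] with s hs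
  exact sub_eq_zero.1 hs

end Continuation

theorem theorem5p1 {F : Type*} [Field F] [CharZero F] [ValuativeRel F] [TopologicalSpace F]
    [IsNonarchimedeanLocalField F] [MeasurableSpace F] [BorelSpace F]
    (hq : Odd (residueCard F))
    (ϖ : 𝒪[F]) (hϖ : Irreducible ϖ)
    (μ : Measure F) [μ.IsAddHaarMeasure] (hμ : μ (𝒪[F] : Set F) = 1)
    (ψ : AddChar F Circle) (hψ : Continuous ψ) (hψ0 : HasOrderZero ψ)
    (n : ℕ) (hn : 1 ≤ n)
    (ν : Measure (SymMat n F)) [ν.IsAddHaarMeasure]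
    (hν : ν {X : SymMat n F | ∀ i j, (X : Matrix (Fin n) (Fin n) F) i j ∈ 𝒪[F]} = 1)
    (α : Fin n → 𝒪[F]ˣ) (e : Fin n → ℕ) (he : Monotone e)
    (t : ℕ) (ht : t ≤ n) :
    (∀ s : ℂ, ∃! f : Sp n F → ℂ, IsBasisVector (quadChar (ϖ : F)) t s f) ∧
    ∀ f : ℂ → Sp n F → ℂ, (∀ s, IsBasisVector (quadChar (ϖ : F)) t s (f s)) →
      ∀ B : Matrix (Fin n) (Fin n) F,
        B = Matrix.diagonal (fun i => ((α i : 𝒪[F]) : F) * (ϖ : F) ^ e i) →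
      (∀ s : ℂ, (n : ℝ) < s.re →
        Integrable (siegelIntegrand ψ B (f s)) ν ∧
        ∫ X, siegelIntegrand ψ B (f s) X ∂ν =
          siegelFormula n (residueCard F) (weilConstant μ ψ (ϖ : F)) (quadChar (ϖ : F))
            (fun i => ((α i : 𝒪[F]) : F)) e t s) ∧
      ∀ S : ℂ → ℂ, IsSiegelSeries ν ψ B f S ↔
        S = siegelFormula n (residueCard F) (weilConstant μ ψ (ϖ : F)) (quadChar (ϖ : F))
          (fun i => ((α i : 𝒪[F]) : F)) e t := by
  refine ⟨fun s => ?_, fun f hf B hB => ?_⟩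
  · obtain ⟨f, hf⟩ := exists_isBasisVector hq hϖ ht s
    exact ⟨f, hf, fun f' hf' => isBasisVector_unique hq hϖ hf' hf⟩
  · rw [weilConstant_uniformizer hμ hq hψ hψ0 hϖ]
    have hint := fun (s : ℂ) (hs : (n : ℝ) < s.re) =>
      siegelIntegral hq hϖ hμ hψ hψ0 hn hν α e hs (hf s)
    have hB' : B = Matrix.diagonal (diagEntry ϖ α e) := hB
    rw [← hB'] at hint
    have hdiff := differentiable_siegelFormula (n := n) (residueCard_pos (F := F)).ne'
      (gaussConst μ ψ ϖ) (quadChar (ϖ : F)) (fun i => ((α i : 𝒪[F]) : F)) e t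
    refine ⟨hint, fun S => ⟨?_, ?_⟩⟩
    · rintro ⟨hS, c, hc⟩
      refine eq_of_meromorphicNFOn_of_eqOn_halfPlane hS hdiff (max c n) fun s hs => ?_
      rw [(hc s ((le_max_left _ _).trans_lt hs)).2, (hint s ((le_max_right _ _).trans_lt hs)).2]
    · rintro rfl
      exact ⟨AnalyticOnNhd.meromorphicNFOn fun z _ => hdiff.analyticAt z, n, fun s hs =>
        ⟨(hint s hs).1, (hint s hs).2.symm⟩⟩
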